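/- **Rigid special geometry relations for hyperelliptic curves.** Let $n\ge 1$, let $W$ be a complex polynomial with $W'$ monic of degree $n$, and let $t\in\mathbb C\setminus\{0\}$. Consider a curve $y^2=W'(x)^2+f_0(x)=\prod_{i=1}^n(x-a_i^-)(x-a_i^+)$, where $f_0$ is a polynomial of degree at most $n-1$ whose coefficient of $x^{n-1}$ is $-4t$. Let $\lambda:\mathbb R\to\mathbb C$ be an injective $C^1$ path with $\dot\lambda\ne0$ which passes through the branch points in the order $a_1^-,a_1^+,\dots,a_n^-,a_n^+$, and let the cut $\mathcal C_i$ be the part of the path from $a_i^-$ to $a_i^+$. Let $y_0$ be the continuous branch of $y$ on $\mathbb C\setminus\bigcup_i\mathcal C_i$ with $y_0/W'\to1$ at infinity; put $y=y_0$ on the upper and $y=-y_0$ on the lower sheet, and $\zeta=y\,dx$. Put $\omega_0=(W'-y_0)/(2t)$, $$\rho_0(s)=\dot\lambda(s)\lim_{\epsilon\to0^+}\frac1{2\pi i}\bigl[\omega_0(\lambda(s)-i\epsilon\dot\lambda(s))-\omega_0(\lambda(s)+i\epsilon\dot\lambda(s))\bigr],$$ $$S_i=t\int_{\lambda^{-1}(\mathcal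 C_i)}\rho_0(s)\,ds,\qquad \tilde S_i=\sum_{j\le i}S_j,$$ $$\mathcal F_0=t^2\,\mathcal P\!\!\int ds\int ds'\,\ln(\lambda(s)-\lambda(s'))\,\rho_0(s)\rho_0(s')-t\int ds\,W(\lambda(s))\,\rho_0(s).$$ Here $x\mapsto\ln(x-\lambda(s'))$ is cut along the part of the path before $\lambda(s')$, with a branch that is continuous in $(s,s')$ for $s'<s$, $x=\lambda(s)$; for $s<s'$ the principal value $\mathcal P$ is the mean of the two boundary values on the cut. 1. One has $S_j=\frac1{4\pi i}\int_{A^j}\zeta$ for $j=1,\dots,n$ and $$\tilde S_i=\frac1{4\pi i}\int_{\alpha_i}\zeta\qquad(i=1,\dots,n-1).$$ Here $A^j$ (respectively $\alpha_i$) is any closed $C^1$ curve on the upper sheet, avoiding the cuts, whose projection to the $x$-plane has winding number $-1$ around the points of $\mathcal C_j$ (respectively of $\mathcal C_1,\dots,\mathcal C_i$) and $0$ around the points of all other cuts. 2. Fix $W$ and $t$, and let $U\subset\mathbb C^{n-1}$ be an open set on which $\tilde S=(\tilde S_1,\dots,\tilde S_{n-1})$ serve as holomorphic coordinates for the curves.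 That is, a curve with path as above is given for each $\tilde S\in U$, its variables have the values $\tilde S$, the coefficients of $f_0$ are holomorphic in $\tilde S$, and $\lambda(s)$ and $\dot\lambda(s)$ (jointly in $(\tilde S,s)$) and the parameters $s$ at which the branch points are met depend continuously on $\tilde S$. Let the branch of the logarithm also be continuous in $\tilde S$. Then the limits and integrals defining $\rho_0$ and $\mathcal F_0(t,\tilde S)$ exist, and on $U$ $$\frac{\partial\mathcal F_0(t,\tilde S)}{\partial\tilde S_i}=\frac12\int_{\beta_i}\zeta\qquad(i=1,\dots,n-1),$$ as complex partial derivatives, where $\beta_i$ runs along the path from $a_i^+$ to $a_{i+1}^-$ on the upper sheet and back from $a_{i+1}^-$ to $a_i^+$ on the lower sheet. -/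

import Mathlib

open Set Filter Topology Polynomial

noncomputable section

namespace RigidSpecialGeometry

/-- The data of a hyperelliptic curve `y² = W'(x)² + f₀(x)` presented as a two-sheeted cover of the
`x`-plane. Here `n = g + 1` is the number of cuts (so `g` is the genus), `W'` is monic of degree
`n`, and `f₀` is a polynomial of degree at most `n - 1` whose coefficient of `x ^ (n - 1)` is
`-4 t`. The curve comes with an oriented regular path `s ↦ path s` in the `x`-plane that is free of
self-intersections and runs through all branch points. The branch points are
`a_i⁻ = path (lo i)` and `a_i⁺ = path (hi i)`, met in the order
`a_0⁻, a_0⁺, a_1⁻, a_1⁺, …, a_g⁻, a_g⁺`, and the `i`-th cut is the part of the path between `a_i⁻`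
and `a_i⁺`. The branch points are pairwise distinct because `path` is injective. The parameter
`s` need not be the arc length. -/
structure SpectralCurve (g : ℕ) (W : ℂ[X]) (t : ℂ) where
  monic_potential : W.derivative.Monic
  natDegree_potential : W.derivative.natDegree = g + 1
  f : ℂ[X]
  natDegree_f : f.natDegree ≤ g
  coeff_f : f.coeff g = -4 * t
  path : ℝ → ℂ
  contDiff_path : ContDiff ℝ 1 path
  deriv_path_ne_zero : ∀ s, deriv path s ≠ 0
  injective_path : Function.Injective path
  lo : Fin (g + 1) → ℝ
  hi : Fin (g + 1) → ℝ
  lo_lt_hi : ∀ i, lo i < hi i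
  hi_lt_lo : ∀ i : Fin g, hi i.castSucc < lo i.succ
  curve_eq : W.derivative ^ 2 + f = ∏ i, ((X - C (path (lo i))) * (X - C (path (hi i))))

/-- The integral of the one-form `ζ = y dx` along the path `τ ↦ (x τ, y τ)`, `τ` from `a` to `b`,
on the curve. -/
def zetaIntegral (x y : ℝ → ℂ) (a b : ℝ) : ℂ :=
  ∫ τ in a..b, y τ * deriv x τ

/-- The winding number of the closed curve `c`, parametrised by `[0, 1]`, around `z`. -/
def windingNumber (c : ℝ → ℂ) (z : ℂ) : ℂ :=
  (1 / (2 * Real.pi * Complex.I)) * ∫ τ in (0 : ℝ)..1, deriv c τ / (c τ - z)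

namespace SpectralCurve

variable {g : ℕ} {W : ℂ[X]} {t : ℂ}

/-- The `i`-th cut, from `a_i⁻` to `a_i⁺`. -/
def cut (D : SpectralCurve g W t) (i : Fin (g + 1)) : Set ℂ :=
  D.path '' Icc (D.lo i) (D.hi i)

/-- The union of all cuts. -/
def cuts (D : SpectralCurve g W t) : Set ℂ :=
  ⋃ i, D.cut i

/-- `y₀` is the branch of `y` on the upper sheet: it is continuous (hence holomorphic) off the cuts,
solves `y₀² = W'² + f₀` there, and satisfies `y₀ ∼ W'` at infinity. -/
def IsUpperBranch (D : SpectralCurve g W t) (y₀ : ℂ → ℂ) : Prop :=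
  ContinuousOn y₀ D.cutsᶜ ∧
  (∀ x ∈ D.cutsᶜ, y₀ x ^ 2 = (W.derivative ^ 2 + D.f).eval x) ∧
  Tendsto (fun x => y₀ x / W.derivative.eval x) (cocompact ℂ) (𝓝 1)

/-! Existence of the branch on the upper sheet: each factor
`(x - a_i⁻) exp (½ ∫ dz / (z - x))`, with the integral over the `i`-th cut, is a square root of
`(x - a_i⁻) (x - a_i⁺)` that is continuous off the cut and `∼ x` at infinity. -/

theorem isCompact_cut (D : SpectralCurve g W t) (i : Fin (g + 1)) : IsCompact (D.cut i) :=
  isCompact_Icc.image D.contDiff_path.continuous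

def cutIntegral (D : SpectralCurve g W t) (i : Fin (g + 1)) (x : ℂ) : ℂ :=
  ∫ s in (D.lo i)..(D.hi i), deriv D.path s / (D.path s - x)

theorem exp_cutIntegral (D : SpectralCurve g W t) (i : Fin (g + 1)) (x : ℂ) (hx : x ∉ D.cut i) :
    (x - D.path (D.lo i)) * Complex.exp (D.cutIntegral i x) = x - D.path (D.hi i) := by
  have hdc : Continuous (deriv D.path) := D.contDiff_path.continuous_deriv le_rfl
  have hne : ∀ s ∈ Icc (D.lo i) (D.hi i), D.path s - x ≠ 0 := by
    intro s hs h
    exact hx ⟨s, hs, sub_eq_zero.mp h⟩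
  have hd : ∀ s, HasDerivAt D.path (deriv D.path s) s := fun s =>
    (D.contDiff_path.differentiable (by norm_num)).differentiableAt.hasDerivAt
  have hc : ContinuousOn (fun s => deriv D.path s / (D.path s - x)) (Icc (D.lo i) (D.hi i)) :=
    hdc.continuousOn.div (D.contDiff_path.continuous.sub continuous_const).continuousOn hne
  have hle := (D.lo_lt_hi i).le
  let J : ℝ → ℂ := fun u => ∫ s in (D.lo i)..u, deriv D.path s / (D.path s - x)
  have hJc : ContinuousOn J (Icc (D.lo i) (D.hi i)) := by
    have := intervalIntegral.continuousOn_primitive_interval (μ := MeasureTheory.volume)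
      (a := D.lo i) (b := D.hi i) (f := fun s => deriv D.path s / (D.path s - x))
      (by rw [uIcc_of_le hle]; exact hc.integrableOn_Icc)
    rwa [uIcc_of_le hle] at this
  have hJd : ∀ u ∈ Ico (D.lo i) (D.hi i),
      HasDerivWithinAt J (deriv D.path u / (D.path u - x)) (Ici u) u := by
    intro u hu
    have hcu : ContinuousWithinAt (fun s => deriv D.path s / (D.path s - x)) (Ioi u) u := by
      apply ContinuousAt.continuousWithinAt
      exact (hdc.continuousAt).div ((D.contDiff_path.continuous.sub continuous_const).continuousAt)
        (hne u ⟨hu.1, hu.2.le⟩)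
    refine intervalIntegral.integral_hasDerivWithinAt_right (s := Ici u) (t := Ioi u) ?_ ?_ ?_
    · apply ContinuousOn.intervalIntegrable
      rw [uIcc_of_le hu.1]
      exact hc.mono (Icc_subset_Icc_right hu.2.le)
    · refine ⟨Ioo u (D.hi i), Ioo_mem_nhdsGT hu.2, ?_⟩
      exact (hc.mono (fun s hs => ⟨hu.1.trans hs.1.le, hs.2.le⟩)).aestronglyMeasurable
        measurableSet_Ioo
    · exact hcu
  have key := constant_of_has_deriv_right_zero
    (f := fun u => Complex.exp (-J u) * (D.path u - x)) (a := D.lo i) (b := D.hi i)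
    ((Complex.continuous_exp.comp_continuousOn hJc.neg).mul
      (D.contDiff_path.continuous.sub continuous_const).continuousOn)
    (by
      intro u hu
      have h1 := ((hJd u hu).neg.cexp).mul ((hd u).hasDerivWithinAt.sub_const x)
      refine h1.congr_deriv ?_
      have h3 : deriv D.path u / (D.path u - x) * (D.path u - x) = deriv D.path u :=
        div_mul_cancel₀ _ (hne u ⟨hu.1, hu.2.le⟩)
      simp only [Pi.neg_apply]
      linear_combination -Complex.exp (-J u) * h3)
    (D.hi i) ⟨hle, le_rfl⟩
  have hJ0 : J (D.lo i) = 0 := intervalIntegral.integral_same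
  simp only [hJ0, neg_zero, Complex.exp_zero, one_mul] at key
  change (x - D.path (D.lo i)) * Complex.exp (J (D.hi i)) = _
  have h2 : Complex.exp (-J (D.hi i)) * Complex.exp (J (D.hi i)) = 1 := by
    rw [← Complex.exp_add]; simp
  linear_combination Complex.exp (J (D.hi i)) * key - (D.path (D.hi i) - x) * h2

theorem continuousOn_cutIntegral (D : SpectralCurve g W t) (i : Fin (g + 1)) :
    ContinuousOn (D.cutIntegral i) (D.cut i)ᶜ := by
  intro x₀ hx₀
  apply ContinuousAt.continuousWithinAt
  have hdc : Continuous (deriv D.path) := D.contDiff_path.continuous_deriv le_rfl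
  have hle := (D.lo_lt_hi i).le
  obtain ⟨δ, hδ, hball⟩ := Metric.isOpen_iff.mp (D.isCompact_cut i).isClosed.isOpen_compl x₀ hx₀
  obtain ⟨M, hM⟩ := (isCompact_Icc (a := D.lo i) (b := D.hi i)).exists_bound_of_continuousOn
    hdc.continuousOn
  have hM0 : 0 ≤ M := (norm_nonneg _).trans (hM _ ⟨le_rfl, hle⟩)
  have hfar : ∀ s ∈ Icc (D.lo i) (D.hi i), δ ≤ ‖D.path s - x₀‖ := by
    intro s hs
    by_contra h
    push Not at h
    exact hball (by simpa [dist_eq_norm] using h) ⟨s, hs, rfl⟩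
  have hsub : ∀ s ∈ uIoc (D.lo i) (D.hi i), s ∈ Icc (D.lo i) (D.hi i) := by
    intro s hs
    rw [uIoc_of_le hle] at hs
    exact Ioc_subset_Icc_self hs
  refine intervalIntegral.continuousAt_of_dominated_interval
    (bound := fun _ => M / (δ / 2)) ?_ ?_ intervalIntegrable_const ?_
  · filter_upwards [Metric.ball_mem_nhds x₀ hδ] with x hx
    rw [uIoc_of_le hle]
    refine ContinuousOn.aestronglyMeasurable ?_ measurableSet_Ioc
    refine hdc.continuousOn.div
      (D.contDiff_path.continuous.sub continuous_const).continuousOn ?_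
    intro s hs h
    exact hball hx ⟨s, Ioc_subset_Icc_self hs, sub_eq_zero.mp h⟩
  · filter_upwards [Metric.ball_mem_nhds x₀ (half_pos hδ)] with x hx
    refine Eventually.of_forall fun s hs => ?_
    have h1 := hfar s (hsub s hs)
    have h2 : ‖x - x₀‖ < δ / 2 := by simpa [dist_eq_norm] using hx
    have h3 : δ / 2 ≤ ‖D.path s - x‖ := by
      have := norm_sub_le_norm_sub_add_norm_sub (D.path s) x x₀
      linarith
    rw [norm_div]
    exact div_le_div₀ hM0 (hM s (hsub s hs)) (half_pos hδ) h3
  · refine Eventually.of_forall fun s hs => ?_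
    refine continuousAt_const.div (continuousAt_const.sub continuousAt_id) ?_
    intro h
    have := hfar s (hsub s hs)
    have h' : D.path s - x₀ = 0 := h
    rw [h', norm_zero] at this
    linarith

theorem tendsto_cutIntegral (D : SpectralCurve g W t) (i : Fin (g + 1)) :
    Tendsto (D.cutIntegral i) (cocompact ℂ) (𝓝 0) := by
  have hdc : Continuous (deriv D.path) := D.contDiff_path.continuous_deriv le_rfl
  have hle := (D.lo_lt_hi i).le
  obtain ⟨M, hM⟩ := (isCompact_Icc (a := D.lo i) (b := D.hi i)).exists_bound_of_continuousOn
    hdc.continuousOn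
  obtain ⟨R, hR⟩ := (isCompact_Icc (a := D.lo i) (b := D.hi i)).exists_bound_of_continuousOn
    D.contDiff_path.continuous.continuousOn
  have hM0 : 0 ≤ M := (norm_nonneg _).trans (hM _ ⟨le_rfl, hle⟩)
  have hlim : Tendsto (fun x : ℂ => M / (‖x‖ - R) * |D.hi i - D.lo i|) (cocompact ℂ) (𝓝 0) := by
    have h1 : Tendsto (fun x : ℂ => ‖x‖ - R) (cocompact ℂ) atTop :=
      tendsto_atTop_add_const_right _ _ (tendsto_norm_cocompact_atTop)
    simpa using (h1.const_div_atTop M).mul_const |D.hi i - D.lo i|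
  refine squeeze_zero_norm' ?_ hlim
  filter_upwards [(tendsto_norm_cocompact_atTop (E := ℂ)).eventually_gt_atTop R] with x hx
  refine intervalIntegral.norm_integral_le_of_norm_le_const fun s hs => ?_
  rw [uIoc_of_le hle] at hs
  have hs' := Ioc_subset_Icc_self hs
  rw [norm_div]
  refine div_le_div₀ hM0 (hM s hs') (by linarith) ?_
  have := norm_sub_norm_le x (D.path s)
  rw [norm_sub_rev] at this
  linarith [hR s hs']

theorem exists_isUpperBranch (D : SpectralCurve g W t) : ∃ y₀ : ℂ → ℂ, D.IsUpperBranch y₀ := by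
  refine ⟨fun x => ∏ i, ((x - D.path (D.lo i)) * Complex.exp (D.cutIntegral i x / 2)),
    ?_, ?_, ?_⟩
  · refine continuousOn_finsetProd _ fun i _ => ?_
    refine (continuousOn_id.sub continuousOn_const).mul ?_
    refine Complex.continuous_exp.comp_continuousOn (ContinuousOn.div_const ?_ 2)
    exact (D.continuousOn_cutIntegral i).mono
      (compl_subset_compl.mpr (subset_iUnion D.cut i))
  · intro x hx
    rw [D.curve_eq, eval_prod, ← Finset.prod_pow]
    refine Finset.prod_congr rfl fun i _ => ?_
    have h := D.exp_cutIntegral i x (fun h => hx (mem_iUnion.mpr ⟨i, h⟩))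
    have h2 : Complex.exp (D.cutIntegral i x / 2) ^ 2 = Complex.exp (D.cutIntegral i x) := by
      rw [← Complex.exp_nat_mul]; congr 1; push_cast; ring
    simp only [eval_mul, eval_sub, eval_X, eval_C]
    rw [mul_pow, h2, ← h]
    ring
  · have hinv : Tendsto (fun x : ℂ => x⁻¹) (cocompact ℂ) (𝓝 0) := by
      rw [← Metric.cobounded_eq_cocompact]; exact tendsto_inv₀_cobounded
    have hne : ∀ᶠ x : ℂ in cocompact ℂ, x ≠ 0 := by
      filter_upwards [(tendsto_norm_cocompact_atTop (E := ℂ)).eventually_gt_atTop 0] with x hx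
      exact norm_pos_iff.mp hx
    have hy : Tendsto (fun x : ℂ => ∏ i,
        ((1 - D.path (D.lo i) * x⁻¹) * Complex.exp (D.cutIntegral i x / 2)))
        (cocompact ℂ) (𝓝 1) := by
      have : Tendsto (fun x : ℂ => ∏ i,
          ((1 - D.path (D.lo i) * x⁻¹) * Complex.exp (D.cutIntegral i x / 2)))
          (cocompact ℂ) (𝓝 (∏ i : Fin (g + 1),
            ((1 - D.path (D.lo i) * 0) * Complex.exp (0 / 2)))) := by
        refine tendsto_finsetProd _ fun i _ => ?_
        refine (tendsto_const_nhds.sub (hinv.const_mul _)).mul ?_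
        exact (Complex.continuous_exp.tendsto _).comp ((D.tendsto_cutIntegral i).div_const 2)
      simpa using this
    have hW : Tendsto (fun x : ℂ => W.derivative.eval x * x⁻¹ ^ (g + 1)) (cocompact ℂ) (𝓝 1) := by
      have h1 : Tendsto (fun x : ℂ => ∑ k ∈ Finset.range (g + 2),
          W.derivative.coeff k * x⁻¹ ^ (g + 1 - k)) (cocompact ℂ)
          (𝓝 (∑ k ∈ Finset.range (g + 2), W.derivative.coeff k * (0 : ℂ) ^ (g + 1 - k))) :=
        tendsto_finsetSum _ fun k _ => (hinv.pow _).const_mul _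
      have hlead : W.derivative.coeff (g + 1) = 1 := by
        rw [← D.natDegree_potential]; exact D.monic_potential
      have h2 : ∑ k ∈ Finset.range (g + 2), W.derivative.coeff k * (0 : ℂ) ^ (g + 1 - k) = 1 := by
        rw [Finset.sum_range_succ, Finset.sum_eq_zero]
        · simp [hlead]
        · intro k hk
          rw [Finset.mem_range] at hk
          rw [zero_pow (by omega), mul_zero]
      rw [h2] at h1
      refine h1.congr' ?_
      filter_upwards [hne] with x hx
      rw [eval_eq_sum_range, D.natDegree_potential, Finset.sum_mul]
      refine Finset.sum_congr rfl fun k hk => ?_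
      rw [Finset.mem_range] at hk
      have : x ^ k * x⁻¹ ^ (g + 1) = x⁻¹ ^ (g + 1 - k) := by
        have e : g + 1 = (g + 1 - k) + k := by omega
        calc x ^ k * x⁻¹ ^ (g + 1) = x ^ k * x⁻¹ ^ ((g + 1 - k) + k) := by rw [← e]
          _ = x⁻¹ ^ (g + 1 - k) * (x * x⁻¹) ^ k := by rw [pow_add, mul_pow]; ring
          _ = _ := by rw [mul_inv_cancel₀ hx, one_pow, mul_one]
      rw [mul_assoc, this]
    have hq := hy.div hW one_ne_zero
    rw [div_one] at hq
    refine hq.congr' ?_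
    filter_upwards [hne] with x hx
    have hp : ∏ i, ((1 - D.path (D.lo i) * x⁻¹) * Complex.exp (D.cutIntegral i x / 2)) =
        (∏ i, ((x - D.path (D.lo i)) * Complex.exp (D.cutIntegral i x / 2))) * x⁻¹ ^ (g + 1) := by
      have hc : x⁻¹ ^ (g + 1) = ∏ _i : Fin (g + 1), x⁻¹ := by simp
      rw [hc, ← Finset.prod_mul_distrib]
      refine Finset.prod_congr rfl fun i _ => ?_
      field_simp
    simp only [Pi.div_apply]
    rw [hp]
    exact mul_div_mul_right _ _ (pow_ne_zero _ (inv_ne_zero hx))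

/-- The branch `y₀` of `y` on the upper sheet (on the lower sheet `y = -y₀`). It is determined off
the cuts by `IsUpperBranch`; its values on the cuts are irrelevant. -/
def y₀ (D : SpectralCurve g W t) : ℂ → ℂ :=
  Classical.choose D.exists_isUpperBranch

/-- The planar resolvent `ω₀`, from `y₀ = W' - 2 t ω₀`. -/
def ω₀ (D : SpectralCurve g W t) (x : ℂ) : ℂ :=
  (W.derivative.eval x - D.y₀ x) / (2 * t)

/-- The (in general complex) planar density
`ρ₀(s) = λ'(s) lim_{ε → 0⁺} (1 / 2πi) [ω₀(λ(s) - iελ'(s)) - ω₀(λ(s) + iελ'(s))]`. -/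
def ρ₀ (D : SpectralCurve g W t) (s : ℝ) : ℂ :=
  deriv D.path s * limUnder (𝓝[>] (0 : ℝ)) (fun ε : ℝ => (1 / (2 * Real.pi * Complex.I)) *
    (D.ω₀ (D.path s - Complex.I * ε * deriv D.path s) -
      D.ω₀ (D.path s + Complex.I * ε * deriv D.path s)))

/-- `S_i = t ∫ ρ₀(s) ds` over the `i`-th cut. -/
def S (D : SpectralCurve g W t) (i : Fin (g + 1)) : ℂ :=
  t * ∫ s in (D.lo i)..(D.hi i), D.ρ₀ s

/-- The variables `S̃_i = ∑_{j ≤ i} S_j`, for the first `g = n - 1` cuts. -/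
def tildeS (D : SpectralCurve g W t) (i : Fin g) : ℂ :=
  ∑ j ∈ Finset.Iic i.castSucc, D.S j

/-- The principal value `𝒫 ln(λ(s) - λ(s'))` of the logarithm along the path. The branch of
`x ↦ ln(x - λ(s'))` is cut along the part of the path before `λ(s')`, and `ℓ s s'` stands for
its value at `x = λ(s)`, `s' < s`. For `s < s'` the point `λ(s)` lies on the branch cut, the two
one-sided boundary values there are `ℓ s' s ± iπ`, and the principal value is their mean.
(For the path `λ(s) = s` and real `ℓ` this is `ln |s - s'|`.) -/
def principalLog (ℓ : ℝ → ℝ → ℂ) (s s' : ℝ) : ℂ :=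
  if s' < s then ℓ s s'
  else ((ℓ s' s + Real.pi * Complex.I) + (ℓ s' s - Real.pi * Complex.I)) / 2

/-- The prepotential
`𝓕₀ = t² 𝒫∫ds ∫ds' ln(λ(s) - λ(s')) ρ₀(s) ρ₀(s') - t ∫ds W(λ(s)) ρ₀(s)`. -/
def prepotential (D : SpectralCurve g W t) (ℓ : ℝ → ℝ → ℂ) : ℂ :=
  t ^ 2 * (∫ s, ∫ s', principalLog ℓ s s' * D.ρ₀ s * D.ρ₀ s') -
    t * ∫ s, W.eval (D.path s) * D.ρ₀ s

/-- All limits and integrals that enter the prepotential exist. -/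
structure Converges (D : SpectralCurve g W t) (ℓ : ℝ → ℝ → ℂ) : Prop where
  density : ∀ s : ℝ, ∃ l : ℂ, Tendsto (fun ε : ℝ => (1 / (2 * Real.pi * Complex.I)) *
    (D.ω₀ (D.path s - Complex.I * ε * deriv D.path s) -
      D.ω₀ (D.path s + Complex.I * ε * deriv D.path s))) (𝓝[>] 0) (𝓝 l)
  integrable_density : MeasureTheory.Integrable D.ρ₀
  integrable_potential : MeasureTheory.Integrable fun s => W.eval (D.path s) * D.ρ₀ s
  integrable_log : MeasureTheory.Integrable
    fun p : ℝ × ℝ => principalLog ℓ p.1 p.2 * D.ρ₀ p.1 * D.ρ₀ p.2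

/-- `c` is a closed curve on the upper sheet, parametrised by `[0, 1]`, that surrounds precisely
the cuts in `J`, once and clockwise (as seen in the `x`-plane), up to homology off the cuts. -/
structure Encircles (D : SpectralCurve g W t) (J : Set (Fin (g + 1))) (c : ℝ → ℂ) : Prop where
  contDiff : ContDiff ℝ 1 c
  closed : c 0 = c 1
  avoids : ∀ τ ∈ Icc (0 : ℝ) 1, c τ ∉ D.cuts
  winding_inside : ∀ j ∈ J, ∀ z ∈ D.cut j, windingNumber c z = -1
  winding_outside : ∀ j ∉ J, ∀ z ∈ D.cut j, windingNumber c z = 0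

/-- `c` represents the cycle `A^j`, which surrounds the `j`-th cut only. -/
def IsACycle (D : SpectralCurve g W t) (j : Fin (g + 1)) (c : ℝ → ℂ) : Prop :=
  D.Encircles {j} c

/-- `c` represents the cycle `α_i`, which surrounds the cuts up to the `i`-th one. -/
def IsαCycle (D : SpectralCurve g W t) (i : Fin g) (c : ℝ → ℂ) : Prop :=
  D.Encircles (Iic i.castSucc) c

/-- The integral of `ζ` over the closed curve `c`, lifted to the upper sheet. -/
def upperPeriod (D : SpectralCurve g W t) (c : ℝ → ℂ) : ℂ :=
  zetaIntegral c (fun τ => D.y₀ (c τ)) 0 1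

/-- The integral of `ζ` over the cycle `β_i`, which runs along the path from `a_i⁺` to
`a_{i+1}⁻` on the upper sheet, and back from `a_{i+1}⁻` to `a_i⁺` on the lower sheet. -/
def βPeriod (D : SpectralCurve g W t) (i : Fin g) : ℂ :=
  zetaIntegral D.path (fun s => D.y₀ (D.path s)) (D.hi i.castSucc) (D.lo i.succ) +
    zetaIntegral D.path (fun s => -D.y₀ (D.path s)) (D.lo i.succ) (D.hi i.castSucc)

end SpectralCurve

/-- A family of curves `y² = W'(x)² + f₀(x)`, with `W` and `t` fixed, over an open set `U` on
which the variables `S̃` are used as coordinates: the member at the point `S̃` of `U` is a curve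
with these values of the variables. The coefficients of `f₀` are holomorphic functions
of `S̃`, and the path, its tangent and the positions of the branch points on it vary
continuously. -/
structure IsCoordinateFamily {g : ℕ} {W : ℂ[X]} {t : ℂ} (U : Set (Fin g → ℂ))
    (D : (Fin g → ℂ) → SpectralCurve g W t) : Prop where
  isOpen : IsOpen U
  tildeS_eq : ∀ σ ∈ U, ∀ i, (D σ).tildeS i = σ i
  differentiableOn_f : ∀ k, DifferentiableOn ℂ (fun σ => (D σ).f.coeff k) U
  continuousOn_path : ContinuousOn (fun p : (Fin g → ℂ) × ℝ => (D p.1).path p.2) (U ×ˢ univ)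
  continuousOn_tangent :
    ContinuousOn (fun p : (Fin g → ℂ) × ℝ => deriv (D p.1).path p.2) (U ×ˢ univ)
  continuousOn_lo : ∀ i, ContinuousOn (fun σ => (D σ).lo i) U
  continuousOn_hi : ∀ i, ContinuousOn (fun σ => (D σ).hi i) U

/-- `ℓ σ s s'` is a branch of `ln(λ_σ(s) - λ_σ(s'))` for `s' < s` that is continuous in all
variables. -/
structure IsLogBranch {g : ℕ} {W : ℂ[X]} {t : ℂ} (U : Set (Fin g → ℂ))
    (D : (Fin g → ℂ) → SpectralCurve g W t) (ℓ : (Fin g → ℂ) → ℝ → ℝ → ℂ) : Prop where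
  continuousOn : ContinuousOn (fun p : (Fin g → ℂ) × ℝ × ℝ => ℓ p.1 p.2.1 p.2.2)
    {p | p.1 ∈ U ∧ p.2.2 < p.2.1}
  exp_eq : ∀ σ ∈ U, ∀ s s' : ℝ, s' < s →
    Complex.exp (ℓ σ s s') = (D σ).path s - (D σ).path s'

end RigidSpecialGeometry

end

/-! Everything rests on one Cauchy formula. Let `edge` be the boundary value of `y₀` on the left of
the path; on the right it is `-edge`. For a polynomial q, the difference of q/y₀ and the Cauchy
transform of the density q λ'/edge on the cuts (`cauchyDefect`) has no jump. It extends
holomorphically over the open cuts, its singularities at the branch points are removable, and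
Liouville's theorem identifies it with the polynomial part of q/y₀ at infinity (`cauchyDefect_eq`).
For q = W'² + f₀ this says that ω₀ is, up to sign, the Cauchy transform of ρ₀ (`y₀_eq`), and the
coefficient -4t of f₀ yields ∫ρ₀ = 1. Part 1 then follows from Fubini: a closed curve sees each
point of the cuts with its winding number (`upperPeriod_eq`).

For part 2 let V be the principal-value logarithmic potential of ρ₀ along the path and Φ = W(λ) -
2tV (`effPotential`). The derivative of V is λ' times the mean of the two boundary values of ω₀. On
a cut these are (W' ∓ y)/2t, so Φ equals a constant Φ_i on the i-th cut. In a gap Φ' = y₀ λ', so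
Φ_{i+1} - Φ_i is half the β-period (`cutPotential_succ_sub`). Eliminating V turns the prepotential
into -(t/2)∫Wρ₀ - ½ Σ Φ_i S_i (`prepotential_eq`).

Let δ be the derivative in a complex parameter. Formally δρ = δf₀ λ'/(4πi t edge) (`varDensity`),
the potential of δρ is a constant Ψ_i on each cut, and δΦ_i = -2tΨ_i. Symmetry of the logarithmic
kernel gives t∫Wδρ = Σ Φ_i δS_i + 2t Σ Ψ_i S_i, and the variation of the prepotential collapses to
-Σ Φ_i δS_i. Moving the i-th coordinate alone raises S_i and lowers S_{i+1} at the same rate, which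
leaves Φ_{i+1} - Φ_i.

The obstacle is that ρ₀(s) cannot be differentiated in the parameter at fixed s: the path is only
continuous in it, and δρ is unbounded at the branch points. The variation is therefore computed off
the path, where y₀(x) is holomorphic in the parameter with derivative δf₀/(2y₀). The exponentiated
potential `potExp` is differentiated far out, as a moment written over a large circle, and the
result is carried along segments through the complement of the path, which is connected
(`isPreconnected_compl_image_Icc`). Two opposite points close to the path then recover the wanted
quantities: across a cut the product of the values of `potExp` contains exp(-Φ_i/t), across a gap
their ratio contains exp(2πi Σ S_k/t). Differentiating these two relations gives δΦ_i = -2tΨ_i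
(`hasDerivAt_cutPotential`) and shows that δS_k is t times the integral of δρ over the k-th cut
(`mul_integral_varDensity`). -/

noncomputable section

namespace RigidSpecialGeometry

open MeasureTheory

/-! ### Parameter integrals and Cauchy transforms. -/

/-- Differentiation under the integral sign for a bounded family of holomorphic functions. -/
theorem hasDerivAt_integral_of_differentiableOn_ball {α : Type*} [MeasurableSpace α]
    {μ : Measure α} {F : ℂ → α → ℂ} {z₀ : ℂ} {r : ℝ} {b : α → ℝ} (hr : 0 < r)
    (hmeas : ∀ z ∈ Metric.ball z₀ r, AEStronglyMeasurable (F z) μ)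
    (hd : ∀ᵐ a ∂μ, DifferentiableOn ℂ (fun z => F z a) (Metric.ball z₀ r))
    (hb : ∀ᵐ a ∂μ, ∀ z ∈ Metric.ball z₀ r, ‖F z a‖ ≤ b a) (hbi : Integrable b μ) :
    HasDerivAt (fun z => ∫ a, F z a ∂μ) (∫ a, deriv (fun z => F z a) z₀ ∂μ) z₀ := by
  have hz₀ : z₀ ∈ Metric.ball z₀ r := Metric.mem_ball_self hr
  have hr2 : 0 < r / 2 := half_pos hr
  have hsub : ∀ z ∈ Metric.ball z₀ (r / 2), Metric.closedBall z (r / 4) ⊆ Metric.ball z₀ r := by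
    intro z hz w hw
    rw [Metric.mem_ball] at hz ⊢
    rw [Metric.mem_closedBall] at hw
    linarith [dist_triangle w z z₀]
  refine (hasDerivAt_integral_of_dominated_loc_of_deriv_le
    (F' := fun z a => deriv (fun z => F z a) z) (bound := fun a => b a / (r / 4))
    (Metric.ball_mem_nhds z₀ hr2) ?_ ?_ ?_ ?_ (hbi.div_const _) ?_).2
  · filter_upwards [Metric.ball_mem_nhds z₀ hr] with z hz using hmeas z hz
  · exact hbi.mono' (hmeas _ hz₀) (hb.mono fun a ha => ha _ hz₀)
  -- The derivative at z₀ is measurable in a as the pointwise limit of difference quotients along a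
  -- sequence tending to z₀.
  · have hseq : Tendsto (fun n : ℕ => z₀ + ((r / 2 / (n + 1) : ℝ) : ℂ)) atTop (𝓝[≠] z₀) := by
      refine tendsto_nhdsWithin_iff.mpr ⟨?_, Eventually.of_forall fun n => ?_⟩
      · have h1 : Tendsto (fun n : ℕ => r / 2 / ((n : ℝ) + 1)) atTop (𝓝 0) :=
          tendsto_const_nhds.div_atTop (tendsto_atTop_add_const_right _ _
            tendsto_natCast_atTop_atTop)
        have h2 := ((Complex.continuous_ofReal.tendsto _).comp h1).const_add z₀
        simpa using h2
      · have : (0 : ℝ) < r / 2 / (n + 1) := by positivity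
        simp only [mem_compl_iff, mem_singleton_iff, add_eq_left]
        exact_mod_cast this.ne'
    refine aestronglyMeasurable_of_tendsto_ae (u := atTop)
      (f := fun (n : ℕ) a => slope (fun z => F z a) z₀ (z₀ + ((r / 2 / (n + 1) : ℝ) : ℂ))) ?_ ?_
    · intro n
      simp only [slope, vsub_eq_sub, smul_eq_mul]
      refine AEStronglyMeasurable.const_mul ((hmeas _ ?_).sub (hmeas _ hz₀)) _
      have h1 : (0 : ℝ) < r / 2 / (n + 1) := by positivity
      have h2 : r / 2 / (n + 1) ≤ r / 2 := by
        apply div_le_self hr2.le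
        linarith [(Nat.cast_nonneg n : (0 : ℝ) ≤ n)]
      rw [Metric.mem_ball, dist_eq_norm, add_sub_cancel_left, Complex.norm_real, Real.norm_eq_abs,
        abs_of_pos h1]
      linarith
    · filter_upwards [hd] with a ha
      exact (hasDerivAt_iff_tendsto_slope.mp
        (ha.differentiableAt (Metric.ball_mem_nhds z₀ hr)).hasDerivAt).comp hseq
  -- Cauchy's estimate on the circle of radius r/4 around a point of the half ball, which stays
  -- inside the ball of radius r.
  · filter_upwards [hd, hb] with a ha hba z hz
    refine Complex.norm_deriv_le_of_forall_mem_sphere_norm_le (by positivity) ?_ ?_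
    · exact (ha.mono (hsub z hz)).diffContOnCl_ball Subset.rfl
    · intro w hw
      exact hba w (hsub z hz (Metric.sphere_subset_closedBall hw))
  · filter_upwards [hd] with a ha z hz
    exact (ha.differentiableAt (Metric.isOpen_ball.mem_nhds
      (Metric.ball_subset_ball (by linarith) hz))).hasDerivAt

/-- The integral of a bounded family of holomorphic functions is holomorphic. -/
theorem differentiableOn_integral {α : Type*} [MeasurableSpace α]
    {μ : Measure α} {F : ℂ → α → ℂ} {U : Set ℂ} {b : α → ℝ} (hU : IsOpen U)
    (hmeas : ∀ z ∈ U, AEStronglyMeasurable (F z) μ)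
    (hd : ∀ᵐ a ∂μ, DifferentiableOn ℂ (fun z => F z a) U)
    (hb : ∀ᵐ a ∂μ, ∀ z ∈ U, ‖F z a‖ ≤ b a) (hbi : Integrable b μ) :
    DifferentiableOn ℂ (fun z => ∫ a, F z a ∂μ) U := by
  intro z hz
  obtain ⟨r, hr, hrU⟩ := Metric.isOpen_iff.mp hU z hz
  exact (hasDerivAt_integral_of_differentiableOn_ball hr (fun w hw => hmeas w (hrU hw))
    (hd.mono fun a ha => ha.mono hrU) (hb.mono fun a ha w hw => ha w (hrU hw))
    hbi).differentiableAt.differentiableWithinAt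

/-- The Cauchy transform of an integrable density along a curve. -/
theorem hasDerivAt_cauchyTransform {γ : ℝ → ℂ} (hγ : Continuous γ) {v : ℝ → ℂ}
    (hv : Integrable v) {x₀ : ℂ} {r : ℝ} (hr : 0 < r)
    (hfar : ∀ s, v s ≠ 0 → γ s ∉ Metric.ball x₀ r) :
    HasDerivAt (fun x => ∫ s, v s / (γ s - x)) (∫ s, v s / (γ s - x₀) ^ 2) x₀ := by
  have hdist : ∀ s, v s ≠ 0 → ∀ x ∈ Metric.ball x₀ (r / 2), r / 2 ≤ ‖γ s - x‖ := by
    intro s hs x hx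
    have h1 := hfar s hs
    rw [Metric.mem_ball, not_lt, dist_eq_norm] at h1
    rw [Metric.mem_ball, dist_eq_norm] at hx
    have := norm_sub_le_norm_sub_add_norm_sub (γ s) x x₀
    linarith
  have hne : ∀ s, v s ≠ 0 → ∀ x ∈ Metric.ball x₀ (r / 2), γ s - x ≠ 0 := by
    intro s hs x hx h
    have := hdist s hs x hx
    rw [h, norm_zero] at this
    linarith
  have hD : ∀ s, ∀ x ∈ Metric.ball x₀ (r / 2),
      HasDerivAt (fun x => v s / (γ s - x)) (v s / (γ s - x) ^ 2) x := by
    intro s x hx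
    by_cases hs : v s = 0
    · simpa [hs] using hasDerivAt_const x (0 : ℂ)
    · have h1 := ((hasDerivAt_id x).const_sub (γ s)).inv (hne s hs x hx)
      have h2 := h1.const_mul (v s)
      refine (h2.congr_deriv ?_).congr_of_eventuallyEq (Eventually.of_forall fun y => ?_)
      · simp [div_eq_mul_inv]
      · simp [div_eq_mul_inv]
  have key := hasDerivAt_integral_of_differentiableOn_ball (μ := volume)
    (F := fun x s => v s / (γ s - x)) (z₀ := x₀) (b := fun s => ‖v s‖ / (r / 2)) (half_pos hr)
    (fun x _ => hv.aestronglyMeasurable.mul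
      (hγ.measurable.sub_const x).inv.aestronglyMeasurable |>.congr
      (Eventually.of_forall fun s => (div_eq_mul_inv _ _).symm))
    (Eventually.of_forall fun s x hx => (hD s x hx).differentiableAt.differentiableWithinAt)
    (Eventually.of_forall fun s x hx => by
      by_cases hs : v s = 0
      · simp [hs]
      · rw [norm_div]
        exact div_le_div_of_nonneg_left (norm_nonneg _) (half_pos hr) (hdist s hs x hx))
    (hv.norm.div_const _)
  refine key.congr_deriv ?_
  exact integral_congr_ae (Eventually.of_forall fun s =>
    (hD s x₀ (Metric.mem_ball_self (half_pos hr))).deriv)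

/-! ### Logarithms along an arc. -/

/-- `∫ dz / (z - x)` along the part of the curve `γ` between the parameters `a` and `b`. -/
def arcLog (γ : ℝ → ℂ) (a b : ℝ) (x : ℂ) : ℂ :=
  ∫ s in a..b, deriv γ s / (γ s - x)

section ArcLog

variable {γ : ℝ → ℂ} {a b c : ℝ} {x e : ℂ}

theorem continuousOn_arcLog_integrand (hγ : ContDiff ℝ 1 γ) (hx : ∀ s ∈ uIcc a b, γ s ≠ x) :
    ContinuousOn (fun s => deriv γ s / (γ s - x)) (uIcc a b) :=
  (hγ.continuous_deriv le_rfl).continuousOn.div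
    (hγ.continuous.sub continuous_const).continuousOn fun s hs => sub_ne_zero.mpr (hx s hs)

theorem arcLog_add (hγ : ContDiff ℝ 1 γ) (hab : ∀ s ∈ uIcc a b, γ s ≠ x)
    (hbc : ∀ s ∈ uIcc b c, γ s ≠ x) :
    arcLog γ a b x + arcLog γ b c x = arcLog γ a c x :=
  intervalIntegral.integral_add_adjacent_intervals
    (continuousOn_arcLog_integrand hγ hab).intervalIntegrable
    (continuousOn_arcLog_integrand hγ hbc).intervalIntegrable

/-- A continuous branch of the logarithm of `γ - x` computes `arcLog`. -/
theorem arcLog_eq_sub_of_branch (hγ : ContDiff ℝ 1 γ) (hab : a ≤ b)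
    {L : ℝ → ℂ} (hLc : ContinuousOn L (Icc a b))
    (hL : ∀ s ∈ Icc a b, Complex.exp (L s) = γ s - x) : arcLog γ a b x = L b - L a := by
  have hne : ∀ s ∈ Icc a b, γ s - x ≠ 0 := fun s hs => hL s hs ▸ Complex.exp_ne_zero _
  refine intervalIntegral.integral_eq_sub_of_hasDerivAt_of_le hab hLc ?_ ?_
  · intro s hs
    have hs' := Ioo_subset_Icc_self hs
    have hγs : HasDerivAt (fun s => γ s - x) (deriv γ s) s :=
      ((hγ.differentiable (by norm_num)).differentiableAt.hasDerivAt).sub_const x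
    -- `L` is locally the composition of a local inverse of `exp` with `γ - x`
    have hLs : ContinuousAt L s := hLc.continuousAt (Icc_mem_nhds hs.1 hs.2)
    have hloc : ∀ᶠ τ in 𝓝 s, L τ = Complex.log ((γ τ - x) / (γ s - x)) + L s := by
      have h1 : ∀ᶠ τ in 𝓝 s, ‖L τ - L s‖ < Real.pi := by
        have : Tendsto (fun τ => ‖L τ - L s‖) (𝓝 s) (𝓝 0) := by
          simpa using (hLs.tendsto.sub_const (L s)).norm
        exact this.eventually (gt_mem_nhds Real.pi_pos)
      filter_upwards [h1, Icc_mem_nhds hs.1 hs.2] with τ hτ hτI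
      have him := (abs_lt.mp ((Complex.abs_im_le_norm _).trans_lt hτ))
      rw [← hL τ hτI, ← hL s hs', ← Complex.exp_sub, Complex.log_exp him.1 him.2.le,
        sub_add_cancel]
    have h0 : HasDerivAt (fun τ => Complex.log ((γ τ - x) / (γ s - x)) + L s)
        (deriv γ s / (γ s - x) / ((γ s - x) / (γ s - x))) s := by
      refine HasDerivAt.add_const _ ?_
      have h2 := hγs.div_const (γ s - x)
      refine h2.clog_real ?_
      rw [div_self (hne s hs')]
      exact Complex.one_mem_slitPlane
    rw [div_self (hne s hs'), div_one] at h0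
    exact h0.congr_of_eventuallyEq hloc
  · exact (continuousOn_arcLog_integrand hγ (by
      rw [uIcc_of_le hab]; exact fun s hs => sub_ne_zero.mp (hne s hs))).intervalIntegrable

/-- The factor κ moves the arc off the cut of the principal logarithm; log κ drops out of the
difference. -/
theorem arcLog_eq_log (hγ : ContDiff ℝ 1 γ) (hab : a ≤ b) {κ : ℂ}
    (hs : ∀ s ∈ Icc a b, κ * (γ s - x) ∈ Complex.slitPlane) :
    arcLog γ a b x = Complex.log (κ * (γ b - x)) - Complex.log (κ * (γ a - x)) := by
  have hκ : κ ≠ 0 := fun h => by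
    have := hs a ⟨le_rfl, hab⟩
    simp [h] at this
  have := arcLog_eq_sub_of_branch (x := x) hγ hab
    (L := fun s => Complex.log (κ * (γ s - x)) - Complex.log κ) ?_ ?_
  · rw [this]; ring
  · refine ContinuousOn.sub (ContinuousOn.clog ?_ hs) continuousOn_const
    exact (continuous_const.mul (hγ.continuous.sub continuous_const)).continuousOn
  · intro s h
    rw [Complex.exp_sub, Complex.exp_log (Complex.slitPlane_ne_zero (hs s h)), Complex.exp_log hκ]
    field_simp

/-- The function exp(-J(u)) (γ(u) - x), with J(u) the integral up to u, has derivative zero. No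
branch of the logarithm is needed in advance. -/
theorem exp_arcLog (hγ : ContDiff ℝ 1 γ) (hab : a ≤ b) (hx : ∀ s ∈ Icc a b, γ s ≠ x) :
    (γ a - x) * Complex.exp (arcLog γ a b x) = γ b - x := by
  have hne : ∀ s ∈ Icc a b, γ s - x ≠ 0 := fun s hs => sub_ne_zero.mpr (hx s hs)
  have hc := continuousOn_arcLog_integrand hγ (by rwa [uIcc_of_le hab])
  have hJc : ContinuousOn (fun u => arcLog γ a u x) (Icc a b) := by
    have := intervalIntegral.continuousOn_primitive_interval (μ := volume)
      (hc.integrableOn_compact isCompact_uIcc)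
    rwa [uIcc_of_le hab] at this
  rw [uIcc_of_le hab] at hc
  have hJd : ∀ u ∈ Ioo a b, HasDerivAt (fun u => arcLog γ a u x) (deriv γ u / (γ u - x)) u := by
    intro u hu
    refine intervalIntegral.integral_hasDerivAt_right ?_ ?_ ?_
    · apply ContinuousOn.intervalIntegrable
      rw [uIcc_of_le hu.1.le]
      exact hc.mono (Icc_subset_Icc_right hu.2.le)
    · exact ⟨Ioo a b, Ioo_mem_nhds hu.1 hu.2,
        (hc.mono Ioo_subset_Icc_self).aestronglyMeasurable measurableSet_Ioo⟩
    · exact hc.continuousAt (Icc_mem_nhds hu.1 hu.2)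
  have key := intervalIntegral.integral_eq_sub_of_hasDerivAt_of_le (f' := fun _ => 0)
    (f := fun u => Complex.exp (-arcLog γ a u x) * (γ u - x)) hab
    ((Complex.continuous_exp.comp_continuousOn hJc.neg).mul
      (hγ.continuous.sub continuous_const).continuousOn)
    (by
      intro u hu
      have h1 := ((hJd u hu).neg.cexp).mul
        ((hγ.differentiable (by norm_num)).differentiableAt.hasDerivAt.sub_const x)
      refine h1.congr_deriv ?_
      have h3 : deriv γ u / (γ u - x) * (γ u - x) = deriv γ u :=
        div_mul_cancel₀ _ (hne u (Ioo_subset_Icc_self hu))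
      simp only [Pi.neg_apply]
      linear_combination -Complex.exp (-arcLog γ a u x) * h3)
    intervalIntegrable_const
  have h0 : arcLog γ a a x = 0 := intervalIntegral.integral_same
  simp only [intervalIntegral.integral_zero, h0, neg_zero, Complex.exp_zero, one_mul] at key
  have h2 : Complex.exp (-arcLog γ a b x) * Complex.exp (arcLog γ a b x) = 1 := by
    rw [← Complex.exp_add]; simp
  linear_combination Complex.exp (arcLog γ a b x) * key + (γ b - x) * h2

theorem re_arcLog (hγ : ContDiff ℝ 1 γ) (hab : a ≤ b) (hx : ∀ s ∈ Icc a b, γ s ≠ x) :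
    (arcLog γ a b x).re = Real.log ‖γ b - x‖ - Real.log ‖γ a - x‖ := by
  have h := congrArg (fun w => ‖w‖) (exp_arcLog hγ hab hx)
  have ha : ‖γ a - x‖ ≠ 0 := norm_ne_zero_iff.mpr (sub_ne_zero.mpr (hx a ⟨le_rfl, hab⟩))
  simp only [norm_mul, Complex.norm_exp] at h
  rw [← h, Real.log_mul ha (Real.exp_ne_zero _), Real.log_exp]
  ring

/-- Differentiation under the integral gives ∫ γ'/(γ - x)², whose integrand is the s-derivative of
1/(x - γ). -/
theorem hasDerivAt_arcLog (hγ : ContDiff ℝ 1 γ) (hab : a ≤ b)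
    (hx : ∀ s ∈ Icc a b, γ s ≠ x) :
    HasDerivAt (arcLog γ a b) (1 / (x - γ b) - 1 / (x - γ a)) x := by
  have hK : IsClosed (γ '' Icc a b) := (isCompact_Icc.image hγ.continuous).isClosed
  have hxK : x ∈ (γ '' Icc a b)ᶜ := by rintro ⟨s, hs, h⟩; exact hx s hs h
  obtain ⟨r, hr, hball⟩ := Metric.isOpen_iff.mp hK.isOpen_compl x hxK
  have hcd := hγ.continuous_deriv le_rfl
  have hv : Integrable (indicator (Ioc a b) (deriv γ)) := by
    rw [integrable_indicator_iff measurableSet_Ioc]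
    exact hcd.integrableOn_Ioc
  have h := hasDerivAt_cauchyTransform hγ.continuous hv hr (x₀ := x) (by
    intro s hs hsb
    have hsI : s ∈ Ioc a b := by
      by_contra h; exact hs (indicator_of_notMem h _)
    exact hball hsb ⟨s, Ioc_subset_Icc_self hsI, rfl⟩)
  have e1 : ∀ y, (∫ s, indicator (Ioc a b) (deriv γ) s / (γ s - y)) = arcLog γ a b y := by
    intro y
    rw [arcLog, intervalIntegral.integral_of_le hab, ← integral_indicator measurableSet_Ioc]
    congr 1; ext s; by_cases hs : s ∈ Ioc a b <;> simp [hs]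
  have e2 : (∫ s, indicator (Ioc a b) (deriv γ) s / (γ s - x) ^ 2) =
      ∫ s in a..b, deriv γ s / (γ s - x) ^ 2 := by
    rw [intervalIntegral.integral_of_le hab, ← integral_indicator measurableSet_Ioc]
    congr 1; ext s; by_cases hs : s ∈ Ioc a b <;> simp [hs]
  have e3 : ∫ s in a..b, deriv γ s / (γ s - x) ^ 2 = 1 / (x - γ b) - 1 / (x - γ a) := by
    have hne : ∀ s ∈ Icc a b, x - γ s ≠ 0 := fun s hs => sub_ne_zero.mpr (hx s hs).symm
    have := intervalIntegral.integral_eq_sub_of_hasDerivAt (a := a) (b := b)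
      (f := fun s => 1 / (x - γ s)) (f' := fun s => deriv γ s / (γ s - x) ^ 2) ?_ ?_
    · rw [this]
    · intro s hs
      rw [uIcc_of_le hab] at hs
      have h1 := ((hγ.differentiable (by norm_num)).differentiableAt (x := s)).hasDerivAt
      have h2 := (h1.const_sub x).inv (hne s hs)
      simp only [one_div]
      refine h2.congr_deriv ?_
      rw [neg_neg, ← neg_sub x (γ s), neg_sq]
    · apply ContinuousOn.intervalIntegrable
      rw [uIcc_of_le hab]
      refine hcd.continuousOn.div
        ((hγ.continuous.sub continuous_const).pow 2).continuousOn fun s hs => ?_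
      exact pow_ne_zero 2 (sub_ne_zero.mpr (hx s hs))
  rw [e2, e3] at h
  exact h.congr_of_eventuallyEq (Eventually.of_forall fun y => (e1 y).symm)

/-- On a part of the curve whose tangent has a positive component in the direction `e`, this
component of the position increases. -/
theorem strictMonoOn_re (hγ : ContDiff ℝ 1 γ) (he : ∀ s ∈ Icc a b, 0 < (deriv γ s / e).re) :
    StrictMonoOn (fun s => (γ s / e).re) (Icc a b) := by
  refine strictMonoOn_of_deriv_pos (convex_Icc a b)
    (Complex.continuous_re.comp (hγ.continuous.div_const e)).continuousOn fun s hs => ?_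
  have h1 := ((hγ.differentiable (by norm_num)).differentiableAt (x := s)).hasDerivAt
  have h2 : HasDerivAt (fun s => (γ s / e).re) ((deriv γ s / e).re) s := by
    have := (Complex.reCLM.hasFDerivAt (x := γ s / e)).comp_hasDerivAt s (h1.div_const e)
    exact this
  rw [h2.deriv]
  exact he s (interior_subset hs)

/-- After division by e the arc is a graph over the real axis and x lies straight above or below the
point with parameter s. Only that point shares the real part of x/e, and there the rotated value is
κε > 0; every other point acquires a nonzero imaginary part. The sign of κ selects the side. -/
theorem mem_slitPlane_of_left (hγ : ContDiff ℝ 1 γ) (he0 : e ≠ 0)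
    (he : ∀ s ∈ Icc a b, 0 < (deriv γ s / e).re) {s : ℝ} (hs : s ∈ Icc a b) {ε : ℝ} (κ : ℝ)
    (hε : 0 < κ * ε) (hx : x = γ s + Complex.I * ε * e) :
    ∀ τ ∈ Icc a b, κ * Complex.I / e * (γ τ - x) ∈ Complex.slitPlane := by
  intro τ hτ
  have hw : (γ τ - x) / e = γ τ / e - γ s / e - Complex.I * ε := by
    rw [hx]; field_simp; ring
  have hre : ((γ τ - x) / e).re = (γ τ / e).re - (γ s / e).re := by rw [hw]; simp
  have e1 : κ * Complex.I / e * (γ τ - x) = κ * Complex.I * ((γ τ - x) / e) := by ring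
  have hκ : κ ≠ 0 := fun h => by simp [h] at hε
  rw [e1, Complex.mem_slitPlane_iff]
  by_cases h : τ = s
  · left
    rw [hw, h]
    simpa using hε
  · right
    have h3 : ((γ τ - x) / e).re ≠ 0 := by
      rw [hre]
      intro h4
      exact h ((strictMonoOn_re hγ he).injOn hτ hs (by simpa [sub_eq_zero] using h4))
    simpa [hκ] using h3

/-- Either x lies on the transversal through a point of the arc, hence strictly on one side of it,
or the arc misses the whole line through x in the direction I e; then the rotation I/e makes all
imaginary parts nonzero. -/
theorem exists_mem_slitPlane (hγ : ContDiff ℝ 1 γ) (he0 : e ≠ 0)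
    (he : ∀ s ∈ Icc a b, 0 < (deriv γ s / e).re) (hx : ∀ s ∈ Icc a b, γ s ≠ x) :
    ∃ κ : ℂ, ∀ τ ∈ Icc a b, κ * (γ τ - x) ∈ Complex.slitPlane := by
  have hmono := strictMonoOn_re hγ he
  by_cases h : ∃ s ∈ Icc a b, (γ s / e).re = (x / e).re
  · obtain ⟨s, hs, hsx⟩ := h
    have hx' : x = γ s + Complex.I * (((x - γ s) / e).im : ℝ) * e := by
      have h1 : (x - γ s) / e = Complex.I * (((x - γ s) / e).im : ℝ) := by
        apply Complex.ext
        · rw [sub_div]; simp [hsx]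
        · simp
      rw [← h1, div_mul_cancel₀ _ he0]; ring
    have hne : ((x - γ s) / e).im ≠ 0 := by
      intro h0
      rw [h0] at hx'
      exact hx s hs (by simpa using hx'.symm)
    exact ⟨_, mem_slitPlane_of_left hγ he0 he hs ((x - γ s) / e).im
      (mul_self_pos.mpr hne) hx'⟩
  · push Not at h
    refine ⟨Complex.I / e, fun τ hτ => ?_⟩
    rw [Complex.mem_slitPlane_iff]
    right
    have e1 : Complex.I / e * (γ τ - x) = Complex.I * (γ τ / e - x / e) := by ring
    rw [e1]
    simpa [sub_eq_zero] using h τ hτ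

/-- The imaginary part is a difference of two principal arguments. The bound does not depend on x,
which later permits dominated convergence as x approaches the arc. -/
theorem abs_im_arcLog_le (hγ : ContDiff ℝ 1 γ) (hab : a ≤ b) (he0 : e ≠ 0)
    (he : ∀ s ∈ Icc a b, 0 < (deriv γ s / e).re) (hx : ∀ s ∈ Icc a b, γ s ≠ x) :
    |(arcLog γ a b x).im| ≤ 2 * Real.pi := by
  obtain ⟨κ, hκ⟩ := exists_mem_slitPlane hγ he0 he hx
  rw [arcLog_eq_log hγ hab hκ, Complex.sub_im, Complex.log_im, Complex.log_im]
  have h1 := Complex.abs_arg_le_pi (κ * (γ b - x))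
  have h2 := Complex.abs_arg_le_pi (κ * (γ a - x))
  have := abs_sub (κ * (γ b - x)).arg (κ * (γ a - x)).arg
  linarith

theorem norm_arcLog_le (hγ : ContDiff ℝ 1 γ) (hab : a ≤ b) (he0 : e ≠ 0)
    (he : ∀ s ∈ Icc a b, 0 < (deriv γ s / e).re) (hx : ∀ s ∈ Icc a b, γ s ≠ x) :
    ‖arcLog γ a b x‖ ≤ |Real.log ‖γ b - x‖| + |Real.log ‖γ a - x‖| + 2 * Real.pi := by
  have h1 := Complex.norm_le_abs_re_add_abs_im (arcLog γ a b x)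
  have h2 := abs_im_arcLog_le hγ hab he0 he hx
  rw [re_arcLog hγ hab hx] at h1
  have := abs_sub (Real.log ‖γ b - x‖) (Real.log ‖γ a - x‖)
  linarith

theorem log_I_mul {w : ℂ} (hw : 0 < w.re) :
    Complex.log (Complex.I * w) = Complex.log w + Real.pi / 2 * Complex.I := by
  have hne : w ≠ 0 := fun h => by simp [h] at hw
  have ha := Complex.abs_arg_lt_pi_div_two_iff.mpr (Or.inl hw)
  have := abs_lt.mp ha
  rw [Complex.log_mul Complex.I_ne_zero hne, Complex.log_I]
  · ring
  · rw [Complex.arg_I]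
    constructor <;> linarith

theorem log_neg_I_mul {w : ℂ} (hw : 0 < w.re) :
    Complex.log (-Complex.I * w) = Complex.log w - Real.pi / 2 * Complex.I := by
  have hne : w ≠ 0 := fun h => by simp [h] at hw
  have ha := Complex.abs_arg_lt_pi_div_two_iff.mpr (Or.inl hw)
  have := abs_lt.mp ha
  rw [Complex.log_mul (neg_ne_zero.mpr Complex.I_ne_zero) hne, Complex.log_neg_I]
  · ring
  · rw [Complex.arg_neg_I]
    constructor <;> linarith

/-- `arcLog` on the left of a part of the curve. -/
theorem arcLog_left (hγ : ContDiff ℝ 1 γ) (he0 : e ≠ 0)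
    (he : ∀ s ∈ Icc a b, 0 < (deriv γ s / e).re) {s : ℝ} (hs : s ∈ Ioo a b) {ε : ℝ}
    (hε : 0 < ε) (hx : x = γ s + Complex.I * ε * e) :
    arcLog γ a b x = Complex.log ((γ b - x) / e) - Complex.log ((x - γ a) / e) +
      Real.pi * Complex.I := by
  have hab : a ≤ b := (hs.1.trans hs.2).le
  have hs' := Ioo_subset_Icc_self hs
  have h := mem_slitPlane_of_left hγ he0 he hs' 1 (by simpa using hε) hx
  have hmono := strictMonoOn_re hγ he
  have hre : ∀ τ, ((γ τ - x) / e).re = (γ τ / e).re - (γ s / e).re := by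
    intro τ
    have hw : (γ τ - x) / e = γ τ / e - γ s / e - Complex.I * ε := by
      rw [hx]; field_simp; ring
    rw [hw]; simp
  have hb : 0 < ((γ b - x) / e).re := by
    rw [hre]; exact sub_pos.mpr (hmono hs' ⟨hab, le_rfl⟩ hs.2)
  have ha : 0 < ((x - γ a) / e).re := by
    have : (x - γ a) / e = -((γ a - x) / e) := by ring
    rw [this, Complex.neg_re, hre]
    have : (γ a / e).re < (γ s / e).re := hmono ⟨le_rfl, hab⟩ hs' hs.1
    linarith
  rw [arcLog_eq_log hγ hab h]
  have e1 : ((1 : ℝ) : ℂ) * Complex.I / e * (γ b - x) = Complex.I * ((γ b - x) / e) := by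
    push_cast; ring
  have e2 : ((1 : ℝ) : ℂ) * Complex.I / e * (γ a - x) = -Complex.I * ((x - γ a) / e) := by
    push_cast; ring
  -- Both quotients lie in the right half plane, so the factors I and -I contribute π/2 each to the
  -- difference of the logarithms.
  rw [e1, e2, log_I_mul hb, log_neg_I_mul ha]
  ring

/-- `arcLog` on the right of a part of the curve. -/
theorem arcLog_right (hγ : ContDiff ℝ 1 γ) (he0 : e ≠ 0)
    (he : ∀ s ∈ Icc a b, 0 < (deriv γ s / e).re) {s : ℝ} (hs : s ∈ Ioo a b) {ε : ℝ}
    (hε : ε < 0) (hx : x = γ s + Complex.I * ε * e) :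
    arcLog γ a b x = Complex.log ((γ b - x) / e) - Complex.log ((x - γ a) / e) -
      Real.pi * Complex.I := by
  have hab : a ≤ b := (hs.1.trans hs.2).le
  have hs' := Ioo_subset_Icc_self hs
  have h := mem_slitPlane_of_left hγ he0 he hs' (-1) (by simpa using hε) hx
  have hmono := strictMonoOn_re hγ he
  have hre : ∀ τ, ((γ τ - x) / e).re = (γ τ / e).re - (γ s / e).re := by
    intro τ
    have hw : (γ τ - x) / e = γ τ / e - γ s / e - Complex.I * ε := by
      rw [hx]; field_simp; ring
    rw [hw]; simp
  have hb : 0 < ((γ b - x) / e).re := by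
    rw [hre]; exact sub_pos.mpr (hmono hs' ⟨hab, le_rfl⟩ hs.2)
  have ha : 0 < ((x - γ a) / e).re := by
    have : (x - γ a) / e = -((γ a - x) / e) := by ring
    rw [this, Complex.neg_re, hre]
    have : (γ a / e).re < (γ s / e).re := hmono ⟨le_rfl, hab⟩ hs' hs.1
    linarith
  rw [arcLog_eq_log hγ hab h]
  have e1 : ((-1 : ℝ) : ℂ) * Complex.I / e * (γ b - x) = -Complex.I * ((γ b - x) / e) := by
    push_cast; ring
  have e2 : ((-1 : ℝ) : ℂ) * Complex.I / e * (γ a - x) = Complex.I * ((x - γ a) / e) := by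
    push_cast; ring
  rw [e1, e2, log_neg_I_mul hb, log_I_mul ha]
  ring

end ArcLog

/-! ### A regular arc does not separate the plane. -/

section Complement

variable {γ : ℝ → ℂ} {e : ℂ}

theorem exists_forall_re_pos (hγ : ContDiff ℝ 1 γ) (hγ' : ∀ s, deriv γ s ≠ 0) (s₀ : ℝ) :
    ∃ δ > 0, ∀ s ∈ Icc (s₀ - δ) (s₀ + δ), 0 < (deriv γ s / deriv γ s₀).re := by
  have hc : ContinuousAt (fun s => (deriv γ s / deriv γ s₀).re) s₀ :=
    (Complex.continuous_re.comp ((hγ.continuous_deriv le_rfl).div_const _)).continuousAt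
  have h0 : 0 < (deriv γ s₀ / deriv γ s₀).re := by rw [div_self (hγ' s₀)]; simp
  obtain ⟨δ, hδ, h⟩ := Metric.eventually_nhds_iff.mp (hc.eventually (lt_mem_nhds h0))
  refine ⟨δ / 2, half_pos hδ, fun s hs => h ?_⟩
  rw [Real.dist_eq]
  exact (abs_le.mpr ⟨by linarith [hs.1], by linarith [hs.2]⟩).trans_lt (half_lt_self hδ)

/-- Every point near the curve lies on a transversal through the curve. -/
theorem eventually_exists_eq_add (hγ : ContDiff ℝ 1 γ) (he0 : e ≠ 0) {a b s : ℝ}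
    (he : ∀ s ∈ Icc a b, 0 < (deriv γ s / e).re) (hs : s ∈ Ioo a b) {ε₀ : ℝ} (hε₀ : 0 < ε₀) :
    ∀ᶠ x in 𝓝 (γ s), ∃ s' ∈ Ioo a b, ∃ ε : ℝ, |ε| < ε₀ ∧ x = γ s' + Complex.I * ε * e := by
  have hmono := strictMonoOn_re hγ he
  have hη : 0 < ε₀ / 2 * ‖e‖ := by positivity
  obtain ⟨δ, hδ, hδb⟩ := Metric.continuousAt_iff.mp (hγ.continuous.continuousAt (x := s)) _ hη
  obtain ⟨a', ha', haa'⟩ := exists_between (max_lt hs.1 (sub_lt_self s hδ))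
  obtain ⟨b', hb', hbb'⟩ := exists_between (lt_min hs.2 (lt_add_of_pos_right s hδ))
  rw [max_lt_iff] at ha'
  rw [lt_min_iff] at hbb'
  have hcre : Continuous fun x : ℂ => (x / e).re := Complex.continuous_re.comp
    (continuous_id.div_const e)
  have hsI := Ioo_subset_Icc_self hs
  have h1 : ∀ᶠ x in 𝓝 (γ s), (γ a' / e).re < (x / e).re :=
    hcre.continuousAt.eventually (lt_mem_nhds
      (hmono ⟨ha'.1.le, (haa'.trans hs.2).le⟩ hsI haa'))
  have h2 : ∀ᶠ x in 𝓝 (γ s), (x / e).re < (γ b' / e).re :=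
    hcre.continuousAt.eventually (gt_mem_nhds
      (hmono hsI ⟨(hs.1.trans hb').le, hbb'.1.le⟩ hb'))
  filter_upwards [h1, h2, Metric.ball_mem_nhds _ hη] with x hx1 hx2 hx3
  have hivt := intermediate_value_Ioo (haa'.trans hb').le
    (f := fun s => (γ s / e).re) (hcre.comp hγ.continuous).continuousOn
  obtain ⟨s', hs', hs'x⟩ := hivt ⟨hx1, hx2⟩
  refine ⟨s', ⟨ha'.1.trans hs'.1, hs'.2.trans hbb'.1⟩, ((x - γ s') / e).im, ?_, ?_⟩
  · refine (Complex.abs_im_le_norm _).trans_lt ?_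
    rw [norm_div, div_lt_iff₀ (norm_pos_iff.mpr he0)]
    have h4 : ‖γ s' - γ s‖ < ε₀ / 2 * ‖e‖ := by
      rw [← dist_eq_norm]
      apply hδb
      rw [Real.dist_eq]
      exact abs_lt.mpr ⟨by linarith [hs'.1], by linarith [hs'.2]⟩
    rw [Metric.mem_ball, dist_eq_norm] at hx3
    have := norm_sub_le_norm_sub_add_norm_sub x (γ s) (γ s')
    rw [norm_sub_rev (γ s) (γ s')] at this
    linarith
  · have h5 : (x - γ s') / e = Complex.I * (((x - γ s') / e).im : ℝ) := by
      apply Complex.ext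
      · rw [sub_div]
        simp only [Complex.sub_re, Complex.mul_re, Complex.I_re, Complex.I_im, Complex.ofReal_im,
          Complex.ofReal_re]
        simp only at hs'x
        rw [hs'x]; ring
      · simp
    rw [← h5, div_mul_cancel₀ _ he0]; ring

/-- Attaching a short arc to a curve does not disconnect its complement. -/
theorem isPreconnected_compl_image_Icc_of_short (hγ : ContDiff ℝ 1 γ)
    (hinj : Function.Injective γ) (he0 : e ≠ 0) {p s₁ s₂ δ : ℝ} (hp : p ≤ s₁) (h12 : s₁ < s₂)
    (hδ : 0 < δ) (he : ∀ s ∈ Icc (s₁ - δ) (s₂ + δ), 0 < (deriv γ s / e).re)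
    (hpre : IsPreconnected (γ '' Icc p s₁)ᶜ) : IsPreconnected (γ '' Icc p s₂)ᶜ := by
  have hmono := strictMonoOn_re hγ he
  set F := γ '' Icc p (s₁ - δ) with hF
  have hFc : IsCompact F := isCompact_Icc.image hγ.continuous
  have hCc : IsCompact (γ '' Icc s₁ (s₂ + δ)) := isCompact_Icc.image hγ.continuous
  have hdisj : γ '' Icc s₁ (s₂ + δ) ⊆ Fᶜ := by
    rintro _ ⟨s, hs, rfl⟩ ⟨τ, hτ, h⟩
    have := hinj h
    linarith [hs.1, hτ.2]
  -- The earlier part F of the arc has positive distance from the short piece, so transversals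
  -- shorter than ε₀ = η/‖e‖ avoid F.
  obtain ⟨η, hη, hηF⟩ := hCc.exists_thickening_subset_open hFc.isClosed.isOpen_compl hdisj
  have hne : 0 < ‖e‖ := norm_pos_iff.mpr he0
  set ε₀ := η / ‖e‖ with hε₀
  have hε₀pos : 0 < ε₀ := div_pos hη hne
  let ψ : ℝ × ℝ → ℂ := fun q => γ q.1 + Complex.I * q.2 * e
  have hψ : Continuous ψ := by
    refine (hγ.continuous.comp continuous_fst).add ?_
    exact (continuous_const.mul (Complex.continuous_ofReal.comp continuous_snd)).mul
      continuous_const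
  have hψF : ∀ s ∈ Icc s₁ (s₂ + δ), ∀ ε : ℝ, |ε| < ε₀ → ψ (s, ε) ∉ F := by
    intro s hs ε hε
    refine hηF (Metric.mem_thickening_iff.mpr ⟨γ s, ⟨s, hs, rfl⟩, ?_⟩)
    rw [dist_eq_norm, show ψ (s, ε) - γ s = Complex.I * ε * e by simp [ψ]]
    rw [norm_mul, norm_mul, Complex.norm_I, one_mul, Complex.norm_real, Real.norm_eq_abs]
    exact (lt_div_iff₀ hne).mp hε
  have hψK : ∀ s ∈ Ioo s₁ (s₂ + δ), ∀ ε : ℝ, |ε| < ε₀ → (ε ≠ 0 ∨ s₂ < s) →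
      ψ (s, ε) ∈ (γ '' Icc p s₂)ᶜ := by
    rintro s hs ε hε hor ⟨τ, hτ, h⟩
    have hs' : s ∈ Icc s₁ (s₂ + δ) := Ioo_subset_Icc_self hs
    by_cases hτ1 : τ ≤ s₁ - δ
    · exact hψF s hs' ε hε ⟨τ, ⟨hτ.1, hτ1⟩, h⟩
    · have hτ2 : τ ∈ Icc (s₁ - δ) (s₂ + δ) := ⟨(not_le.mp hτ1).le, by linarith [hτ.2]⟩
      have hs2 : s ∈ Icc (s₁ - δ) (s₂ + δ) := ⟨by linarith [hs.1], hs.2.le⟩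
      have h1 : γ τ / e = γ s / e + Complex.I * ε := by
        rw [h]; simp only [ψ]; field_simp
      have h2 : (γ τ / e).re = (γ s / e).re := by rw [h1]; simp
      have h3 : τ = s := hmono.injOn hτ2 hs2 h2
      rcases hor with h4 | h4
      · rw [h3] at h1
        have : (ε : ℂ) = 0 := by simpa using h1
        exact h4 (by exact_mod_cast this)
      · linarith [hτ.2]
  -- the collar of the short arc
  set N : Set ℂ := ψ '' ((Ioo s₁ (s₂ + δ) ×ˢ Ioo 0 ε₀ ∪ Ioo s₂ (s₂ + δ) ×ˢ Ioo (-ε₀) ε₀) ∪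
    Ioo s₁ (s₂ + δ) ×ˢ Ioo (-ε₀) 0) with hN
  have hNpre : IsPreconnected N := by
    refine IsPreconnected.image ?_ ψ hψ.continuousOn
    have hm : s₂ + δ / 2 ∈ Ioo s₂ (s₂ + δ) := ⟨by linarith, by linarith⟩
    have hm1 : s₂ + δ / 2 ∈ Ioo s₁ (s₂ + δ) := ⟨by linarith, by linarith⟩
    refine IsPreconnected.union (s₂ + δ / 2, -ε₀ / 2) (Or.inr ⟨hm, ?_, ?_⟩) ⟨hm1, ?_, ?_⟩
      (IsPreconnected.union (s₂ + δ / 2, ε₀ / 2) ⟨hm1, ?_, ?_⟩ ⟨hm, ?_, ?_⟩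
        (isPreconnected_Ioo.prod isPreconnected_Ioo)
        (isPreconnected_Ioo.prod isPreconnected_Ioo))
      (isPreconnected_Ioo.prod isPreconnected_Ioo) <;> simp only <;> linarith
  have hNK : N ⊆ (γ '' Icc p s₂)ᶜ := by
    rintro _ ⟨⟨s, ε⟩, (⟨hs, hε⟩ | ⟨hs, hε⟩) | ⟨hs, hε⟩, rfl⟩
    · exact hψK s hs ε (abs_lt.mpr ⟨by linarith [hε.1], hε.2⟩) (Or.inl hε.1.ne')
    · exact hψK s ⟨h12.trans hs.1, hs.2⟩ ε (abs_lt.mpr hε) (Or.inr hs.1)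
    · exact hψK s hs ε (abs_lt.mpr ⟨hε.1, by linarith [hε.2]⟩) (Or.inl hε.2.ne)
  have hNmem : ∀ s ∈ Ioo s₁ (s₂ + δ), ∀ ε : ℝ, |ε| < ε₀ → (ε ≠ 0 ∨ s₂ < s) → ψ (s, ε) ∈ N := by
    intro s hs ε hε hor
    rcases lt_trichotomy ε 0 with h | h | h
    · exact ⟨(s, ε), Or.inr ⟨hs, (abs_lt.mp hε).1, h⟩, rfl⟩
    · exact ⟨(s, ε), Or.inl (Or.inr ⟨⟨hor.resolve_left (fun h' => h' h), hs.2⟩, abs_lt.mp hε⟩), rfl⟩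
    · exact ⟨(s, ε), Or.inl (Or.inl ⟨hs, h, (abs_lt.mp hε).2⟩), rfl⟩
  have hK2 : IsOpen (γ '' Icc p s₂)ᶜ := (isCompact_Icc.image hγ.continuous).isClosed.isOpen_compl
  have hcompl : (γ '' Icc p s₁)ᶜ = (γ '' Icc p s₂)ᶜ ∪ γ '' Ioc s₁ s₂ := by
    ext x
    simp only [mem_compl_iff, mem_union, mem_image, not_exists, not_and]
    constructor
    · intro h
      by_cases hx : ∃ s ∈ Ioc s₁ s₂, γ s = x
      · exact Or.inr (by obtain ⟨s, hs, h⟩ := hx; exact ⟨s, hs, h⟩)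
      · refine Or.inl fun s hs hsx => ?_
        by_cases hs1 : s ≤ s₁
        · exact h s ⟨hs.1, hs1⟩ hsx
        · exact hx ⟨s, ⟨not_le.mp hs1, hs.2⟩, hsx⟩
    · rintro (h | ⟨s, hs, rfl⟩) τ hτ hτx
      · exact h τ ⟨hτ.1, hτ.2.trans h12.le⟩ hτx
      · have := hinj hτx
        linarith [hs.1, hτ.2]
  -- If the collar lies in u, then u together with the removed arc is open, because near the arc
  -- there is nothing but arc and collar. The old complement is thus separated into this set and v,
  -- and its connectedness pushes everything into the part that contains the arc.
  have key : ∀ u v : Set ℂ, IsOpen u → IsOpen v → (γ '' Icc p s₂)ᶜ ⊆ u ∪ v →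
      (γ '' Icc p s₂)ᶜ ∩ (u ∩ v) = ∅ → N ⊆ u → (γ '' Icc p s₂)ᶜ ⊆ u := by
    intro u v hu hv huv hdis hNu
    have hu' : IsOpen ((u ∩ (γ '' Icc p s₂)ᶜ) ∪ γ '' Ioc s₁ s₂) := by
      rw [isOpen_iff_mem_nhds]
      rintro x (hx | ⟨s, hs, rfl⟩)
      · exact mem_of_superset ((hu.inter hK2).mem_nhds hx) subset_union_left
      · filter_upwards [eventually_exists_eq_add hγ he0
          (fun τ hτ => he τ ⟨by linarith [hτ.1], hτ.2⟩)
          (a := s₁) (b := s₂ + δ) ⟨hs.1, by linarith [hs.2]⟩ hε₀pos] with x hx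
        obtain ⟨s', hs', ε, hε, rfl⟩ := hx
        by_cases hor : ε ≠ 0 ∨ s₂ < s'
        · have := hNmem s' hs' ε hε hor
          exact Or.inl ⟨hNu this, hNK this⟩
        · push Not at hor
          exact Or.inr ⟨s', ⟨hs'.1, hor.2⟩, by simp [hor.1]⟩
    have h2 := (isPreconnected_iff_subset_of_disjoint.mp hpre) _ _ hu' (hv.inter hK2) (by
      rw [hcompl]
      rintro x (hx | hx)
      · rcases huv hx with h | h
        · exact Or.inl (Or.inl ⟨h, hx⟩)
        · exact Or.inr ⟨h, hx⟩
      · exact Or.inl (Or.inr hx)) (by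
      rw [eq_empty_iff_forall_notMem]
      rintro x ⟨-, (hx1 | ⟨s, hs, rfl⟩), hx2⟩
      · exact (eq_empty_iff_forall_notMem.mp hdis) x ⟨hx1.2, hx1.1, hx2.1⟩
      · exact hx2.2 ⟨s, ⟨hp.trans hs.1.le, hs.2⟩, rfl⟩)
    have hmem : γ s₂ ∈ (γ '' Icc p s₁)ᶜ := by
      rw [hcompl]; exact Or.inr ⟨s₂, ⟨h12, le_rfl⟩, rfl⟩
    rcases h2 with h2 | h2
    · intro x hx
      rcases h2 (show x ∈ (γ '' Icc p s₁)ᶜ by rw [hcompl]; exact Or.inl hx) with h | ⟨s, hs, rfl⟩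
      · exact h.1
      · exact absurd ⟨s, ⟨hp.trans hs.1.le, hs.2⟩, rfl⟩ hx
    · exact absurd ⟨s₂, ⟨hp.trans h12.le, le_rfl⟩, rfl⟩ (h2 hmem).2
  rw [isPreconnected_iff_subset_of_disjoint]
  intro u v hu hv huv hdis
  have hNuv := (isPreconnected_iff_subset_of_disjoint.mp hNpre) u v hu hv (hNK.trans huv) (by
    rw [eq_empty_iff_forall_notMem] at hdis ⊢
    exact fun x hx => hdis x ⟨hNK hx.1, hx.2⟩)
  rcases hNuv with h | h
  · exact Or.inl (key u v hu hv huv hdis h)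
  · exact Or.inr (key v u hv hu (by rwa [union_comm]) (by rwa [inter_comm v u]) h)

/-- A regular `C¹` arc without self-intersections does not disconnect the plane. -/
theorem isPreconnected_compl_image_Icc (hγ : ContDiff ℝ 1 γ) (hγ' : ∀ s, deriv γ s ≠ 0)
    (hinj : Function.Injective γ) {p q : ℝ} (hpq : p ≤ q) :
    IsPreconnected (γ '' Icc p q)ᶜ := by
  choose δ hδ hδre using exists_forall_re_pos hγ hγ'
  -- The pieces are chosen inside intervals of half the size on which the tangent keeps a positive
  -- component, which leaves the margin δ/2 at both ends that the attaching step needs.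
  obtain ⟨T, hT0, hTmono, ⟨m, hm⟩, hT⟩ := exists_monotone_Icc_subset_open_cover_Icc hpq
    (c := fun s₀ : ℝ => {x : Icc p q | (x : ℝ) ∈ Ioo (s₀ - δ s₀ / 2) (s₀ + δ s₀ / 2)})
    (fun s₀ => isOpen_Ioo.preimage continuous_subtype_val)
    (fun x _ => mem_iUnion.mpr ⟨x, by
      have := hδ x
      exact ⟨by linarith, by linarith⟩⟩)
  have hstep : ∀ k, IsPreconnected (γ '' Icc p (T k))ᶜ := by
    intro k
    induction k with
    | zero =>
      rw [hT0, Icc_self, image_singleton]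
      exact (isConnected_compl_singleton_of_one_lt_rank (by simp) _).isPreconnected
    | succ k ih =>
      have hle : (T k : ℝ) ≤ T (k + 1) := hTmono (Nat.le_succ k)
      rcases hle.eq_or_lt with h | h
      · rwa [← h]
      · obtain ⟨s₀, hs₀⟩ := hT k
        have h1 := hs₀ ⟨le_rfl, hTmono (Nat.le_succ k)⟩
        have h2 := hs₀ ⟨hTmono (Nat.le_succ k), le_rfl⟩
        refine isPreconnected_compl_image_Icc_of_short hγ hinj (hγ' s₀) (T k).2.1 h
          (half_pos (hδ s₀)) (fun s hs => hδre s₀ s ⟨?_, ?_⟩) ih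
        · linarith [hs.1, h1.1]
        · linarith [hs.2, h2.2]
  have := hstep m
  rwa [hm m le_rfl] at this

theorem dense_compl_range (hγ : ContDiff ℝ 1 γ) : Dense (range γ)ᶜ :=
  hγ.dense_compl_range_of_finrank_lt_finrank (by simp)

end Complement

/-! ### The branch on the upper sheet and its behaviour at infinity. -/

namespace SpectralCurve

variable {g : ℕ} {W : ℂ[X]} {t : ℂ} (D : SpectralCurve g W t)

theorem strictMono_lo : StrictMono D.lo :=
  Fin.strictMono_iff_lt_succ.mpr fun i => (D.lo_lt_hi _).trans (D.hi_lt_lo i)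

theorem strictMono_hi : StrictMono D.hi :=
  Fin.strictMono_iff_lt_succ.mpr fun i => (D.hi_lt_lo i).trans (D.lo_lt_hi _)

theorem hi_lt_lo_of_lt {i j : Fin (g + 1)} (h : i < j) : D.hi i < D.lo j := by
  have hi : i ≠ Fin.last g := (h.trans_le (Fin.le_last j)).ne
  obtain ⟨k, rfl⟩ := Fin.exists_castSucc_eq.mpr hi
  exact (D.hi_lt_lo k).trans_le (D.strictMono_lo.monotone (Fin.castSucc_lt_iff_succ_le.mp h))

/-- The parameters at which the path runs through a cut. -/
def cutSet : Set ℝ := ⋃ i, Icc (D.lo i) (D.hi i)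

theorem mem_cutSet {s : ℝ} : s ∈ D.cutSet ↔ ∃ i, s ∈ Icc (D.lo i) (D.hi i) := mem_iUnion

theorem cuts_eq : D.cuts = D.path '' D.cutSet := by
  simp only [cuts, cut, cutSet, image_iUnion]

theorem isCompact_cutSet : IsCompact D.cutSet := isCompact_iUnion fun _ => isCompact_Icc

theorem isClosed_cuts : IsClosed D.cuts := by
  rw [cuts_eq]
  exact (D.isCompact_cutSet.image D.contDiff_path.continuous).isClosed

theorem path_mem_cuts {s : ℝ} : D.path s ∈ D.cuts ↔ s ∈ D.cutSet := by
  rw [cuts_eq, D.injective_path.mem_set_image]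

theorem cutSet_subset : D.cutSet ⊆ Icc (D.lo 0) (D.hi (Fin.last g)) := by
  intro s hs
  obtain ⟨i, hi⟩ := D.mem_cutSet.mp hs
  exact ⟨(D.strictMono_lo.monotone (Fin.zero_le i)).trans hi.1,
    hi.2.trans (D.strictMono_hi.monotone (Fin.le_last i))⟩

theorem lo_lt_hi_last : D.lo 0 < D.hi (Fin.last g) :=
  (D.lo_lt_hi 0).trans_le (D.strictMono_hi.monotone (Fin.zero_le _))

theorem eq_of_mem_Icc_of_mem_Icc {s : ℝ} {i j : Fin (g + 1)} (hi : s ∈ Icc (D.lo i) (D.hi i))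
    (hj : s ∈ Icc (D.lo j) (D.hi j)) : i = j := by
  rcases lt_trichotomy i j with h | h | h
  · have := D.hi_lt_lo_of_lt h
    linarith [hi.2, hj.1]
  · exact h
  · have := D.hi_lt_lo_of_lt h
    linarith [hi.1, hj.2]

/-- The right-hand side of the equation `y² = W'² + f₀` of the curve. -/
def curvePoly : ℂ[X] := W.derivative ^ 2 + D.f

theorem eval_curvePoly (x : ℂ) : D.curvePoly.eval x =
    ∏ i, ((x - D.path (D.lo i)) * (x - D.path (D.hi i))) := by
  rw [curvePoly, D.curve_eq, eval_prod]
  simp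

theorem eval_curvePoly_path_eq_zero {s : ℝ} :
    D.curvePoly.eval (D.path s) = 0 ↔ ∃ i, s = D.lo i ∨ s = D.hi i := by
  simp [eval_curvePoly, Finset.prod_eq_zero_iff, sub_eq_zero, D.injective_path.eq_iff]

theorem eval_curvePoly_ne_zero {x : ℂ} (hx : x ∉ D.cuts) : D.curvePoly.eval x ≠ 0 := by
  rw [eval_curvePoly, Finset.prod_ne_zero_iff]
  intro i _
  refine mul_ne_zero (sub_ne_zero.mpr fun h => hx ?_) (sub_ne_zero.mpr fun h => hx ?_)
  · rw [h, path_mem_cuts, mem_cutSet]; exact ⟨i, le_rfl, (D.lo_lt_hi i).le⟩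
  · rw [h, path_mem_cuts, mem_cutSet]; exact ⟨i, (D.lo_lt_hi i).le, le_rfl⟩

theorem isUpperBranch_y₀ : D.IsUpperBranch D.y₀ := Classical.choose_spec D.exists_isUpperBranch

theorem y₀_sq {x : ℂ} (hx : x ∉ D.cuts) : D.y₀ x ^ 2 = D.curvePoly.eval x :=
  D.isUpperBranch_y₀.2.1 x hx

theorem y₀_ne_zero {x : ℂ} (hx : x ∉ D.cuts) : D.y₀ x ≠ 0 := fun h => by
  have := D.y₀_sq hx
  rw [h] at this
  exact D.eval_curvePoly_ne_zero hx (by simpa using this.symm)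

/-- The complement of the whole arc from the first to the last branch point is connected and dense,
so every larger set, here the complement of the cuts alone, is connected too. -/
theorem isPreconnected_compl_cuts : IsPreconnected D.cutsᶜ := by
  have h := isPreconnected_compl_image_Icc D.contDiff_path D.deriv_path_ne_zero D.injective_path
    D.lo_lt_hi_last.le
  refine h.subset_closure ?_ ?_
  · rw [cuts_eq]
    exact compl_subset_compl.mpr (image_mono D.cutSet_subset)
  · have hd : Dense (D.path '' Icc (D.lo 0) (D.hi (Fin.last g)))ᶜ :=
      (dense_compl_range D.contDiff_path).mono (compl_subset_compl.mpr (image_subset_range _ _))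
    rw [hd.closure_eq]
    exact subset_univ _

theorem dense_compl_cuts : Dense D.cutsᶜ := by
  refine (dense_compl_range D.contDiff_path).mono (compl_subset_compl.mpr ?_)
  rw [cuts_eq]
  exact image_subset_range _ _

/-- Two continuous square roots of a nonvanishing function on a connected set agree up to a global
sign, and the normalisation at infinity excludes the minus sign. -/
theorem IsUpperBranch.eqOn {D : SpectralCurve g W t} {y y' : ℂ → ℂ} (h : D.IsUpperBranch y)
    (h' : D.IsUpperBranch y') : EqOn y y' D.cutsᶜ := by
  have hsq : EqOn (y ^ 2) (y' ^ 2) D.cutsᶜ := fun x hx => by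
    simp only [Pi.pow_apply]
    rw [h.2.1 x hx, h'.2.1 x hx]
  have hne : ∀ {x}, x ∈ D.cutsᶜ → y' x ≠ 0 := fun {x} hx h0 => by
    have := h'.2.1 x hx
    rw [h0] at this
    exact D.eval_curvePoly_ne_zero hx (by simpa [curvePoly] using this.symm)
  rcases D.isPreconnected_compl_cuts.eq_or_eq_neg_of_sq_eq h.1 h'.1 hsq hne with h1 | h1
  · exact h1
  · exfalso
    have hc : ∀ᶠ x in cocompact ℂ, x ∈ D.cutsᶜ := by
      have : IsCompact D.cuts := by
        rw [cuts_eq]; exact D.isCompact_cutSet.image D.contDiff_path.continuous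
      exact this.compl_mem_cocompact
    have h2 := h'.2.2.neg
    have h3 : Tendsto (fun x => y x / W.derivative.eval x) (cocompact ℂ) (𝓝 (-1)) := by
      refine h2.congr' (hc.mono fun x hx => ?_)
      change _ = y x / _
      rw [h1 hx, Pi.neg_apply, neg_div]
    have := tendsto_nhds_unique h.2.2 h3
    norm_num at this

theorem tendsto_inv_cocompact : Tendsto (fun x : ℂ => x⁻¹) (cocompact ℂ) (𝓝 0) := by
  rw [← Metric.cobounded_eq_cocompact]; exact tendsto_inv₀_cobounded

theorem eventually_ne_zero_cocompact : ∀ᶠ x : ℂ in cocompact ℂ, x ≠ 0 := by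
  filter_upwards [(tendsto_norm_cocompact_atTop (E := ℂ)).eventually_gt_atTop 0] with x hx
  exact norm_pos_iff.mp hx

theorem tendsto_eval_mul_inv_pow (q : ℂ[X]) {n : ℕ} (hq : q.natDegree ≤ n) :
    Tendsto (fun x : ℂ => q.eval x * x⁻¹ ^ n) (cocompact ℂ) (𝓝 (q.coeff n)) := by
  have h1 : Tendsto (fun x : ℂ => ∑ k ∈ Finset.range (n + 1), q.coeff k * x⁻¹ ^ (n - k))
      (cocompact ℂ) (𝓝 (∑ k ∈ Finset.range (n + 1), q.coeff k * (0 : ℂ) ^ (n - k))) :=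
    tendsto_finsetSum _ fun k _ => (tendsto_inv_cocompact.pow _).const_mul _
  have h2 : ∑ k ∈ Finset.range (n + 1), q.coeff k * (0 : ℂ) ^ (n - k) = q.coeff n := by
    rw [Finset.sum_range_succ, Finset.sum_eq_zero]
    · simp
    · intro k hk
      rw [Finset.mem_range] at hk
      rw [zero_pow (by omega), mul_zero]
  rw [h2] at h1
  refine h1.congr' ?_
  filter_upwards [eventually_ne_zero_cocompact] with x hx
  rw [eval_eq_sum_range' (Nat.lt_succ_of_le hq), Finset.sum_mul]
  refine Finset.sum_congr rfl fun k hk => ?_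
  rw [Finset.mem_range] at hk
  have e : n = (n - k) + k := by omega
  have : x ^ k * x⁻¹ ^ n = x⁻¹ ^ (n - k) := by
    calc x ^ k * x⁻¹ ^ n = x ^ k * x⁻¹ ^ ((n - k) + k) := by rw [← e]
      _ = x⁻¹ ^ (n - k) * (x * x⁻¹) ^ k := by rw [pow_add, mul_pow]; ring
      _ = _ := by rw [mul_inv_cancel₀ hx, one_pow, mul_one]
  rw [mul_assoc, this]

theorem tendsto_potential (D : SpectralCurve g W t) :
     Tendsto (fun x : ℂ => W.derivative.eval x * x⁻¹ ^ (g + 1))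
    (cocompact ℂ) (𝓝 1) := by
  have h := tendsto_eval_mul_inv_pow W.derivative D.natDegree_potential.le
  have hlead : W.derivative.coeff (g + 1) = 1 := by
    rw [← D.natDegree_potential]; exact D.monic_potential
  rwa [hlead] at h

theorem eventually_potential_ne_zero (D : SpectralCurve g W t) :
     ∀ᶠ x : ℂ in cocompact ℂ, W.derivative.eval x ≠ 0 := by
  filter_upwards [D.tendsto_potential.eventually_ne one_ne_zero] with x hx h
  exact hx (by rw [h, zero_mul])

/-- The branch on the upper sheet in terms of logarithms. -/
def branchProd (x : ℂ) : ℂ :=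
  ∏ i, ((x - D.path (D.lo i)) * Complex.exp (D.cutIntegral i x / 2))

theorem notMem_cut {x : ℂ} (hx : x ∉ D.cuts) (i : Fin (g + 1)) : x ∉ D.cut i :=
  fun h => hx (mem_iUnion.mpr ⟨i, h⟩)

theorem isUpperBranch_branchProd : D.IsUpperBranch D.branchProd := by
  refine ⟨?_, ?_, ?_⟩
  · refine continuousOn_finsetProd _ fun i _ => ?_
    refine (continuousOn_id.sub continuousOn_const).mul ?_
    refine Complex.continuous_exp.comp_continuousOn (ContinuousOn.div_const ?_ 2)
    exact (D.continuousOn_cutIntegral i).mono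
      (compl_subset_compl.mpr (subset_iUnion D.cut i))
  · intro x hx
    have he := D.eval_curvePoly x
    rw [curvePoly] at he
    rw [he, branchProd, ← Finset.prod_pow]
    refine Finset.prod_congr rfl fun i _ => ?_
    have h := D.exp_cutIntegral i x (D.notMem_cut hx i)
    have h2 : Complex.exp (D.cutIntegral i x / 2) ^ 2 = Complex.exp (D.cutIntegral i x) := by
      rw [← Complex.exp_nat_mul]; congr 1; push_cast; ring
    rw [mul_pow, h2, ← h]
    ring
  · have hy : Tendsto (fun x : ℂ => ∏ i,
        ((1 - D.path (D.lo i) * x⁻¹) * Complex.exp (D.cutIntegral i x / 2)))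
        (cocompact ℂ) (𝓝 1) := by
      have : Tendsto (fun x : ℂ => ∏ i,
          ((1 - D.path (D.lo i) * x⁻¹) * Complex.exp (D.cutIntegral i x / 2)))
          (cocompact ℂ) (𝓝 (∏ i : Fin (g + 1),
            ((1 - D.path (D.lo i) * 0) * Complex.exp (0 / 2)))) := by
        refine tendsto_finsetProd _ fun i _ => ?_
        refine (tendsto_const_nhds.sub (tendsto_inv_cocompact.const_mul _)).mul ?_
        exact (Complex.continuous_exp.tendsto _).comp ((D.tendsto_cutIntegral i).div_const 2)
      simpa using this
    have hq := hy.div D.tendsto_potential one_ne_zero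
    rw [div_one] at hq
    refine hq.congr' ?_
    filter_upwards [eventually_ne_zero_cocompact] with x hx
    have hp : ∏ i, ((1 - D.path (D.lo i) * x⁻¹) * Complex.exp (D.cutIntegral i x / 2)) =
        D.branchProd x * x⁻¹ ^ (g + 1) := by
      have hc : x⁻¹ ^ (g + 1) = ∏ _i : Fin (g + 1), x⁻¹ := by simp
      rw [hc, branchProd, ← Finset.prod_mul_distrib]
      refine Finset.prod_congr rfl fun i _ => ?_
      field_simp
    simp only [Pi.div_apply]
    rw [hp]
    exact mul_div_mul_right _ _ (pow_ne_zero _ (inv_ne_zero hx))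

/-- The chosen branch is replaced by an explicit product, from which holomorphy in x and continuity
in parameters can be read off. -/
theorem y₀_eq_branchProd {x : ℂ} (hx : x ∉ D.cuts) : D.y₀ x = D.branchProd x :=
  D.isUpperBranch_y₀.eqOn D.isUpperBranch_branchProd hx

theorem cutIntegral_eq_arcLog (i : Fin (g + 1)) :
    D.cutIntegral i = arcLog D.path (D.lo i) (D.hi i) := rfl

theorem differentiableAt_cutIntegral {i : Fin (g + 1)} {x : ℂ} (hx : x ∉ D.cut i) :
    DifferentiableAt ℂ (D.cutIntegral i) x :=
  (hasDerivAt_arcLog D.contDiff_path (D.lo_lt_hi i).le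
    fun s hs h => hx ⟨s, hs, h⟩).differentiableAt

theorem differentiableAt_y₀ {x : ℂ} (hx : x ∉ D.cuts) : DifferentiableAt ℂ D.y₀ x := by
  have h : DifferentiableAt ℂ D.branchProd x := by
    refine DifferentiableAt.fun_finsetProd fun i _ => ?_
    exact (differentiableAt_id.sub_const _).mul
      ((D.differentiableAt_cutIntegral (D.notMem_cut hx i)).div_const 2).cexp
  refine h.congr_of_eventuallyEq ?_
  filter_upwards [D.isClosed_cuts.isOpen_compl.mem_nhds hx] with y hy using D.y₀_eq_branchProd hy

theorem eventually_notMem_cuts : ∀ᶠ x in cocompact ℂ, x ∉ D.cuts := by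
  have : IsCompact D.cuts := by
    rw [cuts_eq]; exact D.isCompact_cutSet.image D.contDiff_path.continuous
  exact this.compl_mem_cocompact

/-- `x (y₀ - W') → -2 t` at infinity. -/
theorem tendsto_mul_y₀_sub : Tendsto (fun x => x * (D.y₀ x - W.derivative.eval x))
    (cocompact ℂ) (𝓝 (-2 * t)) := by
  have h1 : Tendsto (fun x => D.y₀ x / W.derivative.eval x + 1) (cocompact ℂ) (𝓝 2) := by
    have := D.isUpperBranch_y₀.2.2.add_const 1
    norm_num at this
    exact this
  have h2 := tendsto_eval_mul_inv_pow D.f D.natDegree_f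
  rw [D.coeff_f] at h2
  have h3 := (h2.div D.tendsto_potential one_ne_zero).div h1 two_ne_zero
  have h4 : -4 * t / 1 / 2 = -2 * t := by ring
  rw [h4] at h3
  refine h3.congr' ?_
  filter_upwards [eventually_ne_zero_cocompact, D.eventually_potential_ne_zero,
    D.eventually_notMem_cuts, h1.eventually_ne two_ne_zero] with x hx hW hc hy
  have hsq := D.y₀_sq hc
  simp only [curvePoly, eval_add, eval_pow] at hsq
  have hsum : D.y₀ x + W.derivative.eval x ≠ 0 := by
    intro h
    apply hy
    rw [eq_neg_of_add_eq_zero_left h, neg_div, div_self hW]; norm_num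
  have e1 : D.y₀ x / W.derivative.eval x + 1 =
      (D.y₀ x + W.derivative.eval x) / W.derivative.eval x := by
    field_simp
  -- The difference y₀ - W' equals f₀/(y₀ + W'), where y₀ + W' behaves like 2W' and f₀ like -4t x^g.
  have e2 : D.f.eval x = (D.y₀ x - W.derivative.eval x) * (D.y₀ x + W.derivative.eval x) := by
    linear_combination -hsq
  simp only [Pi.div_apply]
  rw [e1, e2, pow_succ]
  have hp : x⁻¹ ^ g ≠ 0 := pow_ne_zero _ (inv_ne_zero hx)
  field_simp

theorem tendsto_y₀_sub : Tendsto (fun x => D.y₀ x - W.derivative.eval x)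
    (cocompact ℂ) (𝓝 0) := by
  have h := tendsto_inv_cocompact.mul D.tendsto_mul_y₀_sub
  rw [zero_mul] at h
  refine h.congr' ?_
  filter_upwards [eventually_ne_zero_cocompact] with x hx
  rw [inv_mul_cancel_left₀ hx]

theorem tendsto_eval_div_y₀ (q : ℂ[X]) (hq : q.natDegree ≤ g + 1) :
    Tendsto (fun x => q.eval x / D.y₀ x) (cocompact ℂ) (𝓝 (q.coeff (g + 1))) := by
  have h := ((tendsto_eval_mul_inv_pow q hq).div D.tendsto_potential one_ne_zero).div
    D.isUpperBranch_y₀.2.2 one_ne_zero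
  rw [div_one, div_one] at h
  refine h.congr' ?_
  filter_upwards [eventually_ne_zero_cocompact, D.eventually_potential_ne_zero] with x hx hW
  have hp : x⁻¹ ^ (g + 1) ≠ 0 := pow_ne_zero _ (inv_ne_zero hx)
  simp only [Pi.div_apply]
  rw [mul_div_mul_right _ _ hp, div_div, mul_div_cancel₀ _ hW]

end SpectralCurve

/-! ### Graph charts along the path and its two sides. -/

/-- On the ball of radius `r` around `c`, the part of the curve between the parameters `p` and `q`
is a graph over the direction `e`. -/
structure Chart (γ : ℝ → ℂ) (p q s₁ s₂ : ℝ) (e c : ℂ) (r : ℝ) : Prop where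
  lt : s₁ < s₂
  ne : e ≠ 0
  re_pos : ∀ s ∈ Icc s₁ s₂, 0 < (deriv γ s / e).re
  box : ∀ x ∈ Metric.ball c r, (γ s₁ / e).re < (x / e).re ∧ (x / e).re < (γ s₂ / e).re
  iso : ∀ s ∈ Icc p q, γ s ∈ Metric.ball c r → s ∈ Ioo s₁ s₂

namespace Chart

variable {γ : ℝ → ℂ} {p q s₁ s₂ : ℝ} {e c x : ℂ} {r : ℝ}

theorem mono (h : Chart γ p q s₁ s₂ e c r) {c' : ℂ} {r' : ℝ}
    (hr : Metric.ball c' r' ⊆ Metric.ball c r) : Chart γ p q s₁ s₂ e c' r' :=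
  ⟨h.lt, h.ne, h.re_pos, fun x hx => h.box x (hr hx), fun s hs hx => h.iso s hs (hr hx)⟩

theorem re_sub_pos (h : Chart γ p q s₁ s₂ e c r) (hx : x ∈ Metric.ball c r) :
    0 < ((x - γ s₁) / e).re := by
  rw [sub_div, Complex.sub_re]; linarith [(h.box x hx).1]

theorem re_sub_pos' (h : Chart γ p q s₁ s₂ e c r) (hx : x ∈ Metric.ball c r) :
    0 < ((γ s₂ - x) / e).re := by
  rw [sub_div, Complex.sub_re]; linarith [(h.box x hx).2]

theorem exists_eq (h : Chart γ p q s₁ s₂ e c r) (hγ : ContDiff ℝ 1 γ)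
    (hx : x ∈ Metric.ball c r) :
    ∃ s ∈ Ioo s₁ s₂, ∃ ε : ℝ, x = γ s + Complex.I * ε * e := by
  have hcre : Continuous fun x : ℂ => (x / e).re := Complex.continuous_re.comp
    (continuous_id.div_const e)
  obtain ⟨s, hs, hsx⟩ := intermediate_value_Ioo h.lt.le
    (f := fun s => (γ s / e).re) (hcre.comp hγ.continuous).continuousOn (h.box x hx)
  refine ⟨s, hs, ((x - γ s) / e).im, ?_⟩
  have h5 : (x - γ s) / e = Complex.I * (((x - γ s) / e).im : ℝ) := by
    apply Complex.ext
    · rw [sub_div]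
      simp only at hsx
      simp [hsx]
    · simp
  rw [← h5, div_mul_cancel₀ _ h.ne]; ring

/-- The component along e is strictly increasing on the chart, so a transversal meets the arc only
at its foot. -/
theorem notMem (h : Chart γ p q s₁ s₂ e c r) (hγ : ContDiff ℝ 1 γ) {s : ℝ}
    (hs : s ∈ Ioo s₁ s₂) {ε : ℝ} (hε : ε ≠ 0) (hx : γ s + Complex.I * ε * e ∈ Metric.ball c r) :
    ∀ τ ∈ Icc p q, γ τ ≠ γ s + Complex.I * ε * e := by
  intro τ hτ hτx
  have hτ' := h.iso τ hτ (hτx ▸ hx)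
  have h1 : γ τ / e = γ s / e + Complex.I * ε := by
    have := h.ne
    rw [hτx]; field_simp
  have h3 : τ = s := (strictMonoOn_re hγ h.re_pos).injOn (Ioo_subset_Icc_self hτ')
    (Ioo_subset_Icc_self hs) (by rw [h1]; simp)
  rw [h3] at h1
  exact hε (by exact_mod_cast (by simpa using h1 : (ε : ℂ) = 0))

theorem notMem_Icc (h : Chart γ p q s₁ s₂ e c r) (hx : x ∈ Metric.ball c r) {a b : ℝ}
    (hp : p ≤ a) (hq : b ≤ q) (hab : b ≤ s₁ ∨ s₂ ≤ a) : ∀ τ ∈ Icc a b, γ τ ≠ x := by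
  intro τ hτ hτx
  have := h.iso τ ⟨hp.trans hτ.1, hτ.2.trans hq⟩ (hτx ▸ hx)
  rcases hab with h1 | h1
  · linarith [this.1, hτ.2]
  · linarith [this.2, hτ.1]

end Chart

section

variable {γ : ℝ → ℂ}

/-- The part of the path over [p, q] outside (s₁, s₂) is compact and, by injectivity, misses γ(s₀);
a small ball therefore meets only the graph piece. -/
theorem exists_chart (hγ : ContDiff ℝ 1 γ) (hγ' : ∀ s, deriv γ s ≠ 0)
    (hinj : Function.Injective γ) (p q : ℝ) {α β s₀ : ℝ} (hα : α < s₀) (hβ : s₀ < β) :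
    ∃ s₁ ∈ Ioo α s₀, ∃ s₂ ∈ Ioo s₀ β, ∃ r > 0,
      Chart γ p q s₁ s₂ (deriv γ s₀) (γ s₀) r := by
  obtain ⟨δ, hδ, hδre⟩ := exists_forall_re_pos hγ hγ' s₀
  obtain ⟨s₁, h1, h1'⟩ := exists_between (max_lt hα (sub_lt_self s₀ hδ))
  obtain ⟨s₂, h2, h2'⟩ := exists_between (lt_min hβ (lt_add_of_pos_right s₀ hδ))
  rw [max_lt_iff] at h1
  rw [lt_min_iff] at h2'
  have hre : ∀ s ∈ Icc s₁ s₂, 0 < (deriv γ s / deriv γ s₀).re := fun s hs =>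
    hδre s ⟨h1.2.le.trans hs.1, hs.2.trans h2'.2.le⟩
  have hmono := strictMonoOn_re hγ hre
  have hcre : Continuous fun x : ℂ => (x / deriv γ s₀).re := Complex.continuous_re.comp
    (continuous_id.div_const _)
  have hs₀ : s₀ ∈ Icc s₁ s₂ := ⟨h1'.le, h2.le⟩
  have e1 : ∀ᶠ x in 𝓝 (γ s₀), (γ s₁ / deriv γ s₀).re < (x / deriv γ s₀).re :=
    hcre.continuousAt.eventually (lt_mem_nhds (hmono ⟨le_rfl, (h1'.trans h2).le⟩ hs₀ h1'))
  have e2 : ∀ᶠ x in 𝓝 (γ s₀), (x / deriv γ s₀).re < (γ s₂ / deriv γ s₀).re :=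
    hcre.continuousAt.eventually (gt_mem_nhds (hmono hs₀ ⟨(h1'.trans h2).le, le_rfl⟩ h2))
  have hF : IsClosed (γ '' (Icc p q \ Ioo s₁ s₂)) :=
    ((isCompact_Icc.diff isOpen_Ioo).image hγ.continuous).isClosed
  have e3 : ∀ᶠ x in 𝓝 (γ s₀), x ∉ γ '' (Icc p q \ Ioo s₁ s₂) := by
    refine hF.isOpen_compl.mem_nhds ?_
    rw [mem_compl_iff, hinj.mem_set_image]
    exact fun h => h.2 ⟨h1', h2⟩
  obtain ⟨r, hr, hball⟩ := Metric.eventually_nhds_iff_ball.mp (e1.and (e2.and e3))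
  refine ⟨s₁, ⟨h1.1, h1'⟩, s₂, ⟨h2, h2'.1⟩, r, hr, h1'.trans h2, hγ' s₀, hre,
    fun x hx => ⟨(hball x hx).1, (hball x hx).2.1⟩, fun s hs hx => ?_⟩
  by_contra hn
  exact (hball _ hx).2.2 ⟨s, ⟨hs, hn⟩, rfl⟩

/-- The arguments of a/e' and e'/e are both below π/2, so their logarithms add without a 2πi, and
log(e'/e) cancels in the difference. -/
theorem log_div_sub_log_div {e e' a b : ℂ} (he' : e' ≠ 0) (he : 0 < (e' / e).re)
    (ha : 0 < (a / e).re) (ha' : 0 < (a / e').re) (hb : 0 < (b / e).re) (hb' : 0 < (b / e').re) :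
    Complex.log (a / e) - Complex.log (b / e) = Complex.log (a / e') - Complex.log (b / e') := by
  have key : ∀ a, 0 < (a / e).re → 0 < (a / e').re →
      Complex.log (a / e) = Complex.log (a / e') + Complex.log (e' / e) := by
    intro a ha ha'
    have h1 := abs_lt.mp (Complex.abs_arg_lt_pi_div_two_iff.mpr (Or.inl ha'))
    have h2 := abs_lt.mp (Complex.abs_arg_lt_pi_div_two_iff.mpr (Or.inl he))
    rw [← Complex.log_mul (fun h => by simp [h] at ha') (fun h => by simp [h] at he)
      ⟨by linarith, by linarith⟩]
    congr 1
    field_simp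
  rw [key a ha ha', key b hb hb']
  ring

/-- The two sides of a part of a curve do not depend on the transversal direction. -/
theorem mul_pos_of_eq_add (hγ : ContDiff ℝ 1 γ) {a b s s' ε ε' : ℝ} {e e' : ℂ}
    (he0 : e ≠ 0) (he0' : e' ≠ 0) (hee : 0 < (e' / e).re)
    (he : ∀ s ∈ Icc a b, 0 < (deriv γ s / e).re) (he' : ∀ s ∈ Icc a b, 0 < (deriv γ s / e').re)
    (hs : s ∈ Ioo a b) (hs' : s' ∈ Ioo a b) (hε : ε ≠ 0)
    (h : γ s + Complex.I * ε * e = γ s' + Complex.I * ε' * e') : 0 < ε * ε' := by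
  have hre : ∀ (e : ℂ) (ε s : ℝ), e ≠ 0 → (∀ s ∈ Icc a b, 0 < (deriv γ s / e).re) →
      s ∈ Ioo a b → ∀ x, x = γ s + Complex.I * ε * e →
        0 < ((γ b - x) / e).re ∧ 0 < ((x - γ a) / e).re := by
    intro e ε s he0 he hs x hx
    have hmono := strictMonoOn_re hγ he
    have h1 : (γ b - x) / e = γ b / e - γ s / e - Complex.I * ε := by rw [hx]; field_simp; ring
    have h2 : (x - γ a) / e = γ s / e - γ a / e + Complex.I * ε := by rw [hx]; field_simp; ring
    have hab := (hs.1.trans hs.2).le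
    have h3 : (γ s / e).re < (γ b / e).re := hmono (Ioo_subset_Icc_self hs) ⟨hab, le_rfl⟩ hs.2
    have h4 : (γ a / e).re < (γ s / e).re := hmono ⟨le_rfl, hab⟩ (Ioo_subset_Icc_self hs) hs.1
    rw [h1, h2]
    simp only [Complex.sub_re, Complex.add_re, Complex.mul_re, Complex.I_re, Complex.I_im,
      Complex.ofReal_re, Complex.ofReal_im]
    constructor <;> linarith
  obtain ⟨x, hx⟩ : ∃ x, x = γ s + Complex.I * ε * e := ⟨_, rfl⟩
  have hx' : x = γ s' + Complex.I * ε' * e' := hx.trans h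
  obtain ⟨h1, h2⟩ := hre e ε s he0 he hs x hx
  obtain ⟨h1', h2'⟩ := hre e' ε' s' he0' he' hs' x hx'
  have hlog := log_div_sub_log_div he0' hee h1 h1' h2 h2'
  have hoff : ∀ τ ∈ Icc a b, γ τ ≠ x := by
    intro τ hτ hτx
    rcases lt_or_gt_of_ne hε with h0 | h0
    · have := mem_slitPlane_of_left hγ he0 he (Ioo_subset_Icc_self hs) (-1) (by simpa) hx τ hτ
      rw [hτx, sub_self, mul_zero] at this
      exact Complex.zero_notMem_slitPlane this
    · have := mem_slitPlane_of_left hγ he0 he (Ioo_subset_Icc_self hs) 1 (by simpa) hx τ hτ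
      rw [hτx, sub_self, mul_zero] at this
      exact Complex.zero_notMem_slitPlane this
  have hε' : ε' ≠ 0 := fun h0 => hoff s' (Ioo_subset_Icc_self hs') (by simp [hx', h0])
  have hpi : (Real.pi : ℂ) * Complex.I ≠ 0 := mul_ne_zero
    (by exact_mod_cast Real.pi_ne_zero) Complex.I_ne_zero
  -- If ε and ε' had opposite signs, the same integral `arcLog` would equal the same expression both
  -- with +πi and with -πi.
  rcases lt_or_gt_of_ne hε with h0 | h0 <;> rcases lt_or_gt_of_ne hε' with h0' | h0'
  · exact mul_pos_of_neg_of_neg h0 h0'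
  · exfalso
    have e1 := arcLog_right hγ he0 he hs h0 hx
    have e2 := arcLog_left hγ he0' he' hs' h0' hx'
    rw [e1, hlog] at e2
    apply hpi
    linear_combination -1 / 2 * e2
  · exfalso
    have e1 := arcLog_left hγ he0 he hs h0 hx
    have e2 := arcLog_right hγ he0' he' hs' h0' hx'
    rw [e1, hlog] at e2
    apply hpi
    linear_combination 1 / 2 * e2
  · exact mul_pos h0 h0'

/-- Near the curve, a transversal stays on one side. -/
theorem Chart.eventually_side (hγ : ContDiff ℝ 1 γ) (hγ' : ∀ s, deriv γ s ≠ 0)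
    {p q s₁ s₂ : ℝ} {e c : ℂ} {r : ℝ} (h : Chart γ p q s₁ s₂ e c r) {s : ℝ} (hs : s ∈ Ioo s₁ s₂)
    (hx : γ s ∈ Metric.ball c r) : ∀ᶠ ε : ℝ in 𝓝 0, ε ≠ 0 →
      γ s + Complex.I * ε * deriv γ s ∈ Metric.ball c r ∧ ∃ s' ∈ Ioo s₁ s₂, ∃ ε' : ℝ,
        0 < ε * ε' ∧ γ s + Complex.I * ε * deriv γ s = γ s' + Complex.I * ε' * e := by
  obtain ⟨δ, hδ, hδre⟩ := exists_forall_re_pos hγ hγ' s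
  obtain ⟨a, ha, ha'⟩ := exists_between (max_lt hs.1 (sub_lt_self s hδ))
  obtain ⟨b, hb, hb'⟩ := exists_between (lt_min hs.2 (lt_add_of_pos_right s hδ))
  rw [max_lt_iff] at ha
  rw [lt_min_iff] at hb'
  have hre : ∀ τ ∈ Icc a b, 0 < (deriv γ τ / e).re := fun τ hτ =>
    h.re_pos τ ⟨ha.1.le.trans hτ.1, hτ.2.trans hb'.1.le⟩
  have hre' : ∀ τ ∈ Icc a b, 0 < (deriv γ τ / deriv γ s).re := fun τ hτ =>
    hδre τ ⟨ha.2.le.trans hτ.1, hτ.2.trans hb'.2.le⟩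
  have hsab : s ∈ Ioo a b := ⟨ha', hb⟩
  have hc : Tendsto (fun ε : ℝ => γ s + Complex.I * ε * deriv γ s) (𝓝 0) (𝓝 (γ s)) := by
    have : Continuous fun ε : ℝ => γ s + Complex.I * ε * deriv γ s :=
      continuous_const.add ((continuous_const.mul Complex.continuous_ofReal).mul continuous_const)
    simpa using this.tendsto 0
  filter_upwards [hc.eventually (eventually_exists_eq_add hγ h.ne hre hsab one_pos),
    hc.eventually (Metric.isOpen_ball.mem_nhds hx)] with ε h1 h2 hε
  refine ⟨h2, ?_⟩
  obtain ⟨s', hs', ε', -, h3⟩ := h1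
  refine ⟨s', ⟨ha.1.trans hs'.1, hs'.2.trans hb'.1⟩, ε', ?_, h3⟩
  have hee : 0 < (e / deriv γ s).re := by
    have := hre s (Ioo_subset_Icc_self hsab)
    rw [← inv_div, Complex.inv_re]
    exact div_pos this (Complex.normSq_pos.mpr (div_ne_zero (hγ' s) h.ne))
  exact mul_pos_of_eq_add hγ (hγ' s) h.ne hee hre' hre hsab hs' hε h3

theorem eventually_add_notMem (hγ : ContDiff ℝ 1 γ) (hγ' : ∀ s, deriv γ s ≠ 0)
    (hinj : Function.Injective γ) (p q s : ℝ) : ∀ᶠ ε : ℝ in 𝓝 0, ε ≠ 0 →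
      ∀ τ ∈ Icc p q, γ τ ≠ γ s + Complex.I * ε * deriv γ s := by
  obtain ⟨s₁, h1, s₂, h2, r, hr, h⟩ := exists_chart hγ hγ' hinj p q (sub_one_lt s) (lt_add_one s)
  have hs : s ∈ Ioo s₁ s₂ := ⟨h1.2, h2.1⟩
  filter_upwards [h.eventually_side hγ hγ' hs (Metric.mem_ball_self hr)] with ε hε hne
  exact h.notMem hγ hs hne (hε hne).1

end

/-! ### Local branches of y across a cut. -/

namespace SpectralCurve

variable {g : ℕ} {W : ℂ[X]} {t : ℂ} (D : SpectralCurve g W t)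

/-- A branch of `y` on a ball around an inner point of a cut, which is `y₀` on the left of the cut
and `-y₀` on its right. -/
structure IsLocalBranch (s₁ s₂ : ℝ) (e c : ℂ) (r : ℝ) (Y : ℂ → ℂ) : Prop where
  differentiableOn : DifferentiableOn ℂ Y (Metric.ball c r)
  sq : ∀ x ∈ Metric.ball c r, Y x ^ 2 = D.curvePoly.eval x
  left : ∀ s ∈ Ioo s₁ s₂, ∀ ε : ℝ, 0 < ε → D.path s + Complex.I * ε * e ∈ Metric.ball c r →
    D.y₀ (D.path s + Complex.I * ε * e) = Y (D.path s + Complex.I * ε * e)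
  right : ∀ s ∈ Ioo s₁ s₂, ∀ ε : ℝ, ε < 0 → D.path s + Complex.I * ε * e ∈ Metric.ball c r →
    D.y₀ (D.path s + Complex.I * ε * e) = -Y (D.path s + Complex.I * ε * e)

variable {D}

theorem notMem_cuts_of_chart {p q s₁ s₂ : ℝ} {e c : ℂ} {r : ℝ} (h : Chart D.path p q s₁ s₂ e c r)
    (hp : p ≤ D.lo 0) (hq : D.hi (Fin.last g) ≤ q) {s : ℝ}
    (hs : s ∈ Ioo s₁ s₂) {ε : ℝ} (hε : ε ≠ 0)
    (hx : D.path s + Complex.I * ε * e ∈ Metric.ball c r) :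
    D.path s + Complex.I * ε * e ∉ D.cuts := by
  rw [cuts_eq]
  rintro ⟨τ, hτ, hτx⟩
  have := D.cutSet_subset hτ
  exact h.notMem D.contDiff_path hs hε hx τ ⟨hp.trans this.1, this.2.trans hq⟩ hτx

/-- Near an inner point of the i-th cut only the i-th factor of the product for y₀ is discontinuous,
and only through `arcLog` over (s₁, s₂). On the two sides this differs from one holomorphic
expression by ±πi; halved and exponentiated, the difference is the factor ±I. Hence y₀ = ±I A with A
holomorphic across the cut. -/
theorem exists_isLocalBranch {p q s₁ s₂ : ℝ} {e c : ℂ} {r : ℝ}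
    (h : Chart D.path p q s₁ s₂ e c r) (hp : p ≤ D.lo 0) (hq : D.hi (Fin.last g) ≤ q)
    {i : Fin (g + 1)} (h1 : D.lo i < s₁) (h2 : s₂ < D.hi i) :
    ∃ Y, D.IsLocalBranch s₁ s₂ e c r Y := by
  have hγ := D.contDiff_path
  have hlop : ∀ j, p ≤ D.lo j := fun j => hp.trans (D.strictMono_lo.monotone (Fin.zero_le j))
  have hhiq : ∀ j, D.hi j ≤ q := fun j => (D.strictMono_hi.monotone (Fin.le_last j)).trans hq
  have hsub1 : ∀ x ∈ Metric.ball c r, ∀ τ ∈ Icc (D.lo i) s₁, D.path τ ≠ x := fun x hx =>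
    h.notMem_Icc hx (hlop i) ((h.lt.trans h2).le.trans (hhiq i)) (Or.inl le_rfl)
  have hsub2 : ∀ x ∈ Metric.ball c r, ∀ τ ∈ Icc s₂ (D.hi i), D.path τ ≠ x := fun x hx =>
    h.notMem_Icc hx ((hlop i).trans (h1.trans h.lt).le) (hhiq i) (Or.inr le_rfl)
  have hsub3 : ∀ x ∈ Metric.ball c r, ∀ j ≠ i, x ∉ D.cut j := by
    rintro x hx j hj ⟨τ, hτ, rfl⟩
    have h3 := h.iso τ ⟨(hlop j).trans hτ.1, hτ.2.trans (hhiq j)⟩ hx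
    exact hj (D.eq_of_mem_Icc_of_mem_Icc hτ ⟨(h1.trans h3.1).le, (h3.2.trans h2).le⟩)
  set A : ℂ → ℂ := fun x => (x - D.path (D.lo i)) * Complex.exp ((arcLog D.path (D.lo i) s₁ x +
    (Complex.log ((D.path s₂ - x) / e) - Complex.log ((x - D.path s₁) / e)) +
    arcLog D.path s₂ (D.hi i) x) / 2) *
    ∏ j ∈ Finset.univ.erase i, ((x - D.path (D.lo j)) * Complex.exp (D.cutIntegral j x / 2))
    with hA
  have hAd : DifferentiableOn ℂ A (Metric.ball c r) := by
    intro x hx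
    apply DifferentiableAt.differentiableWithinAt
    refine ((differentiableAt_id.sub_const _).mul (DifferentiableAt.cexp
      (DifferentiableAt.div_const (DifferentiableAt.add (DifferentiableAt.add ?_
        (DifferentiableAt.sub ?_ ?_)) ?_) 2))).mul (DifferentiableAt.fun_finsetProd fun j hj => ?_)
    · exact (hasDerivAt_arcLog hγ h1.le (hsub1 x hx)).differentiableAt
    · refine ((differentiableAt_id.const_sub _).div_const e).clog ?_
      exact Complex.mem_slitPlane_iff.mpr (Or.inl (h.re_sub_pos' hx))
    · refine ((differentiableAt_id.sub_const _).div_const e).clog ?_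
      exact Complex.mem_slitPlane_iff.mpr (Or.inl (h.re_sub_pos hx))
    · exact (hasDerivAt_arcLog hγ h2.le (hsub2 x hx)).differentiableAt
    · exact (differentiableAt_id.sub_const _).mul ((D.differentiableAt_cutIntegral
        (hsub3 x hx j (Finset.ne_of_mem_erase hj))).div_const 2).cexp
  have hy : ∀ x ∈ Metric.ball c r, x ∉ D.cuts → ∀ κ : ℂ, arcLog D.path s₁ s₂ x =
      Complex.log ((D.path s₂ - x) / e) - Complex.log ((x - D.path s₁) / e) + κ →
      D.y₀ x = Complex.exp (κ / 2) * A x := by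
    intro x hx hxc κ hκ
    have hxc' := D.notMem_cut hxc i
    have hall : ∀ τ ∈ Icc (D.lo i) (D.hi i), D.path τ ≠ x := fun τ hτ hτx => hxc' ⟨τ, hτ, hτx⟩
    have h3 : D.cutIntegral i x = arcLog D.path (D.lo i) s₁ x + arcLog D.path s₁ s₂ x +
        arcLog D.path s₂ (D.hi i) x := by
      rw [cutIntegral_eq_arcLog, arcLog_add hγ, arcLog_add hγ]
      · rw [uIcc_of_le (h1.trans h.lt).le]
        exact fun τ hτ => hall τ ⟨hτ.1, hτ.2.trans h2.le⟩
      · rw [uIcc_of_le h2.le]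
        exact hsub2 x hx
      · rw [uIcc_of_le h1.le]
        exact hsub1 x hx
      · rw [uIcc_of_le h.lt.le]
        exact fun τ hτ => hall τ ⟨h1.le.trans hτ.1, hτ.2.trans h2.le⟩
    rw [D.y₀_eq_branchProd hxc, branchProd, ← Finset.mul_prod_erase _ _ (Finset.mem_univ i), h3,
      hκ, hA]
    simp only
    have h4 : ∀ u v w : ℂ, Complex.exp ((u + (v + κ) + w) / 2) =
        Complex.exp (κ / 2) * Complex.exp ((u + v + w) / 2) := by
      intro u v w
      rw [← Complex.exp_add]; congr 1; ring
    rw [h4]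
    ring
  have hleft : ∀ s ∈ Ioo s₁ s₂, ∀ ε : ℝ, 0 < ε → D.path s + Complex.I * ε * e ∈ Metric.ball c r →
      D.y₀ (D.path s + Complex.I * ε * e) = Complex.I * A (D.path s + Complex.I * ε * e) := by
    intro s hs ε hε hx
    rw [hy _ hx (notMem_cuts_of_chart h hp hq hs hε.ne' hx) _
      (arcLog_left hγ h.ne h.re_pos hs hε rfl)]
    rw [show (Real.pi : ℂ) * Complex.I / 2 = Real.pi / 2 * Complex.I by ring,
      Complex.exp_pi_div_two_mul_I]
  have hright : ∀ s ∈ Ioo s₁ s₂, ∀ ε : ℝ, ε < 0 → D.path s + Complex.I * ε * e ∈ Metric.ball c r →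
      D.y₀ (D.path s + Complex.I * ε * e) = -(Complex.I * A (D.path s + Complex.I * ε * e)) := by
    intro s hs ε hε hx
    rw [hy _ hx (notMem_cuts_of_chart h hp hq hs hε.ne hx) (-(Real.pi * Complex.I))
      (by rw [arcLog_right hγ h.ne h.re_pos hs hε rfl, sub_eq_add_neg])]
    rw [show -((Real.pi : ℂ) * Complex.I) / 2 = -Real.pi / 2 * Complex.I by ring,
      Complex.exp_neg_pi_div_two_mul_I]
    ring
  have hYd : DifferentiableOn ℂ (fun x => Complex.I * A x) (Metric.ball c r) := hAd.const_mul _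
  refine ⟨fun x => Complex.I * A x, hYd, ?_, hleft, hright⟩
  intro x hx
  -- The equation for the square is known off the cuts and passes to the cut by density and
  -- continuity.
  have hdense : x ∈ closure (Metric.ball c r ∩ D.cutsᶜ) :=
    (D.dense_compl_cuts.open_subset_closure_inter Metric.isOpen_ball) hx
  have hev : ∀ y ∈ Metric.ball c r ∩ D.cutsᶜ, (Complex.I * A y) ^ 2 = D.curvePoly.eval y := by
    rintro y ⟨hyb, hyc⟩
    rw [← D.y₀_sq hyc]
    obtain ⟨s, hs, ε, rfl⟩ := h.exists_eq hγ hyb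
    rcases lt_trichotomy ε 0 with h0 | h0 | h0
    · rw [hright s hs ε h0 hyb, neg_sq]
    · exfalso
      apply hyc
      rw [h0]
      simp only [Complex.ofReal_zero, mul_zero, zero_mul, add_zero]
      rw [path_mem_cuts, mem_cutSet]
      exact ⟨i, (h1.trans hs.1).le, (hs.2.trans h2).le⟩
    · rw [hleft s hs ε h0 hyb]
  have hne : (𝓝[Metric.ball c r ∩ D.cutsᶜ] x).NeBot := mem_closure_iff_nhdsWithin_neBot.mp hdense
  have t1 : Tendsto (fun y => (Complex.I * A y) ^ 2) (𝓝[Metric.ball c r ∩ D.cutsᶜ] x)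
      (𝓝 ((Complex.I * A x) ^ 2)) :=
    (((hYd.continuousOn.continuousAt (Metric.isOpen_ball.mem_nhds hx)).pow 2).tendsto).mono_left
      nhdsWithin_le_nhds
  have t2 : Tendsto (fun y => D.curvePoly.eval y) (𝓝[Metric.ball c r ∩ D.cutsᶜ] x)
      (𝓝 (D.curvePoly.eval x)) := (D.curvePoly.continuous.tendsto x).mono_left nhdsWithin_le_nhds
  refine tendsto_nhds_unique (t1.congr' ?_) t2
  filter_upwards [self_mem_nhdsWithin] with y hy' using hev y hy'

end SpectralCurve

/-! ### Boundary values and regularity of the density. -/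

namespace SpectralCurve

variable {g : ℕ} {W : ℂ[X]} {t : ℂ} (D : SpectralCurve g W t)

/-- The boundary value of `y₀` on the left of the path, and `0` off the cuts. -/
def edge (s : ℝ) : ℂ := 2 * Real.pi * Complex.I * t * D.ρ₀ s / deriv D.path s

theorem two_pi_I_mul_ne_zero (ht : t ≠ 0) : 2 * Real.pi * Complex.I * t ≠ 0 := by
  simp [Real.pi_ne_zero, ht]

theorem ρ₀_eq (ht : t ≠ 0) (s : ℝ) :
    D.ρ₀ s = deriv D.path s * D.edge s / (2 * Real.pi * Complex.I * t) := by
  have h1 := two_pi_I_mul_ne_zero ht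
  have h2 := D.deriv_path_ne_zero s
  rw [edge, mul_div_cancel₀ _ h2, mul_div_cancel_left₀ _ h1]

variable {D}

/-- The contributions of the continuous function W' cancel in the limit; what survives is the jump
2l of y₀, divided by 2t and 2πi. -/
theorem tendsto_density_of_tendsto {s : ℝ} {l : ℂ}
    (h1 : Tendsto (fun ε : ℝ => D.y₀ (D.path s + Complex.I * ε * deriv D.path s)) (𝓝[>] 0) (𝓝 l))
    (h2 : Tendsto (fun ε : ℝ => D.y₀ (D.path s - Complex.I * ε * deriv D.path s)) (𝓝[>] 0)
      (𝓝 (-l))) :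
    Tendsto (fun ε : ℝ => (1 / (2 * Real.pi * Complex.I)) *
    (D.ω₀ (D.path s - Complex.I * ε * deriv D.path s) -
      D.ω₀ (D.path s + Complex.I * ε * deriv D.path s))) (𝓝[>] 0)
      (𝓝 (l / (2 * Real.pi * Complex.I * t))) := by
  have hc1 : Tendsto (fun ε : ℝ => W.derivative.eval (D.path s + Complex.I * ε * deriv D.path s))
      (𝓝[>] 0) (𝓝 (W.derivative.eval (D.path s))) := by
    have : Continuous fun ε : ℝ =>
        W.derivative.eval (D.path s + Complex.I * ε * deriv D.path s) :=
      W.derivative.continuous.comp (continuous_const.add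
        ((continuous_const.mul Complex.continuous_ofReal).mul continuous_const))
    simpa using (this.tendsto 0).mono_left nhdsWithin_le_nhds
  have hc2 : Tendsto (fun ε : ℝ => W.derivative.eval (D.path s - Complex.I * ε * deriv D.path s))
      (𝓝[>] 0) (𝓝 (W.derivative.eval (D.path s))) := by
    have : Continuous fun ε : ℝ =>
        W.derivative.eval (D.path s - Complex.I * ε * deriv D.path s) :=
      W.derivative.continuous.comp (continuous_const.sub
        ((continuous_const.mul Complex.continuous_ofReal).mul continuous_const))
    simpa using (this.tendsto 0).mono_left nhdsWithin_le_nhds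
  have := (((hc2.sub h2).div_const (2 * t)).sub ((hc1.sub h1).div_const (2 * t))).const_mul
    (1 / (2 * Real.pi * Complex.I))
  have e1 : (1 / (2 * Real.pi * Complex.I)) *
      ((W.derivative.eval (D.path s) - -l) / (2 * t) - (W.derivative.eval (D.path s) - l) / (2 * t))
      = l / (2 * Real.pi * Complex.I * t) := by
    have : (W.derivative.eval (D.path s) - -l) / (2 * t) -
        (W.derivative.eval (D.path s) - l) / (2 * t) = l / t := by
      rw [← sub_div, ← mul_div_mul_left l t two_ne_zero]; congr 1; ring
    rw [this, one_div_mul_eq_div, div_div, mul_comm t]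
  rw [e1] at this
  exact this

theorem edge_eq_of_tendsto (ht : t ≠ 0) {s : ℝ} {l : ℂ}
    (h1 : Tendsto (fun ε : ℝ => D.y₀ (D.path s + Complex.I * ε * deriv D.path s)) (𝓝[>] 0) (𝓝 l))
    (h2 : Tendsto (fun ε : ℝ => D.y₀ (D.path s - Complex.I * ε * deriv D.path s)) (𝓝[>] 0)
      (𝓝 (-l))) : D.edge s = l := by
  have h := (tendsto_density_of_tendsto h1 h2).limUnder_eq
  rw [edge, ρ₀, h, mul_left_comm, mul_div_cancel_left₀ _ (D.deriv_path_ne_zero s),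
    mul_div_cancel₀ _ (two_pi_I_mul_ne_zero ht)]

/-- The limit in the definition of ρ₀ runs along the normal at s, whereas a chart knows sides only
relative to its fixed direction e; `Chart.eventually_side` matches the two. -/
theorem tendsto_y₀_sides {p q s₁ s₂ : ℝ} {e c : ℂ} {r : ℝ} {Y : ℂ → ℂ}
    (h : Chart D.path p q s₁ s₂ e c r) (hY : D.IsLocalBranch s₁ s₂ e c r Y)
    {s : ℝ} (hs : s ∈ Ioo s₁ s₂) (hx : D.path s ∈ Metric.ball c r) :
    Tendsto (fun ε : ℝ => D.y₀ (D.path s + Complex.I * ε * deriv D.path s)) (𝓝[>] 0)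
      (𝓝 (Y (D.path s))) ∧
    Tendsto (fun ε : ℝ => D.y₀ (D.path s - Complex.I * ε * deriv D.path s)) (𝓝[>] 0)
      (𝓝 (-Y (D.path s))) := by
  have hside := h.eventually_side D.contDiff_path D.deriv_path_ne_zero hs hx
  have hYc : ContinuousAt Y (D.path s) :=
    hY.differentiableOn.continuousOn.continuousAt (Metric.isOpen_ball.mem_nhds hx)
  have hc : Continuous fun ε : ℝ => D.path s + Complex.I * ε * deriv D.path s :=
    continuous_const.add ((continuous_const.mul Complex.continuous_ofReal).mul continuous_const)
  have hc0 : Tendsto (fun ε : ℝ => D.path s + Complex.I * ε * deriv D.path s) (𝓝 0)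
      (𝓝 (D.path s)) := by simpa using hc.tendsto 0
  have hneg : Tendsto (fun ε : ℝ => -ε) (𝓝[>] 0) (𝓝 0) := by
    simpa using (tendsto_neg (0 : ℝ)).mono_left nhdsWithin_le_nhds
  constructor
  · refine ((hYc.tendsto.comp hc0).mono_left nhdsWithin_le_nhds).congr' ?_
    filter_upwards [hside.filter_mono nhdsWithin_le_nhds, self_mem_nhdsWithin] with ε h1 (hε : 0 < ε)
    obtain ⟨hb, s', hs', ε', hpos, heq⟩ := h1 hε.ne'
    simp only [Function.comp]
    rw [heq] at hb ⊢
    exact (hY.left s' hs' ε' (pos_of_mul_pos_right hpos hε.le) hb).symm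
  · refine ((hYc.tendsto.comp (hc0.comp hneg)).neg).congr' ?_
    filter_upwards [hneg.eventually hside, self_mem_nhdsWithin] with ε h1 (hε : 0 < ε)
    obtain ⟨hb, s', hs', ε', hpos, heq⟩ := h1 (neg_ne_zero.mpr hε.ne')
    have hε' : ε' < 0 := by
      by_contra h0
      nlinarith
    simp only [Function.comp]
    have e1 : D.path s - Complex.I * ε * deriv D.path s =
        D.path s + Complex.I * (-ε : ℝ) * deriv D.path s := by push_cast; ring
    rw [e1, heq]
    rw [heq] at hb
    rw [hY.right s' hs' ε' hε' hb]

theorem edge_eq (ht : t ≠ 0) {p q s₁ s₂ : ℝ} {e c : ℂ} {r : ℝ} {Y : ℂ → ℂ}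
    (h : Chart D.path p q s₁ s₂ e c r) (hY : D.IsLocalBranch s₁ s₂ e c r Y)
    {s : ℝ} (hs : s ∈ Ioo s₁ s₂) (hx : D.path s ∈ Metric.ball c r) :
    D.edge s = Y (D.path s) :=
  edge_eq_of_tendsto ht (tendsto_y₀_sides h hY hs hx).1 (tendsto_y₀_sides h hY hs hx).2

theorem exists_chart_of_mem_Ioo {i : Fin (g + 1)} {s : ℝ} (hs : s ∈ Ioo (D.lo i) (D.hi i)) :
    ∃ s₁ ∈ Ioo (D.lo i) s, ∃ s₂ ∈ Ioo s (D.hi i), ∃ r > 0, ∃ Y,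
      Chart D.path (D.lo 0) (D.hi (Fin.last g)) s₁ s₂ (deriv D.path s) (D.path s) r ∧
      D.IsLocalBranch s₁ s₂ (deriv D.path s) (D.path s) r Y := by
  obtain ⟨s₁, h1, s₂, h2, r, hr, h⟩ := exists_chart D.contDiff_path D.deriv_path_ne_zero
    D.injective_path (D.lo 0) (D.hi (Fin.last g)) hs.1 hs.2
  obtain ⟨Y, hY⟩ := exists_isLocalBranch h le_rfl le_rfl h1.1 h2.2
  exact ⟨s₁, h1, s₂, h2, r, hr, Y, h, hY⟩

theorem eventually_transversal_notMem_cuts (s : ℝ) : ∀ᶠ ε : ℝ in 𝓝 0, ε ≠ 0 →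
    D.path s + Complex.I * ε * deriv D.path s ∉ D.cuts := by
  filter_upwards [eventually_add_notMem D.contDiff_path D.deriv_path_ne_zero D.injective_path
    (D.lo 0) (D.hi (Fin.last g)) s] with ε hε h0 hc
  rw [cuts_eq] at hc
  obtain ⟨τ, hτ, h⟩ := hc
  exact hε h0 τ (D.cutSet_subset hτ) h

/-- At the branch points, both boundary values vanish. -/
theorem tendsto_y₀_branchPoint {s : ℝ} (hs : D.curvePoly.eval (D.path s) = 0) {κ : ℝ}
    (hκ : κ ≠ 0) : Tendsto (fun ε : ℝ =>
      D.y₀ (D.path s + Complex.I * (κ * ε : ℝ) * deriv D.path s)) (𝓝[>] 0) (𝓝 0) := by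
  have hc : Continuous fun ε : ℝ =>
      D.curvePoly.eval (D.path s + Complex.I * (κ * ε : ℝ) * deriv D.path s) :=
    D.curvePoly.continuous.comp (continuous_const.add ((continuous_const.mul
      (Complex.continuous_ofReal.comp (continuous_const.mul continuous_id))).mul continuous_const))
  have h1 : Tendsto (fun ε : ℝ =>
      D.curvePoly.eval (D.path s + Complex.I * (κ * ε : ℝ) * deriv D.path s)) (𝓝[>] 0) (𝓝 0) := by
    simpa [hs] using (hc.tendsto 0).mono_left nhdsWithin_le_nhds
  have h2 : Tendsto (fun ε : ℝ => κ * ε) (𝓝[>] 0) (𝓝 0) := by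
    simpa using ((continuous_const.mul continuous_id).tendsto (0 : ℝ)).mono_left
      nhdsWithin_le_nhds (f := fun ε : ℝ => κ * ε)
  have h3 : Tendsto (fun ε : ℝ =>
      D.y₀ (D.path s + Complex.I * (κ * ε : ℝ) * deriv D.path s) ^ 2) (𝓝[>] 0) (𝓝 0) := by
    refine h1.congr' ?_
    filter_upwards [h2.eventually (D.eventually_transversal_notMem_cuts s),
      self_mem_nhdsWithin] with ε h (hε : 0 < ε)
    rw [D.y₀_sq (h (mul_ne_zero hκ hε.ne'))]
  rw [tendsto_zero_iff_norm_tendsto_zero] at h3 ⊢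
  simp only [norm_pow] at h3
  have h4 := h3.sqrt
  simpa [Real.sqrt_sq] using h4

theorem cutSet_cases {s : ℝ} (hs : s ∈ D.cutSet) :
    (∃ i, s ∈ Ioo (D.lo i) (D.hi i)) ∨ D.curvePoly.eval (D.path s) = 0 := by
  obtain ⟨i, hi⟩ := D.mem_cutSet.mp hs
  rcases hi.1.eq_or_lt with h | h
  · exact Or.inr (D.eval_curvePoly_path_eq_zero.mpr ⟨i, Or.inl h.symm⟩)
  rcases hi.2.eq_or_lt with h' | h'
  · exact Or.inr (D.eval_curvePoly_path_eq_zero.mpr ⟨i, Or.inr h'⟩)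
  exact Or.inl ⟨i, h, h'⟩

variable (D)

theorem edge_eq_zero_of_branchPoint (ht : t ≠ 0) {s : ℝ} (hs : D.curvePoly.eval (D.path s) = 0) :
    D.edge s = 0 := by
  refine edge_eq_of_tendsto ht ?_ ?_
  · simpa using tendsto_y₀_branchPoint hs one_ne_zero
  · have := tendsto_y₀_branchPoint (D := D) hs (κ := -1) (by norm_num)
    simpa [← sub_eq_add_neg] using this

theorem exists_tendsto_density (s : ℝ) : ∃ l : ℂ, Tendsto (fun ε : ℝ =>
    (1 / (2 * Real.pi * Complex.I)) * (D.ω₀ (D.path s - Complex.I * ε * deriv D.path s) -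
      D.ω₀ (D.path s + Complex.I * ε * deriv D.path s))) (𝓝[>] 0) (𝓝 l) := by
  by_cases hs : s ∈ D.cutSet
  · rcases cutSet_cases hs with ⟨i, hi⟩ | h0
    · obtain ⟨s₁, h1, s₂, h2, r, hr, Y, h, hY⟩ := exists_chart_of_mem_Ioo hi
      obtain ⟨l1, l2⟩ := tendsto_y₀_sides h hY ⟨h1.2, h2.1⟩ (Metric.mem_ball_self hr)
      exact ⟨_, tendsto_density_of_tendsto l1 l2⟩
    · refine ⟨_, tendsto_density_of_tendsto (l := 0) ?_ ?_⟩
      · simpa using tendsto_y₀_branchPoint h0 one_ne_zero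
      · have := tendsto_y₀_branchPoint (D := D) h0 (κ := -1) (by norm_num)
        simpa [← sub_eq_add_neg] using this
  · have hx : D.path s ∉ D.cuts := by rwa [path_mem_cuts]
    have hω : ContinuousAt D.ω₀ (D.path s) :=
      (W.derivative.continuous.continuousAt.sub
        (D.differentiableAt_y₀ hx).continuousAt).div_const _
    have hc1 : Tendsto (fun ε : ℝ => D.path s + Complex.I * ε * deriv D.path s) (𝓝[>] 0)
        (𝓝 (D.path s)) := by
      have : Continuous fun ε : ℝ => D.path s + Complex.I * ε * deriv D.path s := by fun_prop
      simpa using (this.tendsto 0).mono_left nhdsWithin_le_nhds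
    have hc2 : Tendsto (fun ε : ℝ => D.path s - Complex.I * ε * deriv D.path s) (𝓝[>] 0)
        (𝓝 (D.path s)) := by
      have : Continuous fun ε : ℝ => D.path s - Complex.I * ε * deriv D.path s := by fun_prop
      simpa using (this.tendsto 0).mono_left nhdsWithin_le_nhds
    exact ⟨_, ((hω.tendsto.comp hc2).sub (hω.tendsto.comp hc1)).const_mul _⟩

theorem ρ₀_eq_zero {s : ℝ} (hs : s ∉ D.cutSet) : D.ρ₀ s = 0 := by
  have hx : D.path s ∉ D.cuts := by rwa [path_mem_cuts]
  have hω : ContinuousAt D.ω₀ (D.path s) :=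
    (W.derivative.continuous.continuousAt.sub
      (D.differentiableAt_y₀ hx).continuousAt).div_const _
  have hc1 : Tendsto (fun ε : ℝ => D.path s + Complex.I * ε * deriv D.path s) (𝓝[>] 0)
      (𝓝 (D.path s)) := by
    have : Continuous fun ε : ℝ => D.path s + Complex.I * ε * deriv D.path s := by fun_prop
    simpa using (this.tendsto 0).mono_left nhdsWithin_le_nhds
  have hc2 : Tendsto (fun ε : ℝ => D.path s - Complex.I * ε * deriv D.path s) (𝓝[>] 0)
      (𝓝 (D.path s)) := by
    have : Continuous fun ε : ℝ => D.path s - Complex.I * ε * deriv D.path s := by fun_prop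
    simpa using (this.tendsto 0).mono_left nhdsWithin_le_nhds
  have := (((hω.tendsto.comp hc2).sub (hω.tendsto.comp hc1)).const_mul
    (1 / (2 * Real.pi * Complex.I))).limUnder_eq
  simp only [Function.comp, sub_self, mul_zero] at this
  rw [ρ₀, this, mul_zero]

theorem edge_eq_zero {s : ℝ} (hs : s ∉ D.cutSet) : D.edge s = 0 := by
  rw [edge, D.ρ₀_eq_zero hs, mul_zero, zero_div]

theorem edge_sq (ht : t ≠ 0) {s : ℝ} (hs : s ∈ D.cutSet) :
    D.edge s ^ 2 = D.curvePoly.eval (D.path s) := by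
  rcases cutSet_cases hs with ⟨i, hi⟩ | h0
  · obtain ⟨s₁, h1, s₂, h2, r, hr, Y, h, hY⟩ := exists_chart_of_mem_Ioo hi
    rw [edge_eq ht h hY ⟨h1.2, h2.1⟩ (Metric.mem_ball_self hr),
      hY.sq _ (Metric.mem_ball_self hr)]
  · rw [D.edge_eq_zero_of_branchPoint ht h0, h0]; norm_num

theorem norm_edge_sq_le (ht : t ≠ 0) (s : ℝ) :
    ‖D.edge s‖ ^ 2 ≤ ‖D.curvePoly.eval (D.path s)‖ := by
  by_cases hs : s ∈ D.cutSet
  · rw [← norm_pow, D.edge_sq ht hs]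
  · rw [D.edge_eq_zero hs]; simp

theorem edge_ne_zero (ht : t ≠ 0) {i : Fin (g + 1)} {s : ℝ} (hs : s ∈ Ioo (D.lo i) (D.hi i)) :
    D.edge s ≠ 0 := by
  intro h
  have h1 := D.edge_sq ht (D.mem_cutSet.mpr ⟨i, Ioo_subset_Icc_self hs⟩)
  rw [h, zero_pow two_ne_zero, eq_comm, eval_curvePoly_path_eq_zero] at h1
  obtain ⟨j, hj | hj⟩ := h1
  · have := D.eq_of_mem_Icc_of_mem_Icc (Ioo_subset_Icc_self hs)
      (j := j) (by rw [hj]; exact ⟨le_rfl, (D.lo_lt_hi j).le⟩)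
    rw [← this] at hj; linarith [hs.1]
  · have := D.eq_of_mem_Icc_of_mem_Icc (Ioo_subset_Icc_self hs)
      (j := j) (by rw [hj]; exact ⟨(D.lo_lt_hi j).le, le_rfl⟩)
    rw [← this] at hj; linarith [hs.2]

theorem eventuallyEq_edge {D : SpectralCurve g W t} (ht : t ≠ 0) {p q s₁ s₂ : ℝ} {e c : ℂ} {r : ℝ}
    {Y : ℂ → ℂ} (h : Chart D.path p q s₁ s₂ e c r) (hY : D.IsLocalBranch s₁ s₂ e c r Y)
    {s : ℝ} (hs : s ∈ Ioo s₁ s₂) (hx : D.path s ∈ Metric.ball c r) :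
    D.edge =ᶠ[𝓝 s] fun τ => Y (D.path τ) := by
  filter_upwards [Ioo_mem_nhds hs.1 hs.2, D.contDiff_path.continuous.continuousAt.eventually
    (Metric.isOpen_ball.mem_nhds hx)] with τ h1 h2 using edge_eq ht h hY h1 h2

/-- Inside a cut the function is a holomorphic branch evaluated on the path. At a branch point the
bound |edge|² ≤ |P(λ)|, P being the polynomial of the curve, forces the limit 0, which matches the
value 0 off the cuts. -/
theorem continuous_edge (ht : t ≠ 0) : Continuous D.edge := by
  rw [continuous_iff_continuousAt]
  intro s
  by_cases hs : s ∈ D.cutSet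
  · rcases cutSet_cases hs with ⟨i, hi⟩ | h0
    · obtain ⟨s₁, h1, s₂, h2, r, hr, Y, h, hY⟩ := exists_chart_of_mem_Ioo hi
      have hx : D.path s ∈ Metric.ball (D.path s) r := Metric.mem_ball_self hr
      refine ContinuousAt.congr ?_ (eventuallyEq_edge ht h hY ⟨h1.2, h2.1⟩ hx).symm
      exact ContinuousAt.comp (hY.differentiableOn.continuousOn.continuousAt
        (Metric.isOpen_ball.mem_nhds hx)) D.contDiff_path.continuous.continuousAt
    · rw [ContinuousAt, D.edge_eq_zero_of_branchPoint ht h0]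
      have h1 : Tendsto (fun τ => Real.sqrt ‖D.curvePoly.eval (D.path τ)‖) (𝓝 s) (𝓝 0) := by
        have : Continuous fun τ => Real.sqrt ‖D.curvePoly.eval (D.path τ)‖ :=
          (D.curvePoly.continuous.comp D.contDiff_path.continuous).norm.sqrt
        simpa [h0] using this.tendsto s
      refine squeeze_zero_norm (fun τ => ?_) h1
      exact Real.le_sqrt_of_sq_le (D.norm_edge_sq_le ht τ)
  · have : D.edge =ᶠ[𝓝 s] fun _ => 0 := by
      filter_upwards [D.isCompact_cutSet.isClosed.isOpen_compl.mem_nhds hs] with τ hτ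
        using D.edge_eq_zero hτ
    exact continuousAt_const.congr this.symm

theorem hasDerivAt_edge (ht : t ≠ 0) {i : Fin (g + 1)} {s : ℝ} (hs : s ∈ Ioo (D.lo i) (D.hi i)) :
    HasDerivAt D.edge (D.curvePoly.derivative.eval (D.path s) * deriv D.path s /
      (2 * D.edge s)) s := by
  obtain ⟨s₁, h1, s₂, h2, r, hr, Y, h, hY⟩ := exists_chart_of_mem_Ioo hs
  have hx : D.path s ∈ Metric.ball (D.path s) r := Metric.mem_ball_self hr
  have hp : HasDerivAt D.path (deriv D.path s) s :=
    (D.contDiff_path.differentiable (by norm_num)).differentiableAt.hasDerivAt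
  have hYd := (hY.differentiableOn.differentiableAt (Metric.isOpen_ball.mem_nhds hx)).hasDerivAt
  have hd : HasDerivAt D.edge (deriv Y (D.path s) * deriv D.path s) s :=
    (HasDerivAt.comp_of_eq s hYd hp rfl).congr_of_eventuallyEq
      (eventuallyEq_edge ht h hY ⟨h1.2, h2.1⟩ hx)
  refine hd.congr_deriv ?_
  have hsq : HasDerivAt (fun x => Y x ^ 2) (D.curvePoly.derivative.eval (D.path s)) (D.path s) := by
    refine (D.curvePoly.hasDerivAt (D.path s)).congr_of_eventuallyEq ?_
    filter_upwards [Metric.isOpen_ball.mem_nhds hx] with x hx using hY.sq x hx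
  have h3 := hsq.unique (hYd.pow 2)
  have h4 : D.edge s = Y (D.path s) := edge_eq ht h hY ⟨h1.2, h2.1⟩ hx
  have h5 := D.edge_ne_zero ht hs
  rw [h3, ← h4]
  field_simp
  norm_num

theorem continuous_ρ₀ (ht : t ≠ 0) : Continuous D.ρ₀ := by
  have : D.ρ₀ = fun s => deriv D.path s * D.edge s / (2 * Real.pi * Complex.I * t) :=
    funext (D.ρ₀_eq ht)
  rw [this]
  exact ((D.contDiff_path.continuous_deriv le_rfl).mul (D.continuous_edge ht)).div_const _

theorem hasCompactSupport_ρ₀ : HasCompactSupport D.ρ₀ :=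
  HasCompactSupport.intro D.isCompact_cutSet fun _ => D.ρ₀_eq_zero

theorem integrable_ρ₀ (ht : t ≠ 0) : Integrable D.ρ₀ :=
  (D.continuous_ρ₀ ht).integrable_of_hasCompactSupport D.hasCompactSupport_ρ₀

end SpectralCurve

/-! ### Inverse square roots at the branch points. -/

/-- A regular curve without self-intersections is bi-Lipschitz on compact parameter intervals. -/
theorem exists_chord_arc {γ : ℝ → ℂ} (hγ : ContDiff ℝ 1 γ) (hγ' : ∀ s, deriv γ s ≠ 0)
    (hinj : Function.Injective γ) (p q : ℝ) :
    ∃ c > 0, ∀ s ∈ Icc p q, ∀ s' ∈ Icc p q, c * |s - s'| ≤ ‖γ s - γ s'‖ := by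
  have hK : IsCompact (Icc p q ×ˢ Icc p q) := isCompact_Icc.prod isCompact_Icc
  have key := hK.induction_on
    (p := fun S : Set (ℝ × ℝ) => ∃ c > 0, ∀ x ∈ S, c * |x.1 - x.2| ≤ ‖γ x.1 - γ x.2‖)
    ⟨1, one_pos, by simp⟩ (fun S T hST ⟨c, hc, h⟩ => ⟨c, hc, fun x hx => h x (hST hx)⟩)
    (fun S T ⟨c, hc, h⟩ ⟨c', hc', h'⟩ => ⟨min c c', lt_min hc hc', by
      rintro x (hx | hx)
      · exact (mul_le_mul_of_nonneg_right (min_le_left _ _) (abs_nonneg _)).trans (h x hx)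
      · exact (mul_le_mul_of_nonneg_right (min_le_right _ _) (abs_nonneg _)).trans (h' x hx)⟩) ?_
  · obtain ⟨c, hc, h⟩ := key
    exact ⟨c, hc, fun s hs s' hs' => h (s, s') ⟨hs, hs'⟩⟩
  · rintro ⟨a, b⟩ -
    by_cases hab : a = b
    · subst hab
      -- On the diagonal, strict differentiability with nonzero derivative bounds |s - s'| by the
      -- chord; off the diagonal injectivity suffices. Compactness combines the local constants.
      have hst := (hγ.contDiffAt (x := a)).hasStrictDerivAt (by norm_num)
      have hbig := (hst.isTheta_sub (hγ' a)).2
      obtain ⟨C, hC, hCb⟩ := hbig.exists_pos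
      refine ⟨{x | |x.1 - x.2| ≤ C * ‖γ x.1 - γ x.2‖}, mem_nhdsWithin_of_mem_nhds ?_,
        C⁻¹, inv_pos.mpr hC, fun x hx => ?_⟩
      · exact hCb.bound
      · rw [inv_mul_le_iff₀ hC]; exact hx
    · have hpos : 0 < ‖γ a - γ b‖ := norm_pos_iff.mpr (sub_ne_zero.mpr fun h => hab (hinj h))
      have hlim : 0 < |a - b| + 1 := by positivity
      have e1 : ∀ᶠ x : ℝ × ℝ in 𝓝 (a, b), ‖γ a - γ b‖ / 2 < ‖γ x.1 - γ x.2‖ := by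
        have : Continuous fun x : ℝ × ℝ => ‖γ x.1 - γ x.2‖ :=
          ((hγ.continuous.comp continuous_fst).sub (hγ.continuous.comp continuous_snd)).norm
        exact this.continuousAt.eventually (lt_mem_nhds (half_lt_self hpos))
      have e2 : ∀ᶠ x : ℝ × ℝ in 𝓝 (a, b), |x.1 - x.2| < |a - b| + 1 := by
        have : Continuous fun x : ℝ × ℝ => |x.1 - x.2| :=
          (continuous_fst.sub continuous_snd).abs
        exact this.continuousAt.eventually (gt_mem_nhds (lt_add_one |a - b|))
      refine ⟨{x | ‖γ a - γ b‖ / 2 < ‖γ x.1 - γ x.2‖ ∧ |x.1 - x.2| < |a - b| + 1},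
        mem_nhdsWithin_of_mem_nhds (e1.and e2), ‖γ a - γ b‖ / 2 / (|a - b| + 1), by positivity,
        fun x hx => ?_⟩
      refine le_trans ?_ hx.1.le
      rw [div_mul_eq_mul_div, div_le_iff₀ hlim]
      exact mul_le_mul_of_nonneg_left hx.2.le (by positivity)

theorem intervalIntegrable_abs_sub_rpow (s₀ a b : ℝ) :
    IntervalIntegrable (fun s => |s - s₀| ^ (-(1 / 2) : ℝ)) volume a b := by
  have h1 : IntervalIntegrable (fun s => (s - s₀) ^ (-(1 / 2) : ℝ)) volume a b := by
    have := (intervalIntegral.intervalIntegrable_rpow' (a := a - s₀) (b := b - s₀)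
      (r := -(1 / 2)) (by norm_num)).comp_sub_right s₀
    simpa using this
  have h2 : IntervalIntegrable (fun s => (s₀ - s) ^ (-(1 / 2) : ℝ)) volume a b := by
    have := (intervalIntegral.intervalIntegrable_rpow' (a := s₀ - a) (b := s₀ - b)
      (r := -(1 / 2)) (by norm_num)).comp_sub_left s₀
    simpa using this
  -- A real power of a negative base carries the factor cos(π·exponent), which is 0 for exponent
  -- -1/2. Thus the two one-sided functions add up to |s - s₀|^(-1/2).
  have h3 : ∀ x : ℝ, x < 0 → x ^ (-(1 / 2) : ℝ) = 0 := by
    intro x hx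
    rw [Real.rpow_def_of_neg hx, show (-(1 / 2) : ℝ) * Real.pi = -(Real.pi / 2) by ring,
      Real.cos_neg, Real.cos_pi_div_two, mul_zero]
  refine (h1.add h2).congr_ae (ae_restrict_of_ae ?_)
  filter_upwards [compl_mem_ae_iff.mpr (measure_singleton s₀)] with s hs
  rcases lt_or_gt_of_ne (show s ≠ s₀ from hs) with h | h
  · rw [h3 (s - s₀) (by linarith), zero_add, abs_of_neg (by linarith), neg_sub]
  · rw [h3 (s₀ - s) (by linarith), add_zero, abs_of_pos (by linarith)]

namespace SpectralCurve

variable {g : ℕ} {W : ℂ[X]} {t : ℂ} (D : SpectralCurve g W t)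

/-- The branch points are simple zeros. -/
theorem exists_factor {s : ℝ} (hs : D.curvePoly.eval (D.path s) = 0) :
    ∃ p : ℂ[X], p.eval (D.path s) ≠ 0 ∧
      ∀ x, D.curvePoly.eval x = (x - D.path s) * p.eval x := by
  obtain ⟨i, hi⟩ := D.eval_curvePoly_path_eq_zero.mp hs
  have hinj := D.injective_path
  have hout : ∀ j ∈ Finset.univ.erase i, s ∉ Icc (D.lo j) (D.hi j) := by
    intro j hj hsj
    refine Finset.ne_of_mem_erase hj (D.eq_of_mem_Icc_of_mem_Icc hsj ?_)
    rcases hi with h | h <;> rw [h]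
    · exact ⟨le_rfl, (D.lo_lt_hi i).le⟩
    · exact ⟨(D.lo_lt_hi i).le, le_rfl⟩
  have hprod : (∏ j ∈ Finset.univ.erase i,
      ((X - C (D.path (D.lo j))) * (X - C (D.path (D.hi j))))).eval (D.path s) ≠ 0 := by
    rw [eval_prod, Finset.prod_ne_zero_iff]
    intro j hj
    simp only [eval_mul, eval_sub, eval_X, eval_C]
    refine mul_ne_zero (sub_ne_zero.mpr fun h => hout j hj ?_)
      (sub_ne_zero.mpr fun h => hout j hj ?_) <;> rw [hinj h]
    · exact ⟨le_rfl, (D.lo_lt_hi j).le⟩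
    · exact ⟨(D.lo_lt_hi j).le, le_rfl⟩
  have hP : ∀ x, D.curvePoly.eval x = ((x - D.path (D.lo i)) * (x - D.path (D.hi i))) *
      (∏ j ∈ Finset.univ.erase i,
        ((X - C (D.path (D.lo j))) * (X - C (D.path (D.hi j))))).eval x := by
    intro x
    rw [D.eval_curvePoly, ← Finset.mul_prod_erase _ _ (Finset.mem_univ i), eval_prod]
    simp
  rcases hi with h | h
  · refine ⟨(X - C (D.path (D.hi i))) * ∏ j ∈ Finset.univ.erase i,
      ((X - C (D.path (D.lo j))) * (X - C (D.path (D.hi j)))), ?_, fun x => ?_⟩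
    · rw [eval_mul]
      refine mul_ne_zero ?_ hprod
      simp only [eval_sub, eval_X, eval_C]
      exact sub_ne_zero.mpr fun h' => (D.lo_lt_hi i).ne (h ▸ hinj h')
    · rw [hP, eval_mul, h]; simp only [eval_sub, eval_X, eval_C]; ring
  · refine ⟨(X - C (D.path (D.lo i))) * ∏ j ∈ Finset.univ.erase i,
      ((X - C (D.path (D.lo j))) * (X - C (D.path (D.hi j)))), ?_, fun x => ?_⟩
    · rw [eval_mul]
      refine mul_ne_zero ?_ hprod
      simp only [eval_sub, eval_X, eval_C]
      exact sub_ne_zero.mpr fun h' => (D.lo_lt_hi i).ne (h ▸ (hinj h').symm)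
    · rw [hP, eval_mul, h]; simp only [eval_sub, eval_X, eval_C]; ring

theorem exists_le_norm_curvePoly {s : ℝ} (hs : D.curvePoly.eval (D.path s) = 0) :
    ∃ c > 0, ∀ᶠ x in 𝓝 (D.path s), c * ‖x - D.path s‖ ≤ ‖D.curvePoly.eval x‖ := by
  obtain ⟨p, hp, hP⟩ := D.exists_factor hs
  have hpos := norm_pos_iff.mpr hp
  refine ⟨‖p.eval (D.path s)‖ / 2, half_pos hpos, ?_⟩
  filter_upwards [p.continuous.norm.continuousAt.eventually (lt_mem_nhds (half_lt_self hpos))]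
    with x hx
  rw [hP, norm_mul, mul_comm]
  exact mul_le_mul_of_nonneg_left hx.le (norm_nonneg _)

/-- The density `q(λ) λ' / y` on the cuts. -/
def invDensity (q : ℂ[X]) (s : ℝ) : ℂ := q.eval (D.path s) * deriv D.path s / D.edge s

theorem invDensity_eq_zero (q : ℂ[X]) {s : ℝ} (hs : s ∉ D.cutSet) : D.invDensity q s = 0 := by
  rw [invDensity, D.edge_eq_zero hs, div_zero]

/-- Branch points are simple zeros of P, so with the chord-arc bound |P(λ(s))| is at least a
multiple of |s - s₀| there, and the density is O(|s - s₀|^(-1/2)). At inner points of the cuts it is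
continuous, and compactness of `cutSet` patches the local statements. -/
theorem integrable_invDensity (ht : t ≠ 0) (q : ℂ[X]) : Integrable (D.invDensity q) := by
  have hcont : Continuous fun s => q.eval (D.path s) * deriv D.path s :=
    (q.continuous.comp D.contDiff_path.continuous).mul (D.contDiff_path.continuous_deriv le_rfl)
  have hmeas : Measurable (D.invDensity q) :=
    hcont.measurable.div (D.continuous_edge ht).measurable
  have hon : IntegrableOn (D.invDensity q) D.cutSet := by
    refine D.isCompact_cutSet.induction_on (p := fun S => IntegrableOn (D.invDensity q) S volume)
      integrableOn_empty (fun S T hST h => h.mono_set hST) (fun S T h h' => h.union h') ?_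
    intro s hs
    rcases cutSet_cases hs with ⟨i, hi⟩ | h0
    · have hc : ContinuousAt (D.invDensity q) s :=
        hcont.continuousAt.div (D.continuous_edge ht).continuousAt (D.edge_ne_zero ht hi)
      obtain ⟨u, hu, hb⟩ := hc.tendsto.integrableAtFilter (μ := volume)
        ⟨univ, univ_mem, hmeas.aestronglyMeasurable⟩ (Measure.finiteAt_nhds _ _)
      exact ⟨u, mem_nhdsWithin_of_mem_nhds hu, hb⟩
    · obtain ⟨c, hc, hP⟩ := D.exists_le_norm_curvePoly h0
      obtain ⟨c', hc', hch⟩ := exists_chord_arc D.contDiff_path D.deriv_path_ne_zero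
        D.injective_path (s - 1) (s + 1)
      obtain ⟨M, hM⟩ := (isCompact_Icc (a := s - 1) (b := s + 1)).exists_bound_of_continuousOn
        hcont.continuousOn
      have hM0 : 0 ≤ M := (norm_nonneg _).trans (hM s ⟨by linarith, by linarith⟩)
      obtain ⟨δ, hδ, hδP⟩ := Metric.eventually_nhds_iff.mp
        (D.contDiff_path.continuous.continuousAt.eventually hP)
      set η := min (δ / 2) 1 with hη
      have hηpos : 0 < η := lt_min (half_pos hδ) one_pos
      refine ⟨Icc (s - η) (s + η) ∩ D.cutSet, ?_, ?_⟩
      · rw [inter_comm]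
        exact inter_mem_nhdsWithin _ (Icc_mem_nhds (by linarith) (by linarith))
      · have hint := ((intervalIntegrable_abs_sub_rpow s (s - η) (s + η)).const_mul
          (M * (c * c') ^ (-(1 / 2) : ℝ)))
        rw [intervalIntegrable_iff_integrableOn_Icc_of_le (by linarith)] at hint
        refine (hint.mono_set inter_subset_left).mono' hmeas.aestronglyMeasurable ?_
        refine (ae_restrict_mem (measurableSet_Icc.inter D.isCompact_cutSet.measurableSet)).mono ?_
        rintro τ ⟨hτ, hτc⟩
        have hτ1 : τ ∈ Icc (s - 1) (s + 1) := by
          have := min_le_right (δ / 2) 1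
          exact ⟨by linarith [hτ.1], by linarith [hτ.2]⟩
        have hτ2 : dist τ s < δ := by
          have := min_le_left (δ / 2) 1
          rw [Real.dist_eq]
          exact (abs_le.mpr ⟨by linarith [hτ.1], by linarith [hτ.2]⟩).trans_lt (half_lt_self hδ)
        by_cases hτs : τ = s
        · rw [hτs, invDensity, D.edge_eq_zero_of_branchPoint ht h0]
          simp only [div_zero, norm_zero]
          positivity
        have habs : 0 < |τ - s| := abs_pos.mpr (sub_ne_zero.mpr hτs)
        have h1 : c * c' * |τ - s| ≤ ‖D.edge τ‖ ^ 2 := by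
          rw [← norm_pow, D.edge_sq ht hτc, mul_assoc]
          refine le_trans ?_ (hδP hτ2)
          exact mul_le_mul_of_nonneg_left (hch τ hτ1 s ⟨by linarith, by linarith⟩) hc.le
        have h2 : 0 < c * c' * |τ - s| := by positivity
        have h3 : (c * c' * |τ - s|) ^ (1 / 2 : ℝ) ≤ ‖D.edge τ‖ := by
          rw [← Real.sqrt_eq_rpow]
          exact (Real.sqrt_le_left (norm_nonneg _)).mpr h1
        rw [invDensity, norm_div, mul_assoc, ← Real.mul_rpow (by positivity) (by positivity),
          Real.rpow_neg h2.le, ← div_eq_mul_inv]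
        exact div_le_div₀ hM0 (hM τ hτ1) (Real.rpow_pos_of_pos h2 _) h3
  have := hon.integrable_indicator D.isCompact_cutSet.measurableSet
  refine this.congr (Eventually.of_forall fun s => ?_)
  by_cases hs : s ∈ D.cutSet
  · exact indicator_of_mem hs _
  · rw [indicator_of_notMem hs, D.invDensity_eq_zero q hs]

/-- At a branch point `edge` has only square-root behaviour, but edge² = O(τ - s) and edge = o(1)
give its cube the derivative 0. The cube is therefore continuously differentiable along the whole
path. -/
theorem hasDerivAt_edge_pow (ht : t ≠ 0) (s : ℝ) : HasDerivAt (fun s => D.edge s ^ 3)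
    (3 / 2 * D.edge s * (D.curvePoly.derivative.eval (D.path s) * deriv D.path s)) s := by
  by_cases hs : s ∈ D.cutSet
  · rcases cutSet_cases hs with ⟨i, hi⟩ | h0
    · refine ((D.hasDerivAt_edge ht hi).pow 3).congr_deriv ?_
      have := D.edge_ne_zero ht hi
      field_simp
      norm_num
      ring
    · rw [D.edge_eq_zero_of_branchPoint ht h0, mul_zero, zero_mul]
      have hlin : (fun τ => D.curvePoly.eval (D.path τ)) =O[𝓝 s] fun τ => τ - s := by
        have hp : HasDerivAt D.path (deriv D.path s) s :=
          (D.contDiff_path.differentiable (by norm_num)).differentiableAt.hasDerivAt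
        have := (HasDerivAt.comp_of_eq s (D.curvePoly.hasDerivAt (D.path s)) hp rfl).isBigO_sub
        simpa [Function.comp_def, h0] using this
      have h1 : (fun τ => D.edge τ ^ 2) =O[𝓝 s] fun τ => τ - s := by
        refine Asymptotics.IsBigO.trans (Asymptotics.IsBigO.of_bound 1 ?_) hlin
        refine Eventually.of_forall fun τ => ?_
        rw [norm_pow, one_mul]; exact D.norm_edge_sq_le ht τ
      have h2 : D.edge =o[𝓝 s] fun _ => (1 : ℝ) := by
        rw [Asymptotics.isLittleO_one_iff]
        have := (D.continuous_edge ht).tendsto s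
        rwa [D.edge_eq_zero_of_branchPoint ht h0] at this
      have h3 := h2.mul_isBigO h1
      rw [hasDerivAt_iff_isLittleO]
      simp only [D.edge_eq_zero_of_branchPoint ht h0, smul_zero, sub_zero, one_mul] at h3 ⊢
      refine h3.congr_left fun τ => ?_
      ring
  · rw [D.edge_eq_zero hs, mul_zero, zero_mul]
    have : (fun s => D.edge s ^ 3) =ᶠ[𝓝 s] fun _ => 0 := by
      filter_upwards [D.isCompact_cutSet.isClosed.isOpen_compl.mem_nhds hs] with τ hτ
      rw [D.edge_eq_zero hτ]; norm_num
    exact (hasDerivAt_const s (0 : ℂ)).congr_of_eventuallyEq this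

/-- `q(λ) y³` is a Lipschitz function of the position along the path. -/
theorem exists_lipschitz_edge_pow (ht : t ≠ 0) (q : ℂ[X]) (a b : ℝ) :
    ∃ K, ∀ s ∈ Icc a b, ∀ s' ∈ Icc a b,
      ‖q.eval (D.path s) * D.edge s ^ 3 - q.eval (D.path s') * D.edge s' ^ 3‖ ≤
        K * ‖D.path s - D.path s'‖ := by
  obtain ⟨c, hc, hch⟩ := exists_chord_arc D.contDiff_path D.deriv_path_ne_zero
    D.injective_path a b
  have hp : ∀ s, HasDerivAt D.path (deriv D.path s) s := fun s =>
    (D.contDiff_path.differentiable (by norm_num)).differentiableAt.hasDerivAt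
  have hd : ∀ s, HasDerivAt (fun s => q.eval (D.path s) * D.edge s ^ 3)
      (q.derivative.eval (D.path s) * deriv D.path s * D.edge s ^ 3 + q.eval (D.path s) *
        (3 / 2 * D.edge s * (D.curvePoly.derivative.eval (D.path s) * deriv D.path s))) s :=
    fun s => (HasDerivAt.comp_of_eq s (q.hasDerivAt (D.path s)) (hp s) rfl).mul
      (D.hasDerivAt_edge_pow ht s)
  have hcd := D.contDiff_path.continuous_deriv le_rfl
  have hpc := D.contDiff_path.continuous
  have hec := D.continuous_edge ht
  have hcont : Continuous fun s => q.derivative.eval (D.path s) * deriv D.path s * D.edge s ^ 3 +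
      q.eval (D.path s) *
        (3 / 2 * D.edge s * (D.curvePoly.derivative.eval (D.path s) * deriv D.path s)) :=
    (((q.derivative.continuous.comp hpc).mul hcd).mul (hec.pow 3)).add
      ((q.continuous.comp hpc).mul ((continuous_const.mul hec).mul
        ((D.curvePoly.derivative.continuous.comp hpc).mul hcd)))
  obtain ⟨M, hM⟩ := (isCompact_Icc (a := a) (b := b)).exists_bound_of_continuousOn
    hcont.continuousOn
  refine ⟨M / c, fun s hs s' hs' => ?_⟩
  have hM0 : 0 ≤ M := (norm_nonneg _).trans (hM s hs)
  have h1 := (convex_Icc a b).norm_image_sub_le_of_norm_hasDerivWithin_le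
    (fun x _ => (hd x).hasDerivWithinAt) hM hs' hs
  refine h1.trans ?_
  rw [div_mul_eq_mul_div, le_div_iff₀ hc, mul_assoc]
  refine mul_le_mul_of_nonneg_left ?_ hM0
  rw [Real.norm_eq_abs, mul_comm]
  exact hch s hs s' hs'

end SpectralCurve

/-! ### Cauchy integrals near the arc. -/

/-- Boundedness of the Cauchy integral of a Lipschitz density, up to logarithms of the distance to
the end points of the arc. -/
theorem norm_cauchyIntegral_le {γ : ℝ → ℂ} {a b : ℝ} {e : ℂ} (hγ : ContDiff ℝ 1 γ) (hab : a ≤ b)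
    (he0 : e ≠ 0) (he : ∀ s ∈ Icc a b, 0 < (deriv γ s / e).re) {F : ℝ → ℂ}
    (hFc : ContinuousOn F (Icc a b)) {K M : ℝ}
    (hK : ∀ s ∈ Icc a b, ∀ s' ∈ Icc a b, ‖F s - F s'‖ ≤ K * ‖γ s - γ s'‖)
    (hM : ∀ s ∈ Icc a b, ‖F s‖ ≤ M) {x : ℂ} (hx : ∀ s ∈ Icc a b, γ s ≠ x) :
    ‖∫ s in a..b, F s * deriv γ s / (γ s - x)‖ ≤ 2 * |K| * (∫ s in a..b, ‖deriv γ s‖) +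
      M * (|Real.log ‖γ b - x‖| + |Real.log ‖γ a - x‖| + 2 * Real.pi) := by
  have hdc := hγ.continuous_deriv le_rfl
  have hne : (Icc a b).Nonempty := nonempty_Icc.mpr hab
  have hM0 : 0 ≤ M := (norm_nonneg _).trans (hM a ⟨le_rfl, hab⟩)
  -- The value of F at the point of the arc closest to x is subtracted: |γ(s) - γ(s₀)| ≤ 2|γ(s) - x|
  -- removes the singularity and gives the factor 2|K|, and the constant F(s₀) leaves a multiple of
  -- `arcLog`.
  obtain ⟨s₀, hs₀, hmin⟩ := isCompact_Icc.exists_isMinOn hne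
    (f := fun s => ‖γ s - x‖) (hγ.continuous.sub continuous_const).norm.continuousOn
  have hden : ContinuousOn (fun s => deriv γ s / (γ s - x)) (Icc a b) := by
    have := continuousOn_arcLog_integrand (a := a) (b := b) hγ (x := x) (by rwa [uIcc_of_le hab])
    rwa [uIcc_of_le hab] at this
  have i1 : IntervalIntegrable (fun s => (F s - F s₀) * (deriv γ s / (γ s - x))) volume a b := by
    apply ContinuousOn.intervalIntegrable
    rw [uIcc_of_le hab]
    exact (hFc.sub continuousOn_const).mul hden
  have i2 : IntervalIntegrable (fun s => F s₀ * (deriv γ s / (γ s - x))) volume a b := by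
    apply ContinuousOn.intervalIntegrable
    rw [uIcc_of_le hab]
    exact continuousOn_const.mul hden
  have hsplit : ∫ s in a..b, F s * deriv γ s / (γ s - x) =
      (∫ s in a..b, (F s - F s₀) * (deriv γ s / (γ s - x))) + F s₀ * arcLog γ a b x := by
    rw [arcLog, ← intervalIntegral.integral_const_mul, ← intervalIntegral.integral_add i1 i2]
    congr 1; ext s; ring
  rw [hsplit]
  refine (norm_add_le _ _).trans (add_le_add ?_ ?_)
  · rw [← intervalIntegral.integral_const_mul]
    refine intervalIntegral.norm_integral_le_of_norm_le hab (ae_of_all _ fun s hs => ?_)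
      ((continuous_const.mul hdc.norm).intervalIntegrable _ _)
    have hs' := Ioc_subset_Icc_self hs
    have hpos : 0 < ‖γ s - x‖ := norm_pos_iff.mpr (sub_ne_zero.mpr (hx s hs'))
    rw [norm_mul, norm_div, mul_div_assoc', div_le_iff₀ hpos]
    have h1 : ‖F s - F s₀‖ ≤ 2 * |K| * ‖γ s - x‖ := by
      have h2 := hK s hs' s₀ hs₀
      have h3 : ‖γ s - γ s₀‖ ≤ 2 * ‖γ s - x‖ := by
        have := norm_sub_le_norm_sub_add_norm_sub (γ s) x (γ s₀)
        have h4 : ‖γ s₀ - x‖ ≤ ‖γ s - x‖ := hmin hs'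
        rw [norm_sub_rev x] at this
        linarith
      calc ‖F s - F s₀‖ ≤ |K| * ‖γ s - γ s₀‖ :=
            h2.trans (mul_le_mul_of_nonneg_right (le_abs_self K) (norm_nonneg _))
        _ ≤ |K| * (2 * ‖γ s - x‖) := mul_le_mul_of_nonneg_left h3 (abs_nonneg _)
        _ = _ := by ring
    calc ‖F s - F s₀‖ * ‖deriv γ s‖ ≤ 2 * |K| * ‖γ s - x‖ * ‖deriv γ s‖ :=
          mul_le_mul_of_nonneg_right h1 (norm_nonneg _)
      _ = _ := by ring
  · rw [norm_mul]
    exact mul_le_mul (hM s₀ hs₀) (norm_arcLog_le hγ hab he0 he hx) (norm_nonneg _) hM0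

theorem norm_dslope_le {k : ℂ → ℂ} {c : ℂ} {r M : ℝ} (hk : DifferentiableOn ℂ k (Metric.ball c r))
    (hM : ∀ x ∈ Metric.ball c r, ‖deriv k x‖ ≤ M) {w x : ℂ} (hw : w ∈ Metric.ball c r)
    (hx : x ∈ Metric.ball c r) : ‖dslope k w x‖ ≤ M := by
  by_cases h : x = w
  · rw [h, dslope_same]; exact hM w hw
  · rw [dslope_of_ne _ h, slope_def_field, norm_div,
      div_le_iff₀ (norm_pos_iff.mpr (sub_ne_zero.mpr h))]
    exact (convex_ball c r).norm_image_sub_le_of_norm_deriv_le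
      (fun y hy => hk.differentiableAt (Metric.isOpen_ball.mem_nhds hy)) hM hw hx

/-- `∫ (k(γ) - k(x)) / (γ - x) dγ` is holomorphic in `x`. -/
theorem differentiableOn_integral_dslope {γ : ℝ → ℂ} (hγ : ContDiff ℝ 1 γ) {a b : ℝ} (hab : a ≤ b)
    {k : ℂ → ℂ} {c : ℂ} {r M : ℝ} (hk : DifferentiableOn ℂ k (Metric.ball c r))
    (hM : ∀ x ∈ Metric.ball c r, ‖deriv k x‖ ≤ M)
    (hmem : ∀ s ∈ Icc a b, γ s ∈ Metric.ball c r) :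
    DifferentiableOn ℂ (fun x => ∫ s in a..b, dslope k (γ s) x * deriv γ s) (Metric.ball c r) := by
  have hdc := hγ.continuous_deriv le_rfl
  simp only [intervalIntegral.integral_of_le hab]
  refine differentiableOn_integral (b := fun s => M * ‖deriv γ s‖) Metric.isOpen_ball ?_ ?_ ?_ ?_
  · intro x hx
    have h1 : ContinuousOn (fun s => dslope k x (γ s)) (Ioc a b) := by
      have : ContinuousOn (dslope k x) (Metric.ball c r) :=
        (continuousOn_dslope (Metric.isOpen_ball.mem_nhds hx)).mpr
          ⟨hk.continuousOn, hk.differentiableAt (Metric.isOpen_ball.mem_nhds hx)⟩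
      exact this.comp hγ.continuous.continuousOn fun s hs => hmem s (Ioc_subset_Icc_self hs)
    -- The difference quotient is symmetric in its two points, so its measurability in s follows
    -- from continuity in the second argument.
    have h2 : (fun s => dslope k (γ s) x) = fun s => dslope k x (γ s) := by
      ext s
      by_cases h : x = γ s
      · rw [h]
      · rw [dslope_of_ne _ h, dslope_of_ne _ (Ne.symm h), slope_comm]
    rw [← h2] at h1
    exact (h1.mul hdc.continuousOn).aestronglyMeasurable measurableSet_Ioc
  · refine (ae_restrict_mem measurableSet_Ioc).mono fun s hs => ?_
    exact ((Complex.differentiableOn_dslope (Metric.isOpen_ball.mem_nhds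
      (hmem s (Ioc_subset_Icc_self hs)))).mpr hk).mul_const _
  · refine (ae_restrict_mem measurableSet_Ioc).mono fun s hs x hx => ?_
    rw [norm_mul]
    exact mul_le_mul_of_nonneg_right
      (norm_dslope_le hk hM (hmem s (Ioc_subset_Icc_self hs)) hx) (norm_nonneg _)
  · exact (continuous_const.mul hdc.norm).integrableOn_Ioc

theorem integrable_div_sub {γ : ℝ → ℂ} {v : ℝ → ℂ} {x : ℂ} {r : ℝ} (hγ : Continuous γ)
    (hv : Integrable v) (hr : 0 < r) (hfar : ∀ s, v s ≠ 0 → γ s ∉ Metric.ball x r) :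
    Integrable fun s => v s / (γ s - x) := by
  refine (hv.norm.div_const r).mono' ?_ (Eventually.of_forall fun s => ?_)
  · exact (hv.aestronglyMeasurable.mul (hγ.measurable.sub_const x).inv.aestronglyMeasurable).congr
      (Eventually.of_forall fun s => (div_eq_mul_inv _ _).symm)
  · by_cases hs : v s = 0
    · simp [hs]
    · rw [norm_div]
      refine div_le_div_of_nonneg_left (norm_nonneg _) hr ?_
      by_contra h
      push Not at h
      exact hfar s hs (by rwa [Metric.mem_ball, dist_eq_norm])

/-! ### Cauchy's formula for q / y₀ by Liouville's theorem. -/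

namespace SpectralCurve

variable {g : ℕ} {W : ℂ[X]} {t : ℂ} (D : SpectralCurve g W t)

/-- The difference between `q / y₀` and the Cauchy transform of its jump across the cuts. -/
def cauchyDefect (q : ℂ[X]) (x : ℂ) : ℂ :=
  q.eval x / D.y₀ x - 1 / (Real.pi * Complex.I) * ∫ s, D.invDensity q s / (D.path s - x)

theorem mem_cutSet_of_invDensity_ne_zero {q : ℂ[X]} {s : ℝ} (hs : D.invDensity q s ≠ 0) :
    s ∈ D.cutSet := by
  by_contra h; exact hs (D.invDensity_eq_zero q h)

theorem integrable_invDensity_div (ht : t ≠ 0) (q : ℂ[X]) {x : ℂ} (hx : x ∉ D.cuts) :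
    Integrable fun s => D.invDensity q s / (D.path s - x) := by
  obtain ⟨r, hr, hb⟩ := Metric.isOpen_iff.mp D.isClosed_cuts.isOpen_compl x hx
  exact integrable_div_sub D.contDiff_path.continuous (D.integrable_invDensity ht q) hr
    fun s hs hsb => hb hsb (D.path_mem_cuts.mpr (D.mem_cutSet_of_invDensity_ne_zero hs))

theorem differentiableAt_cauchyDefect (ht : t ≠ 0) (q : ℂ[X]) {x : ℂ} (hx : x ∉ D.cuts) :
    DifferentiableAt ℂ (D.cauchyDefect q) x := by
  obtain ⟨r, hr, hb⟩ := Metric.isOpen_iff.mp D.isClosed_cuts.isOpen_compl x hx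
  refine (q.differentiable.differentiableAt.div (D.differentiableAt_y₀ hx)
    (D.y₀_ne_zero hx)).sub (DifferentiableAt.const_mul ?_ _)
  exact (hasDerivAt_cauchyTransform D.contDiff_path.continuous (D.integrable_invDensity ht q) hr
    fun s hs hsb => hb hsb (D.path_mem_cuts.mpr
      (D.mem_cutSet_of_invDensity_ne_zero hs))).differentiableAt

/-- Near an inner point the density is k(λ) λ' with k = q/Y holomorphic. Writing k(λ) = (k(λ) -
k(x)) + k(x) splits the integral into a holomorphic part and k(x) times `arcLog`. The terms ±πi of
`arcLog` on the two sides cancel exactly the values ±k(x) of q/y₀. -/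
theorem exists_extension_interior (ht : t ≠ 0) (q : ℂ[X]) {i : Fin (g + 1)} {s₀ : ℝ}
    (hs₀ : s₀ ∈ Ioo (D.lo i) (D.hi i)) : ∃ r > 0, ∃ h : ℂ → ℂ,
      DifferentiableOn ℂ h (Metric.ball (D.path s₀) r) ∧
      ∀ x ∈ Metric.ball (D.path s₀) r, x ∉ D.cuts → D.cauchyDefect q x = h x := by
  have hγ := D.contDiff_path
  obtain ⟨s₁, h1, s₂, h2, r, hr, Y, hch, hY⟩ := exists_chart_of_mem_Ioo hs₀
  set c := D.path s₀
  -- shrink the chart so that its arc lies well inside the ball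
  have hev : ∀ᶠ s in 𝓝 s₀, D.path s ∈ Metric.ball c (r / 2) :=
    hγ.continuous.continuousAt.eventually (Metric.ball_mem_nhds _ (half_pos hr))
  obtain ⟨δ, hδ, hδb⟩ := Metric.eventually_nhds_iff.mp hev
  obtain ⟨a, ha, b, hb, r', hr', hch'⟩ := exists_chart hγ D.deriv_path_ne_zero
    D.injective_path (D.lo 0) (D.hi (Fin.last g))
    (max_lt h1.2 (sub_lt_self s₀ hδ)) (lt_min h2.1 (lt_add_of_pos_right s₀ hδ))
  have ha1 : s₁ < a := (le_max_left _ _).trans_lt ha.1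
  have ha2 : s₀ - δ < a := (le_max_right _ _).trans_lt ha.1
  have hb1 : b < s₂ := hb.2.trans_le (min_le_left _ _)
  have hb2 : b < s₀ + δ := hb.2.trans_le (min_le_right _ _)
  have hmemab : ∀ s ∈ Icc a b, D.path s ∈ Metric.ball c (r / 2) := fun s hs => hδb (by
    rw [Real.dist_eq, abs_lt]; constructor <;> linarith [hs.1, hs.2])
  set ρ := min r' (r / 2) with hρ
  have hρpos : 0 < ρ := lt_min hr' (half_pos hr)
  have hch2 := hch'.mono (Metric.ball_subset_ball (min_le_left r' (r / 2)))
  have hballs : Metric.ball c ρ ⊆ Metric.ball c (r / 2) :=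
    Metric.ball_subset_ball (min_le_right _ _)
  have hballr : Metric.ball c (r / 2) ⊆ Metric.ball c r := Metric.ball_subset_ball (by linarith)
  have hPne : ∀ x ∈ Metric.ball c r, Y x ≠ 0 := by
    intro x hx hYx
    have hsq := hY.sq x hx
    rw [hYx, zero_pow two_ne_zero, eq_comm] at hsq
    have hxc : x ∈ D.cuts := by by_contra h; exact D.eval_curvePoly_ne_zero h hsq
    rw [cuts_eq] at hxc
    obtain ⟨τ, hτ, rfl⟩ := hxc
    have hτ' := hch.iso τ (D.cutSet_subset hτ) hx
    have hτi : τ ∈ Ioo (D.lo i) (D.hi i) := ⟨h1.1.trans hτ'.1, hτ'.2.trans h2.2⟩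
    have := D.edge_sq ht hτ
    rw [hsq] at this
    exact D.edge_ne_zero ht hτi (by simpa using this)
  set k : ℂ → ℂ := fun x => q.eval x / Y x with hk
  have hkd : DifferentiableOn ℂ k (Metric.ball c r) :=
    q.differentiable.differentiableOn.div hY.differentiableOn hPne
  obtain ⟨M, hM⟩ : ∃ M, ∀ x ∈ Metric.closedBall c (r / 2), ‖deriv k x‖ ≤ M := by
    refine (isCompact_closedBall c (r / 2)).exists_bound_of_continuousOn ?_
    exact (hkd.deriv Metric.isOpen_ball).continuousOn.mono
      (Metric.closedBall_subset_ball (by linarith))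
  have hab : a ≤ b := (ha.2.trans hb.1).le
  have hu : ∀ s ∈ Icc a b, D.invDensity q s = k (D.path s) * deriv D.path s := by
    intro s hs
    rw [invDensity, edge_eq ht hch hY ⟨ha1.trans_le hs.1, hs.2.trans_lt hb1⟩
      (hballr (hmemab s hs)), hk]
    ring
  have hint := D.integrable_invDensity ht q
  -- The density outside (a, b] is supported on cut points that the chart keeps out of the small
  -- ball, so its Cauchy transform is holomorphic there.
  set far : ℝ → ℂ := indicator (Ioc a b)ᶜ (D.invDensity q) with hfar
  have hfarint : Integrable far := hint.indicator measurableSet_Ioc.compl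
  have hfarne : ∀ x ∈ Metric.ball c ρ, ∃ r₁ > 0, ∀ s, far s ≠ 0 → D.path s ∉ Metric.ball x r₁ := by
    intro x hx
    obtain ⟨r₁, hr₁, hsub⟩ := Metric.isOpen_iff.mp Metric.isOpen_ball x hx
    refine ⟨r₁, hr₁, fun s hs hsb => ?_⟩
    have hs1 : s ∈ (Ioc a b)ᶜ := by
      by_contra h; exact hs (indicator_of_notMem h _)
    have hs2 : s ∈ D.cutSet := by
      refine D.mem_cutSet_of_invDensity_ne_zero (q := q) fun h => hs ?_
      rw [hfar, indicator_of_mem hs1, h]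
    exact hs1 (Ioo_subset_Ioc_self (hch2.iso s (D.cutSet_subset hs2) (hsub hsb)))
  set J : ℂ → ℂ := fun x => ∫ s in a..b, dslope k (D.path s) x * deriv D.path s with hJ
  have hJd : DifferentiableOn ℂ J (Metric.ball c (r / 2)) :=
    differentiableOn_integral_dslope hγ hab (hkd.mono hballr)
      (fun x hx => hM x (Metric.ball_subset_closedBall hx)) hmemab
  set Λ : ℂ → ℂ := fun x => Complex.log ((D.path b - x) / deriv D.path s₀) -
    Complex.log ((x - D.path a) / deriv D.path s₀) with hΛ
  have hsplit : ∀ x ∈ Metric.ball c ρ, x ∉ D.cuts →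
      ∫ s, D.invDensity q s / (D.path s - x) =
        (∫ s, far s / (D.path s - x)) + J x + k x * arcLog D.path a b x := by
    intro x hx hxc
    have hoff : ∀ s ∈ Icc a b, D.path s ≠ x := fun s hs hsx => hxc (by
      rw [← hsx, path_mem_cuts, mem_cutSet]
      exact ⟨i, (h1.1.trans (ha1.trans_le hs.1)).le, ((hs.2.trans_lt hb1).trans h2.2).le⟩)
    have hintx := D.integrable_invDensity_div ht q hxc
    rw [← integral_add_compl measurableSet_Ioc hintx (s := Ioc a b), add_assoc, add_comm]
    congr 1
    · rw [← integral_indicator measurableSet_Ioc.compl]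
      congr 1; ext s
      by_cases hs : s ∈ (Ioc a b)ᶜ
      · rw [indicator_of_mem hs, hfar, indicator_of_mem hs]
      · rw [indicator_of_notMem hs, hfar, indicator_of_notMem hs, zero_div]
    · rw [← intervalIntegral.integral_of_le hab, hJ, arcLog,
        ← intervalIntegral.integral_const_mul, ← intervalIntegral.integral_add]
      · refine intervalIntegral.integral_congr fun s hs => ?_
        rw [uIcc_of_le hab] at hs
        have hne : D.path s - x ≠ 0 := sub_ne_zero.mpr (hoff s hs)
        have hne' : x - D.path s ≠ 0 := sub_ne_zero.mpr (hoff s hs).symm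
        rw [hu s hs, dslope_of_ne _ (hoff s hs).symm, slope_def_field]
        field_simp
        ring
      · have hcont : ContinuousOn (fun s => (k (D.path s) - k x) / (D.path s - x) *
            deriv D.path s) (uIcc a b) := by
          rw [uIcc_of_le hab]
          refine ((ContinuousOn.sub ?_ continuousOn_const).div
            (hγ.continuous.sub continuous_const).continuousOn
            fun s hs => sub_ne_zero.mpr (hoff s hs)).mul (hγ.continuous_deriv le_rfl).continuousOn
          exact hkd.continuousOn.comp hγ.continuous.continuousOn
            fun s hs => hballr (hmemab s hs)
        refine hcont.intervalIntegrable.congr_ae ((ae_restrict_mem measurableSet_uIoc).mono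
          fun s hs => ?_)
        rw [uIoc_of_le hab] at hs
        have hs' := Ioc_subset_Icc_self hs
        beta_reduce
        rw [dslope_of_ne _ (hoff s hs').symm, slope_def_field, ← neg_sub (k x), ← neg_sub x,
          neg_div_neg_eq]
      · exact (continuousOn_arcLog_integrand hγ
          (by rwa [uIcc_of_le hab])).intervalIntegrable.const_mul _
  have hpi : (Real.pi : ℂ) * Complex.I ≠ 0 := mul_ne_zero
    (by exact_mod_cast Real.pi_ne_zero) Complex.I_ne_zero
  refine ⟨ρ, hρpos, fun x => -(1 / (Real.pi * Complex.I)) *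
    ((∫ s, far s / (D.path s - x)) + J x + k x * Λ x), ?_, ?_⟩
  · intro x hx
    apply DifferentiableAt.differentiableWithinAt
    have hxb := hballs hx
    refine DifferentiableAt.const_mul (((?_ : DifferentiableAt ℂ _ x).add ?_).add
      (DifferentiableAt.mul ?_ ?_)) _
    · obtain ⟨r₁, hr₁, hf⟩ := hfarne x hx
      exact (hasDerivAt_cauchyTransform hγ.continuous hfarint hr₁ hf).differentiableAt
    · exact hJd.differentiableAt (Metric.isOpen_ball.mem_nhds hxb)
    · exact hkd.differentiableAt (Metric.isOpen_ball.mem_nhds (hballr hxb))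
    · refine DifferentiableAt.sub ?_ ?_
      · refine ((differentiableAt_id.const_sub _).div_const _).clog ?_
        exact Complex.mem_slitPlane_iff.mpr (Or.inl (hch2.re_sub_pos' hx))
      · refine ((differentiableAt_id.sub_const _).div_const _).clog ?_
        exact Complex.mem_slitPlane_iff.mpr (Or.inl (hch2.re_sub_pos hx))
  · intro x hx hxc
    obtain ⟨s, hs, ε, hxe⟩ := hch2.exists_eq hγ hx
    have hsI : s ∈ Ioo s₁ s₂ := ⟨ha1.trans hs.1, hs.2.trans hb1⟩
    have hxr := hballr (hballs hx)
    rcases lt_trichotomy ε 0 with h0 | h0 | h0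
    · have e1 := arcLog_right hγ hch2.ne hch2.re_pos hs h0 hxe
      have e2 : D.y₀ x = -Y x := by
        have := hY.right s hsI ε h0 (hxe ▸ hxr)
        rwa [← hxe] at this
      rw [cauchyDefect, hsplit x hx hxc, e1, e2]
      have : q.eval x / -Y x = -k x := by rw [hk, div_neg]
      rw [this]
      simp only [hΛ]
      field_simp
      ring
    · exfalso
      apply hxc
      rw [hxe, h0]
      simp only [Complex.ofReal_zero, mul_zero, zero_mul, add_zero]
      rw [path_mem_cuts, mem_cutSet]
      exact ⟨i, (h1.1.trans hsI.1).le, (hsI.2.trans h2.2).le⟩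
    · have e1 := arcLog_left hγ hch2.ne hch2.re_pos hs h0 hxe
      have e2 : D.y₀ x = Y x := by
        have := hY.left s hsI ε h0 (hxe ▸ hxr)
        rwa [← hxe] at this
      rw [cauchyDefect, hsplit x hx hxc, e1, e2]
      have : q.eval x / Y x = k x := rfl
      rw [this]
      simp only [hΛ]
      field_simp
      ring

end SpectralCurve

theorem norm_le_add_one_of_sq_eq {y p : ℂ} (h : y ^ 2 = p) : ‖y‖ ≤ ‖p‖ + 1 := by
  have : ‖y‖ ^ 2 = ‖p‖ := by rw [← norm_pow, h]
  nlinarith [sq_nonneg (‖y‖ - 1), norm_nonneg y]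

namespace SpectralCurve

variable {g : ℕ} {W : ℂ[X]} {t : ℂ} (D : SpectralCurve g W t)

/-- On the cuts P² = edge⁴, so this factor trades the singular 1/edge for edge³, which has a
Lipschitz bound along the path. -/
theorem invDensity_mul_curvePoly_sq (ht : t ≠ 0) (q : ℂ[X]) (s : ℝ) :
    D.invDensity q s * D.curvePoly.eval (D.path s) ^ 2 =
      q.eval (D.path s) * D.edge s ^ 3 * deriv D.path s := by
  by_cases hs : s ∈ D.cutSet
  · by_cases h0 : D.edge s = 0
    · rw [invDensity, h0]; simp
    · rw [← D.edge_sq ht hs, invDensity]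
      field_simp
  · rw [D.invDensity_eq_zero q hs, D.edge_eq_zero hs]; simp

/-- Near the path, the defect is `O(P⁻²)`. -/
theorem exists_bound_cauchyDefect (ht : t ≠ 0) (q : ℂ[X]) (s₀ : ℝ) : ∃ C, ∀ᶠ x in 𝓝 (D.path s₀),
    x ∉ range D.path → ‖D.curvePoly.eval x ^ 2 * D.cauchyDefect q x‖ ≤ C := by
  have hγ := D.contDiff_path
  have hdc := hγ.continuous_deriv le_rfl
  obtain ⟨s₁, h1, s₂, h2, r, hr, hch⟩ := exists_chart hγ D.deriv_path_ne_zero D.injective_path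
    (D.lo 0) (D.hi (Fin.last g)) (sub_one_lt s₀) (lt_add_one s₀)
  have h12 := hch.lt.le
  set c := D.path s₀
  set F : ℝ → ℂ := fun s => q.eval (D.path s) * D.edge s ^ 3 with hF
  have hFc : Continuous F := (q.continuous.comp hγ.continuous).mul ((D.continuous_edge ht).pow 3)
  obtain ⟨K, hK⟩ := D.exists_lipschitz_edge_pow ht q s₁ s₂
  obtain ⟨M, hM⟩ := (isCompact_Icc (a := s₁) (b := s₂)).exists_bound_of_continuousOn hFc.continuousOn
  have hM0 : 0 ≤ M := (norm_nonneg _).trans (hM s₁ ⟨le_rfl, h12⟩)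
  have hFsupp : ∀ s ∉ D.cutSet, F s = 0 := fun s hs => by rw [hF]; simp [D.edge_eq_zero hs]
  have hFint : Integrable fun s => F s * deriv D.path s :=
    (hFc.mul hdc).integrable_of_hasCompactSupport
      (HasCompactSupport.intro D.isCompact_cutSet fun s hs => by simp [hFsupp s hs])
  obtain ⟨R, hR⟩ := (D.isCompact_cutSet.image hγ.continuous).isBounded.subset_closedBall 0
  obtain ⟨L, hL⟩ := (isCompact_closedBall (0 : ℂ) (max R (‖c‖ + 1))).exists_bound_of_continuousOn
    (D.curvePoly ^ 2).derivative.continuous.continuousOn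
  have hlip : ∀ x ∈ Metric.closedBall (0 : ℂ) (max R (‖c‖ + 1)),
      ∀ x' ∈ Metric.closedBall (0 : ℂ) (max R (‖c‖ + 1)),
      ‖(D.curvePoly ^ 2).eval x' - (D.curvePoly ^ 2).eval x‖ ≤ L * ‖x' - x‖ :=
    fun x hx x' hx' => (convex_closedBall _ _).norm_image_sub_le_of_norm_hasDerivWithin_le
      (fun y _ => ((D.curvePoly ^ 2).hasDerivAt y).hasDerivWithinAt) hL hx hx'
  have hu := D.integrable_invDensity ht q
  set B₁ := (‖q.eval c‖ + 1) * (‖D.curvePoly.eval c‖ + 2) ^ 3 with hB₁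
  set B₂ := L * ∫ s, ‖D.invDensity q s‖ with hB₂
  set B₃ := (∫ s, ‖F s * deriv D.path s‖) / (r / 2) with hB₃
  -- The logarithms of the distances to the chart ends λ(s₁) and λ(s₂) stay bounded because x
  -- remains close to λ(s₀), which is neither of them.
  set B₄ := 2 * |K| * (∫ s in s₁..s₂, ‖deriv D.path s‖) +
      M * ((|Real.log ‖D.path s₂ - c‖| + 1) + (|Real.log ‖D.path s₁ - c‖| + 1) + 2 * Real.pi)
    with hB₄
  have hne : ∀ s, s ≠ s₀ → D.path s - c ≠ 0 := fun s hs h =>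
    hs (D.injective_path (sub_eq_zero.mp h))
  have hlog : ∀ s, s ≠ s₀ → ∀ᶠ x in 𝓝 c,
      |Real.log ‖D.path s - x‖| < |Real.log ‖D.path s - c‖| + 1 := by
    intro s hs
    have : ContinuousAt (fun x => |Real.log ‖D.path s - x‖|) c :=
      ((continuousAt_const.sub continuousAt_id).norm.log (norm_ne_zero_iff.mpr (hne s hs))).abs
    exact this.eventually (gt_mem_nhds (lt_add_one _))
  have hqb : ∀ᶠ x in 𝓝 c, ‖q.eval x‖ < ‖q.eval c‖ + 1 :=
    q.continuous.norm.continuousAt.eventually (gt_mem_nhds (lt_add_one _))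
  have hPb : ∀ᶠ x in 𝓝 c, ‖D.curvePoly.eval x‖ < ‖D.curvePoly.eval c‖ + 1 :=
    D.curvePoly.continuous.norm.continuousAt.eventually (gt_mem_nhds (lt_add_one _))
  have hxb : ∀ᶠ x in 𝓝 c, ‖x‖ < ‖c‖ + 1 :=
    continuous_norm.continuousAt.eventually (gt_mem_nhds (lt_add_one _))
  refine ⟨B₁ + ‖1 / (Real.pi * Complex.I)‖ * (B₂ + (B₄ + B₃)), ?_⟩
  filter_upwards [hqb, hPb, hxb, hlog s₁ h1.2.ne, hlog s₂ h2.1.ne', Metric.ball_mem_nhds c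
    (half_pos hr)] with x hxq hxP hxn hx1 hx2 hxball hxr
  have hxc : x ∉ D.cuts := fun h => hxr (by
    rw [cuts_eq] at h; exact image_subset_range _ _ h)
  have hoff : ∀ s, D.path s ≠ x := fun s h => hxr ⟨s, h⟩
  have hxR : x ∈ Metric.closedBall (0 : ℂ) (max R (‖c‖ + 1)) := by
    rw [mem_closedBall_zero_iff]; exact hxn.le.trans (le_max_right _ _)
  have i1 := D.integrable_invDensity_div ht q hxc
  -- The first term is bounded since the polynomial P² is Lipschitz on bounded sets and the density
  -- is integrable. The second is the Cauchy integral of the Lipschitz function q(λ) edge³.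
  have hdecomp : ∀ s, D.curvePoly.eval x ^ 2 * (D.invDensity q s / (D.path s - x)) =
      D.invDensity q s * (D.curvePoly.eval x ^ 2 - D.curvePoly.eval (D.path s) ^ 2) /
        (D.path s - x) + F s * deriv D.path s / (D.path s - x) := by
    intro s
    rw [hF, ← D.invDensity_mul_curvePoly_sq ht]
    ring
  obtain ⟨r₁, hr₁, hr₁b⟩ := Metric.isOpen_iff.mp D.isClosed_cuts.isOpen_compl x hxc
  have i2 : Integrable fun s => F s * deriv D.path s / (D.path s - x) :=
    integrable_div_sub hγ.continuous hFint hr₁ fun s hs hsb => hr₁b hsb (D.path_mem_cuts.mpr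
      (by by_contra h; exact hs (by rw [hFsupp s h, zero_mul])))
  have i3 : Integrable fun s => D.invDensity q s *
      (D.curvePoly.eval x ^ 2 - D.curvePoly.eval (D.path s) ^ 2) / (D.path s - x) := by
    refine ((i1.const_mul (D.curvePoly.eval x ^ 2)).sub i2).congr (Eventually.of_forall fun s => ?_)
    simp only [Pi.sub_apply]
    rw [hdecomp, add_sub_cancel_right]
  have e1 : ‖D.curvePoly.eval x ^ 2 * (q.eval x / D.y₀ x)‖ ≤ B₁ := by
    have hy := D.y₀_sq hxc
    have hy0 := D.y₀_ne_zero hxc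
    have : D.curvePoly.eval x ^ 2 * (q.eval x / D.y₀ x) = q.eval x * D.y₀ x ^ 3 := by
      rw [← hy]; field_simp
    rw [this, norm_mul, norm_pow, hB₁]
    have h3 := norm_le_add_one_of_sq_eq hy
    have h4 : ‖D.y₀ x‖ ≤ ‖D.curvePoly.eval c‖ + 2 := by linarith
    gcongr
  have e2 : ‖∫ s, D.invDensity q s * (D.curvePoly.eval x ^ 2 -
      D.curvePoly.eval (D.path s) ^ 2) / (D.path s - x)‖ ≤ B₂ := by
    rw [hB₂, ← integral_const_mul]
    refine norm_integral_le_of_norm_le (hu.norm.const_mul L) (Eventually.of_forall fun s => ?_)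
    by_cases hs : s ∈ D.cutSet
    · have h5 := hlip _ (hR (mem_image_of_mem _ hs)|> fun h =>
        Metric.closedBall_subset_closedBall (le_max_left _ _) h) x hxR
      simp only [eval_pow] at h5
      have hpos : 0 < ‖D.path s - x‖ := norm_pos_iff.mpr (sub_ne_zero.mpr (hoff s))
      rw [norm_div, norm_mul, div_le_iff₀ hpos]
      rw [norm_sub_rev x] at h5
      calc _ ≤ ‖D.invDensity q s‖ * (L * ‖D.path s - x‖) :=
            mul_le_mul_of_nonneg_left h5 (norm_nonneg _)
        _ = _ := by ring
    · rw [D.invDensity_eq_zero q hs]; simp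
  have e3 : ‖∫ s, F s * deriv D.path s / (D.path s - x)‖ ≤ B₄ + B₃ := by
    rw [← integral_add_compl measurableSet_Ioc i2 (s := Ioc s₁ s₂)]
    refine (norm_add_le _ _).trans (add_le_add ?_ ?_)
    · rw [← intervalIntegral.integral_of_le h12]
      refine (norm_cauchyIntegral_le hγ h12 hch.ne hch.re_pos hFc.continuousOn hK hM
        (fun s _ => hoff s)).trans ?_
      rw [hB₄]
      gcongr
    · rw [hB₃, ← integral_div]
      refine (norm_integral_le_of_norm_le (hFint.norm.div_const (r / 2)).integrableOn
        ((ae_restrict_mem measurableSet_Ioc.compl).mono fun s hs => ?_)).trans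
        (setIntegral_le_integral (hFint.norm.div_const _)
          (Eventually.of_forall fun s => by positivity))
      by_cases hsc : s ∈ D.cutSet
      · rw [norm_div]
        refine div_le_div_of_nonneg_left (norm_nonneg _) (half_pos hr) ?_
        by_contra h
        push Not at h
        refine hs (Ioo_subset_Ioc_self (hch.iso s (D.cutSet_subset hsc) ?_))
        rw [Metric.mem_ball, dist_eq_norm] at hxball ⊢
        have := norm_sub_le_norm_sub_add_norm_sub (D.path s) x c
        linarith
      · rw [hFsupp s hsc]; simp
  have hE : D.curvePoly.eval x ^ 2 * D.cauchyDefect q x =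
      D.curvePoly.eval x ^ 2 * (q.eval x / D.y₀ x) - 1 / (Real.pi * Complex.I) *
        ((∫ s, D.invDensity q s * (D.curvePoly.eval x ^ 2 -
          D.curvePoly.eval (D.path s) ^ 2) / (D.path s - x)) +
          ∫ s, F s * deriv D.path s / (D.path s - x)) := by
    rw [← integral_add i3 i2, cauchyDefect, mul_sub, mul_left_comm, ← integral_const_mul]
    congr 3
    ext s
    exact hdecomp s
  rw [hE]
  refine (norm_sub_le _ _).trans (add_le_add e1 ?_)
  rw [norm_mul]
  exact mul_le_mul_of_nonneg_left ((norm_add_le _ _).trans (add_le_add e2 e3)) (norm_nonneg _)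

/-- On the side of a branch point away from its cut. -/
theorem exists_side_of_branchPoint {s₀ : ℝ} (h0 : D.curvePoly.eval (D.path s₀) = 0) :
    ∃ κ : ℝ, |κ| = 1 ∧ ∀ᶠ s in 𝓝 s₀, s ∈ D.cutSet → 0 ≤ κ * (s₀ - s) := by
  obtain ⟨i, hi⟩ := D.eval_curvePoly_path_eq_zero.mp h0
  have hs₀ : s₀ ∈ Icc (D.lo i) (D.hi i) := by
    rcases hi with h | h <;> rw [h]
    exacts [⟨le_rfl, (D.lo_lt_hi i).le⟩, ⟨(D.lo_lt_hi i).le, le_rfl⟩]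
  have hev : ∀ᶠ s in 𝓝 s₀, s ∈ D.cutSet → s ∈ Icc (D.lo i) (D.hi i) := by
    have : ∀ᶠ s in 𝓝 s₀, ∀ j, j ≠ i → s ∉ Icc (D.lo j) (D.hi j) := by
      rw [eventually_all]
      intro j
      by_cases hj : j = i
      · simp [hj]
      · filter_upwards [isClosed_Icc.isOpen_compl.mem_nhds
          (fun h => hj (D.eq_of_mem_Icc_of_mem_Icc h hs₀) : s₀ ∉ Icc (D.lo j) (D.hi j))]
          with s hs _ using hs
    filter_upwards [this] with s hs hsc
    obtain ⟨j, hj⟩ := D.mem_cutSet.mp hsc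
    by_cases hji : j = i
    · exact hji ▸ hj
    · exact absurd hj (hs j hji)
  rcases hi with h | h
  · refine ⟨-1, by norm_num, ?_⟩
    filter_upwards [hev] with s hs hsc
    linarith [(hs hsc).1]
  · refine ⟨1, by norm_num, ?_⟩
    filter_upwards [hev] with s hs hsc
    linarith [(hs hsc).2]

/-- Along a suitable direction the defect is `o(1 / (x - a))` at a branch point `a`. -/
theorem exists_tendsto_cauchyDefect (ht : t ≠ 0) (q : ℂ[X]) {s₀ : ℝ}
    (h0 : D.curvePoly.eval (D.path s₀) = 0) : ∃ e : ℂ, e ≠ 0 ∧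
      (∀ᶠ ε : ℝ in 𝓝[>] 0, D.path s₀ + ε * e ∉ D.cuts) ∧
      Tendsto (fun ε : ℝ => ε * e * D.cauchyDefect q (D.path s₀ + ε * e)) (𝓝[>] 0) (𝓝 0) := by
  have hγ := D.contDiff_path
  obtain ⟨κ, hκ, hside⟩ := D.exists_side_of_branchPoint h0
  have hκ0 : κ ≠ 0 := fun h => by simp [h] at hκ
  have hκκ : κ * κ = 1 := by rw [← abs_mul_abs_self, hκ, one_mul]
  obtain ⟨δ, hδ, hδb⟩ := Metric.eventually_nhds_iff.mp hside
  obtain ⟨s₁, h1, s₂, h2, r, hr, hch⟩ := exists_chart hγ D.deriv_path_ne_zero D.injective_path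
    (D.lo 0) (D.hi (Fin.last g)) (sub_lt_self s₀ hδ) (lt_add_of_pos_right s₀ hδ)
  set e := deriv D.path s₀ with he
  have he0 : e ≠ 0 := D.deriv_path_ne_zero s₀
  have hen : 0 < ‖e‖ := norm_pos_iff.mpr he0
  set c := D.path s₀
  have hmono := strictMonoOn_re hγ hch.re_pos
  have hs₀ : s₀ ∈ Icc s₁ s₂ := ⟨h1.2.le, h2.1.le⟩
  -- On the tangent ray pointing away from the cut, nearby cut points lie behind the branch point a,
  -- and all others are at a fixed distance. Hence |λ(s) - x| ≥ |x - a| on the cuts, and the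
  -- integrand times x - a is dominated by the density alone.
  have hdist : ∀ᶠ ε : ℝ in 𝓝[>] 0, ∀ s ∈ D.cutSet,
      ‖(ε : ℂ) * (κ * e)‖ ≤ ‖D.path s - (c + ε * (κ * e))‖ := by
    have hsm : ∀ᶠ ε : ℝ in 𝓝[>] 0, ε * ‖e‖ < r / 2 := by
      have : ContinuousAt (fun ε : ℝ => ε * ‖e‖) 0 := continuousAt_id.mul continuousAt_const
      exact nhdsWithin_le_nhds (this.eventually (gt_mem_nhds (by simpa using half_pos hr)))
    filter_upwards [hsm, self_mem_nhdsWithin] with ε hε hεp s hs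
    have hεp' : 0 < ε := hεp
    have hn : ‖(ε : ℂ) * (κ * e)‖ = ε * ‖e‖ := by
      rw [norm_mul, norm_mul, Complex.norm_real, Complex.norm_real, Real.norm_eq_abs,
        Real.norm_eq_abs, hκ, abs_of_pos hεp', one_mul]
    rw [hn]
    by_cases hb : D.path s ∈ Metric.ball c r
    · have hsI := hch.iso s (D.cutSet_subset hs) hb
      have hsd : 0 ≤ κ * (s₀ - s) := hδb (by
        rw [Real.dist_eq, abs_lt]; constructor <;> linarith [hsI.1, hsI.2, h1.1, h2.2]) hs
      have hsign : 0 ≤ κ * ((c / e).re - (D.path s / e).re) := by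
        rcases lt_trichotomy s s₀ with h | h | h
        · have := hmono (Ioo_subset_Icc_self hsI) hs₀ h
          have hk : 0 ≤ κ := by
            by_contra hk
            nlinarith
          exact mul_nonneg hk (sub_nonneg.mpr this.le)
        · simp only [h]; exact (by simp [c] : (0:ℝ) ≤ κ * ((c / e).re - (D.path s₀ / e).re))
        · have := hmono hs₀ (Ioo_subset_Icc_self hsI) h
          have hk : κ ≤ 0 := by
            by_contra hk
            nlinarith
          exact mul_nonneg_of_nonpos_of_nonpos hk (sub_nonpos.mpr this.le)
      have hre : ε ≤ κ * ((c + ε * (κ * e) - D.path s) / e).re := by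
        have : (c + ε * (κ * e) - D.path s) / e = c / e - D.path s / e + ((ε * κ : ℝ) : ℂ) := by
          push_cast; field_simp; ring
        rw [this, Complex.add_re, Complex.sub_re, Complex.ofReal_re]
        nlinarith
      have habs : ε ≤ ‖(c + ε * (κ * e) - D.path s) / e‖ := by
        refine hre.trans ((le_abs_self _).trans ?_)
        rw [abs_mul, hκ, one_mul]
        exact Complex.abs_re_le_norm _
      rw [norm_div, le_div_iff₀ hen] at habs
      rwa [norm_sub_rev]
    · rw [Metric.mem_ball, not_lt, dist_eq_norm] at hb
      have h3 := norm_sub_le_norm_sub_add_norm_sub (D.path s) (c + ε * (κ * e)) c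
      rw [add_sub_cancel_left, hn] at h3
      linarith
  have hoff : ∀ᶠ ε : ℝ in 𝓝[>] 0, c + ε * (κ * e) ∉ D.cuts := by
    filter_upwards [hdist, self_mem_nhdsWithin] with ε hε hεp hc
    rw [cuts_eq] at hc
    obtain ⟨s, hs, hsx⟩ := hc
    have := hε s hs
    rw [hsx, sub_self, norm_zero] at this
    have h3 := norm_le_zero_iff.mp this
    have hεp' : (0 : ℝ) < ε := hεp
    simp [hκ0, he0, hεp'.ne'] at h3
  refine ⟨κ * e, mul_ne_zero (by exact_mod_cast hκ0) he0, hoff, ?_⟩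
  have hlimx : Tendsto (fun ε : ℝ => (ε : ℂ) * (κ * e)) (𝓝[>] 0) (𝓝 0) := by
    have : Continuous fun ε : ℝ => (ε : ℂ) * (κ * e) :=
      Complex.continuous_ofReal.mul continuous_const
    simpa using (this.tendsto 0).mono_left nhdsWithin_le_nhds
  have hlimc : Tendsto (fun ε : ℝ => c + (ε : ℂ) * (κ * e)) (𝓝[>] 0) (𝓝 c) := by
    simpa using hlimx.const_add c
  -- the algebraic part
  have hA : Tendsto (fun ε : ℝ => (ε : ℂ) * (κ * e) *
      (q.eval (c + ε * (κ * e)) / D.y₀ (c + ε * (κ * e)))) (𝓝[>] 0) (𝓝 0) := by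
    have h3 : Tendsto (fun ε : ℝ => (ε : ℂ) * (κ * e) / D.y₀ (c + ε * (κ * e)))
        (𝓝[>] 0) (𝓝 0) := by
      obtain ⟨C, hC, hP⟩ := D.exists_le_norm_curvePoly h0
      rw [tendsto_zero_iff_norm_tendsto_zero]
      have hsq : Tendsto (fun ε : ℝ => Real.sqrt (‖(ε : ℂ) * (κ * e)‖ / C)) (𝓝[>] 0) (𝓝 0) := by
        have := (hlimx.norm.div_const C).sqrt
        simpa using this
      refine squeeze_zero' (Eventually.of_forall fun _ => norm_nonneg _) ?_ hsq
      filter_upwards [hlimc.eventually hP, hoff, self_mem_nhdsWithin] with ε h4 h5 h6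
      apply Real.le_sqrt_of_sq_le
      rw [norm_div, div_pow, ← norm_pow (D.y₀ _), D.y₀_sq h5]
      rw [add_sub_cancel_left] at h4
      have h7 : 0 < ‖D.curvePoly.eval (c + ε * (κ * e))‖ :=
        norm_pos_iff.mpr (D.eval_curvePoly_ne_zero h5)
      rw [div_le_div_iff₀ h7 hC]
      nlinarith [norm_nonneg ((ε : ℂ) * (κ * e))]
    have h8 := h3.mul ((q.continuous.tendsto c).comp hlimc)
    rw [zero_mul] at h8
    refine h8.congr fun ε => ?_
    simp only [Function.comp]
    ring
  -- the integral
  have hu := D.integrable_invDensity ht q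
  have hB : Tendsto (fun ε : ℝ => ∫ s, (ε : ℂ) * (κ * e) *
      (D.invDensity q s / (D.path s - (c + ε * (κ * e))))) (𝓝[>] 0) (𝓝 (∫ _s : ℝ, (0 : ℂ))) := by
    refine tendsto_integral_filter_of_dominated_convergence (fun s => ‖D.invDensity q s‖)
      ?_ ?_ hu.norm ?_
    · filter_upwards [hoff] with ε hε
      exact ((D.integrable_invDensity_div ht q hε).const_mul _).aestronglyMeasurable
    · filter_upwards [hdist, hoff] with ε hε hεc
      refine Eventually.of_forall fun s => ?_
      by_cases hs : s ∈ D.cutSet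
      · have hpos : 0 < ‖D.path s - (c + ε * (κ * e))‖ := norm_pos_iff.mpr
          (sub_ne_zero.mpr fun h => hεc (h ▸ D.path_mem_cuts.mpr hs))
        rw [norm_mul, norm_div, mul_div_assoc', div_le_iff₀ hpos, mul_comm]
        exact mul_le_mul_of_nonneg_left (hε s hs) (norm_nonneg _)
      · rw [D.invDensity_eq_zero q hs]; simp
    · refine Eventually.of_forall fun s => ?_
      by_cases hs : s = s₀
      · rw [hs]
        simp [invDensity, D.edge_eq_zero_of_branchPoint ht h0]
      · have hne : D.path s - c ≠ 0 := fun h => hs (D.injective_path (sub_eq_zero.mp h))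
        have := hlimx.mul (((tendsto_const_nhds (x := D.path s)).sub hlimc).inv₀ hne |>.const_mul
          (D.invDensity q s))
        rw [zero_mul] at this
        exact this.congr fun ε => by rw [div_eq_mul_inv]
  rw [integral_zero] at hB
  have := hA.sub (hB.const_mul (1 / (Real.pi * Complex.I : ℂ)))
  rw [mul_zero, sub_zero] at this
  refine this.congr fun ε => ?_
  rw [integral_const_mul, cauchyDefect]
  ring

/-- The continuous extension of the defect across the cuts. -/
def cauchyExt (q : ℂ[X]) (x : ℂ) : ℂ := limUnder (𝓝[D.cutsᶜ] x) (D.cauchyDefect q)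

theorem cauchyExt_eventuallyEq {q : ℂ[X]} {U : Set ℂ} (hU : IsOpen U) {h : ℂ → ℂ}
    (hc : ContinuousOn h U) (heq : ∀ x ∈ U, x ∉ D.cuts → D.cauchyDefect q x = h x) {x : ℂ}
    (hx : x ∈ U) : D.cauchyExt q x = h x := by
  have : (𝓝[D.cutsᶜ] x).NeBot := mem_closure_iff_nhdsWithin_neBot.mp (D.dense_compl_cuts x)
  refine Tendsto.limUnder_eq ?_
  refine ((hc.continuousAt (hU.mem_nhds hx)).tendsto.mono_left nhdsWithin_le_nhds).congr' ?_
  filter_upwards [self_mem_nhdsWithin, mem_nhdsWithin_of_mem_nhds (hU.mem_nhds hx)] with y hy hyU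
  exact (heq y hyU hy).symm

theorem cauchyExt_eq (ht : t ≠ 0) (q : ℂ[X]) {x : ℂ} (hx : x ∉ D.cuts) :
    D.cauchyExt q x = D.cauchyDefect q x :=
  D.cauchyExt_eventuallyEq D.isClosed_cuts.isOpen_compl
    (fun _ hy => (D.differentiableAt_cauchyDefect ht q hy).continuousAt.continuousWithinAt)
    (fun _ _ _ => rfl) hx

theorem differentiableAt_cauchyExt_of_extension {q : ℂ[X]} {x : ℂ} {r : ℝ} (hr : 0 < r) {h : ℂ → ℂ}
    (hd : DifferentiableOn ℂ h (Metric.ball x r))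
    (heq : ∀ y ∈ Metric.ball x r, y ∉ D.cuts → D.cauchyDefect q y = h y) :
    DifferentiableAt ℂ (D.cauchyExt q) x := by
  have hx := Metric.ball_mem_nhds x hr
  refine (hd.differentiableAt hx).congr_of_eventuallyEq ?_
  filter_upwards [hx] with y hy
  exact D.cauchyExt_eventuallyEq Metric.isOpen_ball hd.continuousOn heq hy

theorem differentiableAt_cauchyExt_of_ne_zero (ht : t ≠ 0) (q : ℂ[X]) {x : ℂ}
    (hx : D.curvePoly.eval x ≠ 0) : DifferentiableAt ℂ (D.cauchyExt q) x := by
  by_cases hxc : x ∈ D.cuts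
  · rw [cuts_eq] at hxc
    obtain ⟨s, hs, rfl⟩ := hxc
    rcases cutSet_cases hs with ⟨i, hi⟩ | h
    · obtain ⟨r, hr, h, hd, heq⟩ := D.exists_extension_interior ht q hi
      exact D.differentiableAt_cauchyExt_of_extension hr hd heq
    · exact absurd h hx
  · refine (D.differentiableAt_cauchyDefect ht q hxc).congr_of_eventuallyEq ?_
    filter_upwards [D.isClosed_cuts.isOpen_compl.mem_nhds hxc] with y hy
    exact D.cauchyExt_eq ht q hy

end SpectralCurve

/-- The Cauchy transform of a compactly supported density at infinity. -/
theorem tendsto_mul_cauchyTransform {γ : ℝ → ℂ} {v : ℝ → ℂ} {R : ℝ} (hγ : Continuous γ)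
    (hv : Integrable v) (hR : ∀ s, v s ≠ 0 → ‖γ s‖ ≤ R) :
    Tendsto (fun x => x * ∫ s, v s / (γ s - x)) (cocompact ℂ) (𝓝 (-∫ s, v s)) := by
  have hnorm := tendsto_norm_cocompact_atTop (E := ℂ)
  have hev : ∀ᶠ x : ℂ in cocompact ℂ, ∀ s, v s ≠ 0 → ‖x‖ / 2 ≤ ‖γ s - x‖ := by
    filter_upwards [hnorm.eventually_ge_atTop (2 * R)] with x hx s hs
    have := norm_sub_norm_le x (γ s)
    rw [norm_sub_rev] at this
    linarith [hR s hs]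
  have : IsCountablyGenerated (cocompact ℂ) := by
    rw [← Metric.cobounded_eq_cocompact, ← comap_norm_atTop]; infer_instance
  rw [← integral_neg]
  simp only [← integral_const_mul]
  refine tendsto_integral_filter_of_dominated_convergence (fun s => 2 * ‖v s‖) ?_ ?_
    (hv.norm.const_mul 2) ?_
  · refine Eventually.of_forall fun x => ((hv.aestronglyMeasurable.mul
      (hγ.measurable.sub_const x).inv.aestronglyMeasurable).const_mul x).congr
      (Eventually.of_forall fun s => ?_)
    simp [div_eq_mul_inv]
  · filter_upwards [hev, hnorm.eventually_gt_atTop 0] with x hx hx0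
    refine Eventually.of_forall fun s => ?_
    by_cases hs : v s = 0
    · simp [hs]
    · have h1 := hx s hs
      have hpos : 0 < ‖γ s - x‖ := lt_of_lt_of_le (half_pos hx0) h1
      rw [norm_mul, norm_div, mul_div_assoc', div_le_iff₀ hpos]
      nlinarith [norm_nonneg (v s)]
  · refine Eventually.of_forall fun s => ?_
    have hinv : Tendsto (fun x : ℂ => x⁻¹) (cocompact ℂ) (𝓝 0) :=
      SpectralCurve.tendsto_inv_cocompact
    have h1 : Tendsto (fun x : ℂ => v s / (γ s * x⁻¹ - 1)) (cocompact ℂ) (𝓝 (v s / (γ s * 0 - 1))) :=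
      tendsto_const_nhds.div ((hinv.const_mul _).sub_const 1) (by simp)
    have h2 : v s / (γ s * 0 - 1) = -v s := by simp [div_neg]
    rw [h2] at h1
    refine h1.congr' ?_
    filter_upwards [hnorm.eventually_gt_atTop 0] with x hx0
    have hx : x ≠ 0 := norm_pos_iff.mp hx0
    have : γ s * x⁻¹ - 1 = (γ s - x) / x := by field_simp
    rw [this, div_div_eq_mul_div]
    ring

theorem tendsto_cauchyTransform {γ : ℝ → ℂ} {v : ℝ → ℂ} {R : ℝ} (hγ : Continuous γ)
    (hv : Integrable v) (hR : ∀ s, v s ≠ 0 → ‖γ s‖ ≤ R) :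
    Tendsto (fun x => ∫ s, v s / (γ s - x)) (cocompact ℂ) (𝓝 0) := by
  have h := SpectralCurve.tendsto_inv_cocompact.mul (tendsto_mul_cauchyTransform hγ hv hR)
  rw [zero_mul] at h
  refine h.congr' ?_
  filter_upwards [SpectralCurve.eventually_ne_zero_cocompact] with x hx
  rw [inv_mul_cancel_left₀ hx]

namespace SpectralCurve

variable {g : ℕ} {W : ℂ[X]} {t : ℂ} (D : SpectralCurve g W t)

theorem mem_cutSet_of_eval_eq_zero {s : ℝ} (h0 : D.curvePoly.eval (D.path s) = 0) :
    s ∈ D.cutSet := by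
  obtain ⟨i, h | h⟩ := D.eval_curvePoly_path_eq_zero.mp h0 <;>
    refine D.mem_cutSet.mpr ⟨i, ?_⟩ <;> rw [h]
  exacts [⟨le_rfl, (D.lo_lt_hi i).le⟩, ⟨(D.lo_lt_hi i).le, le_rfl⟩]

/-- P has a simple zero at the branch point a and P² times the defect is bounded, so the defect has
at most a double pole. Along one ray (x - a) times the defect tends to 0, which rules out poles of
both orders. -/
theorem exists_extension_branchPoint (ht : t ≠ 0) (q : ℂ[X]) {s₀ : ℝ}
    (h0 : D.curvePoly.eval (D.path s₀) = 0) : ∃ r > 0, ∃ h : ℂ → ℂ,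
      DifferentiableOn ℂ h (Metric.ball (D.path s₀) r) ∧
      ∀ x ∈ Metric.ball (D.path s₀) r, x ∉ D.cuts → D.cauchyDefect q x = h x := by
  obtain ⟨p, hp, hP⟩ := D.exists_factor h0
  obtain ⟨C, hC⟩ := D.exists_bound_cauchyDefect ht q s₀
  obtain ⟨e, he0, hoff, hlim⟩ := D.exists_tendsto_cauchyDefect ht q h0
  have hcc : D.path s₀ ∈ D.cuts := D.path_mem_cuts.mpr (D.mem_cutSet_of_eval_eq_zero h0)
  set c := D.path s₀
  obtain ⟨r, hr, hball⟩ := Metric.eventually_nhds_iff_ball.mp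
    (hC.and (p.continuous.continuousAt.eventually_ne hp))
  have hPne : ∀ x ∈ Metric.ball c r \ {c}, D.curvePoly.eval x ≠ 0 := fun x hx => by
    rw [hP]; exact mul_ne_zero (sub_ne_zero.mpr hx.2) (hball x hx.1).2
  set H : ℂ → ℂ := fun x => D.curvePoly.eval x ^ 2 * D.cauchyExt q x with hH
  have hHd : ∀ x ∈ Metric.ball c r \ {c}, DifferentiableAt ℂ H x := fun x hx =>
    (D.curvePoly.differentiable.differentiableAt.pow 2).mul
      (D.differentiableAt_cauchyExt_of_ne_zero ht q (hPne x hx))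
  have hHb : ∀ x ∈ Metric.ball c r \ {c}, ‖H x‖ ≤ C := by
    intro x hx
    have hx' : x ∈ closure (range D.path)ᶜ := dense_compl_range D.contDiff_path x
    have : (𝓝[(range D.path)ᶜ] x).NeBot := mem_closure_iff_nhdsWithin_neBot.mp hx'
    refine le_of_tendsto ((hHd x hx).continuousAt.norm.tendsto.mono_left
      (nhdsWithin_le_nhds (s := (range D.path)ᶜ))) ?_
    filter_upwards [self_mem_nhdsWithin,
      mem_nhdsWithin_of_mem_nhds (Metric.isOpen_ball.mem_nhds hx.1)] with y hy hyb
    have hyc : y ∉ D.cuts := fun h => hy (by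
      rw [cuts_eq] at h; exact image_subset_range _ _ h)
    simp only [hH]
    rw [D.cauchyExt_eq ht q hyc]
    exact (hball y hyb).1 hy
  set H' := Function.update H c (limUnder (𝓝[≠] c) H) with hH'
  have hnb := Metric.ball_mem_nhds c hr
  have hd' : DifferentiableOn ℂ H' (Metric.ball c r) :=
    Complex.differentiableOn_update_limUnder_of_bddAbove hnb
      (fun x hx => (hHd x hx).differentiableWithinAt)
      ⟨C, by rintro _ ⟨x, hx, rfl⟩; exact hHb x hx⟩
  have hxlim : Tendsto (fun ε : ℝ => c + (ε : ℂ) * e) (𝓝[>] 0) (𝓝 c) := by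
    have : Continuous fun ε : ℝ => c + (ε : ℂ) * e :=
      continuous_const.add (Complex.continuous_ofReal.mul continuous_const)
    simpa using (this.tendsto 0).mono_left nhdsWithin_le_nhds
  -- With P = (x - c) p, the quotient H'/(x - c) equals p² (x - c) times the defect and tends to 0
  -- along the ray. So H' vanishes to second order at c and can be divided by (x - c)².
  have hHlim : Tendsto (fun ε : ℝ => H' (c + ε * e) / (ε * e)) (𝓝[>] 0) (𝓝 0) := by
    have h1 := ((p.continuous.tendsto c).comp hxlim).pow 2 |>.mul hlim
    rw [mul_zero] at h1
    refine h1.congr' ?_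
    filter_upwards [hoff, self_mem_nhdsWithin] with ε h2 h3
    have h3' : (ε : ℂ) ≠ 0 := by exact_mod_cast (show (0 : ℝ) < ε from h3).ne'
    have h4 : c + ε * e ≠ c := by simp [h3', he0]
    rw [hH', Function.update_of_ne h4]
    simp only [hH, Function.comp]
    rw [hP, D.cauchyExt_eq ht q h2, add_sub_cancel_left]
    field_simp
  have hεlim : Tendsto (fun ε : ℝ => (ε : ℂ) * e) (𝓝[>] 0) (𝓝 0) := by
    simpa using hxlim.sub_const c
  have hne : ∀ᶠ ε : ℝ in 𝓝[>] 0, (ε : ℂ) * e ≠ 0 := by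
    filter_upwards [self_mem_nhdsWithin] with ε h3
    have h3' : (ε : ℂ) ≠ 0 := by exact_mod_cast (show (0 : ℝ) < ε from h3).ne'
    exact mul_ne_zero h3' he0
  have hH'c : H' c = 0 := by
    refine tendsto_nhds_unique ((hd'.continuousOn.continuousAt hnb).tendsto.comp hxlim) ?_
    have := hHlim.mul hεlim
    rw [zero_mul] at this
    refine this.congr' ?_
    filter_upwards [hne] with ε h
    exact div_mul_cancel₀ _ h
  have hd1 : DifferentiableOn ℂ (dslope H' c) (Metric.ball c r) :=
    (Complex.differentiableOn_dslope hnb).mpr hd'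
  have hH1c : dslope H' c c = 0 := by
    refine tendsto_nhds_unique ((hd1.continuousOn.continuousAt hnb).tendsto.comp hxlim) ?_
    refine hHlim.congr' ?_
    filter_upwards [hne] with ε h
    simp only [Function.comp]
    rw [dslope_of_ne _ (by simpa using h), slope_def_field, hH'c, add_sub_cancel_left, sub_zero]
  have hd2 : DifferentiableOn ℂ (dslope (dslope H' c) c) (Metric.ball c r) :=
    (Complex.differentiableOn_dslope hnb).mpr hd1
  refine ⟨r, hr, fun x => dslope (dslope H' c) c x / p.eval x ^ 2,
    hd2.div (p.differentiable.differentiableOn.pow 2) fun x hx => pow_ne_zero 2 (hball x hx).2, ?_⟩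
  intro x hx hxc
  have hxne : x ≠ c := fun h => hxc (h ▸ hcc)
  have hxs := sub_ne_zero.mpr hxne
  have hpx := (hball x hx).2
  beta_reduce
  rw [dslope_of_ne _ hxne, slope_def_field, hH1c, dslope_of_ne _ hxne, slope_def_field, hH'c, hH',
    Function.update_of_ne hxne]
  simp only [hH]
  rw [D.cauchyExt_eq ht q hxc, hP]
  field_simp
  ring

theorem differentiable_cauchyExt (ht : t ≠ 0) (q : ℂ[X]) : Differentiable ℂ (D.cauchyExt q) := by
  intro x
  by_cases hx : D.curvePoly.eval x = 0
  · have hxc : x ∈ D.cuts := by by_contra h; exact D.eval_curvePoly_ne_zero h hx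
    rw [cuts_eq] at hxc
    obtain ⟨s, -, rfl⟩ := hxc
    obtain ⟨r, hr, h, hd, heq⟩ := D.exists_extension_branchPoint ht q hx
    exact D.differentiableAt_cauchyExt_of_extension hr hd heq
  · exact D.differentiableAt_cauchyExt_of_ne_zero ht q hx

theorem exists_bound_path : ∃ R, ∀ s ∈ D.cutSet, ‖D.path s‖ ≤ R :=
  D.isCompact_cutSet.exists_bound_of_continuousOn D.contDiff_path.continuous.continuousOn

theorem tendsto_mul_integral_div {v : ℝ → ℂ} (hv : Integrable v) (h : ∀ s ∉ D.cutSet, v s = 0) :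
    Tendsto (fun x => x * ∫ s, v s / (D.path s - x)) (cocompact ℂ) (𝓝 (-∫ s, v s)) := by
  obtain ⟨R, hR⟩ := D.exists_bound_path
  exact tendsto_mul_cauchyTransform D.contDiff_path.continuous hv
    fun s hs => hR s (by by_contra h'; exact hs (h s h'))

theorem tendsto_integral_div {v : ℝ → ℂ} (hv : Integrable v) (h : ∀ s ∉ D.cutSet, v s = 0) :
    Tendsto (fun x => ∫ s, v s / (D.path s - x)) (cocompact ℂ) (𝓝 0) := by
  obtain ⟨R, hR⟩ := D.exists_bound_path
  exact tendsto_cauchyTransform D.contDiff_path.continuous hv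
    fun s hs => hR s (by by_contra h'; exact hs (h s h'))

/-- The extended defect is entire and the Cauchy transform vanishes at infinity; subtracting E
leaves an entire function that tends to 0. -/
theorem cauchyDefect_eq (ht : t ≠ 0) {q E : ℂ[X]}
    (h : Tendsto (fun x => q.eval x / D.y₀ x - E.eval x) (cocompact ℂ) (𝓝 0)) {x : ℂ}
    (hx : x ∉ D.cuts) : D.cauchyDefect q x = E.eval x := by
  have h1 : Tendsto (fun x => D.cauchyExt q x - E.eval x) (cocompact ℂ) (𝓝 0) := by
    have h2 := h.sub ((D.tendsto_integral_div (D.integrable_invDensity ht q)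
      (fun s => D.invDensity_eq_zero q)).const_mul (1 / (Real.pi * Complex.I) : ℂ))
    rw [mul_zero, sub_zero] at h2
    refine h2.congr' ?_
    filter_upwards [D.eventually_notMem_cuts] with y hy
    rw [D.cauchyExt_eq ht q hy, cauchyDefect]
    ring
  have h3 := ((D.differentiable_cauchyExt ht q).sub E.differentiable).apply_eq_of_tendsto_cocompact
    x h1
  rw [Pi.sub_apply, D.cauchyExt_eq ht q hx] at h3
  exact sub_eq_zero.mp h3

/-- The Cauchy integral formula for `q / y₀`. -/
theorem eval_div_y₀ (ht : t ≠ 0) {q : ℂ[X]} (hq : q.natDegree ≤ g) {x : ℂ} (hx : x ∉ D.cuts) :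
    q.eval x / D.y₀ x = 1 / (Real.pi * Complex.I) * ∫ s, D.invDensity q s / (D.path s - x) := by
  have h := D.tendsto_eval_div_y₀ q (hq.trans (Nat.le_succ g))
  rw [coeff_eq_zero_of_natDegree_lt (Nat.lt_succ_of_le hq)] at h
  have := D.cauchyDefect_eq ht (q := q) (E := 0) (by simpa using h) hx
  rw [cauchyDefect, eval_zero] at this
  exact sub_eq_zero.mp this

/-- The coefficients of 1/x at infinity in Cauchy's formula are compared: x q/y₀ tends to the
coefficient of x^g in q, and x times the Cauchy transform tends to minus the integral. -/
theorem integral_invDensity (ht : t ≠ 0) {q : ℂ[X]} (hq : q.natDegree ≤ g) :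
    ∫ s, D.invDensity q s = -(Real.pi * Complex.I) * q.coeff g := by
  have h1 := D.tendsto_eval_div_y₀ (X * q) 
    (natDegree_mul_le.trans (by rw [natDegree_X]; omega))
  rw [coeff_X_mul] at h1
  have h2 := (D.tendsto_mul_integral_div (D.integrable_invDensity ht q)
    (fun s => D.invDensity_eq_zero q)).const_mul (1 / (Real.pi * Complex.I) : ℂ)
  have h3 := tendsto_nhds_unique (h2.congr' ?_) h1
  · have hpi : (Real.pi : ℂ) ≠ 0 := by exact_mod_cast Real.pi_ne_zero
    have := Complex.I_ne_zero
    rw [← h3]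
    field_simp
  · filter_upwards [D.eventually_notMem_cuts] with x hx
    rw [eval_mul, eval_X, mul_div_assoc, D.eval_div_y₀ ht hq hx]
    ring

/-- Since P/edge = edge on the cuts and P/y₀ = y₀ off them, Cauchy's formula with q = P becomes a
formula for y₀ with density ρ₀. -/
theorem invDensity_curvePoly (ht : t ≠ 0) (s : ℝ) :
    D.invDensity D.curvePoly s = 2 * Real.pi * Complex.I * t * D.ρ₀ s := by
  have h1 := two_pi_I_mul_ne_zero ht
  rw [D.ρ₀_eq ht]
  by_cases hs : s ∈ D.cutSet
  · rw [invDensity, ← D.edge_sq ht hs]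
    by_cases h0 : D.edge s = 0
    · simp [h0]
    · field_simp
  · rw [D.invDensity_eq_zero _ hs, D.edge_eq_zero hs]; simp

/-- The resolvent is the Cauchy transform of the density. -/
theorem y₀_eq (ht : t ≠ 0) {x : ℂ} (hx : x ∉ D.cuts) :
    D.y₀ x = W.derivative.eval x + 2 * t * ∫ s, D.ρ₀ s / (D.path s - x) := by
  have h1 := D.cauchyDefect_eq ht (q := D.curvePoly) (E := W.derivative) ?_ hx
  · rw [cauchyDefect, ← D.y₀_sq hx, sq, mul_self_div_self] at h1
    simp only [D.invDensity_curvePoly ht, mul_div_assoc] at h1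
    rw [integral_const_mul] at h1
    have hpi : (Real.pi : ℂ) ≠ 0 := by exact_mod_cast Real.pi_ne_zero
    have := Complex.I_ne_zero
    rw [← h1]
    field_simp
    ring
  · refine D.tendsto_y₀_sub.congr' ?_
    filter_upwards [D.eventually_notMem_cuts] with y hy
    rw [← D.y₀_sq hy, sq, mul_self_div_self]

/-- Both sides of `y₀_eq` are compared to order 1/x at infinity, where x (y₀ - W') tends to -2t. -/
theorem integral_ρ₀ (ht : t ≠ 0) : ∫ s, D.ρ₀ s = 1 := by
  have h1 := (D.tendsto_mul_integral_div (D.integrable_ρ₀ ht)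
    (fun s => D.ρ₀_eq_zero)).const_mul (2 * t)
  have h2 := tendsto_nhds_unique (h1.congr' ?_) D.tendsto_mul_y₀_sub
  · have : 2 * t ≠ 0 := mul_ne_zero two_ne_zero ht
    apply mul_left_cancel₀ this
    linear_combination -h2
  · filter_upwards [D.eventually_notMem_cuts] with x hx
    rw [D.y₀_eq ht hx]
    ring

end SpectralCurve

/-! ### Periods on the upper sheet. -/

namespace SpectralCurve

variable {g : ℕ} {W : ℂ[X]} {t : ℂ} (D : SpectralCurve g W t)

theorem integral_eq_sum_cuts {v : ℝ → ℂ} (hv : Integrable v) (h : ∀ s ∉ D.cutSet, v s = 0) :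
    ∫ s, v s = ∑ i, ∫ s in (D.lo i)..(D.hi i), v s := by
  rw [← setIntegral_eq_integral_of_forall_compl_eq_zero (s := D.cutSet) h, cutSet,
    integral_iUnion_fintype (fun _ => measurableSet_Icc) ?_ fun _ => hv.integrableOn]
  · refine Finset.sum_congr rfl fun i _ => ?_
    rw [integral_Icc_eq_integral_Ioc, intervalIntegral.integral_of_le (D.lo_lt_hi i).le]
  · intro i j hij
    exact disjoint_left.mpr fun s hi hj => hij (D.eq_of_mem_Icc_of_mem_Icc hi hj)

/-- Periods on the upper sheet in terms of the density. -/
theorem upperPeriod_eq (ht : t ≠ 0) {J : Finset (Fin (g + 1))} {c : ℝ → ℂ}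
    (hc : D.Encircles J c) : D.upperPeriod c = 4 * Real.pi * Complex.I * ∑ j ∈ J, D.S j := by
  have hdc := hc.contDiff.continuous_deriv le_rfl
  have hcd : ∀ τ, HasDerivAt c (deriv c τ) τ := fun τ =>
    (hc.contDiff.differentiable (by norm_num)).differentiableAt.hasDerivAt
  -- The part W' dx of the one-form is exact and drops out over a closed curve, leaving the Cauchy
  -- transform of ρ₀.
  have hW : ∫ τ in (0 : ℝ)..1, W.derivative.eval (c τ) * deriv c τ = 0 := by
    rw [intervalIntegral.integral_eq_sub_of_hasDerivAt (f := fun τ => W.eval (c τ))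
      (fun τ _ => HasDerivAt.comp_of_eq τ (W.hasDerivAt (c τ)) (hcd τ) rfl)
      (((W.derivative.continuous.comp hc.contDiff.continuous).mul hdc).intervalIntegrable _ _),
      hc.closed, sub_self]
  have hne : ∀ s ∈ D.cutSet, ∀ τ ∈ Icc (0 : ℝ) 1, D.path s - c τ ≠ 0 := fun s hs τ hτ h =>
    hc.avoids τ hτ ((sub_eq_zero.mp h) ▸ D.path_mem_cuts.mpr hs)
  set f : ℝ → ℝ → ℂ := fun τ s => D.ρ₀ s / (D.path s - c τ) * deriv c τ with hf
  have hfc : ContinuousOn (Function.uncurry f) (Icc 0 1 ×ˢ D.cutSet) := by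
    refine ContinuousOn.mul (ContinuousOn.div ?_ ?_ fun p hp => hne _ hp.2 _ hp.1) ?_
    · exact ((D.continuous_ρ₀ ht).comp continuous_snd).continuousOn
    · exact ((D.contDiff_path.continuous.comp continuous_snd).sub
        (hc.contDiff.continuous.comp continuous_fst)).continuousOn
    · exact (hdc.comp continuous_fst).continuousOn
  have hfi : Integrable (Function.uncurry f)
      ((volume.restrict (Ioc 0 1)).prod (volume.restrict D.cutSet)) := by
    rw [Measure.prod_restrict]
    exact (hfc.integrableOn_compact (isCompact_Icc.prod D.isCompact_cutSet)).mono_set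
      (prod_mono Ioc_subset_Icc_self le_rfl)
  have hinner : ∀ x, ∫ s, D.ρ₀ s / (D.path s - x) = ∫ s in D.cutSet, D.ρ₀ s / (D.path s - x) :=
    fun x => (setIntegral_eq_integral_of_forall_compl_eq_zero fun s hs => by
      rw [D.ρ₀_eq_zero hs, zero_div]).symm
  have hstep : D.upperPeriod c = 2 * t * ∫ τ in (0 : ℝ)..1, ∫ s in D.cutSet, f τ s := by
    have hcy : ContinuousOn (fun τ => D.y₀ (c τ)) (uIcc (0 : ℝ) 1) := by
      rw [uIcc_of_le zero_le_one]
      exact fun τ hτ => ((D.differentiableAt_y₀ (hc.avoids τ hτ)).continuousAt.comp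
        (hcd τ).continuousAt).continuousWithinAt
    have i1 : IntervalIntegrable (fun τ => D.y₀ (c τ) * deriv c τ) volume 0 1 :=
      (hcy.mul hdc.continuousOn).intervalIntegrable
    have i2 : IntervalIntegrable (fun τ => W.derivative.eval (c τ) * deriv c τ) volume 0 1 :=
      ((W.derivative.continuous.comp hc.contDiff.continuous).mul hdc).intervalIntegrable _ _
    rw [upperPeriod, zetaIntegral, ← sub_zero (∫ τ in (0 : ℝ)..1, D.y₀ (c τ) * deriv c τ), ← hW,
      ← intervalIntegral.integral_sub i1 i2, ← intervalIntegral.integral_const_mul]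
    refine intervalIntegral.integral_congr fun τ hτ => ?_
    rw [uIcc_of_le zero_le_one] at hτ
    simp only [hf]
    rw [D.y₀_eq ht (hc.avoids τ hτ), hinner, integral_mul_const]
    ring
  rw [hstep, intervalIntegral.integral_of_le zero_le_one, integral_integral_swap hfi]
  -- After Fubini the inner integral is a winding number. Its value -1 for clockwise curves cancels
  -- the sign that comes from writing the kernel as 1/(λ - x).
  have hwind : ∀ s, ∫ τ in Ioc (0 : ℝ) 1, f τ s =
      -(2 * Real.pi * Complex.I) * (windingNumber c (D.path s) * D.ρ₀ s) := by
    intro s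
    have hpi : (Real.pi : ℂ) ≠ 0 := by exact_mod_cast Real.pi_ne_zero
    have := Complex.I_ne_zero
    rw [← intervalIntegral.integral_of_le zero_le_one, windingNumber]
    have : ∀ τ, f τ s = -D.ρ₀ s * (deriv c τ / (c τ - D.path s)) := fun τ => by
      simp only [hf]
      rw [← neg_sub (c τ), div_neg]
      ring
    simp only [this]
    rw [intervalIntegral.integral_const_mul]
    field_simp
  simp only [hwind]
  rw [integral_const_mul, cutSet, integral_iUnion_fintype (fun _ => measurableSet_Icc)]
  · have hj : ∀ j, ∫ s in Icc (D.lo j) (D.hi j), windingNumber c (D.path s) * D.ρ₀ s =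
        if j ∈ J then -∫ s in (D.lo j)..(D.hi j), D.ρ₀ s else 0 := by
      intro j
      have hmem : ∀ s ∈ Icc (D.lo j) (D.hi j), D.path s ∈ D.cut j := fun s hs => ⟨s, hs, rfl⟩
      split_ifs with h
      · rw [intervalIntegral.integral_of_le (D.lo_lt_hi j).le, ← integral_Icc_eq_integral_Ioc,
          ← integral_neg]
        refine setIntegral_congr_fun measurableSet_Icc fun s hs => ?_
        rw [hc.winding_inside j (by exact_mod_cast h) _ (hmem s hs), neg_one_mul]
      · rw [← integral_zero ℝ ℂ (μ := volume.restrict (Icc (D.lo j) (D.hi j)))]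
        refine setIntegral_congr_fun measurableSet_Icc fun s hs => ?_
        rw [hc.winding_outside j (by exact_mod_cast h) _ (hmem s hs), zero_mul]
    simp only [hj]
    rw [Finset.sum_ite_mem, Finset.univ_inter]
    simp only [S]
    rw [Finset.sum_neg_distrib, ← Finset.mul_sum]
    ring
  · intro i j hij
    exact disjoint_left.mpr fun s hi hj => hij (D.eq_of_mem_Icc_of_mem_Icc hi hj)
  · intro j
    have h1 : IntegrableOn (fun s => ∫ τ in Ioc (0 : ℝ) 1, f τ s) (Icc (D.lo j) (D.hi j)) :=
      IntegrableOn.mono_set hfi.integral_prod_right (subset_iUnion_of_subset j le_rfl)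
    simp only [hwind] at h1
    have h2 := h1.const_mul (-(2 * Real.pi * Complex.I))⁻¹
    refine h2.congr (Eventually.of_forall fun s => ?_)
    have hpi : (Real.pi : ℂ) ≠ 0 := by exact_mod_cast Real.pi_ne_zero
    have := Complex.I_ne_zero
    field_simp

theorem S_eq_upperPeriod (ht : t ≠ 0) {j : Fin (g + 1)} {c : ℝ → ℂ} (hc : D.IsACycle j c) :
    D.S j = (1 / (4 * Real.pi * Complex.I)) * D.upperPeriod c := by
  have h : D.Encircles ((({j} : Finset (Fin (g + 1))) : Set (Fin (g + 1)))) c := by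
    rw [Finset.coe_singleton]; exact hc
  have hpi : (Real.pi : ℂ) ≠ 0 := by exact_mod_cast Real.pi_ne_zero
  have := Complex.I_ne_zero
  rw [D.upperPeriod_eq ht h, Finset.sum_singleton]
  field_simp

theorem tildeS_eq_upperPeriod (ht : t ≠ 0) {i : Fin g} {c : ℝ → ℂ} (hc : D.IsαCycle i c) :
    D.tildeS i = (1 / (4 * Real.pi * Complex.I)) * D.upperPeriod c := by
  have h : D.Encircles ((Finset.Iic i.castSucc : Finset (Fin (g + 1))) : Set (Fin (g + 1))) c := by
    rw [Finset.coe_Iic]; exact hc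
  have hpi : (Real.pi : ℂ) ≠ 0 := by exact_mod_cast Real.pi_ne_zero
  have := Complex.I_ne_zero
  rw [D.upperPeriod_eq ht h, tildeS]
  field_simp

end SpectralCurve

/-! ### Continuous logarithms and the logarithmic transform near the path. -/

theorem eq_of_exp_eq {X : Type*} [TopologicalSpace X] {S : Set X} (hS : IsPreconnected S)
    {f : X → ℂ} (hf : ContinuousOn f S) (h : ∀ x ∈ S, ∀ y ∈ S, Complex.exp (f x) = Complex.exp (f y))
    {x y : X} (hx : x ∈ S) (hy : y ∈ S) : f x = f y := by
  have key : ∀ z ∈ S, ∃ n : ℤ, f z = f y + n * (2 * Real.pi * Complex.I) := fun z hz =>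
    Complex.exp_eq_exp_iff_exists_int.mp (h z hz y hy)
  have him : (f x - f y).im = (f y - f y).im := by
    refine hS.constant_of_mapsTo (T := (AddSubgroup.zmultiples (2 * Real.pi) : Set ℝ))
      (f := fun z => (f z - f y).im)
      ⟨inferInstanceAs (DiscreteTopology (AddSubgroup.zmultiples (2 * Real.pi)))⟩
      (Complex.continuous_im.comp_continuousOn (hf.sub continuousOn_const)) ?_ hx hy
    intro z hz
    obtain ⟨n, hn⟩ := key z hz
    refine AddSubgroup.mem_zmultiples_iff.mpr ⟨n, ?_⟩
    simp only
    rw [hn, add_sub_cancel_left]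
    simp
  obtain ⟨n, hn⟩ := key x hx
  rw [hn] at him ⊢
  simp only [add_sub_cancel_left, sub_self, Complex.zero_im] at him
  have h2 : (n : ℝ) * (2 * Real.pi) = 0 := by simpa using him
  have h3 : (n : ℝ) = 0 := by
    rcases mul_eq_zero.mp h2 with h | h
    · exact h
    · exact absurd h (by positivity)
  have h4 : n = 0 := by exact_mod_cast h3
  simp [h4]

theorem eventually_eq_add_log {X : Type*} [TopologicalSpace X] {f : X → ℂ} {x₀ : X}
    (hf : ContinuousAt f x₀) :
    ∀ᶠ x in 𝓝 x₀, f x = f x₀ + Complex.log (Complex.exp (f x) / Complex.exp (f x₀)) := by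
  have h1 : ∀ᶠ x in 𝓝 x₀, ‖f x - f x₀‖ < 1 := by
    have : ContinuousAt (fun x => ‖f x - f x₀‖) x₀ := (hf.sub continuousAt_const).norm
    exact this.eventually (gt_mem_nhds (by simp))
  filter_upwards [h1] with x hx
  have h2 := abs_lt.mp ((Complex.abs_im_le_norm _).trans_lt hx)
  have h3 := Real.pi_gt_three
  rw [← Complex.exp_sub, Complex.log_exp (by linarith) (by linarith), add_sub_cancel]

/-- A continuous logarithm of a differentiable function is differentiable. -/
theorem hasDerivAt_of_exp {f g : ℂ → ℂ} {z₀ g' : ℂ} (hf : ContinuousAt f z₀)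
    (hg : HasDerivAt g g' z₀) (h : ∀ᶠ z in 𝓝 z₀, Complex.exp (f z) = g z) :
    HasDerivAt f (g' / g z₀) z₀ := by
  have h0 := h.self_of_nhds
  have hne : g z₀ ≠ 0 := h0 ▸ Complex.exp_ne_zero _
  have h1 : HasDerivAt (fun z => f z₀ + Complex.log (g z / g z₀)) (g' / g z₀) z₀ := by
    refine (((hg.div_const (g z₀)).clog ?_).const_add _).congr_deriv ?_
    · rw [div_self hne]; exact Complex.one_mem_slitPlane
    · rw [div_self hne, div_one]
  refine h1.congr_of_eventuallyEq ?_
  filter_upwards [h, eventually_eq_add_log hf] with z hz hz'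
  rw [hz, h0] at hz'
  exact hz'

theorem hasDerivAt_of_exp_real {f g : ℝ → ℂ} {s₀ : ℝ} {g' : ℂ} (hf : ContinuousAt f s₀)
    (hg : HasDerivAt g g' s₀) (h : ∀ᶠ z in 𝓝 s₀, Complex.exp (f z) = g z) :
    HasDerivAt f (g' / g s₀) s₀ := by
  have h0 := h.self_of_nhds
  have hne : g s₀ ≠ 0 := h0 ▸ Complex.exp_ne_zero _
  have h1 : HasDerivAt (fun z => f s₀ + Complex.log (g z / g s₀)) (g' / g s₀) s₀ := by
    refine (((hg.div_const (g s₀)).clog_real ?_).const_add _).congr_deriv ?_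
    · rw [div_self hne]; exact Complex.one_mem_slitPlane
    · rw [div_self hne, div_one]
  refine h1.congr_of_eventuallyEq ?_
  filter_upwards [h, eventually_eq_add_log hf] with z hz hz'
  rw [hz, h0] at hz'
  exact hz'

theorem norm_log_le (w : ℂ) : ‖Complex.log w‖ ≤ |Real.log ‖w‖| + Real.pi := by
  refine (Complex.norm_le_abs_re_add_abs_im _).trans ?_
  rw [Complex.log_re, Complex.log_im]
  exact add_le_add le_rfl (Complex.abs_arg_le_pi w)

theorem abs_log_le_of_le {y d c C : ℝ} (hd : 0 < d) (hc : 0 < c) (h1 : c * d ≤ y) (h2 : y ≤ C) :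
    |Real.log y| ≤ |Real.log C| + |Real.log c| + |Real.log d| := by
  have hy : 0 < y := lt_of_lt_of_le (mul_pos hc hd) h1
  have h3 := Real.log_le_log (mul_pos hc hd) h1
  have h4 := Real.log_le_log hy h2
  rw [Real.log_mul hc.ne' hd.ne'] at h3
  rw [abs_le]
  constructor
  · linarith [neg_abs_le (Real.log c), neg_abs_le (Real.log d), abs_nonneg (Real.log C)]
  · linarith [le_abs_self (Real.log C), abs_nonneg (Real.log c), abs_nonneg (Real.log d)]

theorem eventually_norm_arcLog_le {γ : ℝ → ℂ} (hγ : ContDiff ℝ 1 γ) {a b : ℝ} {x₀ : ℂ}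
    (hx : ∀ s ∈ Icc a b, γ s ≠ x₀) : ∃ C, ∀ᶠ x in 𝓝 x₀, (∀ s ∈ Icc a b, γ s ≠ x) ∧
      ∀ u ∈ Icc a b, ∀ w ∈ Icc a b, ‖arcLog γ u w x‖ ≤ C := by
  have hK : IsClosed (γ '' Icc a b) := (isCompact_Icc.image hγ.continuous).isClosed
  obtain ⟨r, hr, hball⟩ := Metric.isOpen_iff.mp hK.isOpen_compl x₀
    (by rintro ⟨s, hs, h⟩; exact hx s hs h)
  obtain ⟨M, hM⟩ := (isCompact_Icc (a := a) (b := b)).exists_bound_of_continuousOn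
    (hγ.continuous_deriv le_rfl).continuousOn
  refine ⟨|M| / (r / 2) * |b - a|, ?_⟩
  filter_upwards [Metric.ball_mem_nhds x₀ (half_pos hr)] with x hxb
  have hfar : ∀ s ∈ Icc a b, r / 2 ≤ ‖γ s - x‖ := by
    intro s hs
    by_contra h
    push Not at h
    refine hball (a := γ s) ?_ ⟨s, hs, rfl⟩
    rw [Metric.mem_ball, dist_eq_norm] at hxb ⊢
    have := norm_sub_le_norm_sub_add_norm_sub (γ s) x x₀
    linarith
  refine ⟨fun s hs h => ?_, fun u hu w hw => ?_⟩
  · have := hfar s hs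
    rw [h, sub_self, norm_zero] at this
    linarith
  · refine (intervalIntegral.norm_integral_le_of_norm_le_const (C := |M| / (r / 2))
      fun s hs => ?_).trans ?_
    · have hs' : s ∈ Icc a b := uIcc_subset_Icc hu hw (uIoc_subset_uIcc hs)
      rw [norm_div]
      exact div_le_div₀ (abs_nonneg _) ((hM s hs').trans (le_abs_self M)) (half_pos hr) (hfar s hs')
    · refine mul_le_mul_of_nonneg_left ?_ (by positivity)
      rw [abs_sub_comm, abs_sub_comm b a, abs_le]
      have := le_abs_self (a - b)
      have := neg_abs_le (a - b)
      constructor <;> linarith [hu.1, hu.2, hw.1, hw.2]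

theorem continuousAt_arcLog {γ : ℝ → ℂ} (hγ : ContDiff ℝ 1 γ) {a b : ℝ} {x₀ : ℂ} (hab : a ≤ b)
    (hx : ∀ s ∈ Icc a b, γ s ≠ x₀) : ContinuousAt (arcLog γ a b) x₀ :=
  (hasDerivAt_arcLog hγ hab hx).continuousAt

/-- `ℓ s s'` is a continuous branch of `ln(γ(s) - γ(s'))` for `s' < s`. -/
structure IsLog (γ : ℝ → ℂ) (ℓ : ℝ → ℝ → ℂ) : Prop where
  continuousOn : ContinuousOn (fun p : ℝ × ℝ => ℓ p.1 p.2) {p | p.2 < p.1}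
  exp_eq : ∀ s s', s' < s → Complex.exp (ℓ s s') = γ s - γ s'

theorem principalLog_of_lt (ℓ : ℝ → ℝ → ℂ) {s s' : ℝ} (h : s' < s) :
    SpectralCurve.principalLog ℓ s s' = ℓ s s' := if_pos h

/-- The terms ±iπ cancel in the mean, so the principal value is symmetric in its arguments; this
makes the logarithmic energy a symmetric form. -/
theorem principalLog_of_le (ℓ : ℝ → ℝ → ℂ) {s s' : ℝ} (h : s ≤ s') :
    SpectralCurve.principalLog ℓ s s' = ℓ s' s := by
  rw [SpectralCurve.principalLog, if_neg h.not_gt]; ring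

theorem principalLog_comm (ℓ : ℝ → ℝ → ℂ) (s s' : ℝ) :
    SpectralCurve.principalLog ℓ s s' = SpectralCurve.principalLog ℓ s' s := by
  rcases lt_or_ge s' s with h | h
  · rw [principalLog_of_lt ℓ h, principalLog_of_le ℓ h.le]
  · rcases h.eq_or_lt with rfl | h
    · rfl
    · rw [principalLog_of_lt ℓ h, principalLog_of_le ℓ h.le]

section IsLog

variable {γ : ℝ → ℂ} {ℓ : ℝ → ℝ → ℂ}

theorem IsLog.continuousAt (h : IsLog γ ℓ) {s s' : ℝ} (hs : s' < s) :
    ContinuousAt (fun p : ℝ × ℝ => ℓ p.1 p.2) (s, s') :=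
  h.continuousOn.continuousAt ((isOpen_lt continuous_snd continuous_fst).mem_nhds hs)

theorem IsLog.continuousAt_left (h : IsLog γ ℓ) {s s' : ℝ} (hs : s' < s) :
    ContinuousAt (fun s => ℓ s s') s :=
  ContinuousAt.comp (f := fun s => (s, s')) (h.continuousAt hs) (by fun_prop)

theorem IsLog.continuousAt_right (h : IsLog γ ℓ) {s s' : ℝ} (hs : s' < s) :
    ContinuousAt (fun s' => ℓ s s') s' :=
  ContinuousAt.comp (f := fun s' => (s, s')) (h.continuousAt hs) (by fun_prop)

theorem IsLog.hasDerivAt (h : IsLog γ ℓ) (hγ : ContDiff ℝ 1 γ) {s s' : ℝ} (hs : s' < s) :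
    HasDerivAt (fun s => ℓ s s') (deriv γ s / (γ s - γ s')) s := by
  refine hasDerivAt_of_exp_real (g := fun s => γ s - γ s') (h.continuousAt_left hs)
    ((hγ.differentiable (by norm_num)).differentiableAt.hasDerivAt.sub_const _) ?_
  filter_upwards [lt_mem_nhds hs] with τ hτ
  exact h.exp_eq _ _ hτ

/-- The kernel needs a logarithm of λ(τ) - λ(s), whereas ℓ is one of λ(s) - λ(τ); the constant πi
accounts for the sign and cancels in the difference. -/
theorem IsLog.arcLog_before (h : IsLog γ ℓ) (hγ : ContDiff ℝ 1 γ) {p s s' : ℝ} (hp : p ≤ s')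
    (hs : s' < s) : arcLog γ p s' (γ s) = ℓ s s' - ℓ s p := by
  rw [arcLog_eq_sub_of_branch hγ hp (L := fun τ => ℓ s τ + Real.pi * Complex.I)]
  · ring
  · exact fun τ hτ => ((h.continuousAt_right (hτ.2.trans_lt hs)).add
      continuousAt_const).continuousWithinAt
  · intro τ hτ
    rw [Complex.exp_add, h.exp_eq _ _ (hτ.2.trans_lt hs), Complex.exp_pi_mul_I]
    ring

theorem IsLog.arcLog_after (h : IsLog γ ℓ) (hγ : ContDiff ℝ 1 γ) {b s s' : ℝ} (hs : s < b)
    (hb : b ≤ s') : arcLog γ b s' (γ s) = ℓ s' s - ℓ b s :=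
  arcLog_eq_sub_of_branch hγ hb
    (fun _ hτ => (h.continuousAt_left (hs.trans_le hτ.1)).continuousWithinAt)
    fun _ hτ => h.exp_eq _ _ (hs.trans_le hτ.1)

theorem isPreconnected_triangle (a b : ℝ) :
    IsPreconnected {p : ℝ × ℝ | a ≤ p.2 ∧ p.2 < p.1 ∧ p.1 ≤ b} := by
  refine Convex.isPreconnected ?_
  rintro ⟨s, s'⟩ ⟨h1, h2, h3⟩ ⟨u, u'⟩ ⟨h4, h5, h6⟩ x y hx hy hxy
  simp only [mem_ofPred_eq, Prod.fst_add, Prod.snd_add, Prod.smul_fst, Prod.smul_snd,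
    smul_eq_mul] at *
  obtain rfl : x = 1 - y := by linarith
  refine ⟨by nlinarith, ?_, by nlinarith⟩
  rcases hx.eq_or_lt with h | hx'
  · have : y = 1 := by linarith
    subst this; linarith
  · nlinarith [mul_le_mul_of_nonneg_left h5.le hy, mul_lt_mul_of_pos_left h2 hx']

theorem sub_div_re_pos (hγ : ContDiff ℝ 1 γ) {a b : ℝ} {e : ℂ}
    (he : ∀ s ∈ Icc a b, 0 < (deriv γ s / e).re) {s s' : ℝ} (h1 : a ≤ s') (h2 : s' < s)
    (h3 : s ≤ b) : 0 < ((γ s - γ s') / e).re := by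
  have := strictMonoOn_re hγ he ⟨h1, h2.le.trans h3⟩ ⟨h1.trans h2.le, h3⟩ h2
  rw [sub_div, Complex.sub_re]
  exact sub_pos.mpr this

/-- Near the diagonal the branch differs from the principal branch by a constant. -/
theorem IsLog.sub_log_eq (h : IsLog γ ℓ) (hγ : ContDiff ℝ 1 γ) {a b : ℝ} {e : ℂ} (he0 : e ≠ 0)
    (he : ∀ s ∈ Icc a b, 0 < (deriv γ s / e).re) {s s' u u' : ℝ} (h1 : a ≤ s') (h2 : s' < s)
    (h3 : s ≤ b) (h1' : a ≤ u') (h2' : u' < u) (h3' : u ≤ b) :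
    ℓ s s' - Complex.log ((γ s - γ s') / e) = ℓ u u' - Complex.log ((γ u - γ u') / e) := by
  refine eq_of_exp_eq (X := ℝ × ℝ) (isPreconnected_triangle a b)
    (f := fun p => ℓ p.1 p.2 - Complex.log ((γ p.1 - γ p.2) / e)) (x := (s, s')) (y := (u, u'))
    ?_ ?_ ⟨h1, h2, h3⟩ ⟨h1', h2', h3'⟩
  · refine (h.continuousOn.mono fun p hp => hp.2.1).sub (ContinuousOn.clog ?_ ?_)
    · exact (((hγ.continuous.comp continuous_fst).sub
        (hγ.continuous.comp continuous_snd)).div_const e).continuousOn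
    · exact fun p hp => Complex.mem_slitPlane_iff.mpr
        (Or.inl (sub_div_re_pos hγ he hp.1 hp.2.1 hp.2.2))
  · have key : ∀ p ∈ {p : ℝ × ℝ | a ≤ p.2 ∧ p.2 < p.1 ∧ p.1 ≤ b},
        Complex.exp (ℓ p.1 p.2 - Complex.log ((γ p.1 - γ p.2) / e)) = e := by
      intro p hp
      have h4 := sub_div_re_pos hγ he hp.1 hp.2.1 hp.2.2
      have h5 : (γ p.1 - γ p.2) / e ≠ 0 := fun h => by simp [h] at h4
      have h6 : γ p.1 - γ p.2 ≠ 0 := fun h => h5 (by simp [h])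
      rw [Complex.exp_sub, Complex.exp_log h5, h.exp_eq _ _ hp.2.1]
      field_simp
    intro p hp p' hp'
    rw [key p hp, key p' hp']

theorem exists_mul_le_re (hγ : ContDiff ℝ 1 γ) {a b : ℝ} (hab : a ≤ b) {e : ℂ}
    (he : ∀ s ∈ Icc a b, 0 < (deriv γ s / e).re) :
    ∃ κ > 0, ∀ s ∈ Icc a b, ∀ s' ∈ Icc a b, κ * |s - s'| ≤ |((γ s - γ s') / e).re| := by
  obtain ⟨m, hm, hmin⟩ := isCompact_Icc.exists_isMinOn (nonempty_Icc.mpr hab)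
    (f := fun s => (deriv γ s / e).re)
    (Complex.continuous_re.comp ((hγ.continuous_deriv le_rfl).div_const e)).continuousOn
  set κ := (deriv γ m / e).re with hκ
  have hd : ∀ s, HasDerivAt (fun s => (γ s / e).re - κ * s) ((deriv γ s / e).re - κ) s := by
    intro s
    have h1 := ((hγ.differentiable (by norm_num)).differentiableAt (x := s)).hasDerivAt
    have h2 := (Complex.reCLM.hasFDerivAt (x := γ s / e)).comp_hasDerivAt s (h1.div_const e)
    have h3 := h2.sub ((hasDerivAt_id s).const_mul κ)
    rw [mul_one] at h3
    exact h3
  have hmono : MonotoneOn (fun s => (γ s / e).re - κ * s) (Icc a b) := by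
    refine monotoneOn_of_deriv_nonneg (convex_Icc a b)
      (fun s _ => (hd s).continuousAt.continuousWithinAt)
      (fun s _ => (hd s).differentiableAt.differentiableWithinAt) fun s hs => ?_
    rw [interior_Icc] at hs
    rw [(hd s).deriv]
    exact sub_nonneg.mpr (hmin (Ioo_subset_Icc_self hs))
  have key : ∀ s ∈ Icc a b, ∀ s' ∈ Icc a b, s' ≤ s → κ * |s - s'| ≤ |((γ s - γ s') / e).re| := by
    intro s hs s' hs' h
    have := hmono hs' hs h
    simp only at this
    rw [abs_of_nonneg (sub_nonneg.mpr h), sub_div, Complex.sub_re]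
    exact le_trans (by linarith) (le_abs_self _)
  refine ⟨κ, he m hm, fun s hs s' hs' => ?_⟩
  rcases le_total s' s with h | h
  · exact key s hs s' hs' h
  · have := key s' hs' s hs h
    rwa [abs_sub_comm, ← neg_sub (γ s), neg_div, Complex.neg_re, abs_neg] at this

/-- The logarithmic transform of the density `v` along the path. -/
def logTransform (γ : ℝ → ℂ) (p : ℝ) (v : ℝ → ℂ) (x : ℂ) : ℂ := ∫ s, arcLog γ p s x * v s

/-- The logarithmic potential of the density `v` on the path. -/
def logPotential (ℓ : ℝ → ℝ → ℂ) (v : ℝ → ℂ) (s : ℝ) : ℂ :=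
  ∫ s', SpectralCurve.principalLog ℓ s s' * v s'

theorem intervalIntegrable_log_abs (s a b : ℝ) :
    IntervalIntegrable (fun s' => |Real.log (|s' - s|)|) volume a b := by
  have h := (intervalIntegral.intervalIntegrable_log' (a := a - s) (b := b - s)).comp_sub_right s
  simp only [sub_add_cancel] at h
  simpa [Real.log_abs] using h.abs

end IsLog

section LogTransform

variable {γ : ℝ → ℂ} {ℓ : ℝ → ℝ → ℂ}

theorem aestronglyMeasurable_logTransform (hγ : ContDiff ℝ 1 γ) {p q : ℝ} {v : ℝ → ℂ}
    (hv : AEStronglyMeasurable v) (hsupp : ∀ τ ∉ Icc p q, v τ = 0) {x : ℂ}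
    (hx : ∀ τ ∈ Icc p q, γ τ ≠ x) : AEStronglyMeasurable (fun τ => arcLog γ p τ x * v τ) := by
  have hc : ContinuousOn (fun τ => arcLog γ p τ x) (Icc p q) := by
    rcases le_total p q with hpq | hpq
    · have h1 := continuousOn_arcLog_integrand (a := p) (b := q) hγ (x := x)
        (by rwa [uIcc_of_le hpq])
      have := intervalIntegral.continuousOn_primitive_interval (μ := volume)
        (h1.integrableOn_compact isCompact_uIcc)
      rwa [uIcc_of_le hpq] at this
    · exact ((subsingleton_Icc_of_ge hpq).continuousOn _)
  have h2 : AEStronglyMeasurable (fun τ => arcLog γ p τ x * v τ) (volume.restrict (Icc p q)) :=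
    (hc.aestronglyMeasurable measurableSet_Icc).mul hv.restrict
  refine ((aestronglyMeasurable_indicator_iff measurableSet_Icc).mpr h2).congr
    (Eventually.of_forall fun τ => ?_)
  by_cases hτ : τ ∈ Icc p q
  · exact indicator_of_mem hτ _
  · rw [indicator_of_notMem hτ]
    simp [hsupp τ hτ]

theorem exists_seq_of_eventually {l : Filter ℝ} [l.IsCountablyGenerated] [l.NeBot]
    {P : ℝ → Prop} (h : ∀ᶠ x in l, P x) : ∃ u : ℕ → ℝ, Tendsto u atTop l ∧ ∀ n, P (u n) := by
  obtain ⟨u, hu⟩ := exists_seq_tendsto l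
  obtain ⟨N, hN⟩ := eventually_atTop.mp (hu.eventually h)
  exact ⟨fun n => u (n + N), hu.comp (tendsto_add_atTop_nat N), fun n => hN _ (Nat.le_add_left _ _)⟩

/-- This treats both sides at once: `hside` supplies the constant σ, equal to πi on the left and -πi
on the right, which is picked up by exactly those τ that lie beyond s. Outside [a, b] the arc
integrals are continuous at γ(s); inside they are dominated by log|τ - s| uniformly in ε, and
dominated convergence applies. -/
theorem tendsto_logTransform_aux (hγ : ContDiff ℝ 1 γ) (hinj : Function.Injective γ)
    (hℓ : IsLog γ ℓ) {p q a b s : ℝ} {e : ℂ} (hpa : p ≤ a) (hs : s ∈ Ioo a b) (hbq : b ≤ q)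
    (he0 : e ≠ 0) (he : ∀ τ ∈ Icc a b, 0 < (deriv γ τ / e).re) {v : ℝ → ℂ} (hv : Integrable v)
    (hsupp : ∀ τ ∉ Icc p q, v τ = 0) {M : ℝ} (hM : ∀ τ ∈ Icc a b, ‖v τ‖ ≤ M) {l : Filter ℝ}
    [l.IsCountablyGenerated] [l.NeBot] (hl : l ≤ 𝓝 0) {σ : ℂ}
    (hside : ∀ᶠ ε : ℝ in l, ε ≠ 0 ∧ ∀ b' ∈ Ioc s b, arcLog γ a b' (γ s + Complex.I * ε * e) =
      Complex.log ((γ b' - (γ s + Complex.I * ε * e)) / e) -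
        Complex.log ((γ s + Complex.I * ε * e - γ a) / e) + σ) :
    Tendsto (fun ε : ℝ => logTransform γ p v (γ s + Complex.I * ε * e)) l
      (𝓝 (logPotential ℓ v s - (∫ τ, v τ) * ℓ s p + σ * ∫ τ in Ioi s, v τ)) := by
  have hab : a ≤ b := (hs.1.trans hs.2).le
  have hsab := Ioo_subset_Icc_self hs
  set X : ℝ → ℂ := fun ε => γ s + Complex.I * ε * e with hX
  have hXlim : Tendsto X l (𝓝 (γ s)) := by
    have : Continuous X := by fun_prop
    simpa [hX] using (this.tendsto 0).mono_left hl
  have hbefore : ∀ τ ∈ Icc p a, γ τ ≠ γ s := fun τ hτ h => by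
    have := hinj h
    linarith [hτ.2, hs.1]
  have hafter : ∀ τ ∈ Icc b q, γ τ ≠ γ s := fun τ hτ h => by
    have := hinj h
    linarith [hτ.1, hs.2]
  obtain ⟨C₁, h1⟩ := eventually_norm_arcLog_le hγ hbefore
  obtain ⟨C₂, h2⟩ := eventually_norm_arcLog_le hγ hafter
  obtain ⟨κ, hκ, hlow⟩ := exists_mul_le_re hγ hab he
  obtain ⟨R, hR⟩ := (isCompact_Icc (a := a) (b := b)).exists_bound_of_continuousOn
    hγ.continuous.continuousOn
  have hen : 0 < ‖e‖ := norm_pos_iff.mpr he0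
  have h3 : ∀ᶠ ε in l, ‖X ε‖ < ‖γ s‖ + 1 :=
    hXlim.norm.eventually (gt_mem_nhds (lt_add_one _))
  have hXre : ∀ ε τ, ((γ τ - X ε) / e).re = ((γ τ - γ s) / e).re := by
    intro ε τ
    have : (γ τ - X ε) / e = (γ τ - γ s) / e - Complex.I * ε := by
      rw [hX]; field_simp; ring
    rw [this]; simp
  -- The displacement I ε e does not change the component along e, so the lower bound for the
  -- distance is uniform in ε.
  have hXlow : ∀ ε, ∀ τ ∈ Icc a b, κ * ‖e‖ * |τ - s| ≤ ‖γ τ - X ε‖ := by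
    intro ε τ hτ
    have h5 := (hlow τ hτ s hsab).trans (hXre ε τ ▸ Complex.abs_re_le_norm ((γ τ - X ε) / e))
    rw [norm_div, le_div_iff₀ hen] at h5
    linarith
  set L := |Real.log (R + (‖γ s‖ + 1))| + |Real.log (κ * ‖e‖)| with hL
  have hlogb : ∀ ε, ‖X ε‖ < ‖γ s‖ + 1 → ∀ τ ∈ Icc a b, τ ≠ s →
      |Real.log ‖γ τ - X ε‖| ≤ L + |Real.log (|τ - s|)| := by
    intro ε hε τ hτ hτs
    refine abs_log_le_of_le (abs_pos.mpr (sub_ne_zero.mpr hτs)) (by positivity)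
      (hXlow ε τ hτ) ?_
    exact (norm_sub_le _ _).trans (add_le_add (hR τ hτ) hε.le)
  have hXoff : ∀ ε : ℝ, ε ≠ 0 → ∀ τ ∈ Icc a b, γ τ ≠ X ε := by
    intro ε hε τ hτ h
    by_cases hτs : τ = s
    · rw [hX, hτs] at h
      have h7 : Complex.I * ε * e = 0 := by simpa using h.symm
      simp [hε, he0] at h7
    · have h6 := hXlow ε τ hτ
      rw [h, sub_self, norm_zero] at h6
      have : 0 < |τ - s| := abs_pos.mpr (sub_ne_zero.mpr hτs)
      have : 0 < κ * ‖e‖ * |τ - s| := by positivity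
      linarith
  -- splitting the arc
  have hsplit1 : ∀ ε : ℝ, ε ≠ 0 → (∀ τ ∈ Icc p a, γ τ ≠ X ε) → ∀ τ ∈ Icc a b,
      arcLog γ p τ (X ε) = arcLog γ p a (X ε) + arcLog γ a τ (X ε) := by
    intro ε hε h τ hτ
    refine (arcLog_add hγ ?_ ?_).symm
    · rwa [uIcc_of_le hpa]
    · rw [uIcc_of_le hτ.1]
      exact fun u hu => hXoff ε hε u ⟨hu.1, hu.2.trans hτ.2⟩
  have hsplit2 : ∀ ε : ℝ, ε ≠ 0 → (∀ τ ∈ Icc p a, γ τ ≠ X ε) → (∀ τ ∈ Icc b q, γ τ ≠ X ε) →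
      ∀ τ ∈ Icc b q, arcLog γ p τ (X ε) =
        arcLog γ p a (X ε) + arcLog γ a b (X ε) + arcLog γ b τ (X ε) := by
    intro ε hε h h' τ hτ
    rw [← hsplit1 ε hε h b ⟨hab, le_rfl⟩]
    refine (arcLog_add hγ ?_ ?_).symm
    · rw [uIcc_of_le (hpa.trans hab)]
      intro u hu
      rcases le_total u a with h8 | h8
      · exact h u ⟨hu.1, h8⟩
      · exact hXoff ε hε u ⟨h8, hu.2⟩
    · rw [uIcc_of_le hτ.1]
      exact fun u hu => h' u ⟨hu.1, hu.2.trans hτ.2⟩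
  set A := L + (|Real.log (|a - s|)|) + L + 2 * Real.pi with hA
  have hmid : ∀ ε : ℝ, ε ≠ 0 → ‖X ε‖ < ‖γ s‖ + 1 → ∀ τ ∈ Icc a b, τ ≠ s →
      ‖arcLog γ a τ (X ε)‖ ≤ A + |Real.log (|τ - s|)| := by
    intro ε hε hε' τ hτ hτs
    have h9 := norm_arcLog_le hγ hτ.1 he0 (fun u hu => he u ⟨hu.1, hu.2.trans hτ.2⟩)
      (fun u hu => hXoff ε hε u ⟨hu.1, hu.2.trans hτ.2⟩)
    have h10 := hlogb ε hε' τ hτ hτs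
    have h11 := hlogb ε hε' a ⟨le_rfl, hab⟩ hs.1.ne
    linarith
  set B := |C₁| + |A| + |Real.log (|b - s|)| + |C₂| with hB
  -- The logarithmic singularity is needed only on [a, b], where v is bounded by M; elsewhere a
  -- constant times |v| suffices, so v may be unbounded near branch points.
  set bound : ℝ → ℝ := fun τ => B * ‖v τ‖ +
    indicator (Icc a b) (fun τ => |M| * |Real.log (|τ - s|)|) τ with hbound
  have hboundi : Integrable bound := by
    refine (hv.norm.const_mul B).add ?_
    rw [integrable_indicator_iff measurableSet_Icc]
    have := (intervalIntegrable_log_abs s a b).const_mul |M|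
    rwa [intervalIntegrable_iff_integrableOn_Icc_of_le hab] at this
  have hsae : ∀ᵐ τ : ℝ, τ ≠ s := compl_mem_ae_iff.mpr (measure_singleton s)
  -- the limit
  set lim : ℝ → ℂ := fun τ => (SpectralCurve.principalLog ℓ s τ - ℓ s p +
    indicator (Ioi s) (fun _ => σ) τ) * v τ with hlim
  have hmeas : ∀ᶠ ε in l, AEStronglyMeasurable (fun τ => arcLog γ p τ (X ε) * v τ) := by
    filter_upwards [hXlim.eventually h1, hXlim.eventually h2, hside] with ε e1 e2 e3
    refine aestronglyMeasurable_logTransform hγ hv.aestronglyMeasurable hsupp fun τ hτ => ?_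
    rcases le_total τ a with h | h
    · exact e1.1 τ ⟨hτ.1, h⟩
    · rcases le_total τ b with h' | h'
      · exact hXoff ε e3.1 τ ⟨h, h'⟩
      · exact e2.1 τ ⟨h', hτ.2⟩
  have hdom : ∀ᶠ ε in l, ∀ᵐ τ : ℝ, ‖arcLog γ p τ (X ε) * v τ‖ ≤ bound τ := by
    filter_upwards [hXlim.eventually h1, hXlim.eventually h2, hside, h3] with ε e1 e2 e3 e4
    filter_upwards [hsae] with τ hτs
    rw [norm_mul, hbound]
    beta_reduce
    by_cases hτ : τ ∈ Icc p q
    swap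
    · rw [hsupp τ hτ, norm_zero, mul_zero, mul_zero, zero_add]
      exact indicator_nonneg (fun _ _ => by positivity) _
    have hC₁ := le_abs_self C₁
    have hC₂ := le_abs_self C₂
    have hA' := le_abs_self A
    have habs := abs_nonneg (Real.log (|b - s|))
    have hpa' := (e1.2 p ⟨le_rfl, hpa⟩ a ⟨hpa, le_rfl⟩)
    by_cases hτab : τ ∈ Icc a b
    · rw [indicator_of_mem hτab, hsplit1 ε e3.1 e1.1 τ hτab]
      have h5 := hmid ε e3.1 e4 τ hτab hτs
      have h6 : ‖arcLog γ p a (X ε) + arcLog γ a τ (X ε)‖ ≤ B + |Real.log (|τ - s|)| := by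
        refine (norm_add_le _ _).trans ?_
        linarith [abs_nonneg C₂]
      refine (mul_le_mul_of_nonneg_right h6 (norm_nonneg _)).trans ?_
      rw [add_mul, mul_comm |M|]
      refine add_le_add le_rfl (mul_le_mul_of_nonneg_left ?_ (abs_nonneg _))
      exact (hM τ hτab).trans (le_abs_self M)
    · rw [indicator_of_notMem hτab, add_zero]
      refine mul_le_mul_of_nonneg_right ?_ (norm_nonneg _)
      rcases le_total τ a with h | h
      · have := e1.2 p ⟨le_rfl, hpa⟩ τ ⟨hτ.1, h⟩
        linarith [abs_nonneg C₂, abs_nonneg A]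
      · have h' : b ≤ τ := by
          by_contra h'; exact hτab ⟨h, (not_le.mp h').le⟩
        rw [hsplit2 ε e3.1 e1.1 e2.1 τ ⟨h', hτ.2⟩]
        have h5 := hmid ε e3.1 e4 b ⟨hab, le_rfl⟩ hs.2.ne'
        have h6 := e2.2 b ⟨le_rfl, hbq⟩ τ ⟨h', hτ.2⟩
        refine (norm_add_le _ _).trans ((add_le_add (norm_add_le _ _) le_rfl).trans ?_)
        linarith
  have hpt : ∀ᵐ τ : ℝ, Tendsto (fun ε => arcLog γ p τ (X ε) * v τ) l (𝓝 (lim τ)) := by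
    filter_upwards [hsae] with τ hτs
    by_cases hτ : τ ∈ Icc p q
    swap
    · simp only [hlim, hsupp τ hτ, mul_zero]
      exact tendsto_const_nhds
    refine Tendsto.mul_const _ ?_
    rcases lt_or_gt_of_ne hτs with h | h
    · have h5 : τ ∉ Ioi s := fun h' => (lt_asymm h h')
      rw [principalLog_of_lt ℓ h, indicator_of_notMem h5, add_zero,
        ← hℓ.arcLog_before hγ hτ.1 h]
      exact (continuousAt_arcLog hγ hτ.1 fun u hu hus => by
        have := hinj hus
        linarith [hu.2]).tendsto.comp hXlim
    · rw [principalLog_of_le ℓ h.le, indicator_of_mem (show τ ∈ Ioi s from h)]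
      -- For τ beyond s the arc is divided at a and at b' = min τ b, so that the transversal
      -- crossing takes place inside the chart even if τ lies beyond it.
      have hb' : min τ b ∈ Ioc s b := ⟨lt_min h hs.2, min_le_right _ _⟩
      have hb'τ : min τ b ≤ τ := min_le_left _ _
      set b' := min τ b
      have hafter' : ∀ u ∈ Icc b' τ, γ u ≠ γ s := fun u hu hus => by
        have := hinj hus
        linarith [hu.1, hb'.1]
      have l1 : Tendsto (fun ε => arcLog γ p a (X ε)) l (𝓝 (ℓ s a - ℓ s p)) := by
        rw [← hℓ.arcLog_before hγ hpa hs.1]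
        exact (continuousAt_arcLog hγ hpa hbefore).tendsto.comp hXlim
      have l3 : Tendsto (fun ε => arcLog γ b' τ (X ε)) l (𝓝 (ℓ τ s - ℓ b' s)) := by
        rw [← hℓ.arcLog_after hγ hb'.1 hb'τ]
        exact (continuousAt_arcLog hγ hb'τ hafter').tendsto.comp hXlim
      have l2 : Tendsto (fun ε => arcLog γ a b' (X ε)) l (𝓝 (Complex.log ((γ b' - γ s) / e) -
          Complex.log ((γ s - γ a) / e) + σ)) := by
        have l4 := ((tendsto_const_nhds (x := γ b')).sub hXlim).div_const e |>.clog
          (Complex.mem_slitPlane_iff.mpr (Or.inl (sub_div_re_pos hγ he hs.1.le hb'.1 hb'.2)))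
        have l5 := (hXlim.sub_const (γ a)).div_const e |>.clog
          (Complex.mem_slitPlane_iff.mpr (Or.inl (sub_div_re_pos hγ he le_rfl hs.1 hs.2.le)))
        refine ((l4.sub l5).add_const σ).congr' ?_
        filter_upwards [hside] with ε e3
        exact (e3.2 b' hb').symm
      -- The branch ℓ differs from the principal logarithm by the same constant at (b', s) and at
      -- (s, a), so the principal logarithms cancel and only σ remains.
      have hdiag := hℓ.sub_log_eq hγ he0 he hs.1.le hb'.1 hb'.2 le_rfl hs.1 hs.2.le
      have hsum := (l1.add l2).add l3
      have hval : ℓ s a - ℓ s p + (Complex.log ((γ b' - γ s) / e) -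
          Complex.log ((γ s - γ a) / e) + σ) + (ℓ τ s - ℓ b' s) = ℓ τ s - ℓ s p + σ := by
        linear_combination -hdiag
      rw [hval] at hsum
      refine hsum.congr' ?_
      filter_upwards [hXlim.eventually h1, hside,
        hXlim.eventually (eventually_norm_arcLog_le hγ hafter').choose_spec] with ε e1 e3 e4
      rw [← hsplit1 ε e3.1 e1.1 b' ⟨hs.1.le.trans hb'.1.le, hb'.2⟩]
      refine arcLog_add hγ ?_ ?_
      · rw [uIcc_of_le (hpa.trans (hs.1.le.trans hb'.1.le))]
        intro u hu
        rcases le_total u a with h8 | h8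
        · exact e1.1 u ⟨hu.1, h8⟩
        · exact hXoff ε e3.1 u ⟨h8, hu.2.trans hb'.2⟩
      · rw [uIcc_of_le hb'τ]
        exact e4.1
  have htend := tendsto_integral_filter_of_dominated_convergence bound hmeas hdom hboundi hpt
  have hlimi : Integrable lim := by
    have hm : AEStronglyMeasurable lim := by
      obtain ⟨u, hu, hum⟩ := exists_seq_of_eventually hmeas
      exact aestronglyMeasurable_of_tendsto_ae atTop hum (hpt.mono fun τ h => h.comp hu)
    refine hboundi.mono' hm ?_
    obtain ⟨u, hu, hum⟩ := exists_seq_of_eventually hdom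
    filter_upwards [ae_all_iff.mpr hum, hpt] with τ h4 h5
    exact le_of_tendsto (h5.comp hu).norm (Eventually.of_forall h4)
  have hindi : Integrable (indicator (Ioi s) v) := hv.indicator measurableSet_Ioi
  have hpi : Integrable fun τ => SpectralCurve.principalLog ℓ s τ * v τ := by
    refine ((hlimi.add (hv.const_mul (ℓ s p))).sub (hindi.const_mul σ)).congr
      (Eventually.of_forall fun τ => ?_)
    by_cases hτ : τ ∈ Ioi s
    · simp only [hlim, Pi.add_apply, Pi.sub_apply, indicator_of_mem hτ]; ring
    · simp only [hlim, Pi.add_apply, Pi.sub_apply, indicator_of_notMem hτ]; ring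
  have hval : ∫ τ, lim τ =
      logPotential ℓ v s - (∫ τ, v τ) * ℓ s p + σ * ∫ τ in Ioi s, v τ := by
    have hsub : Integrable fun τ => SpectralCurve.principalLog ℓ s τ * v τ - v τ * ℓ s p :=
      hpi.sub (hv.mul_const _)
    rw [logPotential, ← integral_mul_const, ← integral_indicator measurableSet_Ioi,
      ← integral_const_mul, ← integral_sub hpi (hv.mul_const _),
      ← integral_add hsub (hindi.const_mul σ)]
    congr 1; ext τ
    by_cases hτ : τ ∈ Ioi s
    · simp only [hlim, indicator_of_mem hτ]; ring
    · simp only [hlim, indicator_of_notMem hτ]; ring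
  rw [← hval]
  exact htend

theorem tendsto_logTransform_left (hγ : ContDiff ℝ 1 γ) (hinj : Function.Injective γ)
    (hℓ : IsLog γ ℓ) {p q a b s : ℝ} {e : ℂ} (hpa : p ≤ a) (hs : s ∈ Ioo a b) (hbq : b ≤ q)
    (he0 : e ≠ 0) (he : ∀ τ ∈ Icc a b, 0 < (deriv γ τ / e).re) {v : ℝ → ℂ} (hv : Integrable v)
    (hsupp : ∀ τ ∉ Icc p q, v τ = 0) {M : ℝ} (hM : ∀ τ ∈ Icc a b, ‖v τ‖ ≤ M) :
    Tendsto (fun ε : ℝ => logTransform γ p v (γ s + Complex.I * ε * e)) (𝓝[>] 0)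
      (𝓝 (logPotential ℓ v s - (∫ τ, v τ) * ℓ s p +
        Real.pi * Complex.I * ∫ τ in Ioi s, v τ)) := by
  refine tendsto_logTransform_aux hγ hinj hℓ hpa hs hbq he0 he hv hsupp hM nhdsWithin_le_nhds ?_
  filter_upwards [self_mem_nhdsWithin] with ε hε
  exact ⟨(show (0 : ℝ) < ε from hε).ne', fun b' hb' => arcLog_left hγ he0
    (fun τ hτ => he τ ⟨hτ.1, hτ.2.trans hb'.2⟩) ⟨hs.1, hb'.1⟩ hε rfl⟩

theorem tendsto_logTransform_right (hγ : ContDiff ℝ 1 γ) (hinj : Function.Injective γ)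
    (hℓ : IsLog γ ℓ) {p q a b s : ℝ} {e : ℂ} (hpa : p ≤ a) (hs : s ∈ Ioo a b) (hbq : b ≤ q)
    (he0 : e ≠ 0) (he : ∀ τ ∈ Icc a b, 0 < (deriv γ τ / e).re) {v : ℝ → ℂ} (hv : Integrable v)
    (hsupp : ∀ τ ∉ Icc p q, v τ = 0) {M : ℝ} (hM : ∀ τ ∈ Icc a b, ‖v τ‖ ≤ M) :
    Tendsto (fun ε : ℝ => logTransform γ p v (γ s + Complex.I * ε * e)) (𝓝[<] 0)
      (𝓝 (logPotential ℓ v s - (∫ τ, v τ) * ℓ s p -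
        Real.pi * Complex.I * ∫ τ in Ioi s, v τ)) := by
  rw [sub_eq_add_neg _ (Real.pi * Complex.I * _), ← neg_mul]
  refine tendsto_logTransform_aux hγ hinj hℓ hpa hs hbq he0 he hv hsupp hM nhdsWithin_le_nhds ?_
  filter_upwards [self_mem_nhdsWithin] with ε hε
  refine ⟨(show ε < (0 : ℝ) from hε).ne, fun b' hb' => ?_⟩
  rw [arcLog_right hγ he0 (fun τ hτ => he τ ⟨hτ.1, hτ.2.trans hb'.2⟩) ⟨hs.1, hb'.1⟩ hε rfl]
  ring

/-- Away from the path, the logarithmic transform is a primitive of the resolvent. -/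
theorem hasDerivAt_logTransform (hγ : ContDiff ℝ 1 γ) {p q : ℝ} {v : ℝ → ℂ} (hv : Integrable v)
    (hsupp : ∀ τ ∉ Icc p q, v τ = 0) {x : ℂ} (hx : ∀ τ ∈ Icc p q, γ τ ≠ x) :
    HasDerivAt (logTransform γ p v)
      (-(∫ s, v s / (γ s - x)) - (∫ s, v s) / (x - γ p)) x := by
  have hK : IsClosed (γ '' Icc p q) := (isCompact_Icc.image hγ.continuous).isClosed
  obtain ⟨r₁, hr₁, hball⟩ := Metric.isOpen_iff.mp hK.isOpen_compl x
    (by rintro ⟨s, hs, h⟩; exact hx s hs h)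
  have hoff : ∀ y ∈ Metric.ball x r₁, ∀ τ ∈ Icc p q, γ τ ≠ y :=
    fun y hy τ hτ h => hball hy ⟨τ, hτ, h⟩
  obtain ⟨C, hC⟩ := eventually_norm_arcLog_le hγ hx
  obtain ⟨r₂, hr₂, hCb⟩ := Metric.eventually_nhds_iff_ball.mp hC
  have hmem : ∀ τ, v τ ≠ 0 → τ ∈ Icc p q := fun τ h => by
    by_contra h'; exact h (hsupp τ h')
  have hd : ∀ τ ∈ Icc p q, ∀ y ∈ Metric.ball x (min r₁ r₂),
      HasDerivAt (fun y => arcLog γ p τ y * v τ) ((1 / (y - γ τ) - 1 / (y - γ p)) * v τ) y :=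
    fun τ hτ y hy => (hasDerivAt_arcLog hγ hτ.1 fun u hu => hoff y
      (Metric.ball_subset_ball (min_le_left _ _) hy) u ⟨hu.1, hu.2.trans hτ.2⟩).mul_const _
  have hzero : ∀ τ ∉ Icc p q, (fun y => arcLog γ p τ y * v τ) = fun _ => 0 := fun τ hτ => by
    ext y; rw [hsupp τ hτ, mul_zero]
  have h := hasDerivAt_integral_of_differentiableOn_ball (μ := volume)
    (F := fun y τ => arcLog γ p τ y * v τ) (z₀ := x) (r := min r₁ r₂) (b := fun τ => |C| * ‖v τ‖)
    (lt_min hr₁ hr₂) ?_ ?_ ?_ (hv.norm.const_mul _)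
  · refine h.congr_deriv ?_
    have hi : Integrable fun s => v s / (γ s - x) :=
      integrable_div_sub hγ.continuous hv hr₁ fun s hs hsb => hoff _ hsb s (hmem s hs) rfl
    have hi' : Integrable fun s => -(v s / (γ s - x)) := hi.neg
    rw [← integral_neg, ← integral_div, ← integral_sub hi' (hv.div_const _)]
    congr 1; ext τ
    by_cases hτ : τ ∈ Icc p q
    · rw [(hd τ hτ x (Metric.mem_ball_self (lt_min hr₁ hr₂))).deriv, ← neg_sub (γ τ) x,
        div_neg]
      ring
    · rw [hzero τ hτ, hsupp τ hτ]; simp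
  · intro y hy
    exact aestronglyMeasurable_logTransform hγ hv.aestronglyMeasurable hsupp
      (hoff y (Metric.ball_subset_ball (min_le_left _ _) hy))
  · refine Eventually.of_forall fun τ => ?_
    by_cases hτ : τ ∈ Icc p q
    · exact fun y hy => (hd τ hτ y hy).differentiableAt.differentiableWithinAt
    · rw [hzero τ hτ]; exact differentiableOn_const _
  · refine Eventually.of_forall fun τ y hy => ?_
    rw [norm_mul]
    by_cases hτ : τ ∈ Icc p q
    · refine mul_le_mul_of_nonneg_right ?_ (norm_nonneg _)
      exact ((hCb y (Metric.ball_subset_ball (min_le_right _ _) hy)).2 p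
        ⟨le_rfl, hτ.1.trans hτ.2⟩ τ hτ).trans (le_abs_self C)
    · rw [hsupp τ hτ]; simp

end LogTransform

/-! ### Boundary values on the two sides and the derivative of the potential. -/

section Crossing

variable {γ : ℝ → ℂ} {ℓ : ℝ → ℝ → ℂ} {p q s₁ s₂ : ℝ} {e c : ℂ} {r : ℝ} {v : ℝ → ℂ} {G H : ℂ → ℂ}

/-- On the two sides of the path the resolvent of `v` agrees with the holomorphic functions
`G` and `H`. -/
structure HasSides (γ : ℝ → ℂ) (v : ℝ → ℂ) (s₁ s₂ : ℝ) (e c : ℂ) (r : ℝ) (G H : ℂ → ℂ) :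
    Prop where
  differentiableOn_left : DifferentiableOn ℂ G (Metric.ball c r)
  differentiableOn_right : DifferentiableOn ℂ H (Metric.ball c r)
  left : ∀ s ∈ Ioo s₁ s₂, ∀ ε : ℝ, 0 < ε → γ s + Complex.I * ε * e ∈ Metric.ball c r →
    -(∫ τ, v τ / (γ τ - (γ s + Complex.I * ε * e))) = G (γ s + Complex.I * ε * e)
  right : ∀ s ∈ Ioo s₁ s₂, ∀ ε : ℝ, ε < 0 → γ s + Complex.I * ε * e ∈ Metric.ball c r →
    -(∫ τ, v τ / (γ τ - (γ s + Complex.I * ε * e))) = H (γ s + Complex.I * ε * e)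

/-- This combination is the x-derivative of `logTransform` for a density of mass m: the second term
comes from the base point p of `arcLog`. Its pole γ(p) lies outside the ball, so a primitive exists
there. -/
theorem Chart.exists_primitive (h : Chart γ p q s₁ s₂ e c r) (hpq : p ≤ s₁) (hq : s₂ ≤ q)
    (hG : DifferentiableOn ℂ G (Metric.ball c r)) (m : ℂ) :
    ∃ F : ℂ → ℂ, ∀ x ∈ Metric.ball c r, HasDerivAt F (G x - m / (x - γ p)) x := by
  have hd : DifferentiableOn ℂ (fun x => G x - m / (x - γ p)) (Metric.ball c r) := by
    refine hG.sub ((differentiableOn_const m).div (differentiableOn_id.sub_const _) ?_)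
    intro x hx h0
    have hx' : γ p ∈ Metric.ball c r := by rwa [← sub_eq_zero.mp h0]
    have := h.iso p ⟨le_rfl, hpq.trans (h.lt.le.trans hq)⟩ hx'
    linarith [this.1]
  exact hd.isExactOn_ball

/-- The difference T - F is constant on the half-open segment and is evaluated by a limit at the
starting point, where T itself need not be continuous. -/
theorem eq_of_segment {T F T' : ℂ → ℂ} {x₀ d L : ℂ}
    (hT : ∀ u ∈ Ioc (0 : ℝ) 1, HasDerivAt T (T' (x₀ + u * d)) (x₀ + u * d))
    (hF : ∀ u ∈ Ioc (0 : ℝ) 1, HasDerivAt F (T' (x₀ + u * d)) (x₀ + u * d))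
    (hFc : ContinuousAt F x₀) (hL : Tendsto (fun u : ℝ => T (x₀ + u * d)) (𝓝[>] 0) (𝓝 L)) :
    T (x₀ + d) - F (x₀ + d) = L - F x₀ := by
  have hline : ∀ u : ℝ, HasDerivAt (fun u : ℝ => x₀ + u * d) d u := fun u => by
    simpa using ((Complex.ofRealCLM.hasDerivAt (x := u)).mul_const d).const_add x₀
  have hd : ∀ u ∈ Ioc (0 : ℝ) 1,
      HasDerivWithinAt (fun u : ℝ => T (x₀ + u * d) - F (x₀ + u * d)) 0 (Ioc 0 1) u := by
    intro u hu
    have h1 := (HasDerivAt.comp_of_eq u (hT u hu) (hline u) rfl).sub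
      (HasDerivAt.comp_of_eq u (hF u hu) (hline u) rfl)
    rw [sub_self] at h1
    exact h1.hasDerivWithinAt
  have hconst : ∀ u ∈ Ioc (0 : ℝ) 1,
      T (x₀ + u * d) - F (x₀ + u * d) = T (x₀ + d) - F (x₀ + d) := by
    intro u hu
    have := (convex_Ioc (0 : ℝ) 1).norm_image_sub_le_of_norm_hasDerivWithin_le (C := 0) hd
      (fun _ _ => by simp) ⟨zero_lt_one, le_rfl⟩ hu
    simp only [zero_mul, Complex.ofReal_one, one_mul] at this
    exact sub_eq_zero.mp (norm_le_zero_iff.mp this)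
  have hlim : Tendsto (fun u : ℝ => x₀ + (u : ℂ) * d) (𝓝[>] 0) (𝓝 x₀) := by
    have : Continuous fun u : ℝ => x₀ + (u : ℂ) * d := by fun_prop
    simpa using (this.tendsto 0).mono_left nhdsWithin_le_nhds
  refine tendsto_nhds_unique ?_ (hL.sub (hFc.tendsto.comp hlim))
  refine tendsto_const_nhds.congr' ?_
  filter_upwards [Ioc_mem_nhdsGT zero_lt_one] with u hu
  exact (hconst u hu).symm

theorem segment_mem_ball {x₀ d : ℂ} (h0 : x₀ ∈ Metric.ball c r) (h1 : x₀ + d ∈ Metric.ball c r)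
    {u : ℝ} (hu : u ∈ Icc (0 : ℝ) 1) : x₀ + u * d ∈ Metric.ball c r := by
  have := (convex_ball c r).add_smul_mem h0 h1 hu
  simpa using this

theorem Chart.hasDerivAt_logTransform (h : Chart γ p q s₁ s₂ e c r) (hγ : ContDiff ℝ 1 γ)
    (hv : Integrable v) (hsupp : ∀ τ ∉ Icc p q, v τ = 0) {s ε : ℝ} (hs : s ∈ Ioo s₁ s₂)
    (hε : ε ≠ 0) (hx : γ s + Complex.I * ε * e ∈ Metric.ball c r) :
    HasDerivAt (logTransform γ p v) (-(∫ τ, v τ / (γ τ - (γ s + Complex.I * ε * e))) -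
      (∫ τ, v τ) / (γ s + Complex.I * ε * e - γ p)) (γ s + Complex.I * ε * e) :=
  RigidSpecialGeometry.hasDerivAt_logTransform hγ hv hsupp (h.notMem hγ hs hε hx)

/-- The logarithmic transform on the left of the path. -/
theorem Chart.logTransform_left (h : Chart γ p q s₁ s₂ e c r) (hγ : ContDiff ℝ 1 γ)
    (hinj : Function.Injective γ) (hℓ : IsLog γ ℓ) (hpq : p ≤ s₁) (hq : s₂ ≤ q)
    (hv : Integrable v) (hsupp : ∀ τ ∉ Icc p q, v τ = 0) {M : ℝ}
    (hM : ∀ τ ∈ Icc s₁ s₂, ‖v τ‖ ≤ M) (hS : HasSides γ v s₁ s₂ e c r G H) {F : ℂ → ℂ}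
    (hF : ∀ x ∈ Metric.ball c r, HasDerivAt F (G x - (∫ τ, v τ) / (x - γ p)) x) {s ε : ℝ}
    (hs : s ∈ Ioo s₁ s₂) (hsb : γ s ∈ Metric.ball c r) (hε : 0 < ε)
    (hx : γ s + Complex.I * ε * e ∈ Metric.ball c r) :
    logTransform γ p v (γ s + Complex.I * ε * e) - F (γ s + Complex.I * ε * e) =
      logPotential ℓ v s - (∫ τ, v τ) * ℓ s p + Real.pi * Complex.I * (∫ τ in Ioi s, v τ) -
        F (γ s) := by
  have hmem : ∀ u ∈ Ioc (0 : ℝ) 1, γ s + Complex.I * (u * ε : ℝ) * e ∈ Metric.ball c r := by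
    intro u hu
    have := segment_mem_ball hsb hx (Ioc_subset_Icc_self hu)
    convert this using 1; push_cast; ring
  have hrw : ∀ u : ℝ, γ s + u * (Complex.I * ε * e) = γ s + Complex.I * (u * ε : ℝ) * e :=
    fun u => by push_cast; ring
  refine eq_of_segment (T' := fun x => -(∫ τ, v τ / (γ τ - x)) - (∫ τ, v τ) / (x - γ p))
    ?_ ?_ (hF _ hsb).continuousAt ?_
  · intro u hu
    rw [hrw]
    exact h.hasDerivAt_logTransform hγ hv hsupp hs (mul_pos hu.1 hε).ne' (hmem u hu)
  · intro u hu
    rw [hrw]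
    have := hF _ (hmem u hu)
    rwa [← hS.left s hs _ (mul_pos hu.1 hε) (hmem u hu)] at this
  · simp only [hrw]
    have hlim : Tendsto (fun u : ℝ => u * ε) (𝓝[>] 0) (𝓝[>] 0) := by
      refine tendsto_nhdsWithin_iff.mpr ⟨?_, ?_⟩
      · have : Continuous fun u : ℝ => u * ε := by fun_prop
        simpa using (this.tendsto 0).mono_left nhdsWithin_le_nhds
      · filter_upwards [self_mem_nhdsWithin] with u hu using mul_pos hu hε
    exact (tendsto_logTransform_left hγ hinj hℓ hpq hs hq h.ne h.re_pos hv hsupp hM).comp hlim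

/-- The logarithmic transform on the right of the path. -/
theorem Chart.logTransform_right (h : Chart γ p q s₁ s₂ e c r) (hγ : ContDiff ℝ 1 γ)
    (hinj : Function.Injective γ) (hℓ : IsLog γ ℓ) (hpq : p ≤ s₁) (hq : s₂ ≤ q)
    (hv : Integrable v) (hsupp : ∀ τ ∉ Icc p q, v τ = 0) {M : ℝ}
    (hM : ∀ τ ∈ Icc s₁ s₂, ‖v τ‖ ≤ M) (hS : HasSides γ v s₁ s₂ e c r G H) {F : ℂ → ℂ}
    (hF : ∀ x ∈ Metric.ball c r, HasDerivAt F (H x - (∫ τ, v τ) / (x - γ p)) x) {s ε : ℝ}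
    (hs : s ∈ Ioo s₁ s₂) (hsb : γ s ∈ Metric.ball c r) (hε : ε < 0)
    (hx : γ s + Complex.I * ε * e ∈ Metric.ball c r) :
    logTransform γ p v (γ s + Complex.I * ε * e) - F (γ s + Complex.I * ε * e) =
      logPotential ℓ v s - (∫ τ, v τ) * ℓ s p - Real.pi * Complex.I * (∫ τ in Ioi s, v τ) -
        F (γ s) := by
  have hmem : ∀ u ∈ Ioc (0 : ℝ) 1, γ s + Complex.I * (u * ε : ℝ) * e ∈ Metric.ball c r := by
    intro u hu
    have := segment_mem_ball hsb hx (Ioc_subset_Icc_self hu)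
    convert this using 1; push_cast; ring
  have hrw : ∀ u : ℝ, γ s + u * (Complex.I * ε * e) = γ s + Complex.I * (u * ε : ℝ) * e :=
    fun u => by push_cast; ring
  refine eq_of_segment (T' := fun x => -(∫ τ, v τ / (γ τ - x)) - (∫ τ, v τ) / (x - γ p))
    ?_ ?_ (hF _ hsb).continuousAt ?_
  · intro u hu
    rw [hrw]
    exact h.hasDerivAt_logTransform hγ hv hsupp hs (mul_neg_of_pos_of_neg hu.1 hε).ne (hmem u hu)
  · intro u hu
    rw [hrw]
    have := hF _ (hmem u hu)
    rwa [← hS.right s hs _ (mul_neg_of_pos_of_neg hu.1 hε) (hmem u hu)] at this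
  · simp only [hrw]
    have hlim : Tendsto (fun u : ℝ => u * ε) (𝓝[>] 0) (𝓝[<] 0) := by
      refine tendsto_nhdsWithin_iff.mpr ⟨?_, ?_⟩
      · have : Continuous fun u : ℝ => u * ε := by fun_prop
        simpa using (this.tendsto 0).mono_left nhdsWithin_le_nhds
      · filter_upwards [self_mem_nhdsWithin] with u hu using mul_neg_of_pos_of_neg hu hε
    exact (tendsto_logTransform_right hγ hinj hℓ hpq hs hq h.ne h.re_pos hv hsupp hM).comp hlim

/-- A function of the form `T - F` is constant along a shifted piece of the path. -/
theorem eventually_eq_shift {T F T' : ℂ → ℂ} (hγ : ContDiff ℝ 1 γ) {s₀ : ℝ} {w : ℂ}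
    (hT : ∀ᶠ s in 𝓝 s₀, HasDerivAt T (T' (γ s + w)) (γ s + w))
    (hF : ∀ᶠ s in 𝓝 s₀, HasDerivAt F (T' (γ s + w)) (γ s + w)) :
    ∀ᶠ s in 𝓝 s₀, T (γ s + w) - F (γ s + w) = T (γ s₀ + w) - F (γ s₀ + w) := by
  obtain ⟨δ, hδ, hb⟩ := Metric.eventually_nhds_iff_ball.mp (hT.and hF)
  have hd : ∀ s ∈ Metric.ball s₀ δ,
      HasDerivWithinAt (fun s => T (γ s + w) - F (γ s + w)) 0 (Metric.ball s₀ δ) s := by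
    intro s hs
    have h0 : HasDerivAt (fun s => γ s + w) (deriv γ s) s :=
      ((hγ.differentiable (by norm_num)).differentiableAt.hasDerivAt).add_const w
    have h1 := (HasDerivAt.comp_of_eq s (hb s hs).1 h0 rfl).sub
      (HasDerivAt.comp_of_eq s (hb s hs).2 h0 rfl)
    rw [sub_self] at h1
    exact h1.hasDerivWithinAt
  filter_upwards [Metric.ball_mem_nhds s₀ hδ] with s hs
  have := (convex_ball s₀ δ).norm_image_sub_le_of_norm_hasDerivWithin_le (C := 0) hd
    (fun _ _ => by simp) (Metric.mem_ball_self hδ) hs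
  rw [zero_mul] at this
  exact sub_eq_zero.mp (norm_le_zero_iff.mp this)

/-- The derivative of the logarithmic potential along the path is the mean of the boundary values
of the resolvent. -/
theorem Chart.hasDerivAt_logPotential (h : Chart γ p q s₁ s₂ e c r) (hγ : ContDiff ℝ 1 γ)
    (hinj : Function.Injective γ) (hℓ : IsLog γ ℓ) (hpq : p ≤ s₁) (hq : s₂ ≤ q)
    (hv : Integrable v) (hsupp : ∀ τ ∉ Icc p q, v τ = 0) {M : ℝ}
    (hM : ∀ τ ∈ Icc s₁ s₂, ‖v τ‖ ≤ M) (hS : HasSides γ v s₁ s₂ e c r G H) {s₀ : ℝ}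
    (hs₀ : s₀ ∈ Ioo s₁ s₂) (hsb : γ s₀ ∈ Metric.ball c r) :
    HasDerivAt (logPotential ℓ v) ((G (γ s₀) + H (γ s₀)) / 2 * deriv γ s₀) s₀ := by
  obtain ⟨F₁, hF₁⟩ := h.exists_primitive hpq hq hS.differentiableOn_left (∫ τ, v τ)
  obtain ⟨F₂, hF₂⟩ := h.exists_primitive hpq hq hS.differentiableOn_right (∫ τ, v τ)
  have hshift : ∀ κ : ℝ, ∀ᶠ ε : ℝ in 𝓝[>] 0,
      γ s₀ + Complex.I * (κ * ε : ℝ) * e ∈ Metric.ball c r := by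
    intro κ
    have : Continuous fun ε : ℝ => γ s₀ + Complex.I * (κ * ε : ℝ) * e := by fun_prop
    refine nhdsWithin_le_nhds (this.continuousAt.eventually (Metric.isOpen_ball.mem_nhds ?_))
    simpa using hsb
  -- The transform is not regular on the path, so it is compared with its primitives along two
  -- copies of the path shifted by a fixed amount to the left and to the right.
  obtain ⟨ε, ⟨h1, h2⟩, hε⟩ := (((hshift 1).and (hshift (-1))).and self_mem_nhdsWithin).exists
  have hε : 0 < ε := hε
  rw [one_mul] at h1
  rw [neg_one_mul] at h2
  have hnear : ∀ w : ℂ, γ s₀ + w ∈ Metric.ball c r → ∀ᶠ s in 𝓝 s₀, γ s + w ∈ Metric.ball c r :=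
    fun w hw => (hγ.continuous.add continuous_const).continuousAt.eventually
      (Metric.isOpen_ball.mem_nhds hw)
  have hIoo : ∀ᶠ s in 𝓝 s₀, s ∈ Ioo s₁ s₂ := Ioo_mem_nhds hs₀.1 hs₀.2
  have hb0 : ∀ᶠ s in 𝓝 s₀, γ s ∈ Metric.ball c r := by simpa using hnear 0 (by simpa using hsb)
  have hL := eventually_eq_shift (T := logTransform γ p v) (F := F₁)
    (T' := fun x => -(∫ τ, v τ / (γ τ - x)) - (∫ τ, v τ) / (x - γ p)) hγ (s₀ := s₀)
    (w := Complex.I * ε * e) (by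
      filter_upwards [hIoo, hnear _ h1] with s hs hx
      exact h.hasDerivAt_logTransform hγ hv hsupp hs hε.ne' hx) (by
      filter_upwards [hIoo, hnear _ h1] with s hs hx
      have := hF₁ _ hx
      rwa [← hS.left s hs _ hε hx] at this)
  have hR := eventually_eq_shift (T := logTransform γ p v) (F := F₂)
    (T' := fun x => -(∫ τ, v τ / (γ τ - x)) - (∫ τ, v τ) / (x - γ p)) hγ (s₀ := s₀)
    (w := Complex.I * (-ε : ℝ) * e) (by
      filter_upwards [hIoo, hnear _ h2] with s hs hx
      exact h.hasDerivAt_logTransform hγ hv hsupp hs (neg_ne_zero.mpr hε.ne') hx) (by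
      filter_upwards [hIoo, hnear _ h2] with s hs hx
      have := hF₂ _ hx
      rwa [← hS.right s hs _ (neg_neg_of_pos hε) hx] at this)
  set m := ∫ τ, v τ with hm
  set K := logPotential ℓ v s₀ - m * ℓ s₀ p - (F₁ (γ s₀) + F₂ (γ s₀)) / 2 with hK
  -- In half the sum of the left and right relations the terms ±πi ∫_{τ>s} v cancel. Without this
  -- the potential could not be separated from the jump, which depends on s.
  have hV : ∀ᶠ s in 𝓝 s₀, logPotential ℓ v s =
      K + m * ℓ s p + (F₁ (γ s) + F₂ (γ s)) / 2 := by
    filter_upwards [hIoo, hb0, hnear _ h1, hnear _ h2, hL, hR] with s hs hsb' hx1 hx2 e1 e2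
    rw [h.logTransform_left hγ hinj hℓ hpq hq hv hsupp hM hS hF₁ hs hsb' hε hx1,
      h.logTransform_left hγ hinj hℓ hpq hq hv hsupp hM hS hF₁ hs₀ hsb hε h1] at e1
    rw [h.logTransform_right hγ hinj hℓ hpq hq hv hsupp hM hS hF₂ hs hsb' (neg_neg_of_pos hε) hx2,
      h.logTransform_right hγ hinj hℓ hpq hq hv hsupp hM hS hF₂ hs₀ hsb (neg_neg_of_pos hε) h2]
      at e2
    linear_combination (e1 + e2) / 2
  have hγd : HasDerivAt γ (deriv γ s₀) s₀ :=
    (hγ.differentiable (by norm_num)).differentiableAt.hasDerivAt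
  have hps : p < s₀ := hpq.trans_lt hs₀.1
  have d1 := ((hℓ.hasDerivAt hγ hps).const_mul m).const_add K |>.add
    (((HasDerivAt.comp_of_eq s₀ (hF₁ _ hsb) hγd rfl).add
      (HasDerivAt.comp_of_eq s₀ (hF₂ _ hsb) hγd rfl)).div_const 2)
  refine (d1.congr_of_eventuallyEq hV).congr_deriv ?_
  ring

end Crossing

/-! ### The effective potential along the path. -/

namespace SpectralCurve

variable {g : ℕ} {W : ℂ[X]} {t : ℂ} (D : SpectralCurve g W t) {ℓ : ℝ → ℝ → ℂ}

theorem resolvent_ρ₀ (ht : t ≠ 0) {x : ℂ} (hx : x ∉ D.cuts) :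
    -(∫ s, D.ρ₀ s / (D.path s - x)) = (W.derivative.eval x - D.y₀ x) / (2 * t) := by
  rw [D.y₀_eq ht hx]
  field_simp
  ring

/-- The variation of the density when `f₀` varies in the direction `q`. -/
def varDensity (q : ℂ[X]) (s : ℝ) : ℂ := D.invDensity q s / (4 * Real.pi * Complex.I * t)

theorem integrable_varDensity (ht : t ≠ 0) (q : ℂ[X]) : Integrable (D.varDensity q) :=
  (D.integrable_invDensity ht q).div_const _

theorem varDensity_eq_zero (q : ℂ[X]) {s : ℝ} (hs : s ∉ D.cutSet) : D.varDensity q s = 0 := by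
  rw [varDensity, D.invDensity_eq_zero q hs, zero_div]

theorem integral_varDensity (ht : t ≠ 0) {q : ℂ[X]} (hq : q.natDegree ≤ g) (hq' : q.coeff g = 0) :
    ∫ s, D.varDensity q s = 0 := by
  simp only [varDensity]
  rw [integral_div, D.integral_invDensity ht hq, hq', mul_zero, zero_div]

theorem resolvent_varDensity (ht : t ≠ 0) {q : ℂ[X]} (hq : q.natDegree ≤ g) {x : ℂ}
    (hx : x ∉ D.cuts) :
    -(∫ s, D.varDensity q s / (D.path s - x)) = -(q.eval x) / (4 * t * D.y₀ x) := by
  have h := D.eval_div_y₀ ht hq hx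
  have hy := D.y₀_ne_zero hx
  have hpi : (Real.pi : ℂ) ≠ 0 := by exact_mod_cast Real.pi_ne_zero
  have hI := Complex.I_ne_zero
  have h1 : ∀ s, D.varDensity q s / (D.path s - x) =
      D.invDensity q s / (D.path s - x) / (4 * Real.pi * Complex.I * t) := fun s => by
    rw [varDensity]; ring
  simp only [h1]
  rw [integral_div]
  field_simp at h ⊢
  linear_combination h

theorem continuousAt_varDensity (ht : t ≠ 0) (q : ℂ[X]) {i : Fin (g + 1)} {s : ℝ}
    (hs : s ∈ Ioo (D.lo i) (D.hi i)) : ContinuousAt (D.varDensity q) s :=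
  ((((q.continuous.comp D.contDiff_path.continuous).mul
    (D.contDiff_path.continuous_deriv le_rfl)).continuousAt).div
    (D.continuous_edge ht).continuousAt (D.edge_ne_zero ht hs)).div_const _

theorem eq_zero_of_notMem_Icc {v : ℝ → ℂ} (hv : ∀ s ∉ D.cutSet, v s = 0) {p q : ℝ}
    (hp : p ≤ D.lo 0) (hq : D.hi (Fin.last g) ≤ q) : ∀ s ∉ Icc p q, v s = 0 :=
  fun s hs => hv s fun h => hs (Icc_subset_Icc hp hq (D.cutSet_subset h))

theorem hasSides_ρ₀_cut (ht : t ≠ 0) {p q s₁ s₂ : ℝ} {e c : ℂ} {r : ℝ}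
    (h : Chart D.path p q s₁ s₂ e c r) (hp : p ≤ D.lo 0) (hq : D.hi (Fin.last g) ≤ q) {Y : ℂ → ℂ}
    (hY : D.IsLocalBranch s₁ s₂ e c r Y) :
    HasSides D.path D.ρ₀ s₁ s₂ e c r (fun x => (W.derivative.eval x - Y x) / (2 * t))
      (fun x => (W.derivative.eval x + Y x) / (2 * t)) where
  differentiableOn_left :=
    (W.derivative.differentiable.differentiableOn.sub hY.differentiableOn).div_const _
  differentiableOn_right :=
    (W.derivative.differentiable.differentiableOn.add hY.differentiableOn).div_const _
  left s hs ε hε hx := by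
    rw [D.resolvent_ρ₀ ht (D.notMem_cuts_of_chart h hp hq hs hε.ne' hx), hY.left s hs ε hε hx]
  right s hs ε hε hx := by
    rw [D.resolvent_ρ₀ ht (D.notMem_cuts_of_chart h hp hq hs hε.ne hx), hY.right s hs ε hε hx,
      sub_neg_eq_add]

theorem IsLocalBranch.ne_zero {D : SpectralCurve g W t} (ht : t ≠ 0) {p q s₁ s₂ : ℝ} {e c : ℂ}
    {r : ℝ} (h : Chart D.path p q s₁ s₂ e c r) (hp : p ≤ D.lo 0) (hq : D.hi (Fin.last g) ≤ q)
    {i : Fin (g + 1)} (h1 : D.lo i < s₁) (h2 : s₂ < D.hi i) {Y : ℂ → ℂ}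
    (hY : D.IsLocalBranch s₁ s₂ e c r Y) {x : ℂ} (hx : x ∈ Metric.ball c r) : Y x ≠ 0 := by
  intro hYx
  have hsq := hY.sq x hx
  rw [hYx, zero_pow two_ne_zero, eq_comm] at hsq
  have hxc : x ∈ D.cuts := by by_contra h; exact D.eval_curvePoly_ne_zero h hsq
  rw [cuts_eq] at hxc
  obtain ⟨τ, hτ, rfl⟩ := hxc
  have hτ' := h.iso τ (Icc_subset_Icc hp hq (D.cutSet_subset hτ)) hx
  have hτi : τ ∈ Ioo (D.lo i) (D.hi i) := ⟨h1.trans hτ'.1, hτ'.2.trans h2⟩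
  have := D.edge_sq ht hτ
  rw [hsq] at this
  exact D.edge_ne_zero ht hτi (by simpa using this)

theorem hasSides_varDensity_cut (ht : t ≠ 0) {f : ℂ[X]} (hf : f.natDegree ≤ g) {p q s₁ s₂ : ℝ}
    {e c : ℂ} {r : ℝ} (h : Chart D.path p q s₁ s₂ e c r) (hp : p ≤ D.lo 0)
    (hq : D.hi (Fin.last g) ≤ q) {Y : ℂ → ℂ} (hY : D.IsLocalBranch s₁ s₂ e c r Y)
    (hY0 : ∀ x ∈ Metric.ball c r, Y x ≠ 0) :
    HasSides D.path (D.varDensity f) s₁ s₂ e c r (fun x => -(f.eval x) / (4 * t * Y x))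
      (fun x => f.eval x / (4 * t * Y x)) where
  differentiableOn_left := f.differentiable.differentiableOn.neg.div
    (hY.differentiableOn.const_mul _) fun x hx => by simp [ht, hY0 x hx]
  differentiableOn_right := f.differentiable.differentiableOn.div
    (hY.differentiableOn.const_mul _) fun x hx => by simp [ht, hY0 x hx]
  left s hs ε hε hx := by
    rw [D.resolvent_varDensity ht hf (D.notMem_cuts_of_chart h hp hq hs hε.ne' hx),
      hY.left s hs ε hε hx]
  right s hs ε hε hx := by
    rw [D.resolvent_varDensity ht hf (D.notMem_cuts_of_chart h hp hq hs hε.ne hx),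
      hY.right s hs ε hε hx, mul_neg, neg_div_neg_eq]

theorem notMem_cuts_of_disjoint {p q s₁ s₂ : ℝ} {e c : ℂ} {r : ℝ}
    (h : Chart D.path p q s₁ s₂ e c r) (hp : p ≤ D.lo 0) (hq : D.hi (Fin.last g) ≤ q)
    (hdis : ∀ s ∈ Ioo s₁ s₂, s ∉ D.cutSet) {x : ℂ} (hx : x ∈ Metric.ball c r) : x ∉ D.cuts := by
  rw [cuts_eq]
  rintro ⟨τ, hτ, rfl⟩
  exact hdis τ (h.iso τ (Icc_subset_Icc hp hq (D.cutSet_subset hτ)) hx) hτ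

theorem hasSides_gap {v : ℝ → ℂ} (hv : Integrable v) (hsupp : ∀ s ∉ D.cutSet, v s = 0)
    {p q s₁ s₂ : ℝ} {e c : ℂ} {r : ℝ}
    (h : Chart D.path p q s₁ s₂ e c r) (hp : p ≤ D.lo 0) (hq : D.hi (Fin.last g) ≤ q)
    (hdis : ∀ s ∈ Ioo s₁ s₂, s ∉ D.cutSet) :
    HasSides D.path v s₁ s₂ e c r (fun x => -∫ s, v s / (D.path s - x))
      (fun x => -∫ s, v s / (D.path s - x)) := by
  have hd : DifferentiableOn ℂ (fun x => -∫ s, v s / (D.path s - x)) (Metric.ball c r) := by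
    intro x hx
    obtain ⟨r', hr', hb⟩ := Metric.isOpen_iff.mp D.isClosed_cuts.isOpen_compl x
      (D.notMem_cuts_of_disjoint h hp hq hdis hx)
    exact (hasDerivAt_cauchyTransform D.contDiff_path.continuous hv hr'
      fun s hs hsb => hb hsb (D.path_mem_cuts.mpr
        (by by_contra h'; exact hs (hsupp s h')))).neg.differentiableAt.differentiableWithinAt
  exact ⟨hd, hd, fun _ _ _ _ _ => rfl, fun _ _ _ _ _ => rfl⟩

/-- The potential `W - 2t V` along the path; it is constant on every cut. -/
def effPotential (ℓ : ℝ → ℝ → ℂ) (s : ℝ) : ℂ :=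
  W.eval (D.path s) - 2 * t * logPotential ℓ D.ρ₀ s

theorem hasDerivAt_path (s : ℝ) : HasDerivAt D.path (deriv D.path s) s :=
  (D.contDiff_path.differentiable (by norm_num)).differentiableAt.hasDerivAt

theorem hasDerivAt_eval_path (q : ℂ[X]) (s : ℝ) : HasDerivAt (fun s => q.eval (D.path s))
    (q.derivative.eval (D.path s) * deriv D.path s) s :=
  HasDerivAt.comp_of_eq s (q.hasDerivAt (D.path s)) (D.hasDerivAt_path s) rfl

theorem exists_bound_ρ₀ (ht : t ≠ 0) : ∃ M, ∀ s, ‖D.ρ₀ s‖ ≤ M :=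
  D.hasCompactSupport_ρ₀.exists_bound_of_continuous (D.continuous_ρ₀ ht)

theorem exists_chart_cut {p q : ℝ} (hp : p ≤ D.lo 0) (hq : D.hi (Fin.last g) ≤ q)
    {i : Fin (g + 1)} {s α β : ℝ} (hα : α ∈ Ico (D.lo i) s) (hβ : β ∈ Ioc s (D.hi i)) :
    ∃ s₁ ∈ Ioo α s, ∃ s₂ ∈ Ioo s β, ∃ r > 0, ∃ Y,
      Chart D.path p q s₁ s₂ (deriv D.path s) (D.path s) r ∧
      D.IsLocalBranch s₁ s₂ (deriv D.path s) (D.path s) r Y := by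
  obtain ⟨s₁, h1, s₂, h2, r, hr, h⟩ := exists_chart D.contDiff_path D.deriv_path_ne_zero
    D.injective_path p q hα.2 hβ.1
  obtain ⟨Y, hY⟩ := D.exists_isLocalBranch h hp hq (hα.1.trans_lt h1.1) (h2.2.trans_le hβ.2)
  exact ⟨s₁, h1, s₂, h2, r, hr, Y, h, hY⟩

theorem lo_zero_le (i : Fin (g + 1)) : D.lo 0 ≤ D.lo i := D.strictMono_lo.monotone (Fin.zero_le i)

theorem hi_le_last (i : Fin (g + 1)) : D.hi i ≤ D.hi (Fin.last g) :=
  D.strictMono_hi.monotone (Fin.le_last i)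

/-- This is the saddle point equation: the mean of the boundary values (W' - Y)/2t and (W' + Y)/2t
is W'/2t. -/
theorem hasDerivAt_effPotential_cut (ht : t ≠ 0) (hℓ : IsLog D.path ℓ) {i : Fin (g + 1)} {s : ℝ}
    (hs : s ∈ Ioo (D.lo i) (D.hi i)) : HasDerivAt (D.effPotential ℓ) 0 s := by
  obtain ⟨s₁, h1, s₂, h2, r, hr, Y, h, hY⟩ := D.exists_chart_cut le_rfl le_rfl
    ⟨le_rfl, hs.1⟩ ⟨hs.2, le_rfl⟩
  obtain ⟨M, hM⟩ := D.exists_bound_ρ₀ ht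
  have hV := h.hasDerivAt_logPotential D.contDiff_path D.injective_path hℓ
    ((D.lo_zero_le i).trans h1.1.le) (h2.2.le.trans (D.hi_le_last i)) (D.integrable_ρ₀ ht)
    (D.eq_zero_of_notMem_Icc (fun _ => D.ρ₀_eq_zero) le_rfl le_rfl) (fun τ _ => hM τ)
    (D.hasSides_ρ₀_cut ht h le_rfl le_rfl hY) ⟨h1.2, h2.1⟩ (Metric.mem_ball_self hr)
  refine ((D.hasDerivAt_eval_path W s).sub (hV.const_mul (2 * t))).congr_deriv ?_
  field_simp
  ring

/-- In a gap both sides carry the same resolvent (W' - y₀)/2t, and W' minus 2t times it is y₀. -/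
theorem hasDerivAt_effPotential_gap (ht : t ≠ 0) (hℓ : IsLog D.path ℓ) {s : ℝ}
    (hs : s ∉ D.cutSet) (hs0 : s ∈ Icc (D.lo 0) (D.hi (Fin.last g))) :
    HasDerivAt (D.effPotential ℓ) (D.y₀ (D.path s) * deriv D.path s) s := by
  obtain ⟨δ, hδ, hb⟩ := Metric.isOpen_iff.mp D.isCompact_cutSet.isClosed.isOpen_compl s hs
  obtain ⟨s₁, h1, s₂, h2, r, hr, h⟩ := exists_chart D.contDiff_path D.deriv_path_ne_zero
    D.injective_path (D.lo 0 - δ) (D.hi (Fin.last g) + δ) (sub_lt_self s hδ)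
    (lt_add_of_pos_right s hδ)
  have hp : D.lo 0 - δ ≤ D.lo 0 := by linarith
  have hq : D.hi (Fin.last g) ≤ D.hi (Fin.last g) + δ := by linarith
  have hdis : ∀ τ ∈ Ioo s₁ s₂, τ ∉ D.cutSet := fun τ hτ => hb (by
    rw [Metric.mem_ball, Real.dist_eq, abs_lt]
    constructor <;> linarith [hτ.1, hτ.2, h1.1, h2.2])
  obtain ⟨M, hM⟩ := D.exists_bound_ρ₀ ht
  have hV := h.hasDerivAt_logPotential D.contDiff_path D.injective_path hℓ
    (by linarith [h1.1, hs0.1]) (by linarith [h2.2, hs0.2]) (D.integrable_ρ₀ ht)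
    (D.eq_zero_of_notMem_Icc (fun _ => D.ρ₀_eq_zero) hp hq) (fun τ _ => hM τ)
    (D.hasSides_gap (D.integrable_ρ₀ ht) (fun _ => D.ρ₀_eq_zero) h hp hq hdis) ⟨h1.2, h2.1⟩
    (Metric.mem_ball_self hr)
  refine ((D.hasDerivAt_eval_path W s).sub (hV.const_mul (2 * t))).congr_deriv ?_
  rw [D.resolvent_ρ₀ ht (D.path_mem_cuts.not.mpr hs)]
  field_simp
  ring

end SpectralCurve

/-! ### Families of curves with one complex parameter. -/

theorem hasDerivAt_of_sq {f h : ℂ → ℂ} {z₀ h' : ℂ} (hf : ContinuousAt f z₀)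
    (hh : HasDerivAt h h' z₀) (hsq : ∀ᶠ z in 𝓝 z₀, f z ^ 2 = h z) (h0 : f z₀ ≠ 0) :
    HasDerivAt f (h' / (2 * f z₀)) z₀ := by
  have h2 : f z₀ + f z₀ ≠ 0 := by rw [← two_mul]; exact mul_ne_zero two_ne_zero h0
  rw [hasDerivAt_iff_tendsto_slope] at hh ⊢
  have hs : ContinuousAt (fun z => f z + f z₀) z₀ := hf.add continuousAt_const
  have h1 := hh.div (hs.tendsto.mono_left nhdsWithin_le_nhds) h2
  rw [← two_mul] at h1
  refine h1.congr' ?_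
  filter_upwards [nhdsWithin_le_nhds (hs.eventually_ne h2), nhdsWithin_le_nhds hsq]
    with z hz hz2
  simp only [Pi.div_apply]
  rw [div_eq_iff hz, slope_def_field, slope_def_field, ← hz2, ← hsq.self_of_nhds]
  ring

theorem continuousAt_intervalIntegral {F : ℂ → ℝ → ℂ} {z₀ : ℂ} {a b : ℝ} (hab : a ≤ b)
    (h : ∀ τ ∈ Icc a b, ContinuousAt (fun p : ℂ × ℝ => F p.1 p.2) (z₀, τ))
    (hF : ∀ᶠ z in 𝓝 z₀, ContinuousOn (F z) (Icc a b)) :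
    ContinuousAt (fun z => ∫ τ in a..b, F z τ) z₀ := by
  have hc0 : ∀ τ ∈ Icc a b, ContinuousAt (fun z => F z τ) z₀ := fun τ hτ =>
    ContinuousAt.comp (f := fun z : ℂ => (z, τ)) (h τ hτ) (by fun_prop)
  obtain ⟨C, hC⟩ := isCompact_Icc.exists_bound_of_continuousOn hF.self_of_nhds
  refine intervalIntegral.continuousAt_of_dominated_interval (bound := fun _ => C + 1) ?_ ?_
    intervalIntegrable_const ?_
  · filter_upwards [hF] with z hz
    rw [uIoc_of_le hab]
    exact (hz.mono Ioc_subset_Icc_self).aestronglyMeasurable measurableSet_Ioc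
  · have : ∀ᶠ z in 𝓝 z₀, ∀ τ ∈ Icc a b, ‖F z τ‖ ≤ C + 1 := by
      refine isCompact_Icc.eventually_forall_of_forall_eventually fun τ hτ => ?_
      filter_upwards [(h τ hτ).norm.eventually (gt_mem_nhds (lt_add_one _))] with p hp
      exact hp.le.trans (add_le_add (hC τ hτ) le_rfl)
    filter_upwards [this] with z hz
    refine Eventually.of_forall fun τ hτ => ?_
    rw [uIoc_of_le hab] at hτ
    exact hz τ (Ioc_subset_Icc_self hτ)
  · refine Eventually.of_forall fun τ hτ => ?_
    rw [uIoc_of_le hab] at hτ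
    exact hc0 τ (Ioc_subset_Icc_self hτ)

variable {g : ℕ} {W : ℂ[X]} {t : ℂ}

/-- A family of curves with one complex parameter. -/
structure IsCurveFamily (U : Set ℂ) (D : ℂ → SpectralCurve g W t) : Prop where
  isOpen : IsOpen U
  differentiableOn_f : ∀ k, DifferentiableOn ℂ (fun z => (D z).f.coeff k) U
  continuousOn_path : ContinuousOn (fun p : ℂ × ℝ => (D p.1).path p.2) (U ×ˢ univ)
  continuousOn_tangent : ContinuousOn (fun p : ℂ × ℝ => deriv (D p.1).path p.2) (U ×ˢ univ)
  continuousOn_lo : ∀ i, ContinuousOn (fun z => (D z).lo i) U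
  continuousOn_hi : ∀ i, ContinuousOn (fun z => (D z).hi i) U

/-- The derivative of `f₀` with respect to the parameter. -/
def varPoly (D : ℂ → SpectralCurve g W t) (z₀ : ℂ) : ℂ[X] :=
  ∑ k ∈ Finset.range (g + 1), C (deriv (fun z => (D z).f.coeff k) z₀) * X ^ k

theorem natDegree_varPoly (D : ℂ → SpectralCurve g W t) (z₀ : ℂ) :
    (varPoly D z₀).natDegree ≤ g :=
  natDegree_sum_le_of_forall_le _ _ fun _ hk =>
    (natDegree_C_mul_X_pow_le _ _).trans (Nat.lt_succ_iff.mp (Finset.mem_range.mp hk))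

/-- The leading coefficient of f₀ is pinned to -4t along the family. Consequently variations of the
density have total mass zero. -/
theorem coeff_varPoly (D : ℂ → SpectralCurve g W t) (z₀ : ℂ) : (varPoly D z₀).coeff g = 0 := by
  have : (fun z => (D z).f.coeff g) = fun _ => -4 * t := funext fun z => (D z).coeff_f
  rw [varPoly, finsetSum_coeff, Finset.sum_eq_single_of_mem g (by simp)]
  · rw [coeff_C_mul_X_pow, if_pos rfl, this, deriv_const]
  · intro k _ hk
    rw [coeff_C_mul_X_pow, if_neg (Ne.symm hk)]

theorem eval_curvePoly_eq (D : SpectralCurve g W t) (x : ℂ) : D.curvePoly.eval x =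
    W.derivative.eval x ^ 2 + ∑ k ∈ Finset.range (g + 1), D.f.coeff k * x ^ k := by
  rw [SpectralCurve.curvePoly, eval_add, eval_pow,
    eval_eq_sum_range' (Nat.lt_succ_of_le D.natDegree_f)]

namespace IsCurveFamily

variable {U : Set ℂ} {D : ℂ → SpectralCurve g W t} {z₀ : ℂ}

theorem continuousAt_path (hD : IsCurveFamily U D) (hz : z₀ ∈ U) (s : ℝ) :
    ContinuousAt (fun p : ℂ × ℝ => (D p.1).path p.2) (z₀, s) :=
  hD.continuousOn_path.continuousAt ((hD.isOpen.prod isOpen_univ).mem_nhds ⟨hz, mem_univ s⟩)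

theorem continuousAt_tangent (hD : IsCurveFamily U D) (hz : z₀ ∈ U) (s : ℝ) :
    ContinuousAt (fun p : ℂ × ℝ => deriv (D p.1).path p.2) (z₀, s) :=
  hD.continuousOn_tangent.continuousAt ((hD.isOpen.prod isOpen_univ).mem_nhds ⟨hz, mem_univ s⟩)

theorem continuousAt_path_left (hD : IsCurveFamily U D) (hz : z₀ ∈ U) (s : ℝ) :
    ContinuousAt (fun z => (D z).path s) z₀ :=
  ContinuousAt.comp (f := fun z : ℂ => (z, s)) (hD.continuousAt_path hz s) (by fun_prop)

theorem continuousAt_lo (hD : IsCurveFamily U D) (hz : z₀ ∈ U) (i : Fin (g + 1)) :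
    ContinuousAt (fun z => (D z).lo i) z₀ :=
  (hD.continuousOn_lo i).continuousAt (hD.isOpen.mem_nhds hz)

theorem continuousAt_hi (hD : IsCurveFamily U D) (hz : z₀ ∈ U) (i : Fin (g + 1)) :
    ContinuousAt (fun z => (D z).hi i) z₀ :=
  (hD.continuousOn_hi i).continuousAt (hD.isOpen.mem_nhds hz)

theorem hasDerivAt_eval_curvePoly (hD : IsCurveFamily U D) (hz : z₀ ∈ U) (x : ℂ) :
    HasDerivAt (fun z => (D z).curvePoly.eval x) ((varPoly D z₀).eval x) z₀ := by
  simp only [eval_curvePoly_eq]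
  have h : (varPoly D z₀).eval x =
      ∑ k ∈ Finset.range (g + 1), deriv (fun z => (D z).f.coeff k) z₀ * x ^ k := by
    simp [varPoly, eval_finsetSum]
  rw [h]
  exact (HasDerivAt.fun_sum fun k _ =>
    ((hD.differentiableOn_f k).differentiableAt (hD.isOpen.mem_nhds hz)).hasDerivAt.mul_const
      _).const_add _

theorem continuousAt_eval_curvePoly (hD : IsCurveFamily U D) (hz : z₀ ∈ U) (x : ℂ) :
    ContinuousAt (fun p : ℂ × ℂ => (D p.1).curvePoly.eval p.2) (z₀, x) := by
  simp only [eval_curvePoly_eq]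
  refine ContinuousAt.add ?_ (tendsto_finsetSum _ fun k _ => ContinuousAt.mul ?_ ?_)
  · exact ((W.derivative.continuous.comp continuous_snd).pow 2).continuousAt
  · exact ((hD.differentiableOn_f k).differentiableAt (hD.isOpen.mem_nhds
      hz)).continuousAt.comp (f := Prod.fst) (x := (z₀, x)) continuousAt_fst
  · fun_prop

theorem eventually_mem (hD : IsCurveFamily U D) (hz : z₀ ∈ U) : ∀ᶠ z in 𝓝 z₀, z ∈ U :=
  hD.isOpen.mem_nhds hz

/-- Each condition of a chart is a strict inequality, or the avoidance of the closed ball of radius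
r', over a compact set. Such conditions persist under small changes of the parameter at the cost of
shrinking r to r'. -/
theorem eventually_chart (hD : IsCurveFamily U D) (hz : z₀ ∈ U) {p q s₁ s₂ : ℝ} {e c : ℂ}
    {r r' : ℝ} (h : Chart (D z₀).path p q s₁ s₂ e c r) (hr' : r' < r) :
    ∀ᶠ z in 𝓝 z₀, Chart (D z).path p q s₁ s₂ e c r' := by
  have hre : Continuous fun w : ℂ => (w / e).re :=
    Complex.continuous_re.comp (continuous_id.div_const e)
  have hcb : Metric.closedBall c r' ⊆ Metric.ball c r := Metric.closedBall_subset_ball hr'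
  have e1 : ∀ᶠ z in 𝓝 z₀, ∀ s ∈ Icc s₁ s₂, 0 < (deriv (D z).path s / e).re :=
    isCompact_Icc.eventually_forall_of_forall_eventually fun s hs =>
      (hre.continuousAt.comp (hD.continuousAt_tangent hz s)).eventually
        (lt_mem_nhds (h.re_pos s hs))
  have e2 : ∀ᶠ z in 𝓝 z₀, ∀ x ∈ Metric.closedBall c r',
      ((D z).path s₁ / e).re < (x / e).re ∧ (x / e).re < ((D z).path s₂ / e).re := by
    refine (isCompact_closedBall c r').eventually_forall_of_forall_eventually fun x hx => ?_
    have hb := h.box x (hcb hx)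
    have hp : ∀ s, ContinuousAt (fun p : ℂ × ℂ => ((D p.1).path s / e).re) (z₀, x) := fun s =>
      hre.continuousAt.comp (f := fun p : ℂ × ℂ => (D p.1).path s)
        ((hD.continuousAt_path_left hz s).comp (f := Prod.fst) (x := (z₀, x)) continuousAt_fst)
    have hx' : ContinuousAt (fun p : ℂ × ℂ => (p.2 / e).re) (z₀, x) :=
      (hre.comp continuous_snd).continuousAt
    exact ((hp s₁).eventually_lt hx' hb.1).and (hx'.eventually_lt (hp s₂) hb.2)
  have e3 : ∀ᶠ z in 𝓝 z₀, ∀ s ∈ Icc p q \ Ioo s₁ s₂, (D z).path s ∉ Metric.closedBall c r' := by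
    refine (isCompact_Icc.diff isOpen_Ioo).eventually_forall_of_forall_eventually fun s hs => ?_
    refine (hD.continuousAt_path hz s).eventually
      (Metric.isClosed_closedBall.isOpen_compl.mem_nhds fun hx => ?_)
    exact hs.2 (h.iso s hs.1 (hcb hx))
  filter_upwards [e1, e2, e3] with z h1 h2 h3
  refine ⟨h.lt, h.ne, h1, fun x hx => h2 x (Metric.ball_subset_closedBall hx), fun s hs hx => ?_⟩
  by_contra hs'
  exact h3 s ⟨hs, hs'⟩ (Metric.ball_subset_closedBall hx)

/-- The cuts are parametrised by the fixed interval [0, 1], so that their moving end points do not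
interfere with compactness arguments. -/
theorem continuousAt_cutParam (hD : IsCurveFamily U D) (hz : z₀ ∈ U) (i : Fin (g + 1)) (τ : ℝ) :
    ContinuousAt (fun p : ℂ × ℝ => (p.1, (D p.1).lo i + p.2 * ((D p.1).hi i - (D p.1).lo i)))
      (z₀, τ) := by
  have hlo := (hD.continuousAt_lo hz i).comp (f := Prod.fst) (x := (z₀, τ)) continuousAt_fst
  have hhi := (hD.continuousAt_hi hz i).comp (f := Prod.fst) (x := (z₀, τ)) continuousAt_fst
  exact continuousAt_fst.prodMk (hlo.add (continuousAt_snd.mul (hhi.sub hlo)))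

theorem mem_cut_iff (D : SpectralCurve g W t) (i : Fin (g + 1)) (x : ℂ) :
    x ∈ D.cut i ↔ ∃ τ ∈ Icc (0 : ℝ) 1, D.path (D.lo i + τ * (D.hi i - D.lo i)) = x := by
  have h := sub_pos.mpr (D.lo_lt_hi i)
  constructor
  · rintro ⟨s, hs, rfl⟩
    refine ⟨(s - D.lo i) / (D.hi i - D.lo i), ⟨div_nonneg (sub_nonneg.mpr hs.1) h.le, ?_⟩, ?_⟩
    · rw [div_le_one h]; linarith [hs.2]
    · congr 1; field_simp; ring
  · rintro ⟨τ, hτ, rfl⟩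
    refine ⟨_, ⟨?_, ?_⟩, rfl⟩
    · nlinarith [mul_nonneg hτ.1 h.le]
    · nlinarith [hτ.2]

theorem eventually_notMem_cuts (hD : IsCurveFamily U D) (hz : z₀ ∈ U) {K : Set ℂ}
    (hK : IsCompact K) (h : ∀ x ∈ K, x ∉ (D z₀).cuts) :
    ∀ᶠ z in 𝓝 z₀, ∀ x ∈ K, x ∉ (D z).cuts := by
  have key : ∀ i : Fin (g + 1), ∀ᶠ z in 𝓝 z₀, ∀ y ∈ K ×ˢ Icc (0 : ℝ) 1,
      (D z).path ((D z).lo i + y.2 * ((D z).hi i - (D z).lo i)) ≠ y.1 := by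
    intro i
    refine (hK.prod isCompact_Icc).eventually_forall_of_forall_eventually ?_
    rintro ⟨x, τ⟩ ⟨hx, hτ⟩
    have h1 : ContinuousAt (fun p : ℂ × ℂ × ℝ =>
        (D p.1).path ((D p.1).lo i + p.2.2 * ((D p.1).hi i - (D p.1).lo i))) (z₀, x, τ) :=
      ContinuousAt.comp (f := fun p : ℂ × ℂ × ℝ => (p.1, p.2.2))
        (g := fun p : ℂ × ℝ => (D p.1).path ((D p.1).lo i + p.2 * ((D p.1).hi i - (D p.1).lo i)))
        (ContinuousAt.comp (g := fun p : ℂ × ℝ => (D p.1).path p.2) (x := (z₀, τ))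
          (f := fun p : ℂ × ℝ => (p.1, (D p.1).lo i + p.2 * ((D p.1).hi i - (D p.1).lo i)))
          (hD.continuousAt_path hz _) (hD.continuousAt_cutParam hz i τ))
        (x := (z₀, x, τ)) (by fun_prop)
    have h2 : ContinuousAt (fun p : ℂ × ℂ × ℝ => p.2.1) (z₀, x, τ) := by fun_prop
    refine ((h1.sub h2).eventually_ne (sub_ne_zero.mpr fun he => ?_)).mono fun p hp =>
      sub_ne_zero.mp hp
    exact h x hx (mem_iUnion.mpr ⟨i, (mem_cut_iff _ _ _).mpr ⟨τ, hτ, he⟩⟩)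
  filter_upwards [eventually_all.mpr key] with z hz x hx hc
  obtain ⟨i, hi⟩ := mem_iUnion.mp hc
  obtain ⟨τ, hτ, hx'⟩ := (mem_cut_iff _ _ _).mp hi
  exact hz i (x, τ) ⟨hx, hτ⟩ hx'

end IsCurveFamily

variable {g : ℕ} {W : ℂ[X]} {t : ℂ}

namespace SpectralCurve

theorem cutIntegral_eq_integral_unit (D : SpectralCurve g W t) (i : Fin (g + 1)) (x : ℂ) :
    D.cutIntegral i x = ((D.hi i - D.lo i : ℝ) : ℂ) * ∫ τ in (0 : ℝ)..1,
      deriv D.path (D.lo i + τ * (D.hi i - D.lo i)) /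
        (D.path (D.lo i + τ * (D.hi i - D.lo i)) - x) := by
  have h := intervalIntegral.smul_integral_comp_add_mul (a := 0) (b := 1)
    (fun s => deriv D.path s / (D.path s - x)) (D.hi i - D.lo i) (D.lo i)
  rw [mul_zero, mul_one, add_zero, add_sub_cancel] at h
  rw [cutIntegral, ← h, Complex.real_smul]
  simp only [mul_comm (D.hi i - D.lo i)]

end SpectralCurve

namespace IsCurveFamily

variable {U : Set ℂ} {D : ℂ → SpectralCurve g W t} {z₀ : ℂ}

theorem eventually_notMem_cuts_point (hD : IsCurveFamily U D) (hz : z₀ ∈ U) {x : ℂ}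
    (hx : x ∉ (D z₀).cuts) : ∀ᶠ z in 𝓝 z₀, x ∉ (D z).cuts := by
  filter_upwards [hD.eventually_notMem_cuts hz (isCompact_singleton (x := x))
    (by simpa using hx)] with z h using h x rfl

theorem continuousAt_cutIntegral (hD : IsCurveFamily U D) (hz : z₀ ∈ U) (i : Fin (g + 1)) {x : ℂ}
    (hx : x ∉ (D z₀).cuts) : ContinuousAt (fun z => (D z).cutIntegral i x) z₀ := by
  simp only [SpectralCurve.cutIntegral_eq_integral_unit]
  refine ContinuousAt.mul ?_ (continuousAt_intervalIntegral zero_le_one ?_ ?_)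
  · exact Complex.continuous_ofReal.continuousAt.comp
      ((hD.continuousAt_hi hz i).sub (hD.continuousAt_lo hz i))
  · intro τ hτ
    have h1 := ContinuousAt.comp (g := fun p : ℂ × ℝ => (D p.1).path p.2) (x := (z₀, τ))
      (f := fun p : ℂ × ℝ => (p.1, (D p.1).lo i + p.2 * ((D p.1).hi i - (D p.1).lo i)))
      (hD.continuousAt_path hz _) (hD.continuousAt_cutParam hz i τ)
    have h2 := ContinuousAt.comp (g := fun p : ℂ × ℝ => deriv (D p.1).path p.2) (x := (z₀, τ))
      (f := fun p : ℂ × ℝ => (p.1, (D p.1).lo i + p.2 * ((D p.1).hi i - (D p.1).lo i)))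
      (hD.continuousAt_tangent hz _) (hD.continuousAt_cutParam hz i τ)
    refine h2.div (h1.sub continuousAt_const) fun h => ?_
    exact hx (mem_iUnion.mpr ⟨i, (mem_cut_iff _ _ _).mpr ⟨τ, hτ, sub_eq_zero.mp h⟩⟩)
  · filter_upwards [hD.eventually_notMem_cuts_point hz hx] with z hxz
    have hc : Continuous fun τ : ℝ => (D z).lo i + τ * ((D z).hi i - (D z).lo i) := by fun_prop
    refine ((((D z).contDiff_path.continuous_deriv le_rfl).comp hc).continuousOn).div
      (((D z).contDiff_path.continuous.comp hc).sub continuous_const).continuousOn fun τ hτ h => ?_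
    exact hxz (mem_iUnion.mpr ⟨i, (mem_cut_iff _ _ _).mpr ⟨τ, hτ, sub_eq_zero.mp h⟩⟩)

theorem continuousAt_lo_path (hD : IsCurveFamily U D) (hz : z₀ ∈ U) (i : Fin (g + 1)) :
    ContinuousAt (fun z => (D z).path ((D z).lo i)) z₀ :=
  ContinuousAt.comp (g := fun p : ℂ × ℝ => (D p.1).path p.2) (f := fun z => (z, (D z).lo i))
    (hD.continuousAt_path hz _) (continuousAt_id.prodMk (hD.continuousAt_lo hz i))

theorem continuousAt_y₀ (hD : IsCurveFamily U D) (hz : z₀ ∈ U) {x : ℂ} (hx : x ∉ (D z₀).cuts) :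
    ContinuousAt (fun z => (D z).y₀ x) z₀ := by
  have h : ContinuousAt (fun z => (D z).branchProd x) z₀ := by
    refine tendsto_finsetProd _ fun i _ => ?_
    exact (continuousAt_const.sub (hD.continuousAt_lo_path hz i)).mul
      (Complex.continuous_exp.continuousAt.comp
        ((hD.continuousAt_cutIntegral hz i hx).div_const 2))
  refine h.congr ?_
  filter_upwards [hD.eventually_notMem_cuts_point hz hx] with z hxz
    using ((D z).y₀_eq_branchProd hxz).symm

/-- Here holomorphy of f₀ enters. At a fixed x off the cuts the path influences y₀ only through the
sign of the root, so its continuity in the parameter is enough. -/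
theorem hasDerivAt_y₀ (hD : IsCurveFamily U D) (hz : z₀ ∈ U) {x : ℂ} (hx : x ∉ (D z₀).cuts) :
    HasDerivAt (fun z => (D z).y₀ x) ((varPoly D z₀).eval x / (2 * (D z₀).y₀ x)) z₀ :=
  hasDerivAt_of_sq (hD.continuousAt_y₀ hz hx) (hD.hasDerivAt_eval_curvePoly hz x)
    (by
      filter_upwards [hD.eventually_notMem_cuts_point hz hx] with z hxz using (D z).y₀_sq hxz)
    ((D z₀).y₀_ne_zero hx)

/-- Points on the left of the curve stay on the left under small deformations of the curve. -/
theorem eventually_left (hD : IsCurveFamily U D) (hz : z₀ ∈ U) {p q s₁ s₂ : ℝ} {e c : ℂ} {r : ℝ}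
    (h : Chart (D z₀).path p q s₁ s₂ e c r) {σ s ε : ℝ}
    (hs : s ∈ Icc s₁ s₂) (hε : 0 < σ * ε) :
    ∀ᶠ z in 𝓝 z₀, ∀ s' ∈ Icc s₁ s₂, ∀ ε' : ℝ,
      (D z).path s' + Complex.I * ε' * e = (D z₀).path s + Complex.I * ε * e → 0 < σ * ε' := by
  set x := (D z₀).path s + Complex.I * ε * e with hx
  -- Where s' ≠ s, the component of x - λ(s') along e does not vanish; where s' = s, the normal
  -- component has the sign of ε. Both alternatives are open, and the interval of s' is compact.
  have key : ∀ᶠ z in 𝓝 z₀, ∀ s' ∈ Icc s₁ s₂,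
      ((x - (D z).path s') / e).re ≠ 0 ∨ 0 < σ * ((x - (D z).path s') / e).im := by
    refine isCompact_Icc.eventually_forall_of_forall_eventually fun s' hs' => ?_
    have hc : ContinuousAt (fun p : ℂ × ℝ => (x - (D p.1).path p.2) / e) (z₀, s') :=
      (continuousAt_const.sub (hD.continuousAt_path hz s')).div_const e
    by_cases hne : ((x - (D z₀).path s') / e).re = 0
    · have hss : s' = s := by
        refine (strictMonoOn_re (D z₀).contDiff_path h.re_pos).injOn hs' hs ?_
        rw [hx, sub_div, add_div, Complex.sub_re, Complex.add_re, mul_div_cancel_right₀ _ h.ne]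
          at hne
        simp only [Complex.mul_re, Complex.I_re, Complex.ofReal_re, Complex.I_im,
          Complex.ofReal_im] at hne
        linarith
      have him : ((x - (D z₀).path s') / e).im = ε := by
        rw [hss, hx, add_sub_cancel_left, mul_div_cancel_right₀ _ h.ne]
        simp
      have h1 : ContinuousAt (fun p : ℂ × ℝ => σ * ((x - (D p.1).path p.2) / e).im) (z₀, s') :=
        continuousAt_const.mul (Complex.continuous_im.continuousAt.comp hc)
      filter_upwards [h1.eventually (lt_mem_nhds (show 0 < σ * ((x - (D z₀).path s') / e).im by
        rw [him]; exact hε))] with p hp using Or.inr hp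
    · have h1 : ContinuousAt (fun p : ℂ × ℝ => ((x - (D p.1).path p.2) / e).re) (z₀, s') :=
        Complex.continuous_re.continuousAt.comp hc
      filter_upwards [h1.eventually_ne hne] with p hp using Or.inl hp
  filter_upwards [key] with z hz' s' hs' ε' hε'
  have h1 : (x - (D z).path s') / e = Complex.I * ε' := by
    rw [← hε', add_sub_cancel_left, mul_div_cancel_right₀ _ h.ne]
  have h2 := hz' s' hs'
  rw [h1] at h2
  simpa using h2

/-- A local branch of `y` near an interior point of a cut, continued in the parameter. -/
def familyBranch (D : ℂ → SpectralCurve g W t) (z₀ : ℂ) (Y : ℂ → ℂ) (z x : ℂ) : ℂ :=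
  Y x * Complex.exp (Complex.log ((D z).curvePoly.eval x / (D z₀).curvePoly.eval x) / 2)

theorem familyBranch_self {Y : ℂ → ℂ} {x : ℂ} (hx : (D z₀).curvePoly.eval x ≠ 0) :
    familyBranch D z₀ Y z₀ x = Y x := by
  simp [familyBranch, div_self hx]

theorem familyBranch_sq {Y : ℂ → ℂ} {z x : ℂ} (hY : Y x ^ 2 = (D z₀).curvePoly.eval x)
    (hx : (D z₀).curvePoly.eval x ≠ 0) (hx' : (D z).curvePoly.eval x ≠ 0) :
    familyBranch D z₀ Y z x ^ 2 = (D z).curvePoly.eval x := by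
  rw [familyBranch, mul_pow, hY, ← Complex.exp_nat_mul, Nat.cast_ofNat,
    mul_div_cancel₀ _ two_ne_zero, Complex.exp_log (div_ne_zero hx' hx), mul_div_cancel₀ _ hx]

theorem continuousAt_familyBranch (hD : IsCurveFamily U D) (hz : z₀ ∈ U) {Y : ℂ → ℂ} {x : ℂ}
    (hY : ContinuousAt Y x) (hx : (D z₀).curvePoly.eval x ≠ 0) :
    ContinuousAt (fun p : ℂ × ℂ => familyBranch D z₀ Y p.1 p.2) (z₀, x) := by
  have h1 := hD.continuousAt_eval_curvePoly hz x
  have h2 : ContinuousAt (fun p : ℂ × ℂ => (D z₀).curvePoly.eval p.2) (z₀, x) :=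
    ((D z₀).curvePoly.continuous.comp continuous_snd).continuousAt
  have h3 := (h1.div h2 hx).clog (by simp [div_self hx])
  exact (hY.comp (f := Prod.snd) (x := (z₀, x)) continuousAt_snd).mul
    (Complex.continuous_exp.continuousAt.comp (h3.div_const 2))

/-- The perturbed curve has some local branch with the same square as the continued one, so the two
agree up to sign on the ball. The sign is settled at a single point x₁ on the left, where both y₀
and the continued branch are continuous in the parameter. -/
theorem eventually_isLocalBranch (hD : IsCurveFamily U D) (ht : t ≠ 0) (hz : z₀ ∈ U)
    {p q s₁ s₂ : ℝ} {e c : ℂ} {r r' : ℝ} (h : Chart (D z₀).path p q s₁ s₂ e c r) (hr0 : 0 < r')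
    (hr : r' < r) (hp : p < (D z₀).lo 0) (hq : (D z₀).hi (Fin.last g) < q) {i : Fin (g + 1)}
    (h1 : (D z₀).lo i < s₁) (h2 : s₂ < (D z₀).hi i) {s₀ : ℝ} (hs₀ : s₀ ∈ Ioo s₁ s₂)
    (hc : (D z₀).path s₀ = c) {Y : ℂ → ℂ} (hY : (D z₀).IsLocalBranch s₁ s₂ e c r Y) :
    ∀ᶠ z in 𝓝 z₀, (D z).IsLocalBranch s₁ s₂ e c r' (familyBranch D z₀ Y z) ∧
      ∀ x ∈ Metric.ball c r', (D z).curvePoly.eval x / (D z₀).curvePoly.eval x ∈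
        Complex.slitPlane := by
  have hP0 : ∀ x ∈ Metric.ball c r, (D z₀).curvePoly.eval x ≠ 0 := fun x hx => by
    rw [← hY.sq x hx]
    exact pow_ne_zero 2 (hY.ne_zero ht h hp.le hq.le h1 h2 hx)
  have hsub : Metric.ball c r' ⊆ Metric.ball c r := Metric.ball_subset_ball hr.le
  have hYc : ∀ x ∈ Metric.ball c r, ContinuousAt Y x := fun x hx =>
    (hY.differentiableOn.differentiableAt (Metric.isOpen_ball.mem_nhds hx)).continuousAt
  have hslit : ∀ᶠ z in 𝓝 z₀, ∀ x ∈ Metric.closedBall c r',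
      (D z).curvePoly.eval x / (D z₀).curvePoly.eval x ∈ Complex.slitPlane := by
    refine (isCompact_closedBall c r').eventually_forall_of_forall_eventually fun x hx => ?_
    have hx' := hP0 x (Metric.closedBall_subset_ball hr hx)
    have h3 : ContinuousAt (fun p : ℂ × ℂ => (D z₀).curvePoly.eval p.2) (z₀, x) :=
      ((D z₀).curvePoly.continuous.comp continuous_snd).continuousAt
    refine ((hD.continuousAt_eval_curvePoly hz x).div h3 hx').eventually
      (Complex.isOpen_slitPlane.mem_nhds ?_)
    simp [div_self hx']
  obtain ⟨x₁, hx₁, s, hs, ε, hε, hx₁'⟩ : ∃ x₁ ∈ Metric.ball c r', ∃ s ∈ Ioo s₁ s₂, ∃ ε : ℝ,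
      0 < ε ∧ x₁ = (D z₀).path s + Complex.I * ε * e := by
    have h4 : ContinuousAt (fun u : ℝ => (D z₀).path s₀ + Complex.I * u * e) 0 := by fun_prop
    have h5 := (h4.eventually ((Metric.isOpen_ball (x := c) (ε := r')).mem_nhds (by
      simpa [hc] using hr0))).filter_mono (nhdsWithin_le_nhds (s := Ioi 0))
    obtain ⟨u, hu, hu0⟩ := (h5.and self_mem_nhdsWithin).exists
    exact ⟨_, hu, s₀, hs₀, u, hu0, rfl⟩
  have hx₁c : x₁ ∉ (D z₀).cuts := by
    rw [hx₁'] at hx₁ ⊢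
    exact SpectralCurve.notMem_cuts_of_chart (h.mono hsub) hp.le hq.le hs hε.ne' hx₁
  have hY₁ : (D z₀).y₀ x₁ = Y x₁ := by
    rw [hx₁'] at hx₁ ⊢
    exact hY.left s hs ε hε (hsub hx₁)
  have hY₁0 : Y x₁ ≠ 0 := hY.ne_zero ht h hp.le hq.le h1 h2 (hsub hx₁)
  have hsign : ∀ᶠ z in 𝓝 z₀, (D z).y₀ x₁ + familyBranch D z₀ Y z x₁ ≠ 0 := by
    have hc := (hD.continuousAt_y₀ hz hx₁c).add (ContinuousAt.comp (x := z₀)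
      (f := fun z : ℂ => (z, x₁))
      (hD.continuousAt_familyBranch hz (hYc x₁ (hsub hx₁)) (hP0 x₁ (hsub hx₁))) (by fun_prop))
    refine hc.eventually_ne ?_
    change (D z₀).y₀ x₁ + familyBranch D z₀ Y z₀ x₁ ≠ 0
    rw [familyBranch_self (hP0 x₁ (hsub hx₁)), hY₁, ← two_mul]
    exact mul_ne_zero two_ne_zero hY₁0
  have hleft := hD.eventually_left hz h (σ := 1) (Ioo_subset_Icc_self hs) (ε := ε)
    (by simpa using hε)
  filter_upwards [hslit, hsign, hleft, hD.eventually_chart hz h hr,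
    (hD.continuousAt_lo hz 0).eventually (lt_mem_nhds hp),
    (hD.continuousAt_hi hz (Fin.last g)).eventually (gt_mem_nhds hq),
    (hD.continuousAt_lo hz i).eventually (gt_mem_nhds h1),
    (hD.continuousAt_hi hz i).eventually (lt_mem_nhds h2)] with z hsl hsg hl hch hpz hqz h1z h2z
  have hsl' : ∀ x ∈ Metric.ball c r',
      (D z).curvePoly.eval x / (D z₀).curvePoly.eval x ∈ Complex.slitPlane := fun x hx =>
    hsl x (Metric.ball_subset_closedBall hx)
  refine ⟨?_, hsl'⟩
  obtain ⟨Y', hY'⟩ := SpectralCurve.exists_isLocalBranch hch hpz.le hqz.le h1z h2z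
  have hPz : ∀ x ∈ Metric.ball c r', (D z).curvePoly.eval x ≠ 0 := fun x hx => by
    rw [← hY'.sq x hx]
    exact pow_ne_zero 2 (hY'.ne_zero ht hch hpz.le hqz.le h1z h2z hx)
  have hfsq : ∀ x ∈ Metric.ball c r', familyBranch D z₀ Y z x ^ 2 = (D z).curvePoly.eval x :=
    fun x hx => familyBranch_sq (hY.sq x (hsub hx)) (hP0 x (hsub hx)) (hPz x hx)
  have hfd : DifferentiableOn ℂ (familyBranch D z₀ Y z) (Metric.ball c r') := by
    refine (hY.differentiableOn.mono hsub).mul (DifferentiableOn.cexp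
      (DifferentiableOn.div_const (DifferentiableOn.clog ?_ hsl') 2))
    exact (D z).curvePoly.differentiable.differentiableOn.div
      (D z₀).curvePoly.differentiable.differentiableOn fun x hx => hP0 x (hsub hx)
  have heq : EqOn Y' (familyBranch D z₀ Y z) (Metric.ball c r') := by
    refine ((convex_ball c r').isPreconnected.eq_or_eq_neg_of_sq_eq
      hY'.differentiableOn.continuousOn hfd.continuousOn (fun x hx => ?_) (fun {x} hx h0 => ?_)
      ).resolve_right fun hneg => hsg ?_
    · change Y' x ^ 2 = familyBranch D z₀ Y z x ^ 2
      rw [hfsq x hx, hY'.sq x hx]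
    · have := hfsq x hx
      rw [h0] at this
      exact hPz x hx (by rw [← this]; simp)
    · obtain ⟨s', hs', ε', he⟩ := hch.exists_eq (D z).contDiff_path hx₁
      have hε' : 0 < ε' := by
        simpa using hl s' (Ioo_subset_Icc_self hs') ε' (by rw [← he, hx₁'])
      have h6 := hY'.left s' hs' ε' hε' (he ▸ hx₁)
      rw [← he, hneg hx₁] at h6
      rw [h6]; simp
  exact ⟨hfd, hfsq, fun s hs ε hε hx => (hY'.left s hs ε hε hx).trans (heq hx),
    fun s hs ε hε hx => (hY'.right s hs ε hε hx).trans (congrArg Neg.neg (heq hx))⟩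

end IsCurveFamily

/-! ### Bounds uniform in the parameter. -/

theorem exists_eventually_forall_le {α : Type*} [TopologicalSpace α] {K : Set α}
    (hK : IsCompact K) {F : ℂ × α → ℝ} {z₀ : ℂ} (h : ∀ s ∈ K, ContinuousAt F (z₀, s)) :
    ∃ C, ∀ᶠ z in 𝓝 z₀, ∀ s ∈ K, F (z, s) ≤ C := by
  have h0 : ContinuousOn (fun s => F (z₀, s)) K := fun s hs =>
    (ContinuousAt.comp (f := fun s => (z₀, s)) (h s hs) (by fun_prop)).continuousWithinAt
  obtain ⟨C, hC⟩ := (hK.image_of_continuousOn h0).bddAbove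
  refine ⟨C + 1, hK.eventually_forall_of_forall_eventually fun s hs => ?_⟩
  filter_upwards [(h s hs).eventually (gt_mem_nhds (lt_add_one _))] with p hp
  exact hp.le.trans (add_le_add (hC ⟨s, hs, rfl⟩) le_rfl)

theorem half_mul_sub_le_re {γ : ℝ → ℂ} (hγ : ContDiff ℝ 1 γ) {a b : ℝ} {e : ℂ}
    (he : ∀ s ∈ Icc a b, 1 / 2 ≤ (deriv γ s / e).re) {s s' : ℝ} (h1 : a ≤ s') (h2 : s' ≤ s)
    (h3 : s ≤ b) : 1 / 2 * (s - s') ≤ ((γ s - γ s') / e).re := by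
  have hd : ∀ s, HasDerivAt (fun s => (γ s / e).re) ((deriv γ s / e).re) s := by
    intro s
    have h1 := ((hγ.differentiable (by norm_num)).differentiableAt (x := s)).hasDerivAt
    exact (Complex.reCLM.hasFDerivAt.comp_hasDerivAt s (h1.div_const e))
  have h := (convex_Icc a b).mul_sub_le_image_sub_of_le_deriv (C := 1 / 2)
    (fun s _ => (hd s).continuousAt.continuousWithinAt)
    (fun s _ => (hd s).differentiableAt.differentiableWithinAt)
    (fun s hs => by rw [(hd s).deriv]; exact he s (interior_subset hs))
    s' ⟨h1, h2.trans h3⟩ s ⟨h1.trans h2, h3⟩ h2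
  rwa [sub_div, Complex.sub_re]

theorem norm_sub_div_le {γ : ℝ → ℂ} (hγ : ContDiff ℝ 1 γ) {a b : ℝ} {e : ℂ}
    (he : ∀ s ∈ Icc a b, ‖deriv γ s / e‖ ≤ 2) {s s' : ℝ} (h1 : a ≤ s') (h2 : s' ≤ s)
    (h3 : s ≤ b) : ‖(γ s - γ s') / e‖ ≤ 2 * (s - s') := by
  have hd : ∀ s, HasDerivAt (fun s => γ s / e) (deriv γ s / e) s := fun s =>
    ((hγ.differentiable (by norm_num)).differentiableAt (x := s)).hasDerivAt.div_const e
  have h := (convex_Icc a b).norm_image_sub_le_of_norm_hasDerivWithin_le (C := 2)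
    (fun s _ => (hd s).hasDerivWithinAt) he ⟨h1, h2.trans h3⟩ ⟨h1.trans h2, h3⟩
  rwa [Real.norm_of_nonneg (sub_nonneg.mpr h2), ← sub_div] at h

theorem norm_log_sub_div_le {γ : ℝ → ℂ} (hγ : ContDiff ℝ 1 γ) {a b : ℝ} {e : ℂ}
    (he : ∀ s ∈ Icc a b, 1 / 2 ≤ (deriv γ s / e).re) (he' : ∀ s ∈ Icc a b, ‖deriv γ s / e‖ ≤ 2)
    {s s' : ℝ} (h1 : a ≤ s') (h2 : s' < s) (h3 : s ≤ b) :
    ‖Complex.log ((γ s - γ s') / e)‖ ≤ Real.log 2 + Real.pi + |Real.log (s - s')| := by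
  have hp : 0 < s - s' := sub_pos.mpr h2
  have hlo := (half_mul_sub_le_re hγ he h1 h2.le h3).trans (Complex.re_le_norm _)
  have hhi := norm_sub_div_le hγ he' h1 h2.le h3
  have hpos : 0 < ‖(γ s - γ s') / e‖ := lt_of_lt_of_le (by positivity) hlo
  have h4 := Real.log_le_log (by positivity) hlo
  have h5 := Real.log_le_log hpos hhi
  rw [Real.log_mul (by norm_num) hp.ne', one_div, Real.log_inv] at h4
  rw [Real.log_mul (by norm_num) hp.ne'] at h5
  have h6 : |Real.log ‖(γ s - γ s') / e‖| ≤ Real.log 2 + |Real.log (s - s')| := by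
    rw [abs_le]
    constructor
    · linarith [neg_abs_le (Real.log (s - s'))]
    · linarith [le_abs_self (Real.log (s - s'))]
  linarith [norm_log_le ((γ s - γ s') / e)]

variable {g : ℕ} {W : ℂ[X]} {t : ℂ}

/-- A family of branches of `ln(λ(s) - λ(s'))`, `s' < s`, that is continuous in all variables. -/
structure IsFamilyLog (U : Set ℂ) (D : ℂ → SpectralCurve g W t) (ℓ : ℂ → ℝ → ℝ → ℂ) : Prop where
  continuousOn : ContinuousOn (fun p : ℂ × ℝ × ℝ => ℓ p.1 p.2.1 p.2.2)
    {p | p.1 ∈ U ∧ p.2.2 < p.2.1}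
  exp_eq : ∀ z ∈ U, ∀ s s' : ℝ, s' < s → Complex.exp (ℓ z s s') = (D z).path s - (D z).path s'

namespace IsFamilyLog

variable {U : Set ℂ} {D : ℂ → SpectralCurve g W t} {ℓ : ℂ → ℝ → ℝ → ℂ} {z₀ : ℂ}

theorem isLog (hℓ : IsFamilyLog U D ℓ) {z : ℂ} (hz : z ∈ U) : IsLog (D z).path (ℓ z) := by
  refine ⟨?_, hℓ.exp_eq z hz⟩
  exact hℓ.continuousOn.comp (f := fun p : ℝ × ℝ => (z, p.1, p.2)) (by fun_prop)
    fun p hp => ⟨hz, hp⟩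

theorem continuousAt (hℓ : IsFamilyLog U D ℓ) (hU : IsOpen U) (hz : z₀ ∈ U) {s s' : ℝ}
    (h : s' < s) : ContinuousAt (fun p : ℂ × ℝ × ℝ => ℓ p.1 p.2.1 p.2.2) (z₀, s, s') := by
  refine hℓ.continuousOn.continuousAt (IsOpen.mem_nhds ?_ ⟨hz, h⟩)
  exact (hU.preimage continuous_fst).inter
    (isOpen_lt (continuous_snd.comp continuous_snd) (continuous_fst.comp continuous_snd))

theorem continuousAt_principalLog (hℓ : IsFamilyLog U D ℓ) (hU : IsOpen U) (hz : z₀ ∈ U) {s s' : ℝ}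
    (h : s ≠ s') : ContinuousAt (fun z => SpectralCurve.principalLog (ℓ z) s s') z₀ := by
  rcases lt_or_gt_of_ne h with h | h
  · simp only [principalLog_of_le _ h.le]
    exact ContinuousAt.comp (f := fun z : ℂ => (z, s', s)) (hℓ.continuousAt hU hz h) (by fun_prop)
  · simp only [principalLog_of_lt _ h]
    exact ContinuousAt.comp (f := fun z : ℂ => (z, s, s')) (hℓ.continuousAt hU hz h) (by fun_prop)

/-- Near the diagonal ℓ is the principal logarithm of the chord divided by e plus a constant. The
constant is read off at the pair (a + δ, a - δ), away from the diagonal, where ℓ is continuous in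
the parameter. -/
theorem exists_bound_near_diagonal (hD : IsCurveFamily U D) (hℓ : IsFamilyLog U D ℓ) (hz : z₀ ∈ U)
    (a : ℝ) : ∃ A ∈ 𝓝 (a, a), ∃ C, ∀ᶠ z in 𝓝 z₀, ∀ y ∈ A, y.2 < y.1 →
      ‖ℓ z y.1 y.2‖ ≤ C + |Real.log (y.1 - y.2)| := by
  set e := deriv (D z₀).path a with he
  have he0 : e ≠ 0 := (D z₀).deriv_path_ne_zero a
  have hc : ContinuousAt (fun p : ℂ × ℝ => deriv (D p.1).path p.2 / e) (z₀, a) :=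
    (hD.continuousAt_tangent hz a).div_const e
  have hev : ∀ᶠ p : ℂ × ℝ in 𝓝 z₀ ×ˢ 𝓝 a, 1 / 2 ≤ (deriv (D p.1).path p.2 / e).re ∧
      ‖deriv (D p.1).path p.2 / e‖ ≤ 2 := by
    rw [← nhds_prod_eq]
    refine ((Complex.continuous_re.continuousAt.comp hc).eventually
      (le_mem_nhds ?_)).and (hc.norm.eventually (ge_mem_nhds ?_))
    · simp only [Function.comp_apply, ← he, div_self he0]; norm_num
    · simp only [← he, div_self he0]; norm_num
  obtain ⟨pa, hpa, pb, hpb, hab⟩ := eventually_prod_iff.mp hev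
  obtain ⟨δ, hδ, hδb⟩ := Metric.nhds_basis_closedBall.eventually_iff.mp hpb
  rw [Real.closedBall_eq_Icc] at hδb
  have hu : a - δ < a + δ := by linarith
  have hcl : ContinuousAt (fun z => ℓ z (a + δ) (a - δ)) z₀ :=
    ContinuousAt.comp (f := fun z : ℂ => (z, a + δ, a - δ)) (hℓ.continuousAt hD.isOpen hz hu)
      (by fun_prop)
  refine ⟨Icc (a - δ) (a + δ) ×ˢ Icc (a - δ) (a + δ), prod_mem_nhds
    (Icc_mem_nhds (by linarith) (by linarith)) (Icc_mem_nhds (by linarith) (by linarith)),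
    (‖ℓ z₀ (a + δ) (a - δ)‖ + 1) + (Real.log 2 + Real.pi + |Real.log (a + δ - (a - δ))|) +
      (Real.log 2 + Real.pi), ?_⟩
  filter_upwards [hpa, hD.eventually_mem hz,
    hcl.norm.eventually (ge_mem_nhds (lt_add_one _))] with z hza hzU hzl
  rintro ⟨s, s'⟩ ⟨hs, hs'⟩ hlt
  simp only at hlt hs hs' ⊢
  have h1 : ∀ s ∈ Icc (a - δ) (a + δ), 1 / 2 ≤ (deriv (D z).path s / e).re := fun s hs =>
    (hab hza (hδb hs)).1
  have h2 : ∀ s ∈ Icc (a - δ) (a + δ), ‖deriv (D z).path s / e‖ ≤ 2 := fun s hs =>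
    (hab hza (hδb hs)).2
  have h3 := (hℓ.isLog hzU).sub_log_eq (D z).contDiff_path he0
    (fun s hs => lt_of_lt_of_le (by norm_num) (h1 s hs)) hs'.1 hlt hs.2 le_rfl hu le_rfl
  have h4 := norm_log_sub_div_le (D z).contDiff_path h1 h2 hs'.1 hlt hs.2
  have h5 := norm_log_sub_div_le (D z).contDiff_path h1 h2 le_rfl hu le_rfl
  rw [sub_eq_iff_eq_add] at h3
  rw [h3]
  refine (norm_add_le _ _).trans ?_
  linarith [norm_sub_le (ℓ z (a + δ) (a - δ))
    (Complex.log (((D z).path (a + δ) - (D z).path (a - δ)) / e))]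

/-- A bound for the logarithm that is uniform in the parameter. -/
theorem exists_bound (hD : IsCurveFamily U D) (hℓ : IsFamilyLog U D ℓ) (hz : z₀ ∈ U) (p q : ℝ) :
    ∃ C, ∀ᶠ z in 𝓝 z₀, ∀ s ∈ Icc p q, ∀ s' ∈ Icc p q, s ≠ s' →
      ‖SpectralCurve.principalLog (ℓ z) s s'‖ ≤ C + |Real.log (s - s')| := by
  have key : ∃ C, ∀ᶠ z in 𝓝 z₀, ∀ y ∈ Icc p q ×ˢ Icc p q, y.2 < y.1 →
      ‖ℓ z y.1 y.2‖ ≤ C + |Real.log (y.1 - y.2)| := by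
    refine (isCompact_Icc.prod isCompact_Icc).induction_on (p := fun A : Set (ℝ × ℝ) =>
      ∃ C, ∀ᶠ z in 𝓝 z₀, ∀ y ∈ A, y.2 < y.1 → ‖ℓ z y.1 y.2‖ ≤ C + |Real.log (y.1 - y.2)|)
      ⟨0, by simp⟩ ?_ ?_ ?_
    · rintro A B hAB ⟨C, hC⟩
      exact ⟨C, hC.mono fun z h y hy => h y (hAB hy)⟩
    · rintro A B ⟨C, hC⟩ ⟨C', hC'⟩
      refine ⟨max C C', ?_⟩
      filter_upwards [hC, hC'] with z h h' y hy hlt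
      rcases hy with hy | hy
      · linarith [h y hy hlt, le_max_left C C']
      · linarith [h' y hy hlt, le_max_right C C']
    · rintro ⟨a, b⟩ -
      rcases lt_trichotomy b a with hba | rfl | hba
      · have hc := (hℓ.continuousAt hD.isOpen hz hba).norm.eventually (ge_mem_nhds (lt_add_one _))
        rw [nhds_prod_eq] at hc
        obtain ⟨pa, hpa, pb, hpb, hab⟩ := eventually_prod_iff.mp hc
        refine ⟨{y | pb y}, mem_nhdsWithin_of_mem_nhds hpb, ‖ℓ z₀ a b‖ + 1, ?_⟩
        filter_upwards [hpa] with z hza y hy _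
        exact (hab hza hy).trans (le_add_of_nonneg_right (abs_nonneg _))
      · obtain ⟨A, hA, C, hC⟩ := exists_bound_near_diagonal hD hℓ hz b
        exact ⟨A, mem_nhdsWithin_of_mem_nhds hA, C, hC⟩
      · refine ⟨{y | y.1 < y.2}, mem_nhdsWithin_of_mem_nhds
          ((isOpen_lt continuous_fst continuous_snd).mem_nhds hba), 0, ?_⟩
        exact Eventually.of_forall fun z y hy hlt => absurd hlt (not_lt.mpr (le_of_lt hy))
  obtain ⟨C, hC⟩ := key
  refine ⟨C, hC.mono fun z h s hs s' hs' hne => ?_⟩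
  rcases lt_or_gt_of_ne hne with hlt | hlt
  · rw [principalLog_of_le _ hlt.le, ← Real.log_abs, abs_sub_comm, Real.log_abs]
    exact h (s', s) ⟨hs', hs⟩ hlt
  · rw [principalLog_of_lt _ hlt]
    exact h (s, s') ⟨hs, hs'⟩ hlt

end IsFamilyLog

namespace IsCurveFamily

variable {U : Set ℂ} {D : ℂ → SpectralCurve g W t} {z₀ : ℂ}

theorem exists_bound_ρ₀ (hD : IsCurveFamily U D) (ht : t ≠ 0) (hz : z₀ ∈ U) (p q : ℝ) :
    ∃ M, ∀ᶠ z in 𝓝 z₀, ∀ s ∈ Icc p q, ‖(D z).ρ₀ s‖ ≤ M := by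
  have h2 := SpectralCurve.two_pi_I_mul_ne_zero ht
  obtain ⟨M, hM⟩ := exists_eventually_forall_le (isCompact_Icc (a := p) (b := q)) (z₀ := z₀)
    (F := fun y : ℂ × ℝ => ‖deriv (D y.1).path y.2‖ *
      (‖(D y.1).curvePoly.eval ((D y.1).path y.2)‖ + 1) / ‖2 * Real.pi * Complex.I * t‖)
    fun s _ => by
      have h3 := ContinuousAt.comp (g := fun y : ℂ × ℂ => (D y.1).curvePoly.eval y.2)
        (f := fun y : ℂ × ℝ => (y.1, (D y.1).path y.2)) (x := (z₀, s))
        (hD.continuousAt_eval_curvePoly hz _)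
        (continuousAt_fst.prodMk (hD.continuousAt_path hz s))
      exact ((hD.continuousAt_tangent hz s).norm.mul (h3.norm.add continuousAt_const)).div_const _
  refine ⟨M, hM.mono fun z h s hs => le_trans ?_ (h s hs)⟩
  rw [(D z).ρ₀_eq ht, norm_div, norm_mul]
  have := (D z).norm_edge_sq_le ht s
  gcongr
  nlinarith [sq_nonneg (‖(D z).edge s‖ - 1), norm_nonneg ((D z).edge s)]

/-- The branch points form a finite set of parameters, negligible under the integral. At other
points of the cuts the continued local branch applies, and off the cuts the density stays zero under
small changes of the parameter. -/
theorem continuousAt_ρ₀ (hD : IsCurveFamily U D) (ht : t ≠ 0) (hz : z₀ ∈ U) {s : ℝ}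
    (hs : ∀ i, s ≠ (D z₀).lo i ∧ s ≠ (D z₀).hi i) : ContinuousAt (fun z => (D z).ρ₀ s) z₀ := by
  by_cases hsc : s ∈ (D z₀).cutSet
  · obtain ⟨i, hi⟩ := (D z₀).mem_cutSet.mp hsc
    have hlo : (D z₀).lo i < s := lt_of_le_of_ne hi.1 (hs i).1.symm
    have hhi : s < (D z₀).hi i := lt_of_le_of_ne hi.2 (hs i).2
    obtain ⟨s₁, h1, s₂, h2, r, hr, Y, hch, hY⟩ := (D z₀).exists_chart_cut (p := (D z₀).lo 0 - 1)
      (q := (D z₀).hi (Fin.last g) + 1) (by linarith) (by linarith) ⟨le_rfl, hlo⟩ ⟨hhi, le_rfl⟩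
    have hev := hD.eventually_isLocalBranch ht hz hch (half_pos hr) (half_lt_self hr)
      (by linarith) (by linarith) h1.1 h2.2 ⟨h1.2, h2.1⟩ rfl hY
    have hx : (D z₀).path s ∈ Metric.ball ((D z₀).path s) r := Metric.mem_ball_self hr
    have hYc : ContinuousAt Y ((D z₀).path s) :=
      (hY.differentiableOn.differentiableAt (Metric.isOpen_ball.mem_nhds hx)).continuousAt
    have hP0 : (D z₀).curvePoly.eval ((D z₀).path s) ≠ 0 := by
      rw [← hY.sq _ hx]
      exact pow_ne_zero 2 (hY.ne_zero ht hch (by linarith) (by linarith) h1.1 h2.2 hx)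
    have hpath := hD.continuousAt_path_left hz s
    have hfb := ContinuousAt.comp (x := z₀) (f := fun z => (z, (D z).path s))
      (g := fun p : ℂ × ℂ => familyBranch D z₀ Y p.1 p.2)
      (hD.continuousAt_familyBranch hz hYc hP0) (continuousAt_id.prodMk hpath)
    have htan : ContinuousAt (fun z => deriv (D z).path s) z₀ :=
      ContinuousAt.comp (f := fun z : ℂ => (z, s)) (hD.continuousAt_tangent hz s) (by fun_prop)
    refine ((htan.mul hfb).div_const (2 * Real.pi * Complex.I * t)).congr ?_
    filter_upwards [hev, hD.eventually_chart hz hch (half_lt_self hr),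
      hpath.eventually (Metric.ball_mem_nhds _ (half_pos hr))] with z hz1 hz2 hz3
    rw [(D z).ρ₀_eq ht, SpectralCurve.edge_eq ht hz2 hz1.1 ⟨h1.2, h2.1⟩ hz3]
    rfl
  · have key : ∀ i, ∀ᶠ z in 𝓝 z₀, s ∉ Icc ((D z).lo i) ((D z).hi i) := by
      intro i
      have hi : s ∉ Icc ((D z₀).lo i) ((D z₀).hi i) := fun h => hsc ((D z₀).mem_cutSet.mpr ⟨i, h⟩)
      rw [mem_Icc, not_and_or, not_le, not_le] at hi
      rcases hi with hi | hi
      · filter_upwards [(hD.continuousAt_lo hz i).eventually (lt_mem_nhds hi)] with z h h'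
        exact h'.1.not_gt h
      · filter_upwards [(hD.continuousAt_hi hz i).eventually (gt_mem_nhds hi)] with z h h'
        exact h'.2.not_gt h
    refine continuousAt_const.congr (f := fun _ => (0 : ℂ)) ?_
    filter_upwards [eventually_all.mpr key] with z h
    refine ((D z).ρ₀_eq_zero fun hc => ?_).symm
    obtain ⟨i, hi⟩ := (D z).mem_cutSet.mp hc
    exact h i hi

end IsCurveFamily

/-! ### The logarithmic energy. -/

section Log

variable {γ : ℝ → ℂ} {ℓ : ℝ → ℝ → ℂ}

theorem IsLog.continuousAt_principalLog (h : IsLog γ ℓ) {s s' : ℝ} (hs : s ≠ s') :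
    ContinuousAt (fun p : ℝ × ℝ => SpectralCurve.principalLog ℓ p.1 p.2) (s, s') := by
  rcases lt_or_gt_of_ne hs with hlt | hlt
  · have h1 : ContinuousAt (fun p : ℝ × ℝ => ℓ p.2 p.1) (s, s') :=
      ContinuousAt.comp (f := Prod.swap) (g := fun p : ℝ × ℝ => ℓ p.1 p.2) (x := (s, s'))
        (h.continuousAt hlt) continuous_swap.continuousAt
    refine h1.congr ?_
    filter_upwards [(isOpen_lt continuous_fst continuous_snd).mem_nhds
      (show (s, s') ∈ {p : ℝ × ℝ | p.1 < p.2} from hlt)] with p hp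
    exact (principalLog_of_le ℓ (le_of_lt hp)).symm
  · refine (h.continuousAt hlt).congr ?_
    filter_upwards [(isOpen_lt continuous_snd continuous_fst).mem_nhds
      (show (s, s') ∈ {p : ℝ × ℝ | p.2 < p.1} from hlt)] with p hp
    exact (principalLog_of_lt ℓ hp).symm

theorem IsLog.aestronglyMeasurable_principalLog (h : IsLog γ ℓ) (s : ℝ) :
    AEStronglyMeasurable (SpectralCurve.principalLog ℓ s) volume := by
  have h1 : ContinuousOn (SpectralCurve.principalLog ℓ s) {s}ᶜ := fun s' hs' =>
    (ContinuousAt.comp (f := fun s' => (s, s'))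
      (h.continuousAt_principalLog (Ne.symm hs')) (by fun_prop)).continuousWithinAt
  have h2 := h1.aestronglyMeasurable (μ := volume) (measurableSet_singleton s).compl
  rwa [Measure.restrict_eq_self_of_ae_mem] at h2
  exact compl_mem_ae_iff.mpr (measure_singleton s)

theorem ae_fst_ne_snd : ∀ᵐ y : ℝ × ℝ, y.1 ≠ y.2 := by
  have hm : MeasurableSet {p : ℝ × ℝ | p.1 = p.2} :=
    measurableSet_eq_fun measurable_fst measurable_snd
  rw [ae_iff]
  simp only [ne_eq, not_not]
  rw [Measure.volume_eq_prod, Measure.measure_prod_null hm]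
  refine Eventually.of_forall fun x => ?_
  have : Prod.mk x ⁻¹' {p : ℝ × ℝ | p.1 = p.2} = {x} := by
    ext y; simp [eq_comm]
  simp only [this]
  exact measure_singleton x

theorem IsLog.aestronglyMeasurable_principalLog_prod (h : IsLog γ ℓ) :
    AEStronglyMeasurable (fun p : ℝ × ℝ => SpectralCurve.principalLog ℓ p.1 p.2) volume := by
  have hm : MeasurableSet {p : ℝ × ℝ | p.1 = p.2} :=
    measurableSet_eq_fun measurable_fst measurable_snd
  have h1 : ContinuousOn (fun p : ℝ × ℝ => SpectralCurve.principalLog ℓ p.1 p.2)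
      {p : ℝ × ℝ | p.1 = p.2}ᶜ := fun p hp =>
    (h.continuousAt_principalLog hp).continuousWithinAt
  have h2 := h1.aestronglyMeasurable (μ := volume) hm.compl
  rwa [Measure.restrict_eq_self_of_ae_mem] at h2
  exact ae_fst_ne_snd

theorem integrableOn_log (a b C : ℝ) :
    IntegrableOn (fun u : ℝ => C + |Real.log u|) (Icc a b) := by
  rcases le_total a b with hab | hab
  · rw [integrableOn_Icc_iff_integrableOn_Ioc, ← intervalIntegrable_iff_integrableOn_Ioc_of_le hab]
    exact intervalIntegrable_const.add intervalIntegral.intervalIntegrable_log'.abs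
  · refine IntegrableOn.mono_set (t := {a}) (by simp) fun x hx => ?_
    exact le_antisymm (hx.2.trans hab) hx.1

theorem integrable_indicator_log (a b C M : ℝ) :
    Integrable ((Icc a b).indicator fun x => (|C| + |Real.log x|) * M) :=
  (integrable_indicator_iff measurableSet_Icc).mpr ((integrableOn_log a b |C|).mul_const M)

theorem indicator_log_nonneg {a b C M : ℝ} (hM : 0 ≤ M) (x : ℝ) :
    0 ≤ (Icc a b).indicator (fun x => (|C| + |Real.log x|) * M) x :=
  indicator_nonneg (fun _ _ => by positivity) x

/-- The logarithm of the difference is integrable against the product of a bounded and an integrable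
density of bounded support. -/
theorem integrable_principalLog_mul_mul (h : IsLog γ ℓ) {p q C M : ℝ}
    (hC : ∀ s ∈ Icc p q, ∀ s' ∈ Icc p q, s ≠ s' →
      ‖SpectralCurve.principalLog ℓ s s'‖ ≤ C + |Real.log (s - s')|)
    {u v : ℝ → ℂ} (hu : AEStronglyMeasurable u volume) (hu0 : ∀ s ∉ Icc p q, u s = 0)
    (hM : ∀ s, ‖u s‖ ≤ M) (hv : Integrable v) (hv0 : ∀ s ∉ Icc p q, v s = 0) :
    Integrable fun y : ℝ × ℝ => SpectralCurve.principalLog ℓ y.1 y.2 * u y.1 * v y.2 := by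
  have hM0 : 0 ≤ M := (norm_nonneg _).trans (hM 0)
  -- The majorant is the integrand of the convolution of |v| with the truncated kernel M (|C| +
  -- |log|), both of which are integrable.
  have hint := Integrable.convolution_integrand (ContinuousLinearMap.mul ℝ ℝ) hv.norm
    (integrable_indicator_log (p - q) (q - p) C M) (μ := volume) (ν := volume)
  refine Integrable.mono' hint ?_ ?_
  · exact (h.aestronglyMeasurable_principalLog_prod.mul (hu.comp_fst (ν := volume))).mul
      (hv.aestronglyMeasurable.comp_snd (μ := volume))
  · filter_upwards [ae_fst_ne_snd] with y hy
    simp only [ContinuousLinearMap.mul_apply']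
    by_cases h12 : y.1 ∈ Icc p q ∧ y.2 ∈ Icc p q
    · obtain ⟨h1, h2⟩ := h12
      have h3 : y.1 - y.2 ∈ Icc (p - q) (q - p) :=
        ⟨by linarith [h1.1, h2.2], by linarith [h1.2, h2.1]⟩
      rw [indicator_of_mem h3, norm_mul, norm_mul, mul_comm]
      have h4 := (hC _ h1 _ h2 hy).trans (add_le_add_left (le_abs_self C) _)
      gcongr
      exact hM _
    · have h0 : u y.1 * v y.2 = 0 := by
        rcases not_and_or.mp h12 with h1 | h1
        · rw [hu0 _ h1, zero_mul]
        · rw [hv0 _ h1, mul_zero]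
      rw [mul_assoc, h0, mul_zero, norm_zero]
      exact mul_nonneg (norm_nonneg _) (indicator_log_nonneg hM0 _)

/-- Fubini together with the symmetry of the principal value. Only one of the two densities is
required to be bounded, as the variation of ρ₀ is unbounded at the branch points. -/
theorem integral_logPotential_comm (h : IsLog γ ℓ) {p q C M : ℝ}
    (hC : ∀ s ∈ Icc p q, ∀ s' ∈ Icc p q, s ≠ s' →
      ‖SpectralCurve.principalLog ℓ s s'‖ ≤ C + |Real.log (s - s')|)
    {u v : ℝ → ℂ} (hu : AEStronglyMeasurable u volume) (hu0 : ∀ s ∉ Icc p q, u s = 0)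
    (hM : ∀ s, ‖u s‖ ≤ M) (hv : Integrable v) (hv0 : ∀ s ∉ Icc p q, v s = 0) :
    ∫ s, logPotential ℓ u s * v s = ∫ s, logPotential ℓ v s * u s := by
  have hi := integrable_principalLog_mul_mul h hC hu hu0 hM hv hv0
  have h1 := integral_integral_swap (f := fun s s' =>
    SpectralCurve.principalLog ℓ s s' * u s * v s') hi
  calc ∫ s, logPotential ℓ u s * v s
      = ∫ s', ∫ s, SpectralCurve.principalLog ℓ s s' * u s * v s' := by
        refine integral_congr_ae (Eventually.of_forall fun s' => ?_)
        simp only [logPotential]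
        rw [← integral_mul_const]
        simp only [principalLog_comm ℓ s']
    _ = ∫ s, ∫ s', SpectralCurve.principalLog ℓ s s' * u s * v s' := h1.symm
    _ = _ := by
        refine integral_congr_ae (Eventually.of_forall fun s => ?_)
        simp only [logPotential]
        rw [← integral_mul_const]
        refine integral_congr_ae (Eventually.of_forall fun s' => ?_)
        simp only
        ring

/-- The logarithmic potential of a continuous density is continuous. -/
theorem continuousAt_logPotential (h : IsLog γ ℓ) {p q C M : ℝ}
    (hC : ∀ s ∈ Icc p q, ∀ s' ∈ Icc p q, s ≠ s' →
      ‖SpectralCurve.principalLog ℓ s s'‖ ≤ C + |Real.log (s - s')|)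
    {v : ℝ → ℂ} (hv : Continuous v) (hv0 : ∀ s ∉ Icc p q, v s = 0) (hM : ∀ s, ‖v s‖ ≤ M)
    {s₀ : ℝ} (hs₀ : s₀ ∈ Ioo p q) : ContinuousAt (logPotential ℓ v) s₀ := by
  -- The substitution s' = u + s places the singularity at u = 0 for every s, which allows a
  -- majorant independent of s.
  have heq : logPotential ℓ v = fun s =>
      ∫ u, SpectralCurve.principalLog ℓ s (u + s) * v (u + s) := by
    funext s
    exact (integral_add_right_eq_self (fun s' => SpectralCurve.principalLog ℓ s s' * v s') s).symm
  rw [heq]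
  have hM0 : 0 ≤ M := (norm_nonneg _).trans (hM 0)
  refine continuousAt_of_dominated ?_ ?_ (integrable_indicator_log (p - q) (q - p) C M) ?_
  · refine Eventually.of_forall fun s => ?_
    exact ((h.aestronglyMeasurable_principalLog s).mul
      hv.aestronglyMeasurable).comp_quasiMeasurePreserving
      (measurePreserving_add_right volume s).quasiMeasurePreserving
  · filter_upwards [Ioo_mem_nhds hs₀.1 hs₀.2] with s hs
    filter_upwards [compl_mem_ae_iff.mpr (measure_singleton (0 : ℝ))] with u hu
    by_cases h1 : u + s ∈ Icc p q
    · have h3 : u ∈ Icc (p - q) (q - p) := ⟨by linarith [h1.1, hs.2], by linarith [h1.2, hs.1]⟩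
      have h4 := hC s (Ioo_subset_Icc_self hs) _ h1 (by simpa using hu)
      rw [show s - (u + s) = -u by ring, Real.log_neg_eq_log] at h4
      rw [indicator_of_mem h3, norm_mul]
      have h5 := h4.trans (add_le_add_left (le_abs_self C) _)
      exact mul_le_mul h5 (hM _) (norm_nonneg _) ((norm_nonneg _).trans h5)
    · rw [hv0 _ h1, mul_zero, norm_zero]
      exact indicator_log_nonneg hM0 _
  · filter_upwards [compl_mem_ae_iff.mpr (measure_singleton (0 : ℝ))] with u hu
    refine ContinuousAt.mul ?_ (by fun_prop)
    exact ContinuousAt.comp (f := fun s => (s, u + s))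
      (h.continuousAt_principalLog (by simpa using hu)) (by fun_prop)

end Log

variable {g : ℕ} {W : ℂ[X]} {t : ℂ}

/-! ### Existence of the prepotential, and the constants on the cuts. -/

namespace SpectralCurve

variable (D : SpectralCurve g W t) {ℓ : ℝ → ℝ → ℂ}

variable {D} in
theorem exists_bound_principalLog (hℓ : IsLog D.path ℓ) (p q : ℝ) :
    ∃ C, ∀ s ∈ Icc p q, ∀ s' ∈ Icc p q, s ≠ s' →
      ‖principalLog ℓ s s'‖ ≤ C + |Real.log (s - s')| := by
  -- The bound for a single curve is the uniform bound for the constant family.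
  have hD : IsCurveFamily univ fun _ : ℂ => D := by
    refine ⟨isOpen_univ, fun k => differentiableOn_const _, ?_, ?_, fun i => continuousOn_const,
      fun i => continuousOn_const⟩
    · exact (D.contDiff_path.continuous.comp continuous_snd).continuousOn
    · exact ((D.contDiff_path.continuous_deriv le_rfl).comp continuous_snd).continuousOn
  have hL : IsFamilyLog univ (fun _ : ℂ => D) fun _ => ℓ := by
    refine ⟨?_, fun z _ => hℓ.exp_eq⟩
    exact hℓ.continuousOn.comp (f := fun p : ℂ × ℝ × ℝ => p.2) continuousOn_snd fun p hp => hp.2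
  obtain ⟨C, hC⟩ := hL.exists_bound hD (mem_univ 0) p q
  exact ⟨C, hC.self_of_nhds⟩

theorem ρ₀_eq_zero_of_notMem_Icc {s : ℝ} (hs : s ∉ Icc (D.lo 0) (D.hi (Fin.last g))) :
    D.ρ₀ s = 0 := D.ρ₀_eq_zero fun h => hs (D.cutSet_subset h)

variable {D} in
theorem converges (ht : t ≠ 0) (hℓ : IsLog D.path ℓ) : D.Converges ℓ := by
  obtain ⟨C, hC⟩ := exists_bound_principalLog hℓ (D.lo 0) (D.hi (Fin.last g))
  obtain ⟨M, hM⟩ := D.exists_bound_ρ₀ ht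
  refine ⟨D.exists_tendsto_density, D.integrable_ρ₀ ht, ?_, ?_⟩
  · refine Continuous.integrable_of_hasCompactSupport ?_ D.hasCompactSupport_ρ₀.mul_left
    exact (W.continuous.comp D.contDiff_path.continuous).mul (D.continuous_ρ₀ ht)
  · exact integrable_principalLog_mul_mul hℓ hC (D.continuous_ρ₀ ht).aestronglyMeasurable
      (fun _ => D.ρ₀_eq_zero_of_notMem_Icc) hM (D.integrable_ρ₀ ht)
      (fun _ => D.ρ₀_eq_zero_of_notMem_Icc)

variable {D} in
theorem continuous_logPotential_ρ₀ (ht : t ≠ 0) (hℓ : IsLog D.path ℓ) :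
    Continuous (logPotential ℓ D.ρ₀) := by
  refine continuous_iff_continuousAt.mpr fun s₀ => ?_
  obtain ⟨M, hM⟩ := D.exists_bound_ρ₀ ht
  obtain ⟨C, hC⟩ := exists_bound_principalLog hℓ (min (D.lo 0) (s₀ - 1))
    (max (D.hi (Fin.last g)) (s₀ + 1))
  refine continuousAt_logPotential hℓ hC (D.continuous_ρ₀ ht) (fun s hs => ?_) hM
    ⟨min_lt_of_right_lt (by linarith), lt_max_of_lt_right (by linarith)⟩
  exact D.ρ₀_eq_zero_of_notMem_Icc fun h => hs ⟨min_le_of_left_le h.1, le_max_of_le_left h.2⟩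

variable {D} in
theorem continuous_effPotential (ht : t ≠ 0) (hℓ : IsLog D.path ℓ) :
    Continuous (D.effPotential ℓ) :=
  (W.continuous.comp D.contDiff_path.continuous).sub
    (continuous_const.mul (continuous_logPotential_ρ₀ ht hℓ))

/-- The value of the effective potential on a cut. -/
def cutPotential (ℓ : ℝ → ℝ → ℂ) (i : Fin (g + 1)) : ℂ := D.effPotential ℓ (D.lo i)

variable {D} in
theorem effPotential_eq_cutPotential (ht : t ≠ 0) (hℓ : IsLog D.path ℓ) {i : Fin (g + 1)} {s : ℝ}
    (hs : s ∈ Icc (D.lo i) (D.hi i)) : D.effPotential ℓ s = D.cutPotential ℓ i := by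
  have hc := continuous_effPotential ht hℓ
  have h := intervalIntegral.integral_eq_sub_of_hasDerivAt_of_le hs.1 (f' := fun _ => 0)
    hc.continuousOn (fun u hu => D.hasDerivAt_effPotential_cut ht hℓ
      ⟨hu.1, hu.2.trans_le hs.2⟩) intervalIntegrable_const
  rw [intervalIntegral.integral_zero] at h
  exact (sub_eq_zero.mp h.symm)

theorem notMem_cutSet_of_mem_gap {i : Fin g} {s : ℝ}
    (hs : s ∈ Ioo (D.hi i.castSucc) (D.lo i.succ)) : s ∉ D.cutSet := by
  rw [mem_cutSet]
  rintro ⟨j, hj⟩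
  rcases le_or_gt j i.castSucc with h | h
  · exact (hj.2.trans (D.strictMono_hi.monotone h)).not_gt hs.1
  · have h' : i.succ ≤ j := Fin.castSucc_lt_iff_succ_le.mp h
    exact ((D.strictMono_lo.monotone h').trans hj.1).not_gt hs.2

variable {D} in
-- Integrate the derivative y₀ λ' of the effective potential over the gap. The return on the lower
-- sheet reverses both the direction and the sign of y, which doubles the integral and explains the
-- factor 1/2.
theorem cutPotential_succ_sub (ht : t ≠ 0) (hℓ : IsLog D.path ℓ) (i : Fin g) :
    D.cutPotential ℓ i.succ - D.cutPotential ℓ i.castSucc = 1 / 2 * D.βPeriod i := by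
  have hle := (D.hi_lt_lo i).le
  have hsub : Ioo (D.hi i.castSucc) (D.lo i.succ) ⊆ D.cutSetᶜ := fun s hs =>
    D.notMem_cutSet_of_mem_gap hs
  have hy : ContinuousOn (fun s => D.y₀ (D.path s) * deriv D.path s)
      (Ioo (D.hi i.castSucc) (D.lo i.succ)) := fun s hs =>
    (((D.differentiableAt_y₀ (fun h => hsub hs (D.path_mem_cuts.mp h))).continuousAt.comp
      D.contDiff_path.continuous.continuousAt).mul
      (D.contDiff_path.continuous_deriv le_rfl).continuousAt).continuousWithinAt
  obtain ⟨C, hC⟩ := (isCompact_Icc (a := D.hi i.castSucc)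
    (b := D.lo i.succ)).exists_bound_of_continuousOn
    (f := fun s => (‖D.curvePoly.eval (D.path s)‖ + 1) * ‖deriv D.path s‖) (by
      have h1 := D.contDiff_path.continuous
      have h2 := D.contDiff_path.continuous_deriv le_rfl
      have h3 := D.curvePoly.continuous.comp h1
      exact ((h3.norm.add continuous_const).mul h2.norm).continuousOn)
  -- The values of y₀ at the branch points are unspecified, so regularity is used only on the open
  -- gap, with the bound |y₀| ≤ |P| + 1 up to its ends.
  have hint : IntervalIntegrable (fun s => D.y₀ (D.path s) * deriv D.path s) volume
      (D.hi i.castSucc) (D.lo i.succ) := by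
    rw [intervalIntegrable_iff_integrableOn_Ioo_of_le hle]
    refine Integrable.mono' (g := fun _ => C) (by simp)
      (hy.aestronglyMeasurable measurableSet_Ioo) ?_
    filter_upwards [ae_restrict_mem measurableSet_Ioo] with s hs
    have h1 := norm_le_add_one_of_sq_eq (D.y₀_sq fun h => hsub hs (D.path_mem_cuts.mp h))
    rw [norm_mul]
    exact (mul_le_mul_of_nonneg_right h1 (norm_nonneg _)).trans
      ((le_abs_self _).trans (hC s (Ioo_subset_Icc_self hs)))
  have h := intervalIntegral.integral_eq_sub_of_hasDerivAt_of_le hle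
    (continuous_effPotential ht hℓ).continuousOn (fun s hs =>
      D.hasDerivAt_effPotential_gap ht hℓ (hsub hs)
      ⟨((D.lo_zero_le i.castSucc).trans (D.lo_lt_hi _).le).trans hs.1.le,
        (hs.2.le.trans (D.lo_lt_hi _).le).trans (D.hi_le_last i.succ)⟩) hint
  rw [effPotential_eq_cutPotential ht hℓ (right_mem_Icc.mpr (D.lo_lt_hi i.castSucc).le)] at h
  rw [cutPotential, ← h, βPeriod, zetaIntegral, zetaIntegral]
  simp only [neg_mul]
  rw [intervalIntegral.integral_neg, intervalIntegral.integral_symm (D.hi i.castSucc)]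
  ring

/-- Integration of a density against a function that is constant on each open cut. -/
theorem integral_mul_eq_sum_cuts {v w : ℝ → ℂ} {c : Fin (g + 1) → ℂ} (hv : Integrable v)
    (hv0 : ∀ s ∉ D.cutSet, v s = 0) (hw : ∀ i, ∀ s ∈ Ioo (D.lo i) (D.hi i), w s = c i) :
    Integrable (fun s => w s * v s) ∧
      ∫ s, w s * v s = ∑ i, c i * ∫ s in (D.lo i)..(D.hi i), v s := by
  have hfin : (⋃ i, ({D.lo i, D.hi i} : Set ℝ)).Finite := finite_iUnion fun i => by simp
  have hae : (fun s => w s * v s) =ᵐ[volume]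
      fun s => ∑ i, (Ioo (D.lo i) (D.hi i)).indicator (fun s => c i * v s) s := by
    filter_upwards [compl_mem_ae_iff.mpr (hfin.measure_zero volume)] with s hs
    simp only [mem_compl_iff, mem_iUnion, mem_insert_iff, mem_singleton_iff, not_exists,
      not_or] at hs
    by_cases hsc : s ∈ D.cutSet
    · obtain ⟨i, hi⟩ := D.mem_cutSet.mp hsc
      have hi' : s ∈ Ioo (D.lo i) (D.hi i) :=
        ⟨lt_of_le_of_ne hi.1 (Ne.symm (hs i).1), lt_of_le_of_ne hi.2 (hs i).2⟩
      rw [Finset.sum_eq_single_of_mem i (Finset.mem_univ i), indicator_of_mem hi', hw i s hi']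
      intro j _ hj
      refine indicator_of_notMem (fun hj' => hj ?_) _
      exact D.eq_of_mem_Icc_of_mem_Icc (Ioo_subset_Icc_self hj') hi
    · rw [hv0 s hsc, mul_zero, Finset.sum_eq_zero]
      intro i _
      rw [indicator_apply, hv0 s hsc, mul_zero, ite_self]
  have hint : ∀ i ∈ Finset.univ, Integrable fun s =>
      (Ioo (D.lo i) (D.hi i)).indicator (fun s => c i * v s) s := fun i _ =>
    (hv.const_mul (c i)).indicator measurableSet_Ioo
  refine ⟨(integrable_finsetSum _ hint).congr hae.symm, ?_⟩
  rw [integral_congr_ae hae, integral_finsetSum _ hint]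
  refine Finset.sum_congr rfl fun i _ => ?_
  rw [integral_indicator measurableSet_Ioo, ← integral_Ioc_eq_integral_Ioo,
    ← intervalIntegral.integral_of_le (D.lo_lt_hi i).le, intervalIntegral.integral_const_mul]

theorem integrable_eval_path_mul {v : ℝ → ℂ} (hv : Integrable v) (hv0 : ∀ s ∉ D.cutSet, v s = 0) :
    Integrable fun s => W.eval (D.path s) * v s := by
  have hc := W.continuous.comp D.contDiff_path.continuous
  obtain ⟨C, hC⟩ := D.isCompact_cutSet.exists_bound_of_continuousOn hc.continuousOn
  refine (hv.norm.const_mul C).mono' (hc.aestronglyMeasurable.mul hv.aestronglyMeasurable) ?_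
  refine Eventually.of_forall fun s => ?_
  by_cases hs : s ∈ D.cutSet
  · rw [norm_mul]
    exact mul_le_mul_of_nonneg_right (hC s hs) (norm_nonneg _)
  · simp [hv0 s hs]

variable {D} in
/-- Pairing of the effective potential with a density. -/
theorem integral_eval_path_mul (ht : t ≠ 0) (hℓ : IsLog D.path ℓ) {v : ℝ → ℂ} (hv : Integrable v)
    (hv0 : ∀ s ∉ D.cutSet, v s = 0) :
    ∫ s, W.eval (D.path s) * v s =
      (∑ i, D.cutPotential ℓ i * ∫ s in (D.lo i)..(D.hi i), v s) +
        2 * t * ∫ s, logPotential ℓ D.ρ₀ s * v s := by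
  have h1 := D.integral_mul_eq_sum_cuts hv hv0 (w := D.effPotential ℓ) (c := D.cutPotential ℓ)
    fun i s hs => effPotential_eq_cutPotential ht hℓ (Ioo_subset_Icc_self hs)
  have h2 := D.integrable_eval_path_mul hv hv0
  have h3 : ∫ s, 2 * t * (logPotential ℓ D.ρ₀ s * v s) =
      ∫ s, (W.eval (D.path s) * v s - D.effPotential ℓ s * v s) := by
    congr 1; funext s
    rw [effPotential]; ring
  rw [integral_const_mul, integral_sub h2 h1.1, h1.2] at h3
  rw [h3]; ring

variable {D} in
-- Pairing W = Φ + 2tV with tρ₀ gives t²∫Vρ₀ = (t/2)∫Wρ₀ - ½ Σ Φ_i S_i, which eliminates the double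
-- integral.
theorem prepotential_eq (ht : t ≠ 0) (hℓ : IsLog D.path ℓ) :
    D.prepotential ℓ = -(t / 2) * (∫ s, W.eval (D.path s) * D.ρ₀ s) -
      1 / 2 * ∑ i, D.cutPotential ℓ i * D.S i := by
  have h := integral_eval_path_mul ht hℓ (D.integrable_ρ₀ ht) fun s hs => D.ρ₀_eq_zero hs
  have h1 : ∫ s, ∫ s', principalLog ℓ s s' * D.ρ₀ s * D.ρ₀ s' =
      ∫ s, logPotential ℓ D.ρ₀ s * D.ρ₀ s := by
    congr 1; funext s
    rw [logPotential, ← integral_mul_const]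
    congr 1; funext s'
    ring
  have h2 : ∑ i, D.cutPotential ℓ i * D.S i =
      t * ∑ i, D.cutPotential ℓ i * ∫ s in (D.lo i)..(D.hi i), D.ρ₀ s := by
    rw [Finset.mul_sum]
    refine Finset.sum_congr rfl fun i _ => ?_
    rw [S]; ring
  rw [prepotential, h1, h2]
  linear_combination -(t / 2) * h

variable {D} in
/-- The symmetry of the logarithmic energy, for the density and a variation of it. -/
theorem mul_integral_eval_path_mul_varDensity (ht : t ≠ 0) (hℓ : IsLog D.path ℓ) {q : ℂ[X]}
    {Ψ : Fin (g + 1) → ℂ}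
    (hΨ : ∀ i, ∀ s ∈ Ioo (D.lo i) (D.hi i), logPotential ℓ (D.varDensity q) s = Ψ i) :
    t * ∫ s, W.eval (D.path s) * D.varDensity q s =
      (∑ i, D.cutPotential ℓ i * (t * ∫ s in (D.lo i)..(D.hi i), D.varDensity q s)) +
        ∑ i, 2 * t * Ψ i * D.S i := by
  have hv := D.integrable_varDensity ht q
  have hv0 : ∀ s ∉ D.cutSet, D.varDensity q s = 0 := fun s hs => D.varDensity_eq_zero q hs
  have hr0 : ∀ s ∉ D.cutSet, D.ρ₀ s = 0 := fun s hs => D.ρ₀_eq_zero hs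
  obtain ⟨C, hC⟩ := exists_bound_principalLog hℓ (D.lo 0) (D.hi (Fin.last g))
  obtain ⟨M, hM⟩ := D.exists_bound_ρ₀ ht
  have hcomm := integral_logPotential_comm hℓ hC (D.continuous_ρ₀ ht).aestronglyMeasurable
    (D.eq_zero_of_notMem_Icc hr0 le_rfl le_rfl) hM hv (D.eq_zero_of_notMem_Icc hv0 le_rfl le_rfl)
  rw [integral_eval_path_mul ht hℓ hv hv0, hcomm,
    (D.integral_mul_eq_sum_cuts (D.integrable_ρ₀ ht) hr0 hΨ).2, mul_add, Finset.mul_sum,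
    Finset.mul_sum, Finset.mul_sum]
  congr 1 <;> refine Finset.sum_congr rfl fun i _ => ?_
  · ring
  · rw [S]; ring

end SpectralCurve

/-! ### Moments of the density and their parameter derivatives. -/

/-- Differentiation under the integral sign for integrands holomorphic in the parameter. -/
theorem hasDerivAt_intervalIntegral {a b : ℝ} (hab : a ≤ b) {F : ℂ → ℝ → ℂ} {F' : ℝ → ℂ}
    {z₀ : ℂ} {M : ℝ} (h : ∀ᶠ z in 𝓝 z₀, ContinuousOn (F z) (Icc a b) ∧
      ∀ τ ∈ Icc a b, DifferentiableAt ℂ (fun z => F z τ) z ∧ ‖F z τ‖ ≤ M)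
    (hF' : ∀ τ ∈ Icc a b, HasDerivAt (fun z => F z τ) (F' τ) z₀) :
    HasDerivAt (fun z => ∫ τ in a..b, F z τ) (∫ τ in a..b, F' τ) z₀ := by
  obtain ⟨r, hr, hball⟩ := Metric.eventually_nhds_iff_ball.mp h
  simp only [intervalIntegral.integral_of_le hab]
  have h1 := hasDerivAt_integral_of_differentiableOn_ball (μ := volume.restrict (Ioc a b))
    (F := F) (b := fun _ => M) hr
    (fun z hz => ((hball z hz).1.mono Ioc_subset_Icc_self).aestronglyMeasurable measurableSet_Ioc)
    (by
      filter_upwards [ae_restrict_mem measurableSet_Ioc] with τ hτ z hz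
      exact ((hball z hz).2 τ (Ioc_subset_Icc_self hτ)).1.differentiableWithinAt)
    (by
      filter_upwards [ae_restrict_mem measurableSet_Ioc] with τ hτ z hz
      exact ((hball z hz).2 τ (Ioc_subset_Icc_self hτ)).2)
    (integrable_const M)
  rwa [setIntegral_congr_fun measurableSet_Ioc fun τ hτ =>
    (hF' τ (Ioc_subset_Icc_self hτ)).deriv] at h1

theorem eq_mul_exp_integral {f a : ℝ → ℂ} (ha : ContinuousOn a (Icc 0 1))
    (hf : ∀ u ∈ Icc (0 : ℝ) 1, HasDerivAt f (f u * a u) u) :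
    f 1 = f 0 * Complex.exp (∫ u in (0 : ℝ)..1, a u) := by
  set A : ℝ → ℂ := fun u => ∫ τ in (0 : ℝ)..u, a τ with hA
  have hAc : ContinuousOn A (Icc 0 1) := by
    have := intervalIntegral.continuousOn_primitive_interval (μ := volume) (a := 0) (b := 1) (f := a)
      (by rw [uIcc_of_le zero_le_one]; exact ha.integrableOn_Icc)
    rwa [uIcc_of_le zero_le_one] at this
  have hAd : ∀ u ∈ Ioo (0 : ℝ) 1, HasDerivAt A (a u) u := by
    intro u hu
    refine intervalIntegral.integral_hasDerivAt_right ?_ ?_ ?_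
    · refine (ha.mono ?_).intervalIntegrable
      rw [uIcc_of_le hu.1.le]
      exact Icc_subset_Icc_right hu.2.le
    · exact ⟨Ioo 0 1, Ioo_mem_nhds hu.1 hu.2, (ha.mono Ioo_subset_Icc_self).aestronglyMeasurable
        measurableSet_Ioo⟩
    · exact ha.continuousAt (Icc_mem_nhds hu.1 hu.2)
  have h := intervalIntegral.integral_eq_sub_of_hasDerivAt_of_le zero_le_one
    (f := fun u => f u * Complex.exp (-A u)) (f' := fun _ => 0)
    (ContinuousOn.mul (fun u hu => (hf u hu).continuousAt.continuousWithinAt)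
      (Complex.continuous_exp.comp_continuousOn hAc.neg))
    (fun u hu => by
      have h1 := (hf u (Ioo_subset_Icc_self hu)).mul (hAd u hu).neg.cexp
      refine h1.congr_deriv ?_
      ring) intervalIntegrable_const
  rw [intervalIntegral.integral_zero] at h
  have h0 : A 0 = 0 := intervalIntegral.integral_same
  have h2 : f 1 * Complex.exp (-A 1) = f 0 := by
    rw [h0, neg_zero, Complex.exp_zero, mul_one] at h
    exact sub_eq_zero.mp h.symm
  rw [← h2, mul_assoc, ← Complex.exp_add]
  simp [hA]

variable {g : ℕ} {W : ℂ[X]} {t : ℂ}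

namespace SpectralCurve

variable (D : SpectralCurve g W t)

/-- Moments of a density from its resolvent on a large circle. -/
theorem integral_comp_path_mul {v : ℝ → ℂ} (hv : Integrable v) (hv0 : ∀ s ∉ D.cutSet, v s = 0)
    {R : ℝ} (hR : ∀ s ∈ D.cutSet, D.path s ∈ Metric.ball 0 R) {φ : ℂ → ℂ}
    (hφ : DifferentiableOn ℂ φ (Metric.closedBall 0 R)) :
    ∫ s, φ (D.path s) * v s = ∫ θ in (0 : ℝ)..2 * Real.pi,
      (2 * Real.pi * Complex.I)⁻¹ * deriv (circleMap 0 R) θ * φ (circleMap 0 R θ) *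
        -(∫ s, v s / (D.path s - circleMap 0 R θ)) := by
  have hR0 : 0 < R := by
    have := hR (D.lo 0) (D.mem_cutSet.mpr ⟨0, le_rfl, (D.lo_lt_hi 0).le⟩)
    exact Metric.pos_of_mem_ball this
  have hsph : ∀ θ, circleMap 0 R θ ∈ Metric.closedBall (0 : ℂ) R := fun θ =>
    circleMap_mem_closedBall 0 hR0.le θ
  have hne : ∀ s ∈ D.cutSet, ∀ θ, circleMap 0 R θ - D.path s ≠ 0 := fun s hs θ h => by
    have h1 := hR s hs
    rw [← sub_eq_zero.mp h] at h1
    simp [abs_of_pos hR0] at h1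
  set k : ℝ → ℝ → ℂ := fun s θ => (2 * Real.pi * Complex.I)⁻¹ * deriv (circleMap 0 R) θ *
    φ (circleMap 0 R θ) / (circleMap 0 R θ - D.path s) with hk
  have hkc : ContinuousOn (Function.uncurry k) (D.cutSet ×ˢ Icc 0 (2 * Real.pi)) := by
    have hcm : Continuous fun y : ℝ × ℝ => circleMap 0 R y.2 :=
      (continuous_circleMap 0 R).comp continuous_snd
    refine ContinuousOn.div ?_ (hcm.sub (D.contDiff_path.continuous.comp
      continuous_fst)).continuousOn fun y hy => hne _ hy.1 _
    refine ContinuousOn.mul ?_ (hφ.continuousOn.comp hcm.continuousOn fun y _ => hsph y.2)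
    simp only [deriv_circleMap]
    exact (continuous_const.mul (((continuous_circleMap 0 R).comp continuous_snd).mul
      continuous_const)).continuousOn
  have hKc := D.isCompact_cutSet.prod (isCompact_Icc (a := (0 : ℝ)) (b := 2 * Real.pi))
  obtain ⟨C, hC⟩ := hKc.exists_bound_of_continuousOn hkc
  have hms : MeasurableSet D.cutSet := D.isCompact_cutSet.measurableSet
  have hint : Integrable (Function.uncurry fun s θ => k s θ * v s)
      ((volume.restrict D.cutSet).prod (volume.restrict (Ioc 0 (2 * Real.pi)))) := by
    have h1 : Integrable (fun y : ℝ × ℝ => v y.1)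
        ((volume.restrict D.cutSet).prod (volume.restrict (Ioc 0 (2 * Real.pi)))) :=
      hv.restrict.comp_fst _
    refine (h1.norm.const_mul C).mono' ?_ ?_
    · refine AEStronglyMeasurable.mul ?_ h1.aestronglyMeasurable
      rw [Measure.prod_restrict]
      exact (hkc.mono (prod_mono le_rfl Ioc_subset_Icc_self)).aestronglyMeasurable
        (hms.prod measurableSet_Ioc)
    · rw [Measure.prod_restrict]
      filter_upwards [ae_restrict_mem (hms.prod measurableSet_Ioc)] with y hy
      rw [Function.uncurry_def, norm_mul]
      exact mul_le_mul_of_nonneg_right (hC y ⟨hy.1, Ioc_subset_Icc_self hy.2⟩) (norm_nonneg _)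
  have hpi : (0 : ℝ) ≤ 2 * Real.pi := by positivity
  -- Cauchy's integral formula on the large circle expresses φ(λ(s)) through values on the circle;
  -- Fubini then collects the resolvent of v.
  have hcauchy : ∀ s ∈ D.cutSet, ∫ θ in Ioc 0 (2 * Real.pi), k s θ = φ (D.path s) := by
    intro s hs
    have h1 := Complex.two_pi_I_inv_smul_circleIntegral_sub_inv_smul_of_differentiable_on_off_countable
      countable_empty (hR s hs) hφ.continuousOn fun x hx => hφ.differentiableAt
        (Metric.closedBall_mem_nhds_of_mem hx.1)
    rw [circleIntegral, ← intervalIntegral.integral_smul,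
      intervalIntegral.integral_of_le hpi] at h1
    rw [← h1]
    refine integral_congr_ae (Eventually.of_forall fun θ => ?_)
    simp only [hk, smul_eq_mul]
    ring
  have hzero : ∀ s ∉ D.cutSet, φ (D.path s) * v s = 0 := fun s hs => by rw [hv0 s hs, mul_zero]
  rw [← setIntegral_eq_integral_of_forall_compl_eq_zero hzero,
    setIntegral_congr_fun hms fun s hs => by
      show _ = ∫ θ in Ioc 0 (2 * Real.pi), k s θ * v s
      rw [integral_mul_const, hcauchy s hs],
    integral_integral_swap hint, intervalIntegral.integral_of_le hpi]
  refine integral_congr_ae (Eventually.of_forall fun θ => ?_)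
  simp only
  rw [← setIntegral_eq_integral_of_forall_compl_eq_zero (s := D.cutSet)
    (f := fun s => v s / (D.path s - circleMap 0 R θ))
    fun s hs => by rw [hv0 s hs, zero_div], ← integral_neg, ← integral_const_mul]
  refine setIntegral_congr_fun hms fun s hs => ?_
  simp only [hk]
  rw [← neg_sub (circleMap 0 R θ), div_neg]
  ring

end SpectralCurve

namespace IsCurveFamily

variable {U : Set ℂ} {D : ℂ → SpectralCurve g W t} {z₀ : ℂ}

theorem eventually_cutSet_path (hD : IsCurveFamily U D) (hz : z₀ ∈ U) {R : ℝ}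
    (hR : ∀ s ∈ (D z₀).cutSet, (D z₀).path s ∈ Metric.ball 0 R) :
    ∀ᶠ z in 𝓝 z₀, ∀ s ∈ (D z).cutSet, (D z).path s ∈ Metric.ball 0 R := by
  have key : ∀ i : Fin (g + 1), ∀ᶠ z in 𝓝 z₀, ∀ τ ∈ Icc (0 : ℝ) 1,
      (D z).path ((D z).lo i + τ * ((D z).hi i - (D z).lo i)) ∈ Metric.ball 0 R := by
    intro i
    refine isCompact_Icc.eventually_forall_of_forall_eventually fun τ hτ => ?_
    have h1 := ContinuousAt.comp (g := fun p : ℂ × ℝ => (D p.1).path p.2) (x := (z₀, τ))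
      (f := fun p : ℂ × ℝ => (p.1, (D p.1).lo i + p.2 * ((D p.1).hi i - (D p.1).lo i)))
      (hD.continuousAt_path hz _) (hD.continuousAt_cutParam hz i τ)
    refine h1.eventually (Metric.isOpen_ball.mem_nhds ?_)
    have h2 : (D z₀).path ((D z₀).lo i + τ * ((D z₀).hi i - (D z₀).lo i)) ∈ (D z₀).cuts :=
      mem_iUnion.mpr ⟨i, (mem_cut_iff _ _ _).mpr ⟨τ, hτ, rfl⟩⟩
    exact hR _ ((D z₀).path_mem_cuts.mp h2)
  filter_upwards [eventually_all.mpr key] with z h s hs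
  obtain ⟨i, hi⟩ := mem_iUnion.mp ((D z).path_mem_cuts.mpr hs)
  obtain ⟨τ, hτ, hx⟩ := (mem_cut_iff _ _ _).mp hi
  rw [← hx]
  exact h i τ hτ

/-- The derivative of an integral of the resolvent over a curve that avoids the cuts. -/
theorem hasDerivAt_integral_resolvent (hD : IsCurveFamily U D) (hz : z₀ ∈ U) {a b : ℝ}
    (hab : a ≤ b) {c k : ℝ → ℂ} (hc : ContinuousOn c (Icc a b)) (hk : ContinuousOn k (Icc a b))
    (hcut : ∀ τ ∈ Icc a b, c τ ∉ (D z₀).cuts) :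
    HasDerivAt (fun z => ∫ τ in a..b, k τ * ((W.derivative.eval (c τ) - (D z).y₀ (c τ)) / (2 * t)))
      (∫ τ in a..b, k τ * (-(varPoly D z₀).eval (c τ) / (4 * t * (D z₀).y₀ (c τ)))) z₀ := by
  have hK : IsCompact (c '' Icc a b) := isCompact_Icc.image_of_continuousOn hc
  have hev : ∀ᶠ z in 𝓝 z₀, ∀ τ ∈ Icc a b, c τ ∉ (D z).cuts := by
    filter_upwards [hD.eventually_notMem_cuts hz hK (by
      rintro _ ⟨τ, hτ, rfl⟩; exact hcut τ hτ)] with z h τ hτ using h _ ⟨τ, hτ, rfl⟩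
  obtain ⟨M, hM⟩ := exists_eventually_forall_le hK (z₀ := z₀)
    (F := fun p : ℂ × ℂ => ‖(D p.1).curvePoly.eval p.2‖)
    fun x _ => (hD.continuousAt_eval_curvePoly hz x).norm
  obtain ⟨B, hB⟩ := isCompact_Icc.exists_bound_of_continuousOn hk
  obtain ⟨A, hA⟩ := hK.exists_bound_of_continuousOn W.derivative.continuous.continuousOn
  refine hasDerivAt_intervalIntegral (M := B * ((A + (M + 1)) / ‖2 * t‖)) hab ?_ ?_
  · filter_upwards [hev, hM, hD.eventually_mem hz] with z h1 h2 h3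
    refine ⟨?_, fun τ hτ => ⟨?_, ?_⟩⟩
    · refine hk.mul (ContinuousOn.div_const (ContinuousOn.sub ?_ ?_) _)
      · exact W.derivative.continuous.comp_continuousOn hc
      · exact fun τ hτ => ContinuousAt.comp_continuousWithinAt (g := (D z).y₀) (f := c)
          ((D z).differentiableAt_y₀ (h1 τ hτ)).continuousAt (hc τ hτ)
    · exact ((((hD.hasDerivAt_y₀ h3 (h1 τ hτ)).differentiableAt.const_sub _).div_const
        _).const_mul _)
    · have h4 := norm_le_add_one_of_sq_eq ((D z).y₀_sq (h1 τ hτ))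
      rw [norm_mul, norm_div]
      have h5 : ‖W.derivative.eval (c τ) - (D z).y₀ (c τ)‖ ≤ A + (M + 1) :=
        (norm_sub_le _ _).trans (add_le_add (hA _ ⟨τ, hτ, rfl⟩) (h4.trans
          (add_le_add (h2 _ ⟨τ, hτ, rfl⟩) le_rfl)))
      have h6 := hB τ hτ
      have : 0 ≤ B := (norm_nonneg _).trans h6
      gcongr
  · intro τ hτ
    refine ((((hD.hasDerivAt_y₀ hz (hcut τ hτ)).const_sub _).div_const
      (2 * t)).const_mul (k τ)).congr_deriv ?_
    rw [← neg_div, div_div]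
    congr 2
    ring

/-- The derivative of a moment of the density. -/
theorem hasDerivAt_integral_comp_path (hD : IsCurveFamily U D) (ht : t ≠ 0) (hz : z₀ ∈ U) {R : ℝ}
    (hR : ∀ s ∈ (D z₀).cutSet, (D z₀).path s ∈ Metric.ball 0 R) {φ : ℂ → ℂ}
    (hφ : DifferentiableOn ℂ φ (Metric.closedBall 0 R)) :
    HasDerivAt (fun z => ∫ s, φ ((D z).path s) * (D z).ρ₀ s)
      (∫ s, φ ((D z₀).path s) * (D z₀).varDensity (varPoly D z₀) s) z₀ := by
  have hR0 : 0 < R := by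
    have := hR ((D z₀).lo 0) ((D z₀).mem_cutSet.mpr ⟨0, le_rfl, ((D z₀).lo_lt_hi 0).le⟩)
    exact Metric.pos_of_mem_ball this
  have hcirc : ∀ z, (∀ s ∈ (D z).cutSet, (D z).path s ∈ Metric.ball 0 R) → ∀ θ,
      circleMap 0 R θ ∉ (D z).cuts := by
    intro z h θ hθ
    rw [SpectralCurve.cuts_eq] at hθ
    obtain ⟨s, hs, hsx⟩ := hθ
    have h1 := h s hs
    rw [hsx] at h1
    simp [abs_of_pos hR0] at h1
  -- Written over a fixed circle, the moment depends on the parameter only through y₀ at points off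
  -- the cuts, so the moving path disappears from the differentiation.
  have h := hD.hasDerivAt_integral_resolvent hz (by positivity : (0 : ℝ) ≤ 2 * Real.pi)
    (c := circleMap 0 R) (k := fun θ => (2 * Real.pi * Complex.I)⁻¹ * deriv (circleMap 0 R) θ *
      φ (circleMap 0 R θ)) (continuous_circleMap 0 R).continuousOn (by
        simp only [deriv_circleMap]
        exact (continuous_const.mul ((continuous_circleMap 0 R).mul
          continuous_const)).continuousOn.mul (hφ.continuousOn.comp
          (continuous_circleMap 0 R).continuousOn fun θ _ => circleMap_mem_closedBall 0 hR0.le θ))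
    fun θ _ => hcirc z₀ hR θ
  rw [(D z₀).integral_comp_path_mul ((D z₀).integrable_varDensity ht _)
    (fun s hs => (D z₀).varDensity_eq_zero _ hs) hR hφ]
  simp only [(D z₀).resolvent_varDensity ht (natDegree_varPoly D z₀) (hcirc z₀ hR _)]
  refine h.congr_of_eventuallyEq ?_
  filter_upwards [hD.eventually_cutSet_path hz hR] with z hz'
  rw [(D z).integral_comp_path_mul ((D z).integrable_ρ₀ ht) (fun s hs => (D z).ρ₀_eq_zero hs) hz' hφ]
  simp only [(D z).resolvent_ρ₀ ht (hcirc z hz' _)]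

end IsCurveFamily

/-! ### The exponentiated potential off the path. -/

theorem logTransform_eq_of_norm_lt {γ : ℝ → ℂ} (hγ : ContDiff ℝ 1 γ) {p q : ℝ} {v : ℝ → ℂ}
    (hv : Integrable v) (hv0 : ∀ s ∉ Icc p q, v s = 0) {x : ℂ}
    (hx : ∀ s ∈ Icc p q, ‖γ s‖ < ‖x‖) (hi : Integrable fun s => Complex.log (1 - γ s / x) * v s) :
    logTransform γ p v x =
      (∫ s, Complex.log (1 - γ s / x) * v s) - Complex.log (1 - γ p / x) * ∫ s, v s := by
  rw [logTransform, ← integral_const_mul, ← integral_sub hi (hv.const_mul _)]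
  refine integral_congr_ae (Eventually.of_forall fun s => ?_)
  simp only
  by_cases hs : s ∈ Icc p q
  · have hx0 : x ≠ 0 := norm_pos_iff.mp ((norm_nonneg _).trans_lt (hx s hs))
    have hslit : ∀ τ ∈ Icc p s, 1 - γ τ / x ∈ Complex.slitPlane := by
      intro τ hτ
      rw [sub_eq_add_neg]
      refine Complex.mem_slitPlane_of_norm_lt_one ?_
      rw [norm_neg, norm_div, div_lt_one (norm_pos_iff.mpr hx0)]
      exact hx τ ⟨hτ.1, hτ.2.trans hs.2⟩
    -- For x farther out than the arc, γ - x = -x (1 - γ/x), where 1 - γ/x stays within distance 1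
    -- of 1 and has a principal logarithm along the whole arc.
    rw [arcLog_eq_sub_of_branch hγ hs.1
      (L := fun τ => Complex.log (1 - γ τ / x) + Complex.log (-x))]
    · ring
    · refine ContinuousOn.add (ContinuousOn.clog ?_ hslit) continuousOn_const
      exact (continuous_const.sub (hγ.continuous.div_const x)).continuousOn
    · intro τ hτ
      rw [Complex.exp_add, Complex.exp_log (Complex.slitPlane_ne_zero (hslit τ hτ)),
        Complex.exp_log (neg_ne_zero.mpr hx0)]
      field_simp
      ring
  · simp [hv0 s hs]

variable {g : ℕ} {W : ℂ[X]} {t : ℂ}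

namespace SpectralCurve

variable (D : SpectralCurve g W t)

/-- The exponential of the logarithmic potential of the density, off the path. -/
def potExp (p : ℝ) (x : ℂ) : ℂ :=
  (x - D.path p) * Complex.exp (logTransform D.path p D.ρ₀ x)

theorem notMem_cuts_of_forall_ne {p q : ℝ} (hp : p ≤ D.lo 0) (hq : D.hi (Fin.last g) ≤ q) {x : ℂ}
    (hx : ∀ τ ∈ Icc p q, D.path τ ≠ x) : x ∉ D.cuts := by
  rw [cuts_eq]
  rintro ⟨s, hs, h⟩
  have := D.cutSet_subset hs
  exact hx s ⟨hp.trans this.1, this.2.trans hq⟩ h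

theorem left_mem_Icc_of_le {p q : ℝ} (hp : p ≤ D.lo 0) (hq : D.hi (Fin.last g) ≤ q) :
    p ∈ Icc p q := ⟨le_rfl, (hp.trans D.lo_lt_hi_last.le).trans hq⟩

theorem potExp_ne_zero {p q : ℝ} (hp : p ≤ D.lo 0) (hq : D.hi (Fin.last g) ≤ q) {x : ℂ}
    (hx : ∀ τ ∈ Icc p q, D.path τ ≠ x) : D.potExp p x ≠ 0 :=
  mul_ne_zero (sub_ne_zero.mpr (hx p (D.left_mem_Icc_of_le hp hq)).symm) (Complex.exp_ne_zero _)

/-- The factor x - λ(p) compensates the term -1/(x - λ(p)) from the base point of `arcLog`, because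
ρ₀ has mass one. The logarithmic derivative is then exactly the resolvent. -/
theorem hasDerivAt_potExp (ht : t ≠ 0) {p q : ℝ} (hp : p ≤ D.lo 0) (hq : D.hi (Fin.last g) ≤ q)
    {x : ℂ} (hx : ∀ τ ∈ Icc p q, D.path τ ≠ x) : HasDerivAt (D.potExp p)
      (D.potExp p x * ((W.derivative.eval x - D.y₀ x) / (2 * t))) x := by
  have h := hasDerivAt_logTransform D.contDiff_path (D.integrable_ρ₀ ht)
    (D.eq_zero_of_notMem_Icc (fun s hs => D.ρ₀_eq_zero hs) hp hq) hx
  have hne : x - D.path p ≠ 0 := sub_ne_zero.mpr (hx p (D.left_mem_Icc_of_le hp hq)).symm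
  rw [D.resolvent_ρ₀ ht (D.notMem_cuts_of_forall_ne hp hq hx), D.integral_ρ₀ ht] at h
  refine (((hasDerivAt_id x).sub_const (D.path p)).mul h.cexp).congr_deriv ?_
  simp only [id, potExp]
  field_simp
  ring

/-- The linear differential equation for `potExp` is solved along the segment. The multiplier
involves only y₀ off the cuts, so it can be differentiated in the parameter. -/
theorem potExp_add (ht : t ≠ 0) {p q : ℝ} (hp : p ≤ D.lo 0) (hq : D.hi (Fin.last g) ≤ q)
    {x d : ℂ} (hx : ∀ u ∈ Icc (0 : ℝ) 1, ∀ τ ∈ Icc p q, D.path τ ≠ x + u * d) :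
    D.potExp p (x + d) = D.potExp p x * Complex.exp (∫ u in (0 : ℝ)..1,
      d * ((W.derivative.eval (x + u * d) - D.y₀ (x + u * d)) / (2 * t))) := by
  have hl : ∀ u : ℝ, HasDerivAt (fun u : ℝ => x + u * d) d u := fun u => by
    simpa using ((hasDerivAt_id u).ofReal_comp.mul_const d).const_add x
  have h := eq_mul_exp_integral (f := fun u : ℝ => D.potExp p (x + u * d))
    (a := fun u : ℝ => d * ((W.derivative.eval (x + u * d) - D.y₀ (x + u * d)) / (2 * t))) ?_ ?_
  · simpa using h
  · intro u hu
    have h1 := (D.differentiableAt_y₀ (D.notMem_cuts_of_forall_ne hp hq (hx u hu))).continuousAt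
    have h2 : ContinuousAt (fun u : ℝ => D.y₀ (x + u * d)) u :=
      ContinuousAt.comp (f := fun u : ℝ => x + u * d) h1 (hl u).continuousAt
    have h3 : ContinuousAt (fun u : ℝ => W.derivative.eval (x + u * d)) u :=
      W.derivative.continuous.continuousAt.comp (hl u).continuousAt
    exact (continuousAt_const.mul ((h3.sub h2).div_const _)).continuousWithinAt
  · intro u hu
    refine ((D.hasDerivAt_potExp ht hp hq (hx u hu)).comp_of_eq u (hl u) rfl).congr_deriv ?_
    ring

/-- A variation of the density has mass zero, so there is no base point term and the formula is
additive. It is the parameter derivative of the multiplier in `potExp_add`. -/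
theorem logTransform_varDensity_add (ht : t ≠ 0) {f : ℂ[X]} (hf : f.natDegree ≤ g)
    (hf' : f.coeff g = 0) {p q : ℝ} (hp : p ≤ D.lo 0) (hq : D.hi (Fin.last g) ≤ q)
    {x d : ℂ} (hx : ∀ u ∈ Icc (0 : ℝ) 1, ∀ τ ∈ Icc p q, D.path τ ≠ x + u * d) :
    logTransform D.path p (D.varDensity f) (x + d) = logTransform D.path p (D.varDensity f) x +
      ∫ u in (0 : ℝ)..1, d * (-f.eval (x + u * d) / (4 * t * D.y₀ (x + u * d))) := by
  have hl : ∀ u : ℝ, HasDerivAt (fun u : ℝ => x + u * d) d u := fun u => by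
    simpa using ((hasDerivAt_id u).ofReal_comp.mul_const d).const_add x
  have hd : ∀ u ∈ Icc (0 : ℝ) 1, HasDerivAt
      (fun u : ℝ => logTransform D.path p (D.varDensity f) (x + u * d))
      (d * (-f.eval (x + u * d) / (4 * t * D.y₀ (x + u * d)))) u := by
    intro u hu
    have h := hasDerivAt_logTransform D.contDiff_path (D.integrable_varDensity ht f)
      (D.eq_zero_of_notMem_Icc (fun s hs => D.varDensity_eq_zero f hs) hp hq) (hx u hu)
    rw [D.resolvent_varDensity ht hf (D.notMem_cuts_of_forall_ne hp hq (hx u hu)),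
      D.integral_varDensity ht hf hf', zero_div, sub_zero] at h
    refine (h.comp_of_eq u (hl u) rfl).congr_deriv ?_
    ring
  have h := intervalIntegral.integral_eq_sub_of_hasDerivAt
    (f := fun u : ℝ => logTransform D.path p (D.varDensity f) (x + u * d))
    (f' := fun u : ℝ => d * (-f.eval (x + u * d) / (4 * t * D.y₀ (x + u * d))))
    (a := 0) (b := 1)
    (fun u hu => hd u (by rwa [uIcc_of_le zero_le_one] at hu)) (by
      refine ContinuousOn.intervalIntegrable ?_
      rw [uIcc_of_le zero_le_one]
      intro u hu
      have hc := D.notMem_cuts_of_forall_ne hp hq (hx u hu)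
      have h2 : ContinuousAt (fun u : ℝ => D.y₀ (x + u * d)) u :=
        ContinuousAt.comp (f := fun u : ℝ => x + u * d) (D.differentiableAt_y₀ hc).continuousAt
          (hl u).continuousAt
      have h3 : ContinuousAt (fun u : ℝ => f.eval (x + u * d)) u :=
        f.continuous.continuousAt.comp (hl u).continuousAt
      exact (continuousAt_const.mul (h3.neg.div (continuousAt_const.mul h2)
        (mul_ne_zero (mul_ne_zero (by norm_num) ht) (D.y₀_ne_zero hc)))).continuousWithinAt)
  rw [h]
  simp

end SpectralCurve

namespace IsCurveFamily

variable {U : Set ℂ} {D : ℂ → SpectralCurve g W t} {z₀ : ℂ}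

theorem eventually_forall_ne (hD : IsCurveFamily U D) (hz : z₀ ∈ U) {p q : ℝ} {K : Set ℂ}
    (hK : IsCompact K) (h : ∀ x ∈ K, ∀ τ ∈ Icc p q, (D z₀).path τ ≠ x) :
    ∀ᶠ z in 𝓝 z₀, ∀ x ∈ K, ∀ τ ∈ Icc p q, (D z).path τ ≠ x := by
  have key : ∀ᶠ z in 𝓝 z₀, ∀ y ∈ K ×ˢ Icc p q, (D z).path y.2 ≠ y.1 := by
    refine (hK.prod isCompact_Icc).eventually_forall_of_forall_eventually ?_
    rintro ⟨x, τ⟩ ⟨hx, hτ⟩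
    have h1 : ContinuousAt (fun p : ℂ × ℂ × ℝ => (D p.1).path p.2.2) (z₀, x, τ) :=
      ContinuousAt.comp (f := fun p : ℂ × ℂ × ℝ => (p.1, p.2.2))
        (g := fun p : ℂ × ℝ => (D p.1).path p.2) (hD.continuousAt_path hz _)
        (x := (z₀, x, τ)) (by fun_prop)
    have h2 : ContinuousAt (fun p : ℂ × ℂ × ℝ => p.2.1) (z₀, x, τ) := by fun_prop
    exact ((h1.sub h2).eventually_ne (sub_ne_zero.mpr (h x hx τ hτ))).mono fun p hp =>
      sub_ne_zero.mp hp
  exact key.mono fun z h x hx τ hτ => h (x, τ) ⟨hx, hτ⟩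

theorem eventually_le_lo (hD : IsCurveFamily U D) (hz : z₀ ∈ U) {p : ℝ} (hp : p < (D z₀).lo 0) :
    ∀ᶠ z in 𝓝 z₀, p < (D z).lo 0 := (hD.continuousAt_lo hz 0).eventually (lt_mem_nhds hp)

theorem eventually_hi_le (hD : IsCurveFamily U D) (hz : z₀ ∈ U) {q : ℝ}
    (hq : (D z₀).hi (Fin.last g) < q) : ∀ᶠ z in 𝓝 z₀, (D z).hi (Fin.last g) < q :=
  (hD.continuousAt_hi hz _).eventually (gt_mem_nhds hq)

/-- Outside a disc containing the path, `potExp` is x times the exponential of the moment of log(1 -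
y/x). This function of y is holomorphic on the disc, so the moment formula applies. -/
theorem hasDerivAt_potExp_far (hD : IsCurveFamily U D) (ht : t ≠ 0) (hz : z₀ ∈ U) {p q : ℝ}
    (hp : p < (D z₀).lo 0) (hq : (D z₀).hi (Fin.last g) < q) {R : ℝ}
    (hR : ∀ s ∈ Icc p q, (D z₀).path s ∈ Metric.ball 0 R) {x : ℂ} (hx : R < ‖x‖) :
    HasDerivAt (fun z => (D z).potExp p x) ((D z₀).potExp p x *
      logTransform (D z₀).path p ((D z₀).varDensity (varPoly D z₀)) x) z₀ := by
  have hpm := (D z₀).left_mem_Icc_of_le hp.le hq.le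
  have hR0 : 0 < R := Metric.pos_of_mem_ball (hR p hpm)
  have hx0 : x ≠ 0 := norm_pos_iff.mp (hR0.trans hx)
  have hcs : ∀ s ∈ (D z₀).cutSet, s ∈ Icc p q := fun s hs =>
    ⟨hp.le.trans ((D z₀).cutSet_subset hs).1, ((D z₀).cutSet_subset hs).2.trans hq.le⟩
  have hslit : ∀ y ∈ Metric.closedBall (0 : ℂ) R, 1 - y / x ∈ Complex.slitPlane := by
    intro y hy
    rw [sub_eq_add_neg]
    refine Complex.mem_slitPlane_of_norm_lt_one ?_
    rw [norm_neg, norm_div, div_lt_one (norm_pos_iff.mpr hx0)]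
    exact (mem_closedBall_zero_iff.mp hy).trans_lt hx
  have hφ : DifferentiableOn ℂ (fun y => Complex.log (1 - y / x)) (Metric.closedBall 0 R) :=
    DifferentiableOn.clog (by fun_prop) hslit
  have hint : ∀ {D' : SpectralCurve g W t} {v : ℝ → ℂ}, Integrable v →
      (∀ s ∉ Icc p q, v s = 0) → (∀ s ∈ Icc p q, D'.path s ∈ Metric.ball 0 R) →
      Integrable fun s => Complex.log (1 - D'.path s / x) * v s := by
    intro D' v hv hv0 hR'
    have hc : ContinuousOn (fun s => Complex.log (1 - D'.path s / x)) (Icc p q) :=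
      hφ.continuousOn.comp D'.contDiff_path.continuous.continuousOn fun s hs =>
        Metric.ball_subset_closedBall (hR' s hs)
    obtain ⟨C, hC⟩ := isCompact_Icc.exists_bound_of_continuousOn hc
    have h1 : IntegrableOn (fun s => Complex.log (1 - D'.path s / x) * v s) (Icc p q) := by
      refine (hv.norm.const_mul C).integrableOn.mono' ((hc.aestronglyMeasurable
        measurableSet_Icc).mul hv.aestronglyMeasurable.restrict) ?_
      filter_upwards [ae_restrict_mem measurableSet_Icc] with s hs
      rw [norm_mul]
      exact mul_le_mul_of_nonneg_right (hC s hs) (norm_nonneg _)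
    rwa [integrableOn_iff_integrable_of_support_subset] at h1
    intro s hs
    by_contra h
    exact hs (by simp [hv0 s h])
  have hE : ∀ D' : SpectralCurve g W t, p ≤ D'.lo 0 → D'.hi (Fin.last g) ≤ q →
      (∀ s ∈ Icc p q, D'.path s ∈ Metric.ball 0 R) →
      D'.potExp p x = x * Complex.exp (∫ s, Complex.log (1 - D'.path s / x) * D'.ρ₀ s) := by
    intro D' hp' hq' hR'
    have hv0 := D'.eq_zero_of_notMem_Icc (fun s hs => D'.ρ₀_eq_zero hs) hp' hq'
    have h1 : 1 - D'.path p / x ≠ 0 := Complex.slitPlane_ne_zero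
      (hslit _ (Metric.ball_subset_closedBall (hR' p hpm)))
    rw [SpectralCurve.potExp, logTransform_eq_of_norm_lt D'.contDiff_path (D'.integrable_ρ₀ ht) hv0
      (fun s hs => (mem_ball_zero_iff.mp (hR' s hs)).trans hx)
      (hint (D'.integrable_ρ₀ ht) hv0 hR'), D'.integral_ρ₀ ht, mul_one, Complex.exp_sub,
      Complex.exp_log h1, mul_div_assoc', div_eq_iff h1, mul_right_comm, mul_sub, mul_one,
      mul_div_cancel₀ _ hx0]
  have hRz : ∀ᶠ z in 𝓝 z₀, ∀ s ∈ Icc p q, (D z).path s ∈ Metric.ball 0 R :=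
    isCompact_Icc.eventually_forall_of_forall_eventually fun s hs =>
      (hD.continuousAt_path hz s).eventually (Metric.isOpen_ball.mem_nhds (hR s hs))
  have hT : logTransform (D z₀).path p ((D z₀).varDensity (varPoly D z₀)) x =
      ∫ s, Complex.log (1 - (D z₀).path s / x) * (D z₀).varDensity (varPoly D z₀) s := by
    have hv := (D z₀).integrable_varDensity ht (varPoly D z₀)
    have hv0 := (D z₀).eq_zero_of_notMem_Icc
      (fun s hs => (D z₀).varDensity_eq_zero (varPoly D z₀) hs) hp.le hq.le
    rw [logTransform_eq_of_norm_lt (D z₀).contDiff_path hv hv0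
      (fun s hs => (mem_ball_zero_iff.mp (hR s hs)).trans hx) (hint hv hv0 hR),
      (D z₀).integral_varDensity ht (natDegree_varPoly D z₀) (coeff_varPoly D z₀), mul_zero,
      sub_zero]
  have h := (hD.hasDerivAt_integral_comp_path ht hz (fun s hs => hR s (hcs s hs)) hφ).cexp.const_mul x
  rw [hE (D z₀) hp.le hq.le hR, hT]
  refine (h.congr_of_eventuallyEq ?_).congr_deriv (by ring)
  filter_upwards [hRz, hD.eventually_le_lo hz hp, hD.eventually_hi_le hz hq] with z h1 h2 h3
  exact hE (D z) h2.le h3.le h1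

/-- The derivative of the logarithmic potential with respect to the parameter. -/
theorem hasDerivAt_potExp_param (hD : IsCurveFamily U D) (ht : t ≠ 0) (hz : z₀ ∈ U) {p q : ℝ}
    (hp : p < (D z₀).lo 0) (hq : (D z₀).hi (Fin.last g) < q) {x : ℂ}
    (hx : ∀ τ ∈ Icc p q, (D z₀).path τ ≠ x) :
    HasDerivAt (fun z => (D z).potExp p x) ((D z₀).potExp p x *
      logTransform (D z₀).path p ((D z₀).varDensity (varPoly D z₀)) x) z₀ := by
  set Q : ℂ → Prop := fun x => HasDerivAt (fun z => (D z).potExp p x) ((D z₀).potExp p x *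
    logTransform (D z₀).path p ((D z₀).varDensity (varPoly D z₀)) x) z₀ with hQ
  have hpq : p ≤ q := ((D z₀).left_mem_Icc_of_le hp.le hq.le).2
  have hpre := isPreconnected_compl_image_Icc (D z₀).contDiff_path (D z₀).deriv_path_ne_zero
    (D z₀).injective_path hpq
  have hclosed : IsClosed ((D z₀).path '' Icc p q) :=
    (isCompact_Icc.image (D z₀).contDiff_path.continuous).isClosed
  have hoff : ∀ {y}, y ∈ ((D z₀).path '' Icc p q)ᶜ ↔ ∀ τ ∈ Icc p q, (D z₀).path τ ≠ y := by
    intro y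
    simp only [mem_compl_iff, mem_image, not_exists, not_and, ne_eq]
  -- The formula passes from one end of a segment off the path to the other, since `potExp` and the
  -- transform of the variation change by an exponential factor and by its logarithmic derivative.
  have hstep : ∀ y d : ℂ, (∀ u ∈ Icc (0 : ℝ) 1, ∀ τ ∈ Icc p q, (D z₀).path τ ≠ y + u * d) →
      Q y → Q (y + d) := by
    intro y d hyd hy
    have hcont : Continuous fun u : ℝ => y + u * d := by fun_prop
    have hev := hD.eventually_forall_ne hz (isCompact_Icc.image hcont)
      (K := (fun u : ℝ => y + u * d) '' Icc 0 1) (by rintro _ ⟨u, hu, rfl⟩; exact hyd u hu)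
    have h1 := hD.hasDerivAt_integral_resolvent (t := t) hz zero_le_one (c := fun u : ℝ => y + u * d)
      (k := fun _ => d) hcont.continuousOn continuousOn_const
      fun u hu => (D z₀).notMem_cuts_of_forall_ne hp.le hq.le (hyd u hu)
    have h2 := hy.mul h1.cexp
    simp only [hQ]
    rw [(D z₀).logTransform_varDensity_add ht (natDegree_varPoly D z₀) (coeff_varPoly D z₀) hp.le
      hq.le hyd, (D z₀).potExp_add ht hp.le hq.le hyd]
    refine (h2.congr_of_eventuallyEq ?_).congr_deriv (by ring)
    filter_upwards [hev, hD.eventually_le_lo hz hp, hD.eventually_hi_le hz hq] with z h3 h4 h5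
    exact (D z).potExp_add ht h4.le h5.le fun u hu => h3 _ ⟨u, hu, rfl⟩
  obtain ⟨R, hR⟩ := (isCompact_Icc (a := p) (b := q)).exists_bound_of_continuousOn
    (D z₀).contDiff_path.continuous.continuousOn
  have hR' : ∀ s ∈ Icc p q, (D z₀).path s ∈ Metric.ball 0 (R + 1) := fun s hs => by
    rw [mem_ball_zero_iff]; linarith [hR s hs]
  have hR0 : 0 ≤ R := (norm_nonneg _).trans (hR p ⟨le_rfl, hpq⟩)
  set x₁ : ℂ := ((R + 2 : ℝ) : ℂ) with hx₁
  have hx₁n : ‖x₁‖ = R + 2 := by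
    rw [hx₁, Complex.norm_real, Real.norm_of_nonneg (by linarith)]
  have hx₁Q : Q x₁ := hD.hasDerivAt_potExp_far ht hz hp hq hR' (by rw [hx₁n]; linarith)
  have hx₁m : x₁ ∈ ((D z₀).path '' Icc p q)ᶜ := hoff.mpr fun τ hτ h => by
    have := hR τ hτ
    rw [h, hx₁n] at this
    linarith
  -- Validity of the formula is locally constant off the path, the complement of the path is
  -- connected, and the far point x₁ starts the propagation.
  have hind := hpre.induction₂ (fun y y' => Q y ↔ Q y') ?_ (fun _ _ _ _ _ _ h h' => h.trans h')
    (fun _ _ _ _ h => h.symm) hx₁m (hoff.mpr hx)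
  · exact hind.mp hx₁Q
  · intro y hy
    obtain ⟨r, hr, hball⟩ := Metric.isOpen_iff.mp hclosed.isOpen_compl y hy
    filter_upwards [mem_nhdsWithin_of_mem_nhds (Metric.ball_mem_nhds y hr)] with y' hy'
    have hseg : ∀ u ∈ Icc (0 : ℝ) 1, ∀ τ ∈ Icc p q, (D z₀).path τ ≠ y + u * (y' - y) := by
      intro u hu
      refine hoff.mp (hball (segment_mem_ball (Metric.mem_ball_self hr) ?_ hu))
      simpa using hy'
    have hseg' : ∀ u ∈ Icc (0 : ℝ) 1, ∀ τ ∈ Icc p q, (D z₀).path τ ≠ y' + u * (y - y') := by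
      intro u hu
      refine hoff.mp (hball (segment_mem_ball hy' ?_ hu))
      simpa using hr
    constructor
    · intro h
      simpa using hstep y (y' - y) hseg h
    · intro h
      simpa using hstep y' (y - y') hseg' h

end IsCurveFamily

/-! ### Relations between opposite points across the path. -/

/-- The points `x₁` and `x₂` lie opposite to each other on the left and on the right of the point
with parameter `s` of a curve. -/
structure Crossing (γ : ℝ → ℂ) (s₁ s₂ : ℝ) (e c : ℂ) (r : ℝ) (x₁ x₂ : ℂ) (s : ℝ) : Prop where
  mem : s ∈ Ioo s₁ s₂
  path_mem : γ s ∈ Metric.ball c r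
  mem_left : x₁ ∈ Metric.ball c r
  mem_right : x₂ ∈ Metric.ball c r
  left : ∃ ε : ℝ, 0 < ε ∧ x₁ = γ s + Complex.I * ε * e
  right : ∃ ε : ℝ, ε < 0 ∧ x₂ = γ s + Complex.I * ε * e

section Potential

variable {γ : ℝ → ℂ} {ℓ : ℝ → ℝ → ℂ} {p q s₁ s₂ : ℝ} {e c : ℂ} {r : ℝ} {v : ℝ → ℂ} {G H F : ℂ → ℂ}

/-- This trades a primitive of G - 1/(x - γ(p)) for a primitive of G without choosing a logarithm of
x - γ(p): the displayed function has derivative zero on the ball. -/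
theorem Chart.mul_exp_primitive_eq (h : Chart γ p q s₁ s₂ e c r) (hp : p ≤ s₁) (hq : s₂ ≤ q)
    (hF : ∀ x ∈ Metric.ball c r, HasDerivAt F (G x - 1 / (x - γ p)) x) {P : ℂ → ℂ}
    (hP : ∀ x ∈ Metric.ball c r, HasDerivAt P (G x) x) {x y : ℂ} (hx : x ∈ Metric.ball c r)
    (hy : y ∈ Metric.ball c r) :
    (x - γ p) * Complex.exp (F x - P x) = (y - γ p) * Complex.exp (F y - P y) := by
  have hne : ∀ x ∈ Metric.ball c r, x - γ p ≠ 0 := by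
    intro x hx h0
    have hx' : γ p ∈ Metric.ball c r := by rwa [← sub_eq_zero.mp h0]
    have := h.iso p ⟨le_rfl, hp.trans (h.lt.le.trans hq)⟩ hx'
    linarith [this.1]
  have hd : ∀ x ∈ Metric.ball c r,
      HasDerivAt (fun x => (x - γ p) * Complex.exp (F x - P x)) 0 x := by
    intro x hx
    refine (((hasDerivAt_id x).sub_const (γ p)).mul ((hF x hx).sub (hP x hx)).cexp).congr_deriv ?_
    have := hne x hx
    simp only [id, Pi.sub_apply]
    field_simp
    ring
  exact Metric.isOpen_ball.is_const_of_deriv_eq_zero (convex_ball c r).isPreconnected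
    (fun x hx => (hd x hx).differentiableAt.differentiableWithinAt) (fun x hx => (hd x hx).deriv)
    hx hy

variable (h : Chart γ p q s₁ s₂ e c r) (hγ : ContDiff ℝ 1 γ) (hinj : Function.Injective γ)
  (hℓ : IsLog γ ℓ) (hp : p ≤ s₁) (hq : s₂ ≤ q) (hv : Integrable v) (hsupp : ∀ τ ∉ Icc p q, v τ = 0)
  {M : ℝ} (hM : ∀ τ ∈ Icc s₁ s₂, ‖v τ‖ ≤ M) (hS : HasSides γ v s₁ s₂ e c r G H) {x₁ x₂ : ℂ} {s : ℝ}
  (hc : Crossing γ s₁ s₂ e c r x₁ x₂ s) {P Q : ℂ → ℂ}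
  (hP : ∀ x ∈ Metric.ball c r, HasDerivAt P (G x) x)
  (hQ : ∀ x ∈ Metric.ball c r, HasDerivAt Q (H x) x)

include h hγ hinj hℓ hp hq hv hsupp hM hS hc hP hQ

theorem Chart.logTransform_crossing (hm : ∫ τ, v τ = 0) :
    logTransform γ p v x₁ = logPotential ℓ v s + Real.pi * Complex.I * (∫ τ in Ioi s, v τ) +
      (P x₁ - P (γ s)) ∧
    logTransform γ p v x₂ = logPotential ℓ v s - Real.pi * Complex.I * (∫ τ in Ioi s, v τ) +
      (Q x₂ - Q (γ s)) := by
  obtain ⟨ε, hε, h1⟩ := hc.left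
  obtain ⟨ε', hε', h2⟩ := hc.right
  have e1 := h.logTransform_left hγ hinj hℓ hp hq hv hsupp hM hS (F := P)
    (fun x hx => by simpa [hm] using hP x hx) hc.mem hc.path_mem hε (h1 ▸ hc.mem_left)
  have e2 := h.logTransform_right hγ hinj hℓ hp hq hv hsupp hM hS (F := Q)
    (fun x hx => by simpa [hm] using hQ x hx) hc.mem hc.path_mem hε' (h2 ▸ hc.mem_right)
  rw [← h1, hm] at e1
  rw [← h2, hm] at e2
  constructor
  · linear_combination e1
  · linear_combination e2

/-- For mass one the base point would contribute a branch of log(x - γ(p)); exponentiating makes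
this single-valued and removes ℓ(s, p) as well. -/
theorem Chart.exp_logTransform_crossing (hm : ∫ τ, v τ = 1) :
    (x₁ - γ p) * Complex.exp (logTransform γ p v x₁) = Complex.exp (logPotential ℓ v s +
      Real.pi * Complex.I * (∫ τ in Ioi s, v τ) + (P x₁ - P (γ s))) ∧
    (x₂ - γ p) * Complex.exp (logTransform γ p v x₂) = Complex.exp (logPotential ℓ v s -
      Real.pi * Complex.I * (∫ τ in Ioi s, v τ) + (Q x₂ - Q (γ s))) := by
  obtain ⟨ε, hε, h1⟩ := hc.left
  obtain ⟨ε', hε', h2⟩ := hc.right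
  obtain ⟨F, hF⟩ := h.exists_primitive hp hq hS.differentiableOn_left 1
  obtain ⟨K, hK⟩ := h.exists_primitive hp hq hS.differentiableOn_right 1
  have e1 := h.logTransform_left hγ hinj hℓ hp hq hv hsupp hM hS (F := F)
    (fun x hx => by simpa [hm] using hF x hx) hc.mem hc.path_mem hε (h1 ▸ hc.mem_left)
  have e2 := h.logTransform_right hγ hinj hℓ hp hq hv hsupp hM hS (F := K)
    (fun x hx => by simpa [hm] using hK x hx) hc.mem hc.path_mem hε' (h2 ▸ hc.mem_right)
  rw [← h1, hm] at e1
  rw [← h2, hm] at e2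
  have f1 := h.mul_exp_primitive_eq hp hq hF hP hc.mem_left hc.path_mem
  have f2 := h.mul_exp_primitive_eq hp hq hK hQ hc.mem_right hc.path_mem
  have hexp := hℓ.exp_eq s p (hp.trans_lt hc.mem.1)
  have key : ∀ T Fx Fy Px Py V x : ℂ, T - Fx = V - ℓ s p - Fy →
      (x - γ p) * Complex.exp (Fx - Px) = (γ s - γ p) * Complex.exp (Fy - Py) →
      (x - γ p) * Complex.exp T = Complex.exp (V + (Px - Py)) := by
    intro T Fx Fy Px Py V x h3 h4
    rw [← hexp, ← Complex.exp_add] at h4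
    have h5 : T = (Fx - Px) + (V - ℓ s p - Fy + Px) := by linear_combination h3
    rw [h5, Complex.exp_add, ← mul_assoc, h4, ← Complex.exp_add]
    congr 1; ring
  constructor
  · exact key _ _ _ _ _ _ _ (by linear_combination e1) f1
  · exact key _ _ _ _ _ _ _ (by linear_combination e2) f2

end Potential

theorem sub_eq_integral_segment {c : ℂ} {r : ℝ} {P G : ℂ → ℂ}
    (hG : DifferentiableOn ℂ G (Metric.ball c r))
    (hP : ∀ x ∈ Metric.ball c r, HasDerivAt P (G x) x) {x d : ℂ} (hx : x ∈ Metric.ball c r)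
    (hxd : x + d ∈ Metric.ball c r) :
    P (x + d) - P x = ∫ u in (0 : ℝ)..1, d * G (x + u * d) := by
  have hl : ∀ u : ℝ, HasDerivAt (fun u : ℝ => x + u * d) d u := fun u => by
    simpa using ((hasDerivAt_id u).ofReal_comp.mul_const d).const_add x
  have hm : ∀ u ∈ uIcc (0 : ℝ) 1, x + u * d ∈ Metric.ball c r := fun u hu =>
    segment_mem_ball hx hxd (by rwa [uIcc_of_le zero_le_one] at hu)
  rw [intervalIntegral.integral_eq_sub_of_hasDerivAt (f := fun u : ℝ => P (x + u * d))
    (f' := fun u : ℝ => d * G (x + u * d))]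
  · simp
  · intro u hu
    exact ((hP _ (hm u hu)).comp_of_eq u (hl u) rfl).congr_deriv (mul_comm _ _)
  · refine ContinuousOn.intervalIntegrable (continuousOn_const.mul ?_)
    exact hG.continuousOn.comp (fun u _ => (hl u).continuousAt.continuousWithinAt) hm

variable {g : ℕ} {W : ℂ[X]} {t : ℂ}

namespace SpectralCurve

variable (D : SpectralCurve g W t)

theorem integral_Ioi_gap {v : ℝ → ℂ} (hv : Integrable v) (hv0 : ∀ s ∉ D.cutSet, v s = 0) {i : Fin g}
    {s : ℝ} (hs : s ∈ Ioo (D.hi i.castSucc) (D.lo i.succ)) :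
    ∫ τ in Ioi s, v τ = ∑ k ∈ Finset.Ioi i.castSucc, ∫ τ in (D.lo k)..(D.hi k), v τ := by
  have h := (D.integral_mul_eq_sum_cuts hv hv0 (w := (Ioi s).indicator fun _ => 1)
    (c := fun k => if k ∈ Finset.Ioi i.castSucc then 1 else 0) ?_).2
  · rw [← integral_indicator measurableSet_Ioi]
    simp only [ite_mul, one_mul, zero_mul] at h
    rw [Finset.sum_ite_mem, Finset.univ_inter] at h
    rw [← h]
    congr 1; funext τ
    by_cases hτ : τ ∈ Ioi s <;> simp [hτ]
  · intro k τ hτ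
    split_ifs with hk <;> rw [Finset.mem_Ioi] at hk
    · refine indicator_of_mem ?_ _
      exact hs.2.trans_le ((D.strictMono_lo.monotone (Fin.castSucc_lt_iff_succ_le.mp hk)).trans
        hτ.1.le)
    · refine indicator_of_notMem (fun h => ?_) _
      have := D.strictMono_hi.monotone (not_lt.mp hk)
      exact ((hτ.2.le.trans this).trans_lt hs.1).not_gt h

variable {D} {ℓ : ℝ → ℝ → ℂ} {p q s₁ s₂ : ℝ} {e c : ℂ} {r : ℝ}

/-- In the ratio of the left and right values the potential V drops out, and the jump 2πi ∫_{τ>s} ρ₀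
= 2πi Σ_{k>i} S_k/t remains. The variables S_k thereby become visible in functions off the path. -/
theorem potExp_gap (ht : t ≠ 0) (hℓ : IsLog D.path ℓ) (h : Chart D.path p q s₁ s₂ e c r)
    (hp : p ≤ D.lo 0) (hq : D.hi (Fin.last g) ≤ q) {i : Fin g} (h1 : D.hi i.castSucc < s₁)
    (h2 : s₂ < D.lo i.succ) {x d : ℂ} {s : ℝ} (hc : Crossing D.path s₁ s₂ e c r (x + d) x s) :
    D.potExp p (x + d) = D.potExp p x *
      Complex.exp (2 * Real.pi * Complex.I * (∑ k ∈ Finset.Ioi i.castSucc, D.S k / t) +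
        ∫ u in (0 : ℝ)..1, d * ((W.derivative.eval (x + u * d) - D.y₀ (x + u * d)) / (2 * t))) := by
  have hgap : ∀ τ ∈ Ioo s₁ s₂, τ ∈ Ioo (D.hi i.castSucc) (D.lo i.succ) := fun τ hτ =>
    ⟨h1.trans hτ.1, hτ.2.trans h2⟩
  have hdis : ∀ τ ∈ Ioo s₁ s₂, τ ∉ D.cutSet := fun τ hτ => D.notMem_cutSet_of_mem_gap (hgap τ hτ)
  have hρ0 : ∀ s ∉ D.cutSet, D.ρ₀ s = 0 := fun s => D.ρ₀_eq_zero
  have hS := D.hasSides_gap (D.integrable_ρ₀ ht) hρ0 h hp hq hdis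
  obtain ⟨P, hP⟩ := hS.differentiableOn_left.isExactOn_ball
  obtain ⟨M, hM⟩ := D.exists_bound_ρ₀ ht
  have hp1 : p ≤ s₁ := (hp.trans ((D.lo_zero_le _).trans (D.lo_lt_hi _).le)).trans h1.le
  have hq1 : s₂ ≤ q := h2.le.trans ((D.lo_lt_hi _).le.trans ((D.hi_le_last _).trans hq))
  obtain ⟨e1, e2⟩ := h.exp_logTransform_crossing D.contDiff_path D.injective_path hℓ hp1 hq1
    (D.integrable_ρ₀ ht) (D.eq_zero_of_notMem_Icc hρ0 hp hq) (fun τ _ => hM τ) hS hc hP hP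
    (D.integral_ρ₀ ht)
  have hN : ∫ τ in Ioi s, D.ρ₀ τ = ∑ k ∈ Finset.Ioi i.castSucc, D.S k / t := by
    rw [D.integral_Ioi_gap (D.integrable_ρ₀ ht) hρ0 (hgap s hc.mem)]
    refine Finset.sum_congr rfl fun k _ => ?_
    rw [S, mul_div_cancel_left₀ _ ht]
  have hseg := sub_eq_integral_segment hS.differentiableOn_left hP hc.mem_right hc.mem_left
  have hint : ∫ u in (0 : ℝ)..1, d * ((W.derivative.eval (x + u * d) - D.y₀ (x + u * d)) / (2 * t)) =
      P (x + d) - P x := by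
    rw [hseg]
    refine intervalIntegral.integral_congr fun u hu => ?_
    rw [uIcc_of_le zero_le_one] at hu
    rw [D.resolvent_ρ₀ ht (D.notMem_cuts_of_disjoint h hp hq hdis
      (segment_mem_ball hc.mem_right hc.mem_left hu))]
  rw [potExp, potExp, e1, e2, hint, ← hN, ← Complex.exp_add]
  congr 1; ring

theorem logTransform_varDensity_gap (ht : t ≠ 0) (hℓ : IsLog D.path ℓ) {f : ℂ[X]}
    (hf : f.natDegree ≤ g) (hf' : f.coeff g = 0) (h : Chart D.path p q s₁ s₂ e c r)
    (hp : p ≤ D.lo 0) (hq : D.hi (Fin.last g) ≤ q) {i : Fin g} (h1 : D.hi i.castSucc < s₁)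
    (h2 : s₂ < D.lo i.succ) {x d : ℂ} {s : ℝ} (hc : Crossing D.path s₁ s₂ e c r (x + d) x s) :
    logTransform D.path p (D.varDensity f) (x + d) = logTransform D.path p (D.varDensity f) x +
      (2 * Real.pi * Complex.I *
        (∑ k ∈ Finset.Ioi i.castSucc, ∫ τ in (D.lo k)..(D.hi k), D.varDensity f τ) +
        ∫ u in (0 : ℝ)..1, d * (-f.eval (x + u * d) / (4 * t * D.y₀ (x + u * d)))) := by
  have hgap : ∀ τ ∈ Icc s₁ s₂, τ ∈ Ioo (D.hi i.castSucc) (D.lo i.succ) := fun τ hτ =>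
    ⟨h1.trans_le hτ.1, hτ.2.trans_lt h2⟩
  have hdis : ∀ τ ∈ Icc s₁ s₂, τ ∉ D.cutSet := fun τ hτ => D.notMem_cutSet_of_mem_gap (hgap τ hτ)
  have hdis' : ∀ τ ∈ Ioo s₁ s₂, τ ∉ D.cutSet := fun τ hτ => hdis τ (Ioo_subset_Icc_self hτ)
  have hv0 : ∀ s ∉ D.cutSet, D.varDensity f s = 0 := fun s => D.varDensity_eq_zero f
  have hv := D.integrable_varDensity ht f
  have hS := D.hasSides_gap hv hv0 h hp hq hdis'
  obtain ⟨P, hP⟩ := hS.differentiableOn_left.isExactOn_ball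
  have hp1 : p ≤ s₁ := (hp.trans ((D.lo_zero_le _).trans (D.lo_lt_hi _).le)).trans h1.le
  have hq1 : s₂ ≤ q := h2.le.trans ((D.lo_lt_hi _).le.trans ((D.hi_le_last _).trans hq))
  obtain ⟨e1, e2⟩ := h.logTransform_crossing D.contDiff_path D.injective_path hℓ hp1 hq1
    hv (D.eq_zero_of_notMem_Icc hv0 hp hq) (M := 0) (fun τ hτ => by simp [hv0 τ (hdis τ hτ)]) hS hc
    hP hP (D.integral_varDensity ht hf hf')
  have hN := D.integral_Ioi_gap hv hv0 (hgap s (Ioo_subset_Icc_self hc.mem))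
  have hseg := sub_eq_integral_segment hS.differentiableOn_left hP hc.mem_right hc.mem_left
  have hint : ∫ u in (0 : ℝ)..1, d * (-f.eval (x + u * d) / (4 * t * D.y₀ (x + u * d))) =
      P (x + d) - P x := by
    rw [hseg]
    refine intervalIntegral.integral_congr fun u hu => ?_
    rw [uIcc_of_le zero_le_one] at hu
    rw [D.resolvent_varDensity ht hf (D.notMem_cuts_of_disjoint h hp hq hdis'
      (segment_mem_ball hc.mem_right hc.mem_left hu))]
  rw [e1, e2, hint, ← hN]
  ring

/-- In the product of the left and right values the jumps cancel, and exp(2V) = exp((W - Φ)/t)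
remains. The last exponential removes W and accounts for the distance of the two points from the
path. -/
theorem potExp_cut (ht : t ≠ 0) (hℓ : IsLog D.path ℓ) (h : Chart D.path p q s₁ s₂ e c r)
    (hp : p ≤ D.lo 0) (hq : D.hi (Fin.last g) ≤ q) {i : Fin (g + 1)} (h1 : D.lo i < s₁)
    (h2 : s₂ < D.hi i) {Y : ℂ → ℂ} (hY : D.IsLocalBranch s₁ s₂ e c r Y) {x d : ℂ} {s : ℝ}
    (hc : Crossing D.path s₁ s₂ e c r (x + d) x s) :
    Complex.exp (-(D.cutPotential ℓ i / t)) = D.potExp p (x + d) * D.potExp p x *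
      Complex.exp (-((W.eval (x + d) + W.eval x) / (2 * t)) +
        (∫ u in (0 : ℝ)..1, d * Y (x + u * d)) / (2 * t)) := by
  have hρ0 : ∀ s ∉ D.cutSet, D.ρ₀ s = 0 := fun s => D.ρ₀_eq_zero
  have hS := D.hasSides_ρ₀_cut ht h hp hq hY
  obtain ⟨P, hP⟩ := hY.differentiableOn.isExactOn_ball
  obtain ⟨M, hM⟩ := D.exists_bound_ρ₀ ht
  have hp1 : p ≤ s₁ := (hp.trans (D.lo_zero_le _)).trans h1.le
  have hq1 : s₂ ≤ q := h2.le.trans ((D.hi_le_last _).trans hq)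
  have hL : ∀ x ∈ Metric.ball c r, HasDerivAt (fun x => (W.eval x - P x) / (2 * t))
      ((W.derivative.eval x - Y x) / (2 * t)) x := fun x hx =>
    ((W.hasDerivAt x).sub (hP x hx)).div_const _
  have hR : ∀ x ∈ Metric.ball c r, HasDerivAt (fun x => (W.eval x + P x) / (2 * t))
      ((W.derivative.eval x + Y x) / (2 * t)) x := fun x hx =>
    ((W.hasDerivAt x).add (hP x hx)).div_const _
  obtain ⟨e1, e2⟩ := h.exp_logTransform_crossing D.contDiff_path D.injective_path hℓ hp1 hq1
    (D.integrable_ρ₀ ht) (D.eq_zero_of_notMem_Icc hρ0 hp hq) (fun τ _ => hM τ) hS hc hL hR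
    (D.integral_ρ₀ ht)
  have hΦ := effPotential_eq_cutPotential ht hℓ (i := i) (s := s)
    ⟨(h1.trans hc.mem.1).le, (hc.mem.2.trans h2).le⟩
  rw [potExp, potExp, e1, e2, ← sub_eq_integral_segment hY.differentiableOn hP hc.mem_right
    hc.mem_left, ← hΦ, effPotential, ← Complex.exp_add, ← Complex.exp_add]
  congr 1
  field_simp
  ring

/-- The linearised form of `potExp_cut`: a sum replaces the product, and twice the potential of the
variation remains. -/
theorem logTransform_varDensity_cut (ht : t ≠ 0) (hℓ : IsLog D.path ℓ) {f : ℂ[X]}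
    (hf : f.natDegree ≤ g) (hf' : f.coeff g = 0) (h : Chart D.path p q s₁ s₂ e c r)
    (hp : p ≤ D.lo 0) (hq : D.hi (Fin.last g) ≤ q) {i : Fin (g + 1)} (h1 : D.lo i < s₁)
    (h2 : s₂ < D.hi i) {Y : ℂ → ℂ} (hY : D.IsLocalBranch s₁ s₂ e c r Y) {x d : ℂ} {s : ℝ}
    (hc : Crossing D.path s₁ s₂ e c r (x + d) x s) :
    logTransform D.path p (D.varDensity f) (x + d) + logTransform D.path p (D.varDensity f) x +
      (∫ u in (0 : ℝ)..1, d * (f.eval (x + u * d) / (2 * Y (x + u * d)))) / (2 * t) =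
      2 * logPotential ℓ (D.varDensity f) s := by
  have hv0 : ∀ s ∉ D.cutSet, D.varDensity f s = 0 := fun s => D.varDensity_eq_zero f
  have hv := D.integrable_varDensity ht f
  have hY0 : ∀ x ∈ Metric.ball c r, Y x ≠ 0 := fun x hx => hY.ne_zero ht h hp hq h1 h2 hx
  have hS := D.hasSides_varDensity_cut ht hf h hp hq hY hY0
  have hk : DifferentiableOn ℂ (fun x => f.eval x / (2 * Y x)) (Metric.ball c r) :=
    f.differentiable.differentiableOn.div (hY.differentiableOn.const_mul 2)
      fun x hx => mul_ne_zero two_ne_zero (hY0 x hx)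
  obtain ⟨P, hP⟩ := hk.isExactOn_ball
  obtain ⟨M, hM⟩ := (isCompact_Icc (a := s₁) (b := s₂)).exists_bound_of_continuousOn
    (f := D.varDensity f) fun τ hτ => (D.continuousAt_varDensity ht f
      ⟨h1.trans_le hτ.1, hτ.2.trans_lt h2⟩).continuousWithinAt
  have hp1 : p ≤ s₁ := (hp.trans (D.lo_zero_le _)).trans h1.le
  have hq1 : s₂ ≤ q := h2.le.trans ((D.hi_le_last _).trans hq)
  have hL : ∀ x ∈ Metric.ball c r, HasDerivAt (fun x => -P x / (2 * t))
      (-f.eval x / (4 * t * Y x)) x := fun x hx => by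
    refine ((hP x hx).neg.div_const (2 * t)).congr_deriv ?_
    have := hY0 x hx
    field_simp
    norm_num
  have hR : ∀ x ∈ Metric.ball c r, HasDerivAt (fun x => P x / (2 * t))
      (f.eval x / (4 * t * Y x)) x := fun x hx => by
    refine ((hP x hx).div_const (2 * t)).congr_deriv ?_
    have := hY0 x hx
    field_simp
    norm_num
  obtain ⟨e1, e2⟩ := h.logTransform_crossing D.contDiff_path D.injective_path hℓ hp1 hq1
    hv (D.eq_zero_of_notMem_Icc hv0 hp hq) hM hS hc hL hR (D.integral_varDensity ht hf hf')
  rw [e1, e2, ← sub_eq_integral_segment hk hP hc.mem_right hc.mem_left]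
  field_simp
  ring

end SpectralCurve

variable {g : ℕ} {W : ℂ[X]} {t : ℂ}

theorem exists_opposite_points {c e : ℂ} {r : ℝ} (hr : 0 < r) :
    ∃ η : ℝ, 0 < η ∧ c + Complex.I * η * e ∈ Metric.ball c r ∧
      c + Complex.I * (-η : ℝ) * e ∈ Metric.ball c r := by
  have h1 : ContinuousAt (fun u : ℝ => c + Complex.I * u * e) 0 := by fun_prop
  have h2 : ContinuousAt (fun u : ℝ => c + Complex.I * (-u : ℝ) * e) 0 := by fun_prop
  have hc : Metric.ball c r ∈ 𝓝 c := Metric.ball_mem_nhds c hr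
  have e1 : ∀ᶠ u : ℝ in 𝓝 0, c + Complex.I * u * e ∈ Metric.ball c r ∧
      c + Complex.I * (-u : ℝ) * e ∈ Metric.ball c r :=
    inter_mem (h1.preimage_mem_nhds (t := Metric.ball c r) (by simpa using hc))
      (h2.preimage_mem_nhds (t := Metric.ball c r) (by simpa using hc))
  obtain ⟨η, ⟨ha, hb⟩, hη⟩ := ((e1.filter_mono (nhdsWithin_le_nhds (s := Ioi 0))).and
    self_mem_nhdsWithin).exists
  exact ⟨η, hη, ha, hb⟩

namespace IsCurveFamily

variable {U : Set ℂ} {D : ℂ → SpectralCurve g W t} {ℓ : ℂ → ℝ → ℝ → ℂ} {z₀ : ℂ}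

/-- The two points are fixed while the curve moves. Their difference is parallel to I e, so they
share one foot on each perturbed curve, and `eventually_left` keeps them on their sides. -/
theorem eventually_crossing (hD : IsCurveFamily U D) (hz : z₀ ∈ U) {p q s₁ s₂ : ℝ} {e c : ℂ}
    {r r' : ℝ} (h : Chart (D z₀).path p q s₁ s₂ e c r) (hr : r' < r) {s₀ : ℝ} (hs₀ : s₀ ∈ Ioo s₁ s₂)
    (hc : (D z₀).path s₀ = c) {η : ℝ} (hη : 0 < η) {x d : ℂ}
    (hx : x = c + Complex.I * (-η : ℝ) * e) (hxd : x + d = c + Complex.I * η * e)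
    (hx' : x ∈ Metric.ball c r') (hxd' : x + d ∈ Metric.ball c r') :
    ∀ᶠ z in 𝓝 z₀, ∃ s, Crossing (D z).path s₁ s₂ e c r' (x + d) x s := by
  have hl := hD.eventually_left hz h (σ := 1) (Ioo_subset_Icc_self hs₀) (ε := η) (by simpa using hη)
  have hr' := hD.eventually_left hz h (σ := -1) (Ioo_subset_Icc_self hs₀) (ε := -η)
    (by simpa using hη)
  rw [hc] at hl hr'
  filter_upwards [hl, hr', hD.eventually_chart hz h hr] with z h1 h2 hch
  obtain ⟨s, hs, ε, hε⟩ := hch.exists_eq (D z).contDiff_path hxd'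
  have hd : d = Complex.I * (2 * η) * e := by
    have : x + d - x = Complex.I * (2 * η) * e := by rw [hxd, hx]; push_cast; ring
    simpa using this
  have hxs : x = (D z).path s + Complex.I * (ε - 2 * η : ℝ) * e := by
    have : x = x + d - d := by ring
    rw [this, hε, hd]; push_cast; ring
  have hs' := Ioo_subset_Icc_self hs
  have hεpos : 0 < ε := by simpa using h1 s hs' ε (by rw [← hε, hxd])
  have hεneg : ε - 2 * η < 0 := by
    have := h2 s hs' (ε - 2 * η) (by rw [← hxs, hx])
    linarith
  refine ⟨s, hs, ?_, hxd', hx', ⟨ε, hεpos, hε⟩, ⟨_, hεneg, hxs⟩⟩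
  have hu : (2 * η - ε) / (2 * η) ∈ Icc (0 : ℝ) 1 :=
    ⟨div_nonneg (by linarith) (by linarith), (div_le_one (by linarith)).mpr (by linarith)⟩
  have := segment_mem_ball hx' hxd' hu
  convert this using 1
  have hη' : (η : ℂ) ≠ 0 := by exact_mod_cast hη.ne'
  rw [hxs, hd]
  push_cast
  field_simp
  ring

theorem continuousAt_logPotential (hD : IsCurveFamily U D) (hℓ : IsFamilyLog U D ℓ) (ht : t ≠ 0)
    (hz : z₀ ∈ U) (s : ℝ) :
    ContinuousAt (fun z => logPotential (ℓ z) (D z).ρ₀ s) z₀ := by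
  set p := min ((D z₀).lo 0 - 1) s with hp
  set q := max ((D z₀).hi (Fin.last g) + 1) s with hq
  have hps : s ∈ Icc p q := ⟨min_le_right _ _, le_max_right _ _⟩
  have hp' : p < (D z₀).lo 0 := min_lt_of_left_lt (by linarith)
  have hq' : (D z₀).hi (Fin.last g) < q := lt_max_of_lt_left (by linarith)
  obtain ⟨C, hC⟩ := hℓ.exists_bound hD hz p q
  obtain ⟨M, hM⟩ := hD.exists_bound_ρ₀ ht hz p q
  have hM0 : 0 ≤ M := (norm_nonneg _).trans (hM.self_of_nhds s hps)
  refine continuousAt_of_dominated (bound := fun s' => (Icc (s - q) (s - p)).indicator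
    (fun x => (|C| + |Real.log x|) * M) (s - s')) ?_ ?_ ?_ ?_
  · filter_upwards [hD.eventually_mem hz] with z hzU
    exact ((hℓ.isLog hzU).aestronglyMeasurable_principalLog s).mul
      ((D z).continuous_ρ₀ ht).aestronglyMeasurable
  · filter_upwards [hC, hM, hD.eventually_le_lo hz hp', hD.eventually_hi_le hz hq']
      with z hCz hMz hpz hqz
    filter_upwards [compl_mem_ae_iff.mpr (measure_singleton s)] with s' hs'
    by_cases h : s' ∈ Icc p q
    · rw [indicator_of_mem (show s - s' ∈ Icc (s - q) (s - p) from
        ⟨by linarith [h.2], by linarith [h.1]⟩), norm_mul]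
      have h1 := (hCz s hps s' h (Ne.symm hs')).trans (add_le_add_left (le_abs_self C) _)
      exact mul_le_mul h1 (hMz s' h) (norm_nonneg _) ((norm_nonneg _).trans h1)
    · rw [(D z).eq_zero_of_notMem_Icc (fun _ => (D z).ρ₀_eq_zero) hpz.le hqz.le s' h, mul_zero,
        norm_zero]
      exact indicator_log_nonneg hM0 _
  · exact (integrable_indicator_log _ _ C M).comp_sub_left s
  · have hfin : (⋃ i, ({(D z₀).lo i, (D z₀).hi i} : Set ℝ)).Finite :=
      finite_iUnion fun i => by simp
    filter_upwards [compl_mem_ae_iff.mpr (hfin.measure_zero volume),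
      compl_mem_ae_iff.mpr (measure_singleton s)] with s' h1 h2
    simp only [mem_compl_iff, mem_iUnion, mem_insert_iff, mem_singleton_iff, not_exists,
      not_or] at h1
    exact (hℓ.continuousAt_principalLog hD.isOpen hz (Ne.symm h2)).mul
      (hD.continuousAt_ρ₀ ht hz h1)

/-- The constant is evaluated at a fixed inner parameter s, because the end of the cut moves.
Continuity is what later upgrades differentiability of exp(-Φ_i/t) to that of Φ_i. -/
theorem continuousAt_cutPotential (hD : IsCurveFamily U D) (hℓ : IsFamilyLog U D ℓ) (ht : t ≠ 0)
    (hz : z₀ ∈ U) (i : Fin (g + 1)) : ContinuousAt (fun z => (D z).cutPotential (ℓ z) i) z₀ := by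
  obtain ⟨s, hs1, hs2⟩ := exists_between ((D z₀).lo_lt_hi i)
  have h : ContinuousAt (fun z => (D z).effPotential (ℓ z) s) z₀ :=
    (W.continuous.continuousAt.comp (hD.continuousAt_path_left hz s)).sub
      (continuousAt_const.mul (hD.continuousAt_logPotential hℓ ht hz s))
  refine h.congr ?_
  filter_upwards [hD.eventually_mem hz, (hD.continuousAt_lo hz i).eventually (gt_mem_nhds hs1),
    (hD.continuousAt_hi hz i).eventually (lt_mem_nhds hs2)] with z h1 h2 h3
  exact SpectralCurve.effPotential_eq_cutPotential ht (hℓ.isLog h1) ⟨h2.le, h3.le⟩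

theorem hasDerivAt_integral_familyBranch (hD : IsCurveFamily U D) (hz : z₀ ∈ U) {Y : ℂ → ℂ} {c : ℂ}
    {r : ℝ} (hYc : ContinuousOn Y (Metric.ball c r))
    (hsq : ∀ x ∈ Metric.ball c r, Y x ^ 2 = (D z₀).curvePoly.eval x)
    (h0 : ∀ x ∈ Metric.ball c r, Y x ≠ 0)
    (hev : ∀ᶠ z in 𝓝 z₀, ContinuousOn (familyBranch D z₀ Y z) (Metric.ball c r) ∧
      (∀ x ∈ Metric.ball c r, familyBranch D z₀ Y z x ^ 2 = (D z).curvePoly.eval x) ∧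
      ∀ x ∈ Metric.ball c r, (D z).curvePoly.eval x / (D z₀).curvePoly.eval x ∈ Complex.slitPlane)
    {x d : ℂ} (hx : x ∈ Metric.ball c r) (hxd : x + d ∈ Metric.ball c r) :
    HasDerivAt (fun z => ∫ u in (0 : ℝ)..1, d * familyBranch D z₀ Y z (x + u * d))
      (∫ u in (0 : ℝ)..1, d * ((varPoly D z₀).eval (x + u * d) / (2 * Y (x + u * d)))) z₀ := by
  have hl : Continuous fun u : ℝ => x + u * d := by fun_prop
  have hm : ∀ u ∈ Icc (0 : ℝ) 1, x + u * d ∈ Metric.ball c r := fun u hu =>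
    segment_mem_ball hx hxd hu
  obtain ⟨M, hM⟩ := exists_eventually_forall_le (isCompact_Icc.image hl) (z₀ := z₀)
    (K := (fun u : ℝ => x + u * d) '' Icc 0 1)
    (F := fun p : ℂ × ℂ => ‖(D p.1).curvePoly.eval p.2‖)
    fun x _ => (hD.continuousAt_eval_curvePoly hz x).norm
  have hP0 : ∀ x ∈ Metric.ball c r, (D z₀).curvePoly.eval x ≠ 0 := fun x hx => by
    rw [← hsq x hx]; exact pow_ne_zero 2 (h0 x hx)
  refine hasDerivAt_intervalIntegral (M := ‖d‖ * (M + 1)) zero_le_one ?_ ?_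
  · filter_upwards [hev, hM, hD.eventually_mem hz] with z h1 h2 h3
    refine ⟨continuousOn_const.mul (h1.1.comp hl.continuousOn hm), fun u hu => ⟨?_, ?_⟩⟩
    · refine DifferentiableAt.const_mul (DifferentiableAt.const_mul (DifferentiableAt.cexp
        (DifferentiableAt.div_const (DifferentiableAt.clog (DifferentiableAt.div_const ?_ _) ?_)
        _)) _) _
      · exact (hD.hasDerivAt_eval_curvePoly h3 _).differentiableAt
      · exact h1.2.2 _ (hm u hu)
    · rw [norm_mul]
      refine mul_le_mul_of_nonneg_left ?_ (norm_nonneg _)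
      exact (norm_le_add_one_of_sq_eq (h1.2.1 _ (hm u hu))).trans
        (add_le_add (h2 _ ⟨u, hu, rfl⟩) le_rfl)
  · intro u hu
    have hxu := hm u hu
    have hself := familyBranch_self (D := D) (Y := Y) (hP0 _ hxu)
    have hc : ContinuousAt (fun z => familyBranch D z₀ Y z (x + u * d)) z₀ :=
      ContinuousAt.comp (f := fun z : ℂ => (z, x + u * d)) (x := z₀)
        (hD.continuousAt_familyBranch hz (hYc.continuousAt (Metric.isOpen_ball.mem_nhds hxu))
          (hP0 _ hxu)) (by fun_prop)
    have h1 := hasDerivAt_of_sq hc (hD.hasDerivAt_eval_curvePoly hz (x + u * d))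
      (hev.mono fun z h => h.2.1 _ hxu) (by rw [hself]; exact h0 _ hxu)
    rw [hself] at h1
    exact h1.const_mul d

/-- The variation of the effective potential on a cut. -/
theorem hasDerivAt_cutPotential (hD : IsCurveFamily U D) (hℓ : IsFamilyLog U D ℓ) (ht : t ≠ 0)
    (hz : z₀ ∈ U) {i : Fin (g + 1)} {s₀ : ℝ} (hs₀ : s₀ ∈ Ioo ((D z₀).lo i) ((D z₀).hi i)) :
    HasDerivAt (fun z => (D z).cutPotential (ℓ z) i)
      (-(2 * t) * logPotential (ℓ z₀) ((D z₀).varDensity (varPoly D z₀)) s₀) z₀ := by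
  set p := (D z₀).lo 0 - 1 with hp
  set q := (D z₀).hi (Fin.last g) + 1 with hq
  have hp' : p < (D z₀).lo 0 := by linarith
  have hq' : (D z₀).hi (Fin.last g) < q := by linarith
  obtain ⟨s₁, h1, s₂, h2, r, hr, Y, h, hY⟩ := (D z₀).exists_chart_cut hp'.le hq'.le
    ⟨le_rfl, hs₀.1⟩ ⟨hs₀.2, le_rfl⟩
  set c := (D z₀).path s₀ with hc
  set e := deriv (D z₀).path s₀ with he
  have hr2 := half_lt_self hr
  have hsub : Metric.ball c (r / 2) ⊆ Metric.ball c r := Metric.ball_subset_ball hr2.le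
  obtain ⟨η, hη, hx1, hx2⟩ := exists_opposite_points (c := c) (e := e) (half_pos hr)
  obtain ⟨x, hx⟩ : ∃ x, x = c + Complex.I * (-η : ℝ) * e := ⟨_, rfl⟩
  obtain ⟨d, hd⟩ : ∃ d, d = Complex.I * (2 * η) * e := ⟨_, rfl⟩
  have hxd : x + d = c + Complex.I * η * e := by rw [hx, hd]; push_cast; ring
  have hs := (⟨h1.2, h2.1⟩ : s₀ ∈ Ioo s₁ s₂)
  have hoff1 : ∀ τ ∈ Icc p q, (D z₀).path τ ≠ x + d := by
    rw [hxd]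
    exact h.notMem (D z₀).contDiff_path hs hη.ne' (hsub hx1)
  have hoff2 : ∀ τ ∈ Icc p q, (D z₀).path τ ≠ x := by
    rw [hx]
    exact h.notMem (D z₀).contDiff_path hs (neg_ne_zero.mpr hη.ne') (hsub hx2)
  rw [← hx] at hx2
  rw [← hxd] at hx1
  have hbr := hD.eventually_isLocalBranch ht hz h (half_pos hr) hr2 hp' hq' h1.1 h2.2 hs rfl hY
  have hcr := hD.eventually_crossing hz h hr2 hs rfl hη hx hxd hx2 hx1
  have hcr0 : Crossing (D z₀).path s₁ s₂ e c (r / 2) (x + d) x s₀ :=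
    ⟨hs, Metric.mem_ball_self (half_pos hr), hx1, hx2, ⟨η, hη, hxd⟩, ⟨-η, by linarith, hx⟩⟩
  have hY0 : ∀ x ∈ Metric.ball c r, Y x ≠ 0 := fun x hx =>
    hY.ne_zero ht h hp'.le hq'.le h1.1 h2.2 hx
  have hY' : (D z₀).IsLocalBranch s₁ s₂ e c (r / 2) Y :=
    ⟨hY.differentiableOn.mono hsub, fun x hx => hY.sq x (hsub hx),
      fun s hs ε hε hx => hY.left s hs ε hε (hsub hx),
      fun s hs ε hε hx => hY.right s hs ε hε (hsub hx)⟩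
  have hJ := hD.hasDerivAt_integral_familyBranch hz hY'.differentiableOn.continuousOn hY'.sq
    (fun x hx => hY0 x (hsub hx))
    (hbr.mono fun z hz => ⟨hz.1.differentiableOn.continuousOn, hz.1.sq, hz.2⟩) hx2 hx1
  -- The right-hand side of `potExp_cut` consists of values off the path and of a local branch
  -- continued in the parameter, all of which are differentiable.
  have hE := ((hD.hasDerivAt_potExp_param ht hz hp' hq' hoff1).mul
    (hD.hasDerivAt_potExp_param ht hz hp' hq' hoff2)).mul
    ((hJ.div_const (2 * t)).const_add (-((W.eval (x + d) + W.eval x) / (2 * t)))).cexp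
  have hV := SpectralCurve.logTransform_varDensity_cut ht (hℓ.isLog hz) (natDegree_varPoly D z₀)
    (coeff_varPoly D z₀) (h.mono hsub) hp'.le hq'.le h1.1 h2.2 hY' hcr0
  -- A continuous logarithm of a differentiable function is differentiable; by `hV` its derivative
  -- is twice the potential of the variation at s₀.
  have hΦ := hasDerivAt_of_exp (f := fun z => -((D z).cutPotential (ℓ z) i / t))
    ((hD.continuousAt_cutPotential hℓ ht hz i).div_const t).neg hE ?_
  · have h3 := (hΦ.neg.mul_const t)
    simp only [Pi.neg_apply, neg_neg] at h3
    have h4 : (fun z => (D z).cutPotential (ℓ z) i / t * t) =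
        fun z => (D z).cutPotential (ℓ z) i := by
      funext z; exact div_mul_cancel₀ _ ht
    have h3' : HasDerivAt (fun z => (D z).cutPotential (ℓ z) i / t * t) _ z₀ := h3
    rw [h4] at h3'
    refine h3'.congr_deriv ?_
    have hne1 := (D z₀).potExp_ne_zero hp'.le hq'.le hoff1
    have hne2 := (D z₀).potExp_ne_zero hp'.le hq'.le hoff2
    have key : ∀ A B X T₁ T₂ J V : ℂ, A ≠ 0 → B ≠ 0 → X ≠ 0 → T₁ + T₂ + J = 2 * V →
        -(((A * T₁ * B + A * (B * T₂)) * X + A * B * (X * J)) / (A * B * X)) * t =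
          -(2 * t) * V := by
      intro A B X T₁ T₂ J V hA hB hX hT
      have : (A * T₁ * B + A * (B * T₂)) * X + A * B * (X * J) = (A * B * X) * (2 * V) := by
        rw [← hT]; ring
      rw [this, mul_div_cancel_left₀ _ (mul_ne_zero (mul_ne_zero hA hB) hX)]
      ring
    exact key _ _ _ _ _ _ _ hne1 hne2 (Complex.exp_ne_zero _) hV
  · filter_upwards [hbr, hcr, hD.eventually_chart hz h hr2, hD.eventually_mem hz,
      hD.eventually_le_lo hz hp', hD.eventually_hi_le hz hq',
      (hD.continuousAt_lo hz i).eventually (gt_mem_nhds h1.1),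
      (hD.continuousAt_hi hz i).eventually (lt_mem_nhds h2.2)] with z k1 k2 k3 k4 k5 k6 k7 k8
    obtain ⟨s, hcs⟩ := k2
    exact SpectralCurve.potExp_cut ht (hℓ.isLog k4) k3 k5.le k6.le k7 k8 k1.1 hcs

/-- The relation `potExp_gap` is differentiated with the given derivatives of the S_k. The
logarithmic derivatives on both sides satisfy the same relation with the masses of the variation in
place of the derivatives divided by t, so the two sums agree. -/
theorem sum_integral_varDensity_gap (hD : IsCurveFamily U D) (hℓ : IsFamilyLog U D ℓ) (ht : t ≠ 0)
    (hz : z₀ ∈ U) {S' : Fin (g + 1) → ℂ} (hS : ∀ k, HasDerivAt (fun z => (D z).S k) (S' k) z₀)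
    (i : Fin g) : ∑ k ∈ Finset.Ioi i.castSucc, S' k / t = ∑ k ∈ Finset.Ioi i.castSucc,
      ∫ τ in ((D z₀).lo k)..((D z₀).hi k), (D z₀).varDensity (varPoly D z₀) τ := by
  set p := (D z₀).lo 0 - 1 with hp
  set q := (D z₀).hi (Fin.last g) + 1 with hq
  have hp' : p < (D z₀).lo 0 := by linarith
  have hq' : (D z₀).hi (Fin.last g) < q := by linarith
  obtain ⟨s₀, hs1, hs2⟩ := exists_between ((D z₀).hi_lt_lo i)
  obtain ⟨s₁, h1, s₂, h2, r, hr, h⟩ := exists_chart (D z₀).contDiff_path (D z₀).deriv_path_ne_zero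
    (D z₀).injective_path p q hs1 hs2
  set c := (D z₀).path s₀ with hc
  set e := deriv (D z₀).path s₀ with he
  have hr2 := half_lt_self hr
  have hsub : Metric.ball c (r / 2) ⊆ Metric.ball c r := Metric.ball_subset_ball hr2.le
  obtain ⟨η, hη, hx1, hx2⟩ := exists_opposite_points (c := c) (e := e) (half_pos hr)
  obtain ⟨x, hx⟩ : ∃ x, x = c + Complex.I * (-η : ℝ) * e := ⟨_, rfl⟩
  obtain ⟨d, hd⟩ : ∃ d, d = Complex.I * (2 * η) * e := ⟨_, rfl⟩
  have hxd : x + d = c + Complex.I * η * e := by rw [hx, hd]; push_cast; ring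
  have hs := (⟨h1.2, h2.1⟩ : s₀ ∈ Ioo s₁ s₂)
  have hoff1 : ∀ τ ∈ Icc p q, (D z₀).path τ ≠ x + d := by
    rw [hxd]
    exact h.notMem (D z₀).contDiff_path hs hη.ne' (hsub hx1)
  have hoff2 : ∀ τ ∈ Icc p q, (D z₀).path τ ≠ x := by
    rw [hx]
    exact h.notMem (D z₀).contDiff_path hs (neg_ne_zero.mpr hη.ne') (hsub hx2)
  rw [← hx] at hx2
  rw [← hxd] at hx1
  have hcr := hD.eventually_crossing hz h hr2 hs rfl hη hx hxd hx2 hx1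
  have hcr0 : Crossing (D z₀).path s₁ s₂ e c (r / 2) (x + d) x s₀ :=
    ⟨hs, Metric.mem_ball_self (half_pos hr), hx1, hx2, ⟨η, hη, hxd⟩, ⟨-η, by linarith, hx⟩⟩
  have hdis : ∀ τ ∈ Ioo s₁ s₂, τ ∉ (D z₀).cutSet := fun τ hτ =>
    (D z₀).notMem_cutSet_of_mem_gap ⟨h1.1.trans hτ.1, hτ.2.trans h2.2⟩
  have hJ := hD.hasDerivAt_integral_resolvent (t := t) hz zero_le_one
    (c := fun u : ℝ => x + u * d) (k := fun _ => d) (by fun_prop) continuousOn_const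
    fun u hu => (D z₀).notMem_cuts_of_disjoint (h.mono hsub) hp'.le hq'.le hdis
      (segment_mem_ball hx2 hx1 hu)
  have hN : HasDerivAt (fun z => ∑ k ∈ Finset.Ioi i.castSucc, (D z).S k / t)
      (∑ k ∈ Finset.Ioi i.castSucc, S' k / t) z₀ :=
    HasDerivAt.fun_sum fun k _ => (hS k).div_const t
  have hE1 := hD.hasDerivAt_potExp_param ht hz hp' hq' hoff1
  have hE2 := (hD.hasDerivAt_potExp_param ht hz hp' hq' hoff2).mul
    ((hN.const_mul (2 * Real.pi * Complex.I)).add hJ).cexp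
  have hgap : ∀ᶠ z in 𝓝 z₀, (D z).potExp p (x + d) = (D z).potExp p x *
      Complex.exp (2 * Real.pi * Complex.I * (∑ k ∈ Finset.Ioi i.castSucc, (D z).S k / t) +
        ∫ u in (0 : ℝ)..1, d *
          ((W.derivative.eval (x + u * d) - (D z).y₀ (x + u * d)) / (2 * t))) := by
    filter_upwards [hcr, hD.eventually_chart hz h hr2, hD.eventually_mem hz,
      hD.eventually_le_lo hz hp', hD.eventually_hi_le hz hq',
      (hD.continuousAt_hi hz i.castSucc).eventually (gt_mem_nhds h1.1),
      (hD.continuousAt_lo hz i.succ).eventually (lt_mem_nhds h2.2)] with z k2 k3 k4 k5 k6 k7 k8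
    obtain ⟨s, hcs⟩ := k2
    exact SpectralCurve.potExp_gap ht (hℓ.isLog k4) k3 k5.le k6.le k7 k8 hcs
  have huniq := hE1.unique (hE2.congr_of_eventuallyEq hgap)
  have hV := SpectralCurve.logTransform_varDensity_gap ht (hℓ.isLog hz) (natDegree_varPoly D z₀)
    (coeff_varPoly D z₀) (h.mono hsub) hp'.le hq'.le h1.1 h2.2 hcr0
  have hE0 := hgap.self_of_nhds
  have hne := (D z₀).potExp_ne_zero hp'.le hq'.le hoff1
  have hpi : 2 * (Real.pi : ℂ) * Complex.I ≠ 0 := Complex.two_pi_I_ne_zero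
  have key : ∀ A B X T₁ T₂ J N N' q : ℂ, A ≠ 0 → q ≠ 0 → A = B * X →
      A * T₁ = B * T₂ * X + B * (X * (q * N + J)) → T₁ = T₂ + (q * N' + J) → N = N' := by
    intro A B X T₁ T₂ J N N' q hA hq hAB h5 h6
    have h7 : A * (T₂ + (q * N' + J)) = A * (T₂ + (q * N + J)) := by
      rw [← h6, h5, hAB]; ring
    have h8 := mul_left_cancel₀ hA h7
    refine mul_left_cancel₀ hq ?_
    linear_combination -h8
  exact key _ _ _ _ _ _ _ _ _ hne hpi hE0 huniq hV

end IsCurveFamily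

/-! ### The derivative of the prepotential. -/

variable {g : ℕ} {W : ℂ[X]} {t : ℂ}

theorem Iic_succ_eq {g : ℕ} (m : Fin g) :
    Finset.Iic m.succ = insert m.succ (Finset.Iic m.castSucc) := by
  ext k
  simp only [Finset.mem_Iic, Finset.mem_insert, Fin.le_def, Fin.ext_iff, Fin.val_succ,
    Fin.val_castSucc]
  omega

theorem eq_zero_of_sum_Ioi_eq_zero {a : Fin (g + 1) → ℂ} (h0 : ∑ k, a k = 0)
    (h : ∀ i : Fin g, ∑ k ∈ Finset.Ioi i.castSucc, a k = 0) (k : Fin (g + 1)) : a k = 0 := by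
  have hIoi : ∀ k : Fin (g + 1), ∑ j ∈ Finset.Ioi k, a j = 0 := by
    intro k
    induction k using Fin.lastCases with
    | last => rw [show Finset.Ioi (Fin.last g) = ∅ from Finset.Ioi_top, Finset.sum_empty]
    | cast i => exact h i
  have hIci : ∑ j ∈ Finset.Ici k, a j = 0 := by
    induction k using Fin.cases with
    | zero => rwa [show Finset.Ici (0 : Fin (g + 1)) = Finset.univ from Finset.Ici_bot]
    | succ i =>
      rw [← h i]
      congr 1
      ext j
      simp only [Finset.mem_Ici, Finset.mem_Ioi, Fin.castSucc_lt_iff_succ_le]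
  rw [← Finset.Ioi_insert, Finset.sum_insert (by simp), hIoi, add_zero] at hIci
  exact hIci

namespace SpectralCurve

theorem sum_S (D : SpectralCurve g W t) (ht : t ≠ 0) : ∑ k, D.S k = t := by
  have h := D.integral_eq_sum_cuts (D.integrable_ρ₀ ht) fun s => D.ρ₀_eq_zero
  rw [D.integral_ρ₀ ht] at h
  simp only [S]
  rw [← Finset.mul_sum, ← h, mul_one]

theorem S_succ (D : SpectralCurve g W t) (m : Fin g) :
    D.S m.succ = ∑ j ∈ Finset.Iic m.succ, D.S j - ∑ j ∈ Finset.Iic m.castSucc, D.S j := by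
  rw [Iic_succ_eq, Finset.sum_insert (by simp)]
  ring

end SpectralCurve

namespace IsCurveFamily

variable {U : Set ℂ} {D : ℂ → SpectralCurve g W t} {ℓ : ℂ → ℝ → ℝ → ℂ} {z₀ : ℂ}

/-- The gaps give equality of all tail sums over k > i. The full sums agree as well, both being
zero: Σ S_k = t is fixed and the variation has mass zero. Hence the individual terms agree. -/
theorem mul_integral_varDensity (hD : IsCurveFamily U D) (hℓ : IsFamilyLog U D ℓ) (ht : t ≠ 0)
    (hz : z₀ ∈ U) {S' : Fin (g + 1) → ℂ} (hS : ∀ k, HasDerivAt (fun z => (D z).S k) (S' k) z₀)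
    (k : Fin (g + 1)) :
    t * ∫ τ in ((D z₀).lo k)..((D z₀).hi k), (D z₀).varDensity (varPoly D z₀) τ = S' k := by
  have h0 : ∑ k, S' k = 0 := by
    have h1 : HasDerivAt (fun z => ∑ k, (D z).S k) (∑ k, S' k) z₀ :=
      HasDerivAt.fun_sum fun k _ => hS k
    simp only [SpectralCurve.sum_S _ ht] at h1
    exact h1.unique (hasDerivAt_const _ _)
  have h2 := (D z₀).integral_eq_sum_cuts ((D z₀).integrable_varDensity ht (varPoly D z₀))
    fun s => (D z₀).varDensity_eq_zero _
  rw [(D z₀).integral_varDensity ht (natDegree_varPoly D z₀) (coeff_varPoly D z₀)] at h2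
  have h3 := eq_zero_of_sum_Ioi_eq_zero (a := fun k => S' k / t -
    ∫ τ in ((D z₀).lo k)..((D z₀).hi k), (D z₀).varDensity (varPoly D z₀) τ)
    (by rw [Finset.sum_sub_distrib, ← h2, ← Finset.sum_div, h0, zero_div, sub_zero])
    (fun i => by
      rw [Finset.sum_sub_distrib, hD.sum_integral_varDensity_gap hℓ ht hz hS i, sub_self]) k
  rw [← sub_eq_zero.mp h3, mul_div_cancel₀ _ ht]

/-- The variation of the prepotential. -/
theorem hasDerivAt_prepotential (hD : IsCurveFamily U D) (hℓ : IsFamilyLog U D ℓ) (ht : t ≠ 0)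
    (hz : z₀ ∈ U) {S' : Fin (g + 1) → ℂ} (hS : ∀ k, HasDerivAt (fun z => (D z).S k) (S' k) z₀) :
    HasDerivAt (fun z => (D z).prepotential (ℓ z))
      (-∑ k, (D z₀).cutPotential (ℓ z₀) k * S' k) z₀ := by
  choose m hm1 hm2 using fun k => exists_between ((D z₀).lo_lt_hi k)
  set v := (D z₀).varDensity (varPoly D z₀) with hv
  set Ψ : Fin (g + 1) → ℂ := fun k => logPotential (ℓ z₀) v (m k) with hΨ
  have hΦ : ∀ k, HasDerivAt (fun z => (D z).cutPotential (ℓ z) k) (-(2 * t) * Ψ k) z₀ := fun k =>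
    hD.hasDerivAt_cutPotential hℓ ht hz ⟨hm1 k, hm2 k⟩
  -- The derivative of Φ_k was computed at an arbitrary inner point of the cut; its uniqueness
  -- forces the potential of the variation to be constant there.
  have hconst : ∀ k, ∀ s ∈ Ioo ((D z₀).lo k) ((D z₀).hi k), logPotential (ℓ z₀) v s = Ψ k := by
    intro k s hs
    have h1 := (hD.hasDerivAt_cutPotential hℓ ht hz hs).unique (hΦ k)
    exact mul_left_cancel₀ (neg_ne_zero.mpr (mul_ne_zero two_ne_zero ht)) h1
  have hsym := SpectralCurve.mul_integral_eval_path_mul_varDensity ht (hℓ.isLog hz) hconst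
  simp only [hD.mul_integral_varDensity hℓ ht hz hS] at hsym
  obtain ⟨R, hR⟩ := (D z₀).exists_bound_path
  have hR' : ∀ s ∈ (D z₀).cutSet, (D z₀).path s ∈ Metric.ball 0 (R + 1) := fun s hs => by
    rw [mem_ball_zero_iff]; linarith [hR s hs]
  have hW := hD.hasDerivAt_integral_comp_path ht hz hR' (φ := fun x => W.eval x)
    W.differentiable.differentiableOn
  have hsum : HasDerivAt (fun z => ∑ k, (D z).cutPotential (ℓ z) k * (D z).S k)
      (∑ k, (-(2 * t) * Ψ k * (D z₀).S k + (D z₀).cutPotential (ℓ z₀) k * S' k)) z₀ :=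
    HasDerivAt.fun_sum fun k _ => (hΦ k).mul (hS k)
  -- By `hsym`, the moment term contributes -½ Σ Φ_k S'_k - t Σ Ψ_k S_k. The second sum cancels
  -- against the variation of Φ_k in the other term, and the remaining halves add up.
  have h := (hW.const_mul (-(t / 2))).sub (hsum.const_mul (1 / 2))
  refine (h.congr_of_eventuallyEq ?_).congr_deriv ?_
  · filter_upwards [hD.eventually_mem hz] with z hzU
    exact SpectralCurve.prepotential_eq ht (hℓ.isLog hzU)
  · have h4 : ∑ k, -(2 * t) * Ψ k * (D z₀).S k = -∑ k, 2 * t * Ψ k * (D z₀).S k := by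
      rw [← Finset.sum_neg_distrib]
      exact Finset.sum_congr rfl fun k _ => by ring
    rw [Finset.sum_add_distrib, h4]
    linear_combination -(1 / 2) * hsym

end IsCurveFamily

namespace IsCoordinateFamily

variable {U : Set (Fin g → ℂ)} {D : (Fin g → ℂ) → SpectralCurve g W t}
  {ℓ : (Fin g → ℂ) → ℝ → ℝ → ℂ}

theorem isCurveFamily (hD : IsCoordinateFamily U D) (σ : Fin g → ℂ) (i : Fin g) :
    IsCurveFamily {z | Function.update σ i z ∈ U} fun z => D (Function.update σ i z) := by
  have hu : Continuous fun z => Function.update σ i z := continuous_const.update i continuous_id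
  have hp : Continuous fun p : ℂ × ℝ => (Function.update σ i p.1, p.2) :=
    (hu.comp continuous_fst).prodMk continuous_snd
  refine ⟨hD.isOpen.preimage hu, fun k => ?_, ?_, ?_, fun k => ?_, fun k => ?_⟩
  · have hd : Differentiable ℂ fun z => Function.update σ i z := fun z =>
      (hasFDerivAt_update σ z).differentiableAt
    exact (hD.differentiableOn_f k).comp hd.differentiableOn fun z hz => hz
  · exact hD.continuousOn_path.comp hp.continuousOn fun p hp => ⟨hp.1, mem_univ _⟩
  · exact hD.continuousOn_tangent.comp hp.continuousOn fun p hp => ⟨hp.1, mem_univ _⟩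
  · exact (hD.continuousOn_lo k).comp hu.continuousOn fun z hz => hz
  · exact (hD.continuousOn_hi k).comp hu.continuousOn fun z hz => hz

end IsCoordinateFamily

theorem IsLogBranch.isFamilyLog {U : Set (Fin g → ℂ)} {D : (Fin g → ℂ) → SpectralCurve g W t}
    {ℓ : (Fin g → ℂ) → ℝ → ℝ → ℂ} (hℓ : IsLogBranch U D ℓ) (σ : Fin g → ℂ) (i : Fin g) :
    IsFamilyLog {z | Function.update σ i z ∈ U} (fun z => D (Function.update σ i z))
      fun z => ℓ (Function.update σ i z) := by
  have hu : Continuous fun z => Function.update σ i z := continuous_const.update i continuous_id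
  refine ⟨?_, fun z hz => hℓ.exp_eq _ hz⟩
  exact hℓ.continuousOn.comp (f := fun p : ℂ × ℝ × ℝ => (Function.update σ i p.1, p.2))
    ((hu.comp continuous_fst).prodMk continuous_snd).continuousOn fun p hp => hp

theorem IsLogBranch.isLog {U : Set (Fin g → ℂ)} {D : (Fin g → ℂ) → SpectralCurve g W t}
    {ℓ : (Fin g → ℂ) → ℝ → ℝ → ℂ} (hℓ : IsLogBranch U D ℓ) {σ : Fin g → ℂ} (hσ : σ ∈ U) :
    IsLog (D σ).path (ℓ σ) := by
  refine ⟨?_, hℓ.exp_eq σ hσ⟩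
  exact hℓ.continuousOn.comp (f := fun p : ℝ × ℝ => (σ, p.1, p.2)) (by fun_prop)
    fun p hp => ⟨hσ, hp⟩

/-- The derivative of the prepotential with respect to one of the coordinates. -/
theorem IsCoordinateFamily.hasDerivAt_prepotential {U : Set (Fin g → ℂ)}
    {D : (Fin g → ℂ) → SpectralCurve g W t} {ℓ : (Fin g → ℂ) → ℝ → ℝ → ℂ}
    (hD : IsCoordinateFamily U D) (hℓ : IsLogBranch U D ℓ) (ht : t ≠ 0) {σ : Fin g → ℂ} (hσ : σ ∈ U)
    (i : Fin g) : HasDerivAt (fun z : ℂ => (D (Function.update σ i z)).prepotential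
      (ℓ (Function.update σ i z))) ((1 / 2) * (D σ).βPeriod i) (σ i) := by
  have hF := hD.isCurveFamily σ i
  have hL := hℓ.isFamilyLog σ i
  have hz : σ i ∈ {z | Function.update σ i z ∈ U} := by
    simpa using hσ
  -- The derivatives of the partial sums of S along the i-th coordinate line: 1 for the i-th sum, 0
  -- for the others, including the last, which is constantly t.
  set a : Fin (g + 1) → ℂ := fun k => if k = i.castSucc then 1 else 0 with ha
  have hA : ∀ k, HasDerivAt (fun z => ∑ j ∈ Finset.Iic k, (D (Function.update σ i z)).S j) (a k)
      (σ i) := by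
    intro k
    induction k using Fin.lastCases with
    | last =>
      have h1 : ∀ z, ∑ j ∈ Finset.Iic (Fin.last g), (D (Function.update σ i z)).S j = t := fun z => by
        rw [show Finset.Iic (Fin.last g) = Finset.univ from Finset.Iic_top,
          SpectralCurve.sum_S _ ht]
      simp only [h1, ha, if_neg (Fin.castSucc_lt_last i).ne']
      exact hasDerivAt_const _ _
    | cast m =>
      have h1 : HasDerivAt (fun z => Function.update σ i z m) (a m.castSucc) (σ i) := by
        simp only [ha, Fin.castSucc_inj]
        split_ifs with h
        · subst h
          simpa using hasDerivAt_id' (σ m)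
        · simpa [Function.update_of_ne h] using hasDerivAt_const (σ i) (σ m)
      refine h1.congr_of_eventuallyEq ?_
      filter_upwards [hF.eventually_mem hz] with z hzU
      exact hD.tildeS_eq _ hzU m
  -- Differences of consecutive partial sums: 1 at the i-th cut, -1 at the next one and 0 elsewhere.
  set S' : Fin (g + 1) → ℂ := Fin.cases (a 0) fun m => a m.succ - a m.castSucc with hS'
  have hS : ∀ k, HasDerivAt (fun z => (D (Function.update σ i z)).S k) (S' k) (σ i) := by
    intro k
    induction k using Fin.cases with
    | zero =>
      have h1 := hA 0
      rw [show Finset.Iic (0 : Fin (g + 1)) = {0} from Finset.Iic_bot] at h1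
      simp only [Finset.sum_singleton] at h1
      exact h1
    | succ m =>
      simp only [SpectralCurve.S_succ]
      exact (hA m.succ).sub (hA m.castSucc)
  have h := hF.hasDerivAt_prepotential hL ht hz hS
  refine h.congr_deriv ?_
  simp only [Function.update_eq_self]
  rw [← SpectralCurve.cutPotential_succ_sub ht (hℓ.isLog hσ) i]
  have e1 : ∀ Φ : Fin (g + 1) → ℂ, ∑ k, Φ k * S' k = Φ i.castSucc - Φ i.succ := by
    intro Φ
    have h1 : ∑ k, Φ k * a k = Φ i.castSucc := by simp [ha]
    have h2 : ∑ m : Fin g, Φ m.succ * a m.castSucc = Φ i.succ := by simp [ha]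
    rw [← h1, ← h2, Fin.sum_univ_succ, Fin.sum_univ_succ, add_sub_assoc, ← Finset.sum_sub_distrib]
    simp only [hS', Fin.cases_zero, Fin.cases_succ, mul_sub]
  rw [e1]
  ring

end RigidSpecialGeometry

end

theorem mainTheorem1 (g : ℕ) (W : ℂ[X]) (t : ℂ) (ht : t ≠ 0) :
    (∀ D : RigidSpecialGeometry.SpectralCurve g W t,
      (∀ (j : Fin (g + 1)) (c : ℝ → ℂ), D.IsACycle j c →
        D.S j = (1 / (4 * Real.pi * Complex.I)) * D.upperPeriod c) ∧
      (∀ (i : Fin g) (c : ℝ → ℂ), D.IsαCycle i c →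
        D.tildeS i = (1 / (4 * Real.pi * Complex.I)) * D.upperPeriod c)) ∧
    (∀ (U : Set (Fin g → ℂ)) (D : (Fin g → ℂ) → RigidSpecialGeometry.SpectralCurve g W t)
      (ℓ : (Fin g → ℂ) → ℝ → ℝ → ℂ),
      RigidSpecialGeometry.IsCoordinateFamily U D → RigidSpecialGeometry.IsLogBranch U D ℓ →
      ∀ σ ∈ U, (D σ).Converges (ℓ σ) ∧ ∀ i : Fin g,
        HasDerivAt (fun z : ℂ => (D (Function.update σ i z)).prepotential
            (ℓ (Function.update σ i z)))
          ((1 / 2) * (D σ).βPeriod i) (σ i)) := by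
  refine ⟨fun D => ⟨fun j c hc => D.S_eq_upperPeriod ht hc,
    fun i c hc => D.tildeS_eq_upperPeriod ht hc⟩, ?_⟩
  intro U D ℓ hD hℓ σ hσ
  exact ⟨RigidSpecialGeometry.SpectralCurve.converges ht (hℓ.isLog hσ),
    fun i => hD.hasDerivAt_prepotential hℓ ht hσ i⟩
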